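/- Let $k\in\mathbb C$ with $2k+3\neq 0$, let $\alpha_+$ be a square root of $2k+3$, and $\alpha_-=-1/\alpha_+$. Let $\beta(z)=\sum_n\beta_nz^{-n-1}$, $\gamma(z)=\sum_n\gamma_nz^{-n}$ be bosonic, $\psi^+(z)=\sum_n\psi^+_nz^{-n-1}$, $\psi(z)=\sum_n\psi_nz^{-n}$ fermionic, and $i\partial\phi(z)=\sum_n\phi_nz^{-n-1}$, with $[\beta_n,\gamma_m]=\delta_{n+m,0}$, $\{\psi^+_n,\psi_m\}=\delta_{n+m,0}$, $[\phi_n,\phi_m]=n\,\delta_{n+m,0}$ and all other (anti)commutators zero. For $j\in\mathbb C$ let $W_j=F_j$ be the Fock space generated by $\beta_n,\psi^+_n,\phi_n$ $(n<0)$ and $\gamma_n,\psi_n$ $(n\le0)$ from a vacuum that is annihilated by the remaining modes with $n\geq 0$ other than $\phi_0$, and on which $\phi_0=2j/\alpha_+$. On $W_j$ consider the normally ordered currents $$J^+=-\beta,\qquad J^3=-\beta\gamma+\tfrac{i\alpha_+}{2}\partial\phi-\tfrac12\psi\psi^+,\qquad j^+=\psi^+-\beta\psi,$$ $$J^-=\beta\gamma^2-i\alpha_+\gamma\partial\phi+\gamma\psi\psi^+-k\,\partial\gamma+(k+1)\psi\partial\psi,\qquad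 j^-=\gamma(\psi^+-\beta\psi)+i\alpha_+\psi\partial\phi+(2k+1)\partial\psi,$$ and $d=-L_0$, where $L_0$ is the energy operator with value $j(2j+1)/(2k+3)$ on the vacuum. Their modes make $W_j$ a module of level $k$ over the affine Lie superalgebra $\widehat{osp}(1|2)$ (the Wakimoto module). Let $$V(z)=(\psi^++\beta\psi)\,e^{i\alpha_-\phi}(z):\ F_j\to F_{j-1/2},\qquad V(z)\in z^{-2j/(2k+3)}\,\mathrm{Hom}(F_j,F_{j-1/2})[[z,z^{-1}]].$$ (i) $V(z)$ is a screening operator: for every current $J^a$ there is a field $U^a(w)$ with $$J^a(z)V(w)\sim\partial_w\!\left(\frac{U^a(w)}{z-w}\right).$$ (ii) If $2j/(2k+3)\in\mathbb Z$, so that $V(z)=\sum_{n\in\mathbb Z}V_nz^{-n-1}$ on $F_j$, then the zero mode $V_0$ is an odd homomorphism $W_j\to W_{j-1/2}$ of $\widehat{osp}(1|2)$-modules, i.e. it supercommutes with all modes of the currents and commutes with $d$. (iii) Let $\operatorname{Re}(2k+3)>0$, $m\ge1$, and suppose that $\dfrac{m(m-1-4j)}{2(2k+3)}\in\mathbb Z$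 (for example $4j+1=m-s(2k+3)$ with $s\in\mathbb Z$, $m+s$ odd). Then the multiple integral $$Q_m=\oint\!\oint\cdots\oint V(z_1)V(z_2)\cdots V(z_m)\,dz_1\cdots dz_m,$$ where $z_1$ runs once around the origin on the unit circle, each $z_i$ with $i\ge2$ runs once around the origin starting and ending at the angle of $z_1$, and the integral is the limit of the integrals over radially ordered circles $|z_1|>|z_2|>\dots>|z_m|$, $|z_i|=r^{i-1}$, as $r\to1^-$, exists in every matrix coefficient, and it is a homomorphism $W_j\to W_{j-m/2}$ of $\widehat{osp}(1|2)$-modules of parity $m \bmod 2$. -/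

import Mathlib

open Filter Topology MeasureTheory

noncomputable section

namespace Osp12

/-! ### The Fock space of the free fields `β, γ, ψ⁺, ψ, φ` -/

/-- Occupation numbers of the creation operators.
* `bos a` is the occupation number of `β_a` if `a < 0` and of `γ_{-a}` if `0 ≤ a`;
* `osc i` is the occupation number of `φ_{-(i+1)}`;
* `a ∈ fer` says that `ψ⁺_a` (if `a < 0`), respectively `ψ_{-a}` (if `0 ≤ a`), is occupied. -/
@[ext]
structure Occ where
  bos : ℤ →₀ ℕ
  osc : ℕ →₀ ℕ
  fer : Finset ℤ

/-- The Fock space. The basis vector `⟨0, 0, ∅⟩` is the vacuum. The Fock spaces `F_j` differ only in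
the eigenvalue `2j/α₊` of `φ₀`, so all of them have this underlying space. -/
abbrev Fock := Occ →₀ ℂ

/-- Linear operators on the Fock space; multiplication is composition. -/
abbrev Op := Module.End ℂ Fock

/-- The linear operator with prescribed values on the basis. -/
def basisOp (g : Occ → Fock) : Op := Finsupp.linearCombination ℂ g

/-- The sum of a family of operators of which only finitely many are nonzero on each basis
vector. -/
def locSum {ι : Type} (T : ι → Op) : Op :=
  basisOp fun s => ∑ᶠ i, T i (Finsupp.single s 1)

/-- Bosonic creation operators of the `βγ` system. -/
def bosCreate (a : ℤ) : Op := basisOp fun s =>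
  Finsupp.single { s with bos := s.bos + Finsupp.single a 1 } 1

/-- Bosonic annihilation operators of the `βγ` system (partial derivatives). -/
def bosAnnih (a : ℤ) : Op := basisOp fun s =>
  Finsupp.single { s with bos := s.bos - Finsupp.single a 1 } (s.bos a : ℂ)

/-- Multiplication by `φ_{-(i+1)}`. -/
def oscCreate (i : ℕ) : Op := basisOp fun s =>
  Finsupp.single { s with osc := s.osc + Finsupp.single i 1 } 1

/-- The partial derivative with respect to `φ_{-(i+1)}`. -/
def oscAnnih (i : ℕ) : Op := basisOp fun s =>
  Finsupp.single { s with osc := s.osc - Finsupp.single i 1 } (s.osc i : ℂ)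

/-- The sign from moving a fermion `a` past the occupied fermions with smaller label. -/
def ferSign (a : ℤ) (f : Finset ℤ) : ℂ := (-1) ^ (f.filter (· < a)).card

/-- Fermionic creation operators. -/
def ferCreate (a : ℤ) : Op := basisOp fun s =>
  if a ∈ s.fer then 0 else Finsupp.single { s with fer := insert a s.fer } (ferSign a s.fer)

/-- Fermionic annihilation operators. -/
def ferAnnih (a : ℤ) : Op := basisOp fun s =>
  if a ∈ s.fer then Finsupp.single { s with fer := s.fer.erase a } (ferSign a s.fer) else 0

/-- `β_n`. -/
def betaMode (n : ℤ) : Op := if n < 0 then bosCreate n else bosAnnih n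

/-- `γ_n`; `[β_n, γ_m] = δ_{n+m,0}`. -/
def gammaMode (n : ℤ) : Op := if n ≤ 0 then bosCreate (-n) else -bosAnnih (-n)

/-- `ψ⁺_n`. -/
def psiPlusMode (n : ℤ) : Op := if n < 0 then ferCreate n else ferAnnih n

/-- `ψ_n`; `{ψ⁺_n, ψ_m} = δ_{n+m,0}`. -/
def psiMode (n : ℤ) : Op := if n ≤ 0 then ferCreate (-n) else ferAnnih (-n)

/-- `φ_n`, with `φ_0` acting by the scalar `c`; `[φ_n, φ_m] = n δ_{n+m,0}`. -/
def phiMode (c : ℂ) (n : ℤ) : Op :=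
  if n = 0 then c • 1
  else if n < 0 then oscCreate (n.natAbs - 1) else (n : ℂ) • oscAnnih (n.natAbs - 1)

/-- The energy level (number operator eigenvalue) of a basis vector. -/
def energy (s : Occ) : ℕ :=
  (s.bos.sum fun a c => a.natAbs * c) + (s.osc.sum fun i c => (i + 1) * c)
    + ∑ a ∈ s.fer, a.natAbs

/-- The parity operator of the super vector space `Fock`. -/
def parityOp : Op := basisOp fun s => Finsupp.single s ((-1) ^ s.fer.card)

/-! ### Fields -/

/-- The modes `A_(n)` of a field `A(z) = z^μ ∑ₙ A_(n) z^(-n-1)`; the exponent `μ` is `0` unless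
otherwise said. -/
abbrev Modes := ℤ → Op

/-- The truncation property: `A_(n) v = 0` for large `n`. -/
def IsField (A : Modes) : Prop := ∀ v : Fock, ∃ N : ℤ, ∀ n : ℤ, N ≤ n → A n v = 0

/-- The Koszul sign for elements of parities `p` and `q`. -/
def koszul (p q : ℕ) : ℂ := (-1) ^ (p * q)

/-- The normally ordered product `:A(z)B(z):` of fields of parities `p`, `q`: the modes `A_(l)` with
`0 ≤ l` stand on the right. -/
def normalProd (p q : ℕ) (A B : Modes) : Modes := fun n =>
  locSum fun l : ℤ => if l < 0 then A l * B (n - l - 1) else koszul p q • (B (n - l - 1) * A l)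

/-- The derivative of `z^μ ∑ₙ A_(n) z^(-n-1)`. -/
def derivField (μ : ℂ) (A : Modes) : Modes := fun n => (μ - n) • A (n - 1)

def beta : Modes := fun n => betaMode n
def gamma : Modes := fun n => gammaMode (n + 1)
def psiPlus : Modes := fun n => psiPlusMode n
def psi : Modes := fun n => psiMode (n + 1)

/-- `i∂φ(z) = ∑ₙ φ_n z^(-n-1)` on the Fock space `F_j`, where `φ_0 = 2j/α₊`. -/
def iDphi (α j : ℂ) : Modes := fun n => phiMode (2 * j / α) n

/-! ### The free field currents -/

/-- Labels of the generators `J⁺, J³, J⁻` (even) and `j⁺, j⁻` (odd) of `osp(1|2)`. -/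
inductive Gen
  | Jplus | J3 | Jminus | jplus | jminus

/-- The parity of a generator. -/
def Gen.parity : Gen → ℕ
  | .Jplus => 0
  | .J3 => 0
  | .Jminus => 0
  | .jplus => 1
  | .jminus => 1

/-- The free field currents at level `k` on `F_j`, with `α = α₊`. -/
def current (k α j : ℂ) : Gen → Modes
  | .Jplus => -beta
  | .J3 =>
      -normalProd 0 0 beta gamma + (α / 2) • iDphi α j - (1 / 2 : ℂ) • normalProd 1 1 psi psiPlus
  | .Jminus =>
      normalProd 0 0 beta (normalProd 0 0 gamma gamma)
        - α • normalProd 0 0 gamma (iDphi α j)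
        + normalProd 0 0 gamma (normalProd 1 1 psi psiPlus)
        - k • derivField 0 gamma
        + (k + 1) • normalProd 1 1 psi (derivField 0 psi)
  | .jplus => psiPlus - normalProd 0 1 beta psi
  | .jminus =>
      normalProd 0 1 gamma (psiPlus - normalProd 0 1 beta psi)
        + α • normalProd 1 0 psi (iDphi α j)
        + (2 * k + 1) • derivField 0 psi

/-! ### Modules over the affine superalgebra and the Wakimoto modules -/

/-- Operators `J^a_n` and `d` on the Fock space. -/
structure Action where
  cur : Gen → ℤ → Op
  d : Op

/-- The superbracket of operators of parities `p` and `q`. -/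
def superBracket (p q : ℕ) (A B : Op) : Op := A * B - koszul p q • (B * A)

/-- The central term `c δ_{n+m,0}`. -/
def central (n m : ℤ) (c : ℂ) : Op := if n + m = 0 then c • 1 else 0

/-- The operators make the Fock space a (`ℤ/2`-graded) module of level `k` over the affine Lie
superalgebra of `osp(1|2)`. -/
structure IsAffineModule (k : ℂ) (ρ : Action) : Prop where
  parity : ∀ a n, parityOp * ρ.cur a n = (-1 : ℂ) ^ a.parity • (ρ.cur a n * parityOp)
  parity_d : parityOp * ρ.d = ρ.d * parityOp
  jplus_jminus : ∀ r s, superBracket 1 1 (ρ.cur .jplus r) (ρ.cur .jminus s)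
    = (2 : ℂ) • ρ.cur .J3 (r + s) + central r s (2 * r * k)
  jplus_jplus : ∀ r s, superBracket 1 1 (ρ.cur .jplus r) (ρ.cur .jplus s)
    = (2 : ℂ) • ρ.cur .Jplus (r + s)
  jminus_jminus : ∀ r s, superBracket 1 1 (ρ.cur .jminus r) (ρ.cur .jminus s)
    = (-2 : ℂ) • ρ.cur .Jminus (r + s)
  J3_jplus : ∀ n r, superBracket 0 1 (ρ.cur .J3 n) (ρ.cur .jplus r)
    = (1 / 2 : ℂ) • ρ.cur .jplus (n + r)
  J3_jminus : ∀ n r, superBracket 0 1 (ρ.cur .J3 n) (ρ.cur .jminus r)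
    = (-1 / 2 : ℂ) • ρ.cur .jminus (n + r)
  Jplus_jminus : ∀ n r, superBracket 0 1 (ρ.cur .Jplus n) (ρ.cur .jminus r)
    = -ρ.cur .jplus (n + r)
  Jminus_jplus : ∀ n r, superBracket 0 1 (ρ.cur .Jminus n) (ρ.cur .jplus r)
    = -ρ.cur .jminus (n + r)
  Jplus_jplus : ∀ n r, superBracket 0 1 (ρ.cur .Jplus n) (ρ.cur .jplus r) = 0
  Jminus_jminus : ∀ n r, superBracket 0 1 (ρ.cur .Jminus n) (ρ.cur .jminus r) = 0
  Jplus_Jminus : ∀ n m, superBracket 0 0 (ρ.cur .Jplus n) (ρ.cur .Jminus m)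
    = (2 : ℂ) • ρ.cur .J3 (n + m) + central n m (n * k)
  J3_Jplus : ∀ n m, superBracket 0 0 (ρ.cur .J3 n) (ρ.cur .Jplus m) = ρ.cur .Jplus (n + m)
  J3_Jminus : ∀ n m, superBracket 0 0 (ρ.cur .J3 n) (ρ.cur .Jminus m) = -ρ.cur .Jminus (n + m)
  J3_J3 : ∀ n m, superBracket 0 0 (ρ.cur .J3 n) (ρ.cur .J3 m) = central n m (n * k / 2)
  Jplus_Jplus : ∀ n m, superBracket 0 0 (ρ.cur .Jplus n) (ρ.cur .Jplus m) = 0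
  Jminus_Jminus : ∀ n m, superBracket 0 0 (ρ.cur .Jminus n) (ρ.cur .Jminus m) = 0
  d_cur : ∀ a n, superBracket 0 a.parity ρ.d (ρ.cur a n) = (n : ℂ) • ρ.cur a n

/-- The Wakimoto module `W_j`: the Fock space `F_j` with the modes of the free field currents and
`d = -L₀`, the energy of the highest weight vector being `j(2j+1)/(2k+3)`. -/
def wakimoto (k α j : ℂ) : Action where
  cur a n := current k α j a n
  d := basisOp fun s => Finsupp.single s (-((energy s : ℂ) + j * (2 * j + 1) / (2 * k + 3)))

/-- `f` is a homomorphism of parity `p` between modules over the affine superalgebra. -/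
structure IsAffineHom (p : ℕ) (ρ ρ' : Action) (f : Op) : Prop where
  parity : parityOp * f = (-1 : ℂ) ^ p • (f * parityOp)
  map_cur : ∀ a n, f * ρ.cur a n = koszul p a.parity • (ρ'.cur a n * f)
  map_d : f * ρ.d = ρ'.d * f

/-! ### The field `V(z) = (ψ⁺ + βψ) e^{iα₋φ}(z)` -/

/-- `α₋ = -1/α₊`. -/
def alphaMinus (α : ℂ) : ℂ := -1 / α

/-- The coefficient of `t^N` in `exp (∑_{n ≥ 1} xₙ tⁿ)`. -/
def expCoeff (x : ℕ → Op) (N : ℕ) : Op :=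
  ∑ c : Composition N, ((c.length.factorial : ℂ)⁻¹) • (c.blocks.map x).prod

/-- The exponent of the factor `z^(α₋ φ₀)` on `F_j`, where `φ₀ = 2j/α₊`. -/
def exponent (α j : ℂ) : ℂ := alphaMinus α * (2 * j / α)

/-- The modes of `e^{iα₋φ}(z) : F_j → F_{j-1/2}`,
`e^{iα₋φ}(z) = z^(α₋φ₀) exp (α₋ ∑_{n≥1} φ_{-n} zⁿ/n) exp (-α₋ ∑_{n≥1} φ_n z⁻ⁿ/n)`
times the shift `F_j → F_{j-1/2}`; the factor `z^(α₋φ₀)` is split off, so the modes do not depend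
on `j` and go with the exponent `exponent α j`. -/
def vertexExp (α : ℂ) : Modes := fun n =>
  locSum fun N : ℕ =>
    if n + 1 ≤ (N : ℤ) then
      expCoeff (fun i => (alphaMinus α / i) • phiMode 0 (-(i : ℤ))) ((N : ℤ) - n - 1).toNat
        * expCoeff (fun i => (-alphaMinus α / i) • phiMode 0 (i : ℤ)) N
    else 0

/-- On `F_j`, `V(z) = z^(exponent α j) ∑ₙ (screening α n) z^(-n-1)`. In particular the zero mode of
`V(z)`, the coefficient of `z⁻¹`, is `screening α p` if `exponent α j` is an integer `p`. -/
def screening (α : ℂ) : Modes :=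
  normalProd 1 0 (psiPlus + normalProd 0 1 beta psi) (vertexExp α)

/-! ### Operator product expansions -/

/-- The operator product expansion `A(z)B(w) ∼ ∑_{i<N} C_i(w)/(z-w)^(i+1)`, for a field `A` of
parity `p` acting by `A` on the source and by `A'` on the target of the field `B` of parity `q`
(`B` and the `C_i` carry the same factor `w^μ`). It says that `A(z)B(w)`, `|z| > |w|`, and
`± B(w)A(z)`, `|w| > |z|`, equal the singular part expanded in the respective region plus the same
normally ordered product `:A(z)B(w):`; comparing coefficients of `z^(-m-1)`, for `0 ≤ m` in the
first region and `m < 0` in the second, gives the identities below. -/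
def HasOPE (p q : ℕ) (A' A B : Modes) (N : ℕ) (C : ℕ → Modes) : Prop :=
  ∀ m n : ℤ, A' m * B n - koszul p q • (B n * A m)
    = ∑ i ∈ Finset.range N, ((Ring.choose m i : ℤ) : ℂ) • C i (m + n - i)

/-- `V` is an (odd) screening field: its operator product expansion with each current is a total
derivative, `J^a(z)V(w) ∼ ∂_w (U(w)/(z-w)) = ∂U(w)/(z-w) + U(w)/(z-w)²` for a field `U`. -/
def IsScreening (k α : ℂ) (V : Modes) : Prop :=
  IsField V ∧ ∀ a : Gen, ∃ U : Modes, IsField U ∧ ∀ j : ℂ,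
    HasOPE a.parity 1 (current k α (j - 1 / 2) a) (current k α j a) V 2
      (fun i => if i = 0 then derivField (exponent α j) U else U)

/-! ### The multiple integrals `Q_m` -/

/-- Logarithms of the points `z_i = r^i e^{iθ_i}`, `0 ≤ i < m`; for `0 < r < 1` they are radially
ordered, `|z_0| > |z_1| > …`. -/
def logPoint {m : ℕ} (r : ℝ) (θ : Fin m → ℝ) (i : Fin m) : ℂ :=
  ((i : ℕ) * Real.log r : ℝ) + θ i * Complex.I

/-- The terms of the matrix coefficient of `V(z_0) V(z_1) ⋯ V(z_{m-1})` between `v ∈ F_j` and the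
basis vector `w`; the factor `V(z_i)` acts on `F_{j-(m-1-i)/2}`. -/
def correlatorTerm (α j : ℂ) (m : ℕ) (v : Fock) (w : Occ) (L : Fin m → ℂ) (n : Fin m → ℤ) : ℂ :=
  ((List.ofFn fun i => screening α (n i)).prod v) w
    * ∏ i : Fin m,
        Complex.exp ((exponent α (j - ((m : ℂ) - 1 - (i : ℕ)) / 2) - n i - 1) * L i)

/-- The matrix coefficient of `V(z_0) ⋯ V(z_{m-1}) dz_0 ⋯ dz_{m-1}` in the coordinates `θ`, where
`dz_i = i z_i dθ_i`. -/
def contourIntegrand (α j : ℂ) (m : ℕ) (v : Fock) (w : Occ) (r : ℝ) (θ : Fin m → ℝ) : ℂ :=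
  (∑' n : Fin m → ℤ, correlatorTerm α j m v w (logPoint r θ) n)
    * ∏ i : Fin m, (Complex.I * Complex.exp (logPoint r θ i))

/-- The angles: `z_0` runs once around the origin, and every other `z_i` runs once around the
origin, starting and ending at the angle of `z_0`. -/
def contourDomain (m : ℕ) [NeZero m] : Set (Fin m → ℝ) :=
  {θ | θ 0 ∈ Set.Icc 0 (2 * Real.pi) ∧ ∀ i, θ i ∈ Set.Icc (θ 0) (θ 0 + 2 * Real.pi)}

/-- `Q` is the operator `Q_m = ∮⋯∮ V(z_0) ⋯ V(z_{m-1}) dz_0 ⋯ dz_{m-1}` on `F_j`: each of its matrix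
coefficients is the limit, as the radially ordered contours approach the unit circle, of convergent
integrals of convergent series. -/
def IsMultipleIntegral (α j : ℂ) (m : ℕ) [NeZero m] (Q : Op) : Prop :=
  ∀ (v : Fock) (w : Occ),
    (∀ r ∈ Set.Ioo (0 : ℝ) 1,
      (∀ θ : Fin m → ℝ, Summable (correlatorTerm α j m v w (logPoint r θ))) ∧
      IntegrableOn (contourIntegrand α j m v w r) (contourDomain m)) ∧
    Tendsto (fun r : ℝ => ∫ θ in contourDomain m, contourIntegrand α j m v w r θ)
      (𝓝[<] 1) (𝓝 (Q v w))

end Osp12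

end

noncomputable section

namespace Osp12

/-! Algebraic part. Brackets of fields with poles of order at most two are recorded by `Brk`. Wick's
theorem (`Brk.wick`), together with commuting (`nP_comm`) and reassociating (`nP_assoc`) the factors
of normally ordered products, reduces brackets of currents to those of the free fields. Not all
relations have to be computed in this way: the even currents are anticommutators of the odd ones, so
several brackets follow from the super Jacobi identity. The same holds for brackets with `V`. The
current `j⁺` anticommutes with `V`, and because `α₋ :i∂φ e^{iα₋φ}:` is the derivative of the
exponential (`nP_phi_vertexExp`) and `α² = 2k+3`, the bracket of `j⁻_m` with `V_n` is `-α² (μ - n)`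
times the mode `m + n - 1` of `e^{iα₋φ}`, where `μ` is the exponent of `z` in `V`
(`jminus_screening`). The factor `μ - n` expresses a total derivative, and it vanishes on the zero
mode. This gives the module structure, the screening property and the zero mode.

Matrix coefficients of products. The vacuum expectation value of a product of exponentials is
`∏_{i<j} (1 - z_j/z_i)^ρ` with `ρ = α₋² = 1/(2k+3)` (`expWord_vac`). Any matrix coefficient of a
product of `V`'s reduces to vacuum expectation values by commuting creation and annihilation
operators through the product. There `β` contributes nothing, and a fermion is contracted with
another letter at the cost of a simple pole; both letters are then used up. Hence every coefficient
function lies in the span of the translates of the coefficients of `∏ (1 - z_j/z_i)^(ρ - [(i,j) ∈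
M])` with `M` a matching, that is, with each variable in at most one pole (`wordCoeff_mem`).

Analytic part. Let `Re ρ > 0`. The coefficients of `(1-x)^ρ` are absolutely summable, those of
`(1-x)^(ρ-1)` are `O(k^(-Re ρ))`. The integral of `z^(λ-1)` over a circle decays like `1/|λ|`, and
every matched pair contains a variable of its own for which such a factor is available. So the
series obtained by integrating term by term on the unit circle converges absolutely
(`Decays.summable`), and the limit over radially ordered circles is an Abel limit of it
(`Decays.tendsto`). Energy and charge confine the image of a basis vector to finitely many basis
vectors, so the coefficients define an operator.

Homomorphism property. Moving a current other than `J⁻` through the product leaves total derivatives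
in one variable `z_p`, with `V(z_p)` replaced by a multiple of the exponential, so that `z_p` occurs
in no pole. For `p ≠ 0` the boundary values lie at `z_p = z_0`, where `(1-x)^ρ` vanishes;
algebraically this is `tsum_coeffZero`. For `p = 0` one uses that the total degree is an integer,
which trades the derivative in `z_0` for those in the other variables (`tsum_mul_contourWeight`).
The current `J⁻` is treated as an anticommutator of `j⁻` with itself. -/

instance instRingOp : Ring Op := inferInstance

/-! ### Locally finite sums of operators -/

/-- Only finitely many members of the family are nonzero on each vector. -/
def LocFin {ι : Type} (T : ι → Op) : Prop := ∀ v : Fock, {i | T i v ≠ 0}.Finite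

theorem op_ext {A B : Op} (h : ∀ s : Occ, A (Finsupp.single s 1) = B (Finsupp.single s 1)) :
    A = B := by
  refine Finsupp.lhom_ext' fun s => ?_
  ext1
  exact h s

@[simp] theorem basisOp_single (g : Occ → Fock) (s : Occ) (c : ℂ) :
    basisOp g (Finsupp.single s c) = c • g s := by
  simp [basisOp]

section LocSum

variable {ι κ : Type} {S T : ι → Op}

theorem LocFin.add (hS : LocFin S) (hT : LocFin T) : LocFin (fun i => S i + T i) := fun v =>
  ((hS v).union (hT v)).subset fun i hi => by
    by_contra h
    simp only [Set.mem_union, Set.mem_ofPred_eq, not_or, not_not] at h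
    exact hi (by simp [h.1, h.2])

theorem LocFin.smul (c : ℂ) (hT : LocFin T) : LocFin (fun i => c • T i) := fun v =>
  (hT v).subset fun i hi h => hi (by simp [h])

theorem LocFin.mul_left (A : Op) (hT : LocFin T) : LocFin (fun i => A * T i) := fun v =>
  (hT v).subset fun i hi h => hi (by simp [h])

theorem LocFin.mul_right (A : Op) (hT : LocFin T) : LocFin (fun i => T i * A) := fun v =>
  hT (A v)

theorem LocFin.comp (hT : LocFin T) {f : κ → ι} (hf : Function.Injective f) :
    LocFin (fun i => T (f i)) := fun v => (hT v).preimage hf.injOn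

/-- `locSum` is prescribed on basis vectors only. Local finiteness on every vector makes the
pointwise finite sum additive, so the formula extends linearly; without it `finsum` could take its
default value `0`. -/
theorem locSum_apply (hT : LocFin T) (v : Fock) : locSum T v = ∑ᶠ i, T i v := by
  induction v using Finsupp.induction_linear with
  | zero => simp
  | add f g hf hg =>
    rw [map_add, hf, hg, ← finsum_add_distrib (hT f) (hT g)]
    simp
  | single s c =>
    have h : (Finsupp.single s c : Fock) = c • Finsupp.single s 1 := by simp
    rw [h, map_smul, locSum, basisOp_single, one_smul, smul_finsum]
    simp_rw [map_smul]

theorem locSum_add (hS : LocFin S) (hT : LocFin T) :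
    locSum (fun i => S i + T i) = locSum S + locSum T := by
  ext1; ext1
  simp only [LinearMap.comp_apply, Finsupp.lsingle_apply, LinearMap.add_apply]
  rw [locSum_apply (hS.add hT), locSum_apply hS, locSum_apply hT,
    ← finsum_add_distrib (hS _) (hT _)]
  rfl

theorem locSum_smul (c : ℂ) (hT : LocFin T) : locSum (fun i => c • T i) = c • locSum T := by
  ext1; ext1
  simp only [LinearMap.comp_apply, Finsupp.lsingle_apply, LinearMap.smul_apply]
  rw [locSum_apply (hT.smul c), locSum_apply hT, smul_finsum]
  rfl

theorem mul_locSum (A : Op) (hT : LocFin T) : A * locSum T = locSum (fun i => A * T i) := by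
  ext1; ext1
  simp only [LinearMap.comp_apply, Finsupp.lsingle_apply, Module.End.mul_apply]
  rw [locSum_apply (hT.mul_left A), locSum_apply hT]
  exact A.toAddMonoidHom.map_finsum (hT _)

theorem locSum_mul (A : Op) (hT : LocFin T) : locSum T * A = locSum (fun i => T i * A) := by
  ext1; ext1
  simp only [LinearMap.comp_apply, Finsupp.lsingle_apply, Module.End.mul_apply]
  rw [locSum_apply (hT.mul_right A), locSum_apply hT]
  rfl

theorem locSum_equiv (e : κ ≃ ι) (hT : LocFin T) : locSum (fun i => T (e i)) = locSum T := by
  ext1; ext1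
  simp only [LinearMap.comp_apply, Finsupp.lsingle_apply]
  rw [locSum_apply (hT.comp e.injective), locSum_apply hT]
  exact finsum_comp_equiv e (f := fun i => T i _)

/-- Fubini for locally finite families. The first indices that matter on a vector form the
projection of a finite set, so the family of inner sums is locally finite again. -/
theorem locSum_prod {T : ι × κ → Op} (hT : LocFin T) :
    locSum (fun i => locSum fun j => T (i, j)) = locSum T := by
  have h1 : ∀ i, LocFin (fun j => T (i, j)) := fun i => hT.comp (Prod.mk_right_injective i)
  have h2 : LocFin (fun i => locSum fun j => T (i, j)) := fun v =>
    ((hT v).image Prod.fst).subset fun i hi => by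
      simp only [Set.mem_ofPred_eq, locSum_apply (h1 i)] at hi
      by_contra h
      refine hi (finsum_eq_zero_of_forall_eq_zero fun j => ?_)
      by_contra hj
      exact h ⟨(i, j), hj, rfl⟩
  ext1; ext1
  simp only [LinearMap.comp_apply, Finsupp.lsingle_apply]
  rw [locSum_apply h2, locSum_apply hT]
  simp_rw [fun i => locSum_apply (h1 i)]
  exact (finsum_curry _ (hT _)).symm

theorem locSum_eq_sum (s : Finset ι) (h : ∀ i ∉ s, T i = 0) : locSum T = ∑ i ∈ s, T i := by
  have hT : LocFin T := fun v => s.finite_toSet.subset fun i hi => by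
    by_contra h'
    exact hi (by rw [h i h']; rfl)
  ext1; ext1
  simp only [LinearMap.comp_apply, Finsupp.lsingle_apply]
  rw [locSum_apply hT, LinearMap.sum_apply]
  refine finsum_eq_sum_of_support_subset _ fun i hi => ?_
  by_contra h'
  exact hi (by simp [h i h'])

end LocSum

/-! ### Fields and normally ordered products -/

/-- Fields, as a class. -/
class Fld (A : Modes) : Prop where
  trunc : IsField A

section Fields

variable (A B C : Modes)

instance [hA : Fld A] [hB : Fld B] : Fld (A + B) := ⟨fun v => by
  obtain ⟨M, hM⟩ := hA.trunc v
  obtain ⟨N, hN⟩ := hB.trunc v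
  exact ⟨max M N, fun n hn => by
    simp [hM n (le_trans (le_max_left _ _) hn), hN n (le_trans (le_max_right _ _) hn)]⟩⟩

instance [hA : Fld A] : Fld (-A) := ⟨fun v => by
  obtain ⟨M, hM⟩ := hA.trunc v
  exact ⟨M, fun n hn => by simp [hM n hn]⟩⟩

instance [hA : Fld A] (c : ℂ) : Fld (c • A) := ⟨fun v => by
  obtain ⟨M, hM⟩ := hA.trunc v
  exact ⟨M, fun n hn => by simp [hM n hn]⟩⟩

instance [hA : Fld A] [hB : Fld B] : Fld (A - B) := by
  rw [sub_eq_add_neg]; infer_instance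

instance : Fld 0 := ⟨fun v => ⟨0, fun n _ => by simp⟩⟩

instance [hA : Fld A] (μ : ℂ) : Fld (derivField μ A) := ⟨fun v => by
  obtain ⟨M, hM⟩ := hA.trunc v
  exact ⟨M + 1, fun n hn => by simp [derivField, hM (n - 1) (by omega)]⟩⟩

/-- The terms of the product of two fields, the modes of the first with index `≥ c` being put to
the right. -/
def cutTerm (σ : ℂ) (c : ℤ) (A B : Modes) (n l : ℤ) : Op :=
  if l < c then A l * B (n - l - 1) else σ • (B (n - l - 1) * A l)

/-- The normally ordered product with sign `σ`. -/
def nP (σ : ℂ) (A B : Modes) : Modes := fun n => locSum (cutTerm σ 0 A B n)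

theorem normalProd_eq (p q : ℕ) : normalProd p q A B = nP (koszul p q) A B := rfl

variable {A B C}

/-- For very negative `l` the factor `B` acts first and has the large index `n - l - 1`; for large
`l` the factor `A` acts first. Truncation leaves a finite window for `l`. -/
theorem locFin_cutTerm [hA : Fld A] [hB : Fld B] (σ : ℂ) (c n : ℤ) :
    LocFin (cutTerm σ c A B n) := fun v => by
  obtain ⟨M, hM⟩ := hA.trunc v
  obtain ⟨N, hN⟩ := hB.trunc v
  refine (Set.finite_Ioo (min c (n - N) - 1) (max c M)).subset fun l hl => ?_
  simp only [Set.mem_ofPred_eq, cutTerm] at hl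
  by_contra h
  simp only [Set.mem_Ioo, not_and_or, not_lt] at h
  apply hl
  split_ifs with hc
  · have : N ≤ n - l - 1 := by
      rcases h with h | h
      · have := min_le_right c (n - N); omega
      · have := le_max_left c M; omega
    simp [hN _ this]
  · have : M ≤ l := by
      rcases h with h | h
      · have := min_le_left c (n - N); omega
      · exact le_trans (le_max_right _ _) h
    simp [hM _ this]

/-- The bound is uniform in `l`. This makes `nP` a field, and it gives the local finiteness of the
double sums in `nP_assoc`. -/
theorem cutTerm_eventually_zero [hA : Fld A] [hB : Fld B] (σ : ℂ) (v : Fock) :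
    ∃ K : ℤ, ∀ n, K ≤ n → ∀ l, cutTerm σ 0 A B n l v = 0 := by
  obtain ⟨M, hM⟩ := hA.trunc v
  obtain ⟨N, hN⟩ := hB.trunc v
  have hfin : ∀ l : ℤ, ∃ K : ℤ, ∀ n, K ≤ n → B n (A l v) = 0 := fun l => hB.trunc _
  choose K hK using hfin
  -- Only the finitely many `0 ≤ l < M` need a bound of their own; the sum of the absolute values
  -- serves for all of them.
  obtain ⟨R, hR⟩ : ∃ R : ℤ, ∀ l ∈ Finset.Ico 0 M, K l ≤ R :=
    ⟨∑ l ∈ Finset.Ico 0 M, |K l|, fun l hl => le_trans (le_abs_self _)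
      (Finset.single_le_sum (f := fun l => |K l|) (fun _ _ => abs_nonneg _) hl)⟩
  refine ⟨max (N) (R + M + 1), fun n hn l => ?_⟩
  unfold cutTerm
  have h1 := le_trans (le_max_left _ _) hn
  have h2 := le_trans (le_max_right _ _) hn
  split_ifs with hl
  · simp [hN (n - l - 1) (by omega)]
  · by_cases hlM : M ≤ l
    · simp [hM l hlM]
    · have := hR l (by simp; omega)
      simp [hK l (n - l - 1) (by omega)]

instance [hA : Fld A] [hB : Fld B] (σ : ℂ) : Fld (nP σ A B) := ⟨fun v => by
  obtain ⟨K, hK⟩ := cutTerm_eventually_zero (A := A) (B := B) σ v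
  refine ⟨K, fun n hn => ?_⟩
  rw [nP, locSum_apply (locFin_cutTerm σ 0 n)]
  exact finsum_eq_zero_of_forall_eq_zero fun l => hK n hn l⟩

theorem nP_add_left [Fld A] [Fld B] [Fld C] (σ : ℂ) : nP σ (A + B) C = nP σ A C + nP σ B C := by
  funext n
  rw [Pi.add_apply, nP, nP, nP, ← locSum_add (locFin_cutTerm _ _ _) (locFin_cutTerm _ _ _)]
  congr 1; funext l; unfold cutTerm
  split_ifs <;> simp [add_mul, mul_add]

theorem nP_smul_left [Fld A] [Fld B] (σ c : ℂ) : nP σ (c • A) B = c • nP σ A B := by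
  funext n
  rw [Pi.smul_apply, nP, nP, ← locSum_smul _ (locFin_cutTerm _ _ _)]
  congr 1; funext l; unfold cutTerm
  simp only [Pi.smul_apply, smul_mul_assoc, mul_smul_comm]
  split_ifs
  · rfl
  · rw [smul_comm]

theorem nP_smul_right [Fld A] [Fld B] (σ c : ℂ) : nP σ A (c • B) = c • nP σ A B := by
  funext n
  rw [Pi.smul_apply, nP, nP, ← locSum_smul _ (locFin_cutTerm _ _ _)]
  congr 1; funext l; unfold cutTerm
  simp only [Pi.smul_apply, smul_mul_assoc, mul_smul_comm]
  split_ifs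
  · rfl
  · rw [smul_comm]

theorem nP_neg_left [Fld A] [Fld B] (σ : ℂ) : nP σ (-A) B = -nP σ A B := by
  rw [← neg_one_smul ℂ A, nP_smul_left, neg_one_smul]

theorem nP_neg_right [Fld A] [Fld B] (σ : ℂ) : nP σ A (-B) = -nP σ A B := by
  rw [← neg_one_smul ℂ B, nP_smul_right, neg_one_smul]

theorem nP_sub_left [Fld A] [Fld B] [Fld C] (σ : ℂ) : nP σ (A - B) C = nP σ A C - nP σ B C := by
  rw [sub_eq_add_neg, nP_add_left, nP_neg_left, sub_eq_add_neg]

theorem nP_zero_left [Fld B] (σ : ℂ) : nP σ 0 B = 0 := by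
  have := nP_smul_left (A := 0) (B := B) σ 0; simpa using this

theorem nP_zero_right [Fld A] (σ : ℂ) : nP σ A 0 = 0 := by
  have := nP_smul_right (A := A) (B := 0) σ 0; simpa using this

/-- The identity field. -/
def oneF : Modes := fun n => if n = -1 then 1 else 0

instance : Fld oneF := ⟨fun v => ⟨0, fun n hn => by simp [oneF, show n ≠ -1 by omega]⟩⟩

theorem nP_one_left [Fld A] (σ : ℂ) : nP σ oneF A = A := by
  funext n
  rw [nP, locSum_eq_sum {-1}]
  · simp [cutTerm, oneF]
  · intro l hl
    simp only [Finset.mem_singleton] at hl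
    simp [cutTerm, oneF, hl]

/-- The sign has to be `1`, because the only surviving term is `l = n`, and it carries the sign
exactly when `0 ≤ n`. -/
theorem nP_one_right [Fld A] : nP 1 A oneF = A := by
  funext n
  rw [nP, locSum_eq_sum {n}]
  · simp [cutTerm, oneF]
  · intro l hl
    simp only [Finset.mem_singleton] at hl
    simp [cutTerm, oneF, show n - l ≠ 0 by omega]

theorem derivField_one : derivField 0 oneF = 0 := by
  funext n
  by_cases h : n = 0 <;> simp [derivField, oneF, h]

/-! ### Brackets of fields -/

/-- `[A_m, B_n] = C0_(m+n) + m C1_(m+n-1)` with the sign `ε` in the bracket. -/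
def Brk (ε : ℂ) (A B C0 C1 : Modes) : Prop :=
  ∀ m n : ℤ, A m * B n - ε • (B n * A m) = C0 (m + n) + (m : ℂ) • C1 (m + n - 1)

theorem Brk.add_left {ε : ℂ} {A A' B C0 C1 C0' C1' : Modes} (h : Brk ε A B C0 C1)
    (h' : Brk ε A' B C0' C1') : Brk ε (A + A') B (C0 + C0') (C1 + C1') := fun m n => by
  simp only [Pi.add_apply, add_mul, mul_add]
  linear_combination (norm := module) h m n + h' m n

theorem Brk.add_right {ε : ℂ} {A B B' C0 C1 C0' C1' : Modes} (h : Brk ε A B C0 C1)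
    (h' : Brk ε A B' C0' C1') : Brk ε A (B + B') (C0 + C0') (C1 + C1') := fun m n => by
  simp only [Pi.add_apply, add_mul, mul_add]
  linear_combination (norm := module) h m n + h' m n

theorem Brk.smul_left {ε : ℂ} {A B C0 C1 : Modes} (c : ℂ) (h : Brk ε A B C0 C1) :
    Brk ε (c • A) B (c • C0) (c • C1) := fun m n => by
  simp only [Pi.smul_apply, smul_mul_assoc, mul_smul_comm]
  linear_combination (norm := module) c • h m n

theorem Brk.smul_right {ε : ℂ} {A B C0 C1 : Modes} (c : ℂ) (h : Brk ε A B C0 C1) :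
    Brk ε A (c • B) (c • C0) (c • C1) := fun m n => by
  simp only [Pi.smul_apply, smul_mul_assoc, mul_smul_comm]
  linear_combination (norm := module) c • h m n

theorem Brk.neg_left {ε : ℂ} {A B C0 C1 : Modes} (h : Brk ε A B C0 C1) :
    Brk ε (-A) B (-C0) (-C1) := by simpa using h.smul_left (-1)

theorem Brk.neg_right {ε : ℂ} {A B C0 C1 : Modes} (h : Brk ε A B C0 C1) :
    Brk ε A (-B) (-C0) (-C1) := by simpa using h.smul_right (-1)

theorem Brk.sub_right {ε : ℂ} {A B B' C0 C1 C0' C1' : Modes} (h : Brk ε A B C0 C1)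
    (h' : Brk ε A B' C0' C1') : Brk ε A (B - B') (C0 - C0') (C1 - C1') := by
  simpa [sub_eq_add_neg] using h.add_right h'.neg_right

theorem Brk.congr {ε ε' : ℂ} {A B C0 C1 C0' C1' : Modes} (h : Brk ε A B C0 C1) (he : ε = ε')
    (h0 : C0 = C0') (h1 : C1 = C1') : Brk ε' A B C0' C1' := he ▸ h0 ▸ h1 ▸ h

/-- The reversed bracket carries the coefficient `n` in place of `m`. Writing `n = (m + n) - m`, the
part with `m + n` is a mode of the derivative of `C1`. -/
theorem Brk.symm {ε : ℂ} {A B C0 C1 : Modes} (h : Brk ε A B C0 C1) (hε : ε * ε = 1) :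
    Brk ε B A (ε • (derivField 0 C1 - C0)) (ε • C1) := fun m n => by
  have h' := h n m
  simp only [Pi.smul_apply, Pi.sub_apply, derivField]
  rw [add_comm n m] at h'
  push_cast
  linear_combination (norm := skip) (-ε) • h'
  have e : ∀ X : Op, ε • ε • X = X := fun X => by rw [smul_smul, hε, one_smul]
  simp only [neg_smul, smul_sub, e]
  module

theorem Brk.symm0 {ε : ℂ} {A B C0 : Modes} (h : Brk ε A B C0 0) (hε : ε * ε = 1) :
    Brk ε B A (-ε • C0) 0 := by
  refine (h.symm hε).congr rfl ?_ (by simp)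
  have : derivField 0 (0 : Modes) = 0 := by funext n; simp [derivField]
  rw [this]; module

/-- The modes of the derivative of `B` are `-n B_(n-1)`, and `-n = -(m + n) + m` splits into the
derivative of `C0` and a second-order pole. A second-order pole in the given bracket would lead to a
third-order one, outside the scope of `Brk`. -/
theorem Brk.deriv {ε : ℂ} {A B C0 : Modes} (h : Brk ε A B C0 0) :
    Brk ε A (derivField 0 B) (derivField 0 C0) C0 := fun m n => by
  have h' := h m (n - 1)
  simp only [derivField, smul_mul_assoc, mul_smul_comm, Pi.zero_apply, smul_zero, add_zero] at h' ⊢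
  rw [← add_sub_assoc] at h'
  push_cast
  linear_combination (norm := module) (-(n : ℂ)) • h'

theorem Brk.deriv_left {ε : ℂ} {A B : Modes} (h : Brk ε A B 0 0) :
    Brk ε (derivField 0 A) B 0 0 := fun m n => by
  have h' := h (m - 1) n
  simp only [derivField, smul_mul_assoc, mul_smul_comm, Pi.zero_apply, smul_zero, add_zero] at h' ⊢
  linear_combination (norm := module) (-(m : ℂ)) • h'

theorem brk_zero_left (ε : ℂ) (B : Modes) : Brk ε 0 B 0 0 := fun m n => by simp

theorem brk_one_left (B : Modes) : Brk 1 oneF B 0 0 := fun m n => by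
  by_cases h : m = -1 <;> simp [oneF, h]

theorem brk_one_right (B : Modes) : Brk 1 B oneF 0 0 := fun m n => by
  by_cases h : n = -1 <;> simp [oneF, h]

/-- Moving the cut by one reverses the order in the single term `l = c`, at the price of the bracket
`F_(n-1)`, which does not depend on `c`. The cuts move when the summation index is shifted, as in
Wick's theorem. -/
theorem locSum_cutTerm [Fld A] [Fld B] {F : Modes} {σ : ℂ} (h : Brk σ A B F 0) (c n : ℤ) :
    locSum (cutTerm σ c A B n) = nP σ A B n + (c : ℂ) • F (n - 1) := by
  have key : ∀ c : ℤ, locSum (cutTerm σ (c + 1) A B n)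
      = locSum (cutTerm σ c A B n) + F (n - 1) := fun c => by
    have h1 : locSum (fun l : ℤ => if l = c then F (n - 1) else 0) = F (n - 1) := by
      rw [locSum_eq_sum {c}]
      · simp
      · intro i hi; simp only [Finset.mem_singleton] at hi; simp [hi]
    have h2 : LocFin (fun l : ℤ => if l = c then F (n - 1) else 0) := fun v =>
      (Set.finite_singleton c).subset fun l hl => by
        by_contra h'
        exact hl (by simp [show l ≠ c from h'])
    conv_rhs => rw [← h1, ← locSum_add (locFin_cutTerm _ _ _) h2]
    congr 1; funext l; unfold cutTerm
    rcases lt_trichotomy l c with hl | hl | hl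
    · simp [hl, hl.ne, show l < c + 1 by omega]
    · subst hl
      have := h l (n - l - 1)
      simp only [Pi.zero_apply, smul_zero, add_zero,
        show l + (n - l - 1) = n - 1 by ring] at this
      simp only [lt_add_one, if_true, lt_irrefl, if_false]
      linear_combination (norm := module) this
    · simp [hl.ne', show ¬ l < c by omega, show ¬ l < c + 1 by omega]
  induction c using Int.induction_on with
  | zero => simp [nP]
  | succ i ih => rw [key, ih]; push_cast; module
  | pred i ih =>
    have := key (-i - 1)
    rw [sub_add_cancel, ih] at this
    push_cast at this ⊢
    linear_combination (norm := module) -this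

/-- Wick's theorem for the bracket of a field with a normally ordered product, for fields whose
triple bracket is of first order. -/
theorem Brk.wick [Fld B] [Fld C] {D0 D1 E0 E1 F : Modes} [Fld D0] [Fld D1] [Fld E0] [Fld E1]
    {εB εC σ : ℂ} (hε : εB * εB = 1) (hB : Brk εB A B D0 D1) (hC : Brk εC A C E0 E1)
    (hF : Brk (σ * εC) D0 C F 0) (hG : Brk (σ * εC) D1 C 0 0) :
    Brk (εB * εC) A (nP σ B C)
      (nP (σ * εC) D0 C + εB • nP (σ * εB) B E0)
      (nP (σ * εC) D1 C + εB • nP (σ * εB) B E1 + F) := fun m n => by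
  -- Leibniz rule in each term. The bracket with the first factor raises its index from `l` to `m +
  -- l`, or to `m - 1 + l` for `D1`, while the ordering is still decided by the sign of `l`; so the
  -- cut now stands at `m` or `m - 1`.
  have key : ∀ l, A m * cutTerm σ 0 B C n l - (εB * εC) • (cutTerm σ 0 B C n l * A m)
      = cutTerm (σ * εC) m D0 C (m + n) (m + l)
        + (m : ℂ) • cutTerm (σ * εC) (m - 1) D1 C (m + n - 1) (m - 1 + l)
        + εB • cutTerm (σ * εB) 0 B E0 (m + n) l
        + (m : ℂ) • εB • cutTerm (σ * εB) 0 B E1 (m + n - 1) l := fun l => by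
    have h1 := hB m l
    have h2 := hC m (n - l - 1)
    unfold cutTerm
    simp only [show m + l < m ↔ l < 0 by omega, show m - 1 + l < m - 1 ↔ l < 0 by omega,
      show m + n - (m + l) - 1 = n - l - 1 by ring,
      show m + n - 1 - (m - 1 + l) - 1 = n - l - 1 by ring,
      show m + n - l - 1 = m + (n - l - 1) by ring,
      show m + n - 1 - l - 1 = m + (n - l - 1) - 1 by ring]
    rw [show m - 1 + l = m + l - 1 by ring]
    split_ifs with hl
    · have e1 := congrArg (· * C (n - l - 1)) h1
      have e2 := congrArg (B l * ·) h2
      simp only [sub_mul, add_mul, mul_sub, mul_add, smul_mul_assoc, mul_smul_comm] at e1 e2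
      simp only [← mul_assoc] at e1 e2 ⊢
      linear_combination (norm := module) e1 + εB • e2
    · have e1 := congrArg (C (n - l - 1) * ·) h1
      have e2 := congrArg (· * B l) h2
      simp only [sub_mul, add_mul, mul_sub, mul_add, smul_mul_assoc, mul_smul_comm] at e1 e2
      simp only [← mul_assoc, smul_mul_assoc, mul_smul_comm, smul_smul] at e1 e2 ⊢
      have e3 : εB * σ * εB = σ := by linear_combination σ * hε
      have e4 : (m : ℂ) * εB * σ * εB = m * σ := by linear_combination m * σ * hε
      simp only [e3, e4]
      linear_combination (norm := module) (σ * εC) • e1 + σ • e2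
  have f1 : LocFin (fun l => cutTerm (σ * εC) m D0 C (m + n) (m + l)) :=
    (locFin_cutTerm _ _ _).comp (add_right_injective m)
  have f2 : LocFin (fun l => cutTerm (σ * εC) (m - 1) D1 C (m + n - 1) (m - 1 + l)) :=
    (locFin_cutTerm _ _ _).comp (add_right_injective _)
  have f3 : LocFin (fun l => cutTerm (σ * εB) 0 B E0 (m + n) l) := locFin_cutTerm _ _ _
  have f4 : LocFin (fun l => cutTerm (σ * εB) 0 B E1 (m + n - 1) l) := locFin_cutTerm _ _ _
  have f0 : LocFin (cutTerm σ 0 B C n) := locFin_cutTerm _ _ _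
  -- Moving the cut back from `m` to `0` produces `m F`: the double contraction, a second-order
  -- pole.
  have s1 : locSum (fun l => cutTerm (σ * εC) m D0 C (m + n) (m + l))
      = nP (σ * εC) D0 C (m + n) + (m : ℂ) • F (m + n - 1) := by
    rw [← locSum_cutTerm hF]
    exact locSum_equiv (Equiv.addLeft m) (locFin_cutTerm _ _ _)
  have s2 : locSum (fun l => cutTerm (σ * εC) (m - 1) D1 C (m + n - 1) (m - 1 + l))
      = nP (σ * εC) D1 C (m + n - 1) := by
    have := locSum_cutTerm hG (m - 1) (m + n - 1)
    simp only [Pi.zero_apply, smul_zero, add_zero] at this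
    rw [← this]
    exact locSum_equiv (Equiv.addLeft (m - 1)) (locFin_cutTerm _ _ _)
  have lhs : A m * nP σ B C n - (εB * εC) • (nP σ B C n * A m)
      = locSum (fun l => A m * cutTerm σ 0 B C n l
        - (εB * εC) • (cutTerm σ 0 B C n l * A m)) := by
    simp only [nP, sub_eq_add_neg, ← neg_smul]
    rw [locSum_add (f0.mul_left _) ((f0.mul_right _).smul _), locSum_smul _ (f0.mul_right _),
      mul_locSum _ f0, locSum_mul _ f0]
  rw [lhs]
  simp_rw [key]
  rw [locSum_add ((f1.add (f2.smul _)).add (f3.smul _)) ((f4.smul _).smul _),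
    locSum_add (f1.add (f2.smul _)) (f3.smul _), locSum_add f1 (f2.smul _),
    locSum_smul _ f2, locSum_smul _ f3, locSum_smul _ (f4.smul _), locSum_smul _ f4, s1, s2]
  simp only [Pi.add_apply, Pi.smul_apply, nP]
  module

/-- Commuting the factors of a normally ordered product. -/
theorem nP_comm [Fld A] [Fld B] {σ : ℂ} {H : Modes} (hσ : σ * σ = 1) (h : Brk σ A B H 0) :
    nP σ B A = σ • (nP σ A B - derivField 0 H) := by
  funext n
  -- The reflection `l ↦ n - 1 - l` exchanges the two indices, and the order of the factors becomes
  -- that of `A B` with the cut at `n`.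
  have e : nP σ B A n = locSum (fun l => σ • cutTerm σ n A B n l) := by
    rw [nP, ← locSum_equiv (Equiv.subLeft (n - 1)) (locFin_cutTerm _ _ _)]
    congr 1; funext l
    simp only [Equiv.subLeft_apply, cutTerm, show n - 1 - l = n - l - 1 by ring,
      show n - (n - l - 1) - 1 = l by ring]
    by_cases hl : l < n
    · simp [show ¬ n - l - 1 < 0 by omega, hl]
    · simp [show n - l - 1 < 0 by omega, hl, smul_smul, hσ]
  rw [e, locSum_smul _ (locFin_cutTerm _ _ _), locSum_cutTerm h]
  simp only [Pi.smul_apply, Pi.sub_apply, derivField]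
  module

theorem derivField_smul (μ c : ℂ) (A : Modes) : derivField μ (c • A) = c • derivField μ A := by
  funext n; exact smul_comm (μ - n) c (A (n - 1))

theorem derivField_zero (μ : ℂ) : derivField μ 0 = 0 := by
  funext n; simp [derivField]

theorem derivField_neg (μ : ℂ) (A : Modes) : derivField μ (-A) = -derivField μ A := by
  funext n; simp [derivField]

end Fields

/-! ### Reassociating normally ordered products -/

theorem locFin_of_slices {ι κ : Type} {T : ι × κ → Op} (h : ∀ i, LocFin fun j => T (i, j))
    (h' : ∀ v, {i | ∃ j, T (i, j) v ≠ 0}.Finite) : LocFin T := fun v => by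
  refine ((h' v).biUnion (t := fun i => Prod.mk i '' {j | T (i, j) v ≠ 0})
    fun i _ => (h i v).image _).subset ?_
  rintro ⟨i, j⟩ hij
  simp only [Set.mem_iUnion]
  exact ⟨i, ⟨j, hij⟩, j, hij, rfl⟩

/-- A signed count of the integers between `0` and `c`. In `nP_assoc` it counts the terms in which
the two bracketings order `x` and `f` differently. -/
theorem locSum_interval (c : ℤ) (X : Op) :
    locSum (fun a : ℤ => if 0 ≤ a ∧ a < c then X else if c ≤ a ∧ a < 0 then -X else 0)
      = (c : ℂ) • X := by
  rcases le_total 0 c with hc | hc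
  · rw [locSum_eq_sum (Finset.Ico 0 c)]
    · rw [Finset.sum_congr rfl (g := fun _ => X) fun a ha => if_pos (Finset.mem_Ico.1 ha)]
      obtain ⟨n, rfl⟩ := Int.eq_ofNat_of_zero_le hc
      simp [Nat.cast_smul_eq_nsmul]
    · intro a ha
      rw [Finset.mem_Ico] at ha
      rw [if_neg ha, if_neg (by omega)]
  · rw [locSum_eq_sum (Finset.Ico c 0)]
    · rw [Finset.sum_congr rfl (g := fun _ => -X) fun a ha => by
        rw [Finset.mem_Ico] at ha
        rw [if_neg (by omega), if_pos ha]]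
      obtain ⟨n, hn⟩ := Int.eq_ofNat_of_zero_le (neg_nonneg.2 hc)
      obtain rfl : c = -(n : ℤ) := by omega
      simp [Nat.cast_smul_eq_nsmul]
    · intro a ha
      rw [Finset.mem_Ico] at ha
      rw [if_neg (by omega), if_neg ha]

theorem nP_apply (σ : ℂ) (A B : Modes) (n : ℤ) : nP σ A B n = locSum (cutTerm σ 0 A B n) := rfl

-- Both bracketings are sums over the indices `a` of `x` and `b` of `g` of the same monomials. They
-- order `x` and `f` differently only if `a` and `a + b + 1` lie on different sides of `0`, and then
-- the difference is the bracket `h` of `x` and `f`. For given `b` the signed number of such `a` is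
-- `-b - 1`, which is the coefficient of `g_b` in the derivative of `g`. That `g` commutes up to
-- sign with `f` and `h` makes all other orderings immaterial.
set_option maxHeartbeats 1000000 in
theorem nP_assoc {x g f h : Modes} [hx : Fld x] [Fld g] [hf : Fld f] [Fld h] {σ τ ε : ℂ}
    (hσ : σ * σ = 1) (hτ : τ * τ = 1) (hε : ε * ε = 1) (hxf : Brk ε x f h 0)
    (hgf : Brk τ g f 0 0) (hgh : Brk (σ * τ) g h 0 0) :
    nP (ε * τ) (nP σ x g) f = nP (σ * ε) x (nP τ g f) + σ • nP (σ * τ) (derivField 0 g) h := by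
  funext n
  have cgf : ∀ b c, f c * g b = τ • (g b * f c) := fun b c => by
    have := hgf b c
    simp only [Pi.zero_apply, smul_zero, add_zero, sub_eq_zero] at this
    rw [this, smul_smul, hτ, one_smul]
  have cgh : ∀ b c, h c * g b = (σ * τ) • (g b * h c) := fun b c => by
    have := hgh b c
    simp only [Pi.zero_apply, smul_zero, add_zero, sub_eq_zero] at this
    rw [this, smul_smul, show σ * τ * (σ * τ) = (σ * σ) * (τ * τ) by ring, hσ, hτ, one_mul,
      one_smul]
  have cxf : ∀ a c, f c * x a = ε • (x a * f c) - ε • h (a + c) := fun a c => by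
    have := hxf a c
    simp only [Pi.zero_apply, smul_zero, add_zero] at this
    rw [← this, smul_sub, smul_smul, hε]; module
  let X : ℤ → Op := fun b => σ • (g b * h (n - b - 2))
  let T : ℤ × ℤ → Op := fun p => if p.1 < 0 then cutTerm σ 0 x g p.1 p.2 * f (n - p.1 - 1)
    else (ε * τ) • (f (n - p.1 - 1) * cutTerm σ 0 x g p.1 p.2)
  let T' : ℤ × ℤ → Op := fun p => if p.1 < 0 then x p.1 * cutTerm τ 0 g f (n - p.1 - 1) p.2
    else (σ * ε) • (cutTerm τ 0 g f (n - p.1 - 1) p.2 * x p.1)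
  -- The discrepancy of the two orderings, with the index of `g` in the first place and the index of
  -- `x` in the second.
  let Z : ℤ × ℤ → Op := fun p => if 0 ≤ p.2 ∧ p.2 < -p.1 - 1 then X p.1
    else if -p.1 - 1 ≤ p.2 ∧ p.2 < 0 then -X p.1 else 0
  -- The index of the inner product of `x` and `g` is `a + b + 1`.
  let e : ℤ × ℤ ≃ ℤ × ℤ := ⟨fun p => (p.1 + p.2 + 1, p.1), fun q => (q.2, q.1 - q.2 - 1),
    fun p => by ext <;> simp only <;> ring,
    fun q => by ext <;> simp only <;> ring⟩
  have hT : LocFin T := by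
    refine locFin_of_slices (fun l => ?_) fun v => ?_
    · by_cases hl : l < 0
      · simpa [T, hl] using (locFin_cutTerm σ 0 l).mul_right (f (n - l - 1))
      · simpa [T, hl] using ((locFin_cutTerm σ 0 l).mul_left (f (n - l - 1))).smul (ε * τ)
    · obtain ⟨M, hM⟩ := hf.trunc v
      obtain ⟨K, hK⟩ := cutTerm_eventually_zero (A := x) (B := g) σ v
      refine (Set.finite_Icc (min (n - 1 - M) 0) (max K 0)).subset ?_
      rintro l ⟨a, ha⟩
      by_contra hl
      simp only [Set.mem_Icc, not_and_or, not_le, lt_inf_iff, sup_lt_iff] at hl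
      apply ha
      by_cases hl0 : l < 0
      · simp only [T, hl0, if_true, Module.End.mul_apply]
        rw [hM _ (by omega), map_zero]
      · simp only [T, hl0, if_false, LinearMap.smul_apply, Module.End.mul_apply]
        rw [hK l (by omega), map_zero, smul_zero]
  have hT' : LocFin T' := by
    refine locFin_of_slices (fun a => ?_) fun v => ?_
    · by_cases ha : a < 0
      · simpa [T', ha] using (locFin_cutTerm τ 0 (n - a - 1)).mul_left (x a)
      · simpa [T', ha] using ((locFin_cutTerm τ 0 (n - a - 1)).mul_right (x a)).smul (σ * ε)
    · obtain ⟨M, hM⟩ := hx.trunc v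
      obtain ⟨K, hK⟩ := cutTerm_eventually_zero (A := g) (B := f) τ v
      refine (Set.finite_Icc (min (n - 1 - K) 0) (max M 0)).subset ?_
      rintro a ⟨b, hb⟩
      by_contra ha
      simp only [Set.mem_Icc, not_and_or, not_le, lt_inf_iff, sup_lt_iff] at ha
      apply hb
      by_cases ha0 : a < 0
      · simp only [T', ha0, if_true, Module.End.mul_apply]
        rw [hK _ (by omega), map_zero]
      · simp only [T', ha0, if_false, LinearMap.smul_apply, Module.End.mul_apply]
        rw [hM _ (by omega), map_zero, smul_zero]
  have key : ∀ p, T (e p) = T' p + Z p.swap := by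
    rintro ⟨a, b⟩
    have c1 : n - (a + b + 1) - 1 = n - a - 1 - b - 1 := by ring
    have c2 : a + b + 1 - a - 1 = b := by ring
    have c3 : a + (n - a - 1 - b - 1) = n - b - 2 := by ring
    have t1 : cutTerm τ 0 g f (n - a - 1) b = g b * f (n - a - 1 - b - 1) := by
      unfold cutTerm
      split_ifs
      · rfl
      · rw [cgf, smul_smul, hτ, one_smul]
    have d1 := cxf a (n - a - 1 - b - 1)
    rw [c3] at d1
    have d2 : x a * f (n - a - 1 - b - 1)
        = ε • (f (n - a - 1 - b - 1) * x a) + h (n - b - 2) := by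
      rw [d1, smul_sub, smul_smul, smul_smul, hε]; module
    simp only [T, T', Z, X, e, Equiv.coe_fn_mk, Prod.swap, t1]
    unfold cutTerm
    rw [c1, c2]
    by_cases ha : a < 0 <;> by_cases hl : a + b + 1 < 0
    · rw [if_pos hl, if_pos ha, if_pos ha, if_neg (by omega), if_neg (by omega), mul_assoc,
        add_zero]
    · rw [if_neg hl, if_pos ha, if_pos ha, if_neg (by omega), if_pos (by omega), ← mul_assoc, d1,
        sub_mul, smul_mul_assoc, smul_mul_assoc, cgh, mul_assoc, cgf]
      simp only [mul_smul_comm, smul_sub, smul_smul]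
      rw [show ε * τ * (ε * τ) = (ε * ε) * (τ * τ) by ring,
        show ε * τ * (ε * (σ * τ)) = (ε * ε) * (τ * τ) * σ by ring, hε, hτ]
      module
    · rw [if_pos hl, if_neg ha, if_neg ha, if_pos (by omega), smul_mul_assoc, mul_assoc, d2,
        mul_add, mul_smul_comm, ← mul_assoc]
      module
    · rw [if_neg hl, if_neg ha, if_neg ha, if_neg (by omega), if_neg (by omega), add_zero,
        mul_smul_comm, ← mul_assoc, cgf, smul_mul_assoc, smul_smul, smul_smul,
        show ε * τ * σ * τ = (τ * τ) * (σ * ε) by ring, hτ, one_mul]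
  have hTe : LocFin fun p => T (e p) := hT.comp e.injective
  have hZ' : LocFin fun p : ℤ × ℤ => Z p.swap := by
    have : (fun p : ℤ × ℤ => Z p.swap) = fun p => T (e p) + (-1 : ℂ) • T' p := by
      funext p; rw [key]; module
    rw [this]
    exact hTe.add (hT'.smul _)
  have hZ : LocFin Z := hZ'.comp Prod.swap_injective
  have l1 : nP (ε * τ) (nP σ x g) f n = locSum T := by
    rw [← locSum_prod hT]
    rw [nP_apply]
    congr 1; funext l
    rw [cutTerm, nP_apply]
    by_cases hl : l < 0
    · simp [T, hl, locSum_mul _ (locFin_cutTerm (A := x) (B := g) σ 0 l)]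
    · simp [T, hl, mul_locSum _ (locFin_cutTerm (A := x) (B := g) σ 0 l), locSum_smul _
        ((locFin_cutTerm (A := x) (B := g) σ 0 l).mul_left (f (n - l - 1)))]
  have l2 : nP (σ * ε) x (nP τ g f) n = locSum T' := by
    rw [← locSum_prod hT']
    rw [nP_apply]
    congr 1; funext l
    rw [cutTerm, nP_apply]
    by_cases hl : l < 0
    · simp [T', hl, mul_locSum _ (locFin_cutTerm (A := g) (B := f) τ 0 (n - l - 1))]
    · simp [T', hl, locSum_mul _ (locFin_cutTerm (A := g) (B := f) τ 0 (n - l - 1)), locSum_smul _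
        ((locFin_cutTerm (A := g) (B := f) τ 0 (n - l - 1)).mul_right (x l))]
  have l3 : σ • nP (σ * τ) (derivField 0 g) h n = locSum Z := by
    rw [← locSum_prod hZ]
    simp only [Z, locSum_interval]
    unfold nP
    rw [← locSum_smul _ (locFin_cutTerm _ _ _), ← locSum_equiv (Equiv.addRight 1)
      ((locFin_cutTerm (σ * τ) 0 n).smul σ)]
    congr 1; funext b
    have d : cutTerm (σ * τ) 0 (derivField 0 g) h n (b + 1)
        = (-(b : ℂ) - 1) • (g b * h (n - b - 2)) := by
      unfold cutTerm derivField
      rw [show n - (b + 1) - 1 = n - b - 2 by ring, show b + 1 - 1 = b by ring]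
      split_ifs
      · rw [smul_mul_assoc]; push_cast; module
      · rw [mul_smul_comm, cgh, smul_smul, smul_smul,
          show σ * τ * (0 - ((b + 1 : ℤ) : ℂ)) * (σ * τ)
            = (σ * σ) * (τ * τ) * (0 - ((b + 1 : ℤ) : ℂ)) by ring, hσ, hτ]
        push_cast; module
    simp only [Equiv.coe_addRight, d, X]
    push_cast
    module
  have l4 : locSum (fun p : ℤ × ℤ => Z p.swap) = locSum Z := locSum_equiv (Equiv.prodComm ℤ ℤ) hZ
  rw [Pi.add_apply, Pi.smul_apply, l1, l2, l3, ← locSum_equiv e hT, ← l4, ← locSum_add hT' hZ']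
  congr 1; funext p
  exact key p

/-! ### Creation and annihilation operators -/

section Finsupp

variable {ι : Type} [DecidableEq ι]

theorem tsub_single_comm (f : ι →₀ ℕ) (a b : ι) :
    f - Finsupp.single a 1 - Finsupp.single b 1 = f - Finsupp.single b 1 - Finsupp.single a 1 := by
  rw [tsub_tsub, tsub_tsub, add_comm]

theorem add_single_tsub_single (f : ι →₀ ℕ) {a b : ι} (h : a ≠ b) :
    f + Finsupp.single b 1 - Finsupp.single a 1 = f - Finsupp.single a 1 + Finsupp.single b 1 := by
  ext i
  by_cases hb : i = b
  · subst hb; simp [h]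
  · simp [Ne.symm hb]

theorem tsub_single_add_single (f : ι →₀ ℕ) {a : ι} (h : f a ≠ 0) :
    f - Finsupp.single a 1 + Finsupp.single a 1 = f := by
  ext i
  by_cases hb : i = a
  · subst hb; simp; omega
  · simp [Ne.symm hb]

end Finsupp

theorem bosCreate_comm (a b : ℤ) : bosCreate a * bosCreate b = bosCreate b * bosCreate a := by
  refine op_ext fun s => ?_
  simp [bosCreate, add_right_comm]

theorem oscCreate_comm (a b : ℕ) : oscCreate a * oscCreate b = oscCreate b * oscCreate a := by
  refine op_ext fun s => ?_
  simp [oscCreate, add_right_comm]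

theorem bosAnnih_comm (a b : ℤ) : bosAnnih a * bosAnnih b = bosAnnih b * bosAnnih a := by
  refine op_ext fun s => ?_
  by_cases h : a = b
  · rw [h]
  · simp [bosAnnih, tsub_single_comm s.bos a b, h, Ne.symm h, mul_comm]

theorem oscAnnih_comm (a b : ℕ) : oscAnnih a * oscAnnih b = oscAnnih b * oscAnnih a := by
  refine op_ext fun s => ?_
  by_cases h : a = b
  · rw [h]
  · simp [oscAnnih, tsub_single_comm s.osc a b, h, Ne.symm h, mul_comm]

theorem bosAnnih_bosCreate (a b : ℤ) :
    bosAnnih a * bosCreate b - bosCreate b * bosAnnih a = if a = b then 1 else 0 := by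
  refine op_ext fun s => ?_
  by_cases h : a = b
  · subst h
    by_cases h0 : s.bos a = 0
    · simp [bosCreate, bosAnnih, h0]
    · simp [bosCreate, bosAnnih, tsub_single_add_single _ h0, ← Finsupp.single_sub]
  · simp [bosCreate, bosAnnih, h, Ne.symm h, add_single_tsub_single s.bos h]

theorem oscAnnih_oscCreate (a b : ℕ) :
    oscAnnih a * oscCreate b - oscCreate b * oscAnnih a = if a = b then 1 else 0 := by
  refine op_ext fun s => ?_
  by_cases h : a = b
  · subst h
    by_cases h0 : s.osc a = 0
    · simp [oscCreate, oscAnnih, h0]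
    · simp [oscCreate, oscAnnih, tsub_single_add_single _ h0, ← Finsupp.single_sub]
  · simp [oscCreate, oscAnnih, h, Ne.symm h, add_single_tsub_single s.osc h]

theorem ferSign_insert {a b : ℤ} {f : Finset ℤ} (h : b ∉ f) :
    ferSign a (insert b f) = if b < a then -ferSign a f else ferSign a f := by
  unfold ferSign
  rw [Finset.filter_insert]
  split_ifs with hb
  · rw [Finset.card_insert_of_notMem (by simp [h]), pow_succ]; ring
  · rfl

theorem ferSign_erase {a b : ℤ} {f : Finset ℤ} (h : b ∈ f) :
    ferSign a (f.erase b) = if b < a then -ferSign a f else ferSign a f := by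
  have := ferSign_insert (a := a) (Finset.notMem_erase b f)
  rw [Finset.insert_erase h] at this
  rw [this]
  split_ifs <;> simp

theorem ferSign_mul_self (a : ℤ) (f : Finset ℤ) : ferSign a f * ferSign a f = 1 := by
  unfold ferSign; rw [← mul_pow]; simp

/-- Inserting the smaller label reverses the sign attached to the larger one, and not conversely; so
exactly one of the two orders picks up an extra sign. -/
theorem ferCreate_anticomm (a b : ℤ) :
    ferCreate a * ferCreate b + ferCreate b * ferCreate a = 0 := by
  refine op_ext fun s => ?_
  by_cases hab : a = b
  · subst hab
    by_cases ha : a ∈ s.fer <;> simp [ferCreate, ha]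
  by_cases ha : a ∈ s.fer <;> by_cases hb : b ∈ s.fer <;>
    simp [ferCreate, ha, hb, hab, Ne.symm hab, ferSign_insert, Finset.insert_comm a b]
  rw [← Finsupp.single_add]
  rcases lt_or_gt_of_ne hab with h | h <;> simp [h, h.le, not_lt_of_gt h, mul_comm]

theorem ferAnnih_anticomm (a b : ℤ) :
    ferAnnih a * ferAnnih b + ferAnnih b * ferAnnih a = 0 := by
  refine op_ext fun s => ?_
  by_cases hab : a = b
  · subst hab
    by_cases ha : a ∈ s.fer <;> simp [ferAnnih, ha]
  by_cases ha : a ∈ s.fer <;> by_cases hb : b ∈ s.fer <;>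
    simp [ferAnnih, ha, hb, hab, Ne.symm hab, ferSign_erase, Finset.erase_right_comm (a := a)]
  rw [← Finsupp.single_add]
  rcases lt_or_gt_of_ne hab with h | h <;> simp [h, h.le, not_lt_of_gt h, mul_comm]

theorem ferAnnih_ferCreate (a b : ℤ) :
    ferAnnih a * ferCreate b + ferCreate b * ferAnnih a = if a = b then 1 else 0 := by
  refine op_ext fun s => ?_
  by_cases hab : a = b
  · subst hab
    by_cases ha : a ∈ s.fer <;>
      simp [ferAnnih, ferCreate, ha, ferSign_insert, ferSign_erase, ferSign_mul_self]
  · by_cases ha : a ∈ s.fer <;> by_cases hb : b ∈ s.fer <;>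
      simp [ferAnnih, ferCreate, ha, hb, hab, Ne.symm hab, ferSign_insert, ferSign_erase]
    rw [Finset.erase_insert_of_ne (Ne.symm hab), ← Finsupp.single_add]
    rcases lt_or_gt_of_ne hab with h | h <;> simp [h, h.le, not_lt_of_gt h, mul_comm]

theorem commute_bos_osc (a : ℤ) (i : ℕ) : Commute (bosCreate a) (oscCreate i) ∧
    Commute (bosCreate a) (oscAnnih i) ∧ Commute (bosAnnih a) (oscCreate i) ∧
    Commute (bosAnnih a) (oscAnnih i) := by
  refine ⟨?_, ?_, ?_, ?_⟩ <;> refine op_ext fun s => ?_ <;>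
    simp [bosCreate, bosAnnih, oscCreate, oscAnnih, mul_comm]

theorem commute_bos_fer (a b : ℤ) : Commute (bosCreate a) (ferCreate b) ∧
    Commute (bosCreate a) (ferAnnih b) ∧ Commute (bosAnnih a) (ferCreate b) ∧
    Commute (bosAnnih a) (ferAnnih b) := by
  refine ⟨?_, ?_, ?_, ?_⟩ <;> refine op_ext fun s => ?_ <;> by_cases h : b ∈ s.fer <;>
    simp [bosCreate, bosAnnih, ferCreate, ferAnnih, h, mul_comm]

theorem commute_osc_fer (i : ℕ) (b : ℤ) : Commute (oscCreate i) (ferCreate b) ∧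
    Commute (oscCreate i) (ferAnnih b) ∧ Commute (oscAnnih i) (ferCreate b) ∧
    Commute (oscAnnih i) (ferAnnih b) := by
  refine ⟨?_, ?_, ?_, ?_⟩ <;> refine op_ext fun s => ?_ <;> by_cases h : b ∈ s.fer <;>
    simp [oscCreate, oscAnnih, ferCreate, ferAnnih, h, mul_comm]

/-! ### Brackets of the free fields -/

theorem brk_of_commute {A B : Modes} (h : ∀ m n, Commute (A m) (B n)) : Brk 1 A B 0 0 :=
  fun m n => by simp [(h m n).eq]

theorem Brk.commute {A B : Modes} (h : Brk 1 A B 0 0) (m n : ℤ) : Commute (A m) (B n) := by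
  have := h m n
  simp only [one_smul, Pi.zero_apply, smul_zero, add_zero, sub_eq_zero] at this
  exact this

theorem brk_of_anticommute {A B : Modes} (h : ∀ m n, A m * B n + B n * A m = 0) :
    Brk (-1) A B 0 0 := fun m n => by simp [h m n]

theorem Brk.anticommute {A B : Modes} (h : Brk (-1) A B 0 0) (m n : ℤ) :
    A m * B n + B n * A m = 0 := by
  have := h m n
  simpa using this

theorem brk_beta_beta : Brk 1 beta beta 0 0 := brk_of_commute fun m n => by
  unfold beta betaMode
  split_ifs with h1 h2 h2
  · exact bosCreate_comm _ _
  · have := bosAnnih_bosCreate n m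
    rw [if_neg (by omega)] at this
    exact (sub_eq_zero.1 this).symm
  · have := bosAnnih_bosCreate m n
    rw [if_neg (by omega)] at this
    exact sub_eq_zero.1 this
  · exact bosAnnih_comm _ _

theorem brk_gamma_gamma : Brk 1 gamma gamma 0 0 := brk_of_commute fun m n => by
  unfold gamma gammaMode
  split_ifs with h1 h2 h2
  · exact bosCreate_comm _ _
  · have := bosAnnih_bosCreate (-(n + 1)) (-(m + 1))
    rw [if_neg (by omega)] at this
    exact Commute.neg_right (sub_eq_zero.1 this).symm
  · have := bosAnnih_bosCreate (-(m + 1)) (-(n + 1))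
    rw [if_neg (by omega)] at this
    exact Commute.neg_left (sub_eq_zero.1 this)
  · exact Commute.neg_left (Commute.neg_right (bosAnnih_comm _ _))

/-- As a field, `gamma` has the modes `γ_(n+1)`, so the Kronecker symbol sits at `m + n = -1`, where
the identity field has its only mode. -/
theorem brk_beta_gamma : Brk 1 beta gamma oneF 0 := fun m n => by
  simp only [Pi.zero_apply, smul_zero, add_zero, one_smul, oneF]
  unfold beta gamma betaMode gammaMode
  split_ifs with h1 h2 h3 h3 h2 h3 h3
  · omega
  · rw [bosCreate_comm]; simp
  · have := bosAnnih_bosCreate (-(n + 1)) m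
    rw [if_pos (by omega)] at this
    rw [← this]; noncomm_ring
  · have := bosAnnih_bosCreate (-(n + 1)) m
    rw [if_neg (by omega)] at this
    rw [← this]; noncomm_ring
  · have := bosAnnih_bosCreate m (-(n + 1))
    rw [if_pos (by omega)] at this
    exact this
  · have := bosAnnih_bosCreate m (-(n + 1))
    rw [if_neg (by omega)] at this
    exact this
  · omega
  · have := bosAnnih_comm m (-(n + 1))
    rw [mul_neg, this]; noncomm_ring

theorem brk_psiPlus_psiPlus : Brk (-1) psiPlus psiPlus 0 0 := brk_of_anticommute fun m n => by
  unfold psiPlus psiPlusMode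
  split_ifs with h1 h2 h2
  · exact ferCreate_anticomm _ _
  · have := ferAnnih_ferCreate n m
    rwa [if_neg (by omega), add_comm] at this
  · have := ferAnnih_ferCreate m n
    rwa [if_neg (by omega)] at this
  · exact ferAnnih_anticomm _ _

theorem brk_psi_psi : Brk (-1) psi psi 0 0 := brk_of_anticommute fun m n => by
  unfold psi psiMode
  split_ifs with h1 h2 h2
  · exact ferCreate_anticomm _ _
  · have := ferAnnih_ferCreate (-(n + 1)) (-(m + 1))
    rwa [if_neg (by omega), add_comm] at this
  · have := ferAnnih_ferCreate (-(m + 1)) (-(n + 1))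
    rwa [if_neg (by omega)] at this
  · exact ferAnnih_anticomm _ _

theorem brk_psiPlus_psi : Brk (-1) psiPlus psi oneF 0 := fun m n => by
  simp only [Pi.zero_apply, smul_zero, add_zero, neg_smul, one_smul, sub_neg_eq_add, oneF]
  unfold psiPlus psi psiPlusMode psiMode
  split_ifs with h1 h2 h3 h3 h2 h3 h3
  · omega
  · exact ferCreate_anticomm _ _
  · have := ferAnnih_ferCreate (-(n + 1)) m
    rwa [if_pos (by omega), add_comm] at this
  · have := ferAnnih_ferCreate (-(n + 1)) m
    rwa [if_neg (by omega), add_comm] at this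
  · have := ferAnnih_ferCreate m (-(n + 1))
    rwa [if_pos (by omega)] at this
  · have := ferAnnih_ferCreate m (-(n + 1))
    rwa [if_neg (by omega)] at this
  · omega
  · exact ferAnnih_anticomm _ _

theorem commute_smul_one (c : ℂ) (A : Op) : Commute (c • (1 : Op)) A :=
  (Commute.one_left A).smul_left c

theorem phiMode_bracket (c : ℂ) (m n : ℤ) : phiMode c m * phiMode c n - phiMode c n * phiMode c m
    = if m + n = 0 then (m : ℂ) • 1 else 0 := by
  have h := fun a b : ℕ => oscAnnih_oscCreate a b
  have e : phiMode c 0 = c • 1 := if_pos rfl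
  by_cases hm : m = 0
  · subst hm; rw [e, (commute_smul_one c _).eq]; simp
  by_cases hn : n = 0
  · subst hn; rw [e, (commute_smul_one c _).eq]; simp [hm]
  unfold phiMode
  rw [if_neg hm, if_neg hn]
  by_cases hm' : m < 0 <;> by_cases hn' : n < 0
  · rw [if_pos hm', if_pos hn', if_neg (by omega), oscCreate_comm, sub_self]
  · have := h (n.natAbs - 1) (m.natAbs - 1)
    rw [if_pos hm', if_neg hn', mul_smul_comm, smul_mul_assoc, ← smul_sub, ← neg_sub, this]
    by_cases hmn : m + n = 0
    · rw [if_pos hmn, if_pos (by omega), show m = -n by omega]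
      push_cast; simp
    · rw [if_neg hmn, if_neg (by omega)]; simp
  · have := h (m.natAbs - 1) (n.natAbs - 1)
    rw [if_neg hm', if_pos hn', mul_smul_comm, smul_mul_assoc, ← smul_sub, this]
    by_cases hmn : m + n = 0
    · rw [if_pos hmn, if_pos (by omega)]
    · rw [if_neg hmn, if_neg (by omega)]; simp
  · rw [if_neg hm', if_neg hn', if_neg (by omega)]
    simp only [mul_smul_comm, smul_mul_assoc]
    rw [oscAnnih_comm, smul_comm, sub_self]

theorem brk_iDphi (α j : ℂ) : Brk 1 (iDphi α j) (iDphi α j) 0 oneF := fun m n => by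
  have := phiMode_bracket (2 * j / α) m n
  simp only [iDphi, one_smul, Pi.zero_apply, zero_add, oneF, this,
    show m + n - 1 = -1 ↔ m + n = 0 by omega]
  split_ifs <;> simp

theorem commute_phiMode {A : Op} (h : ∀ i, Commute (oscCreate i) A ∧ Commute (oscAnnih i) A) (c : ℂ)
    (n : ℤ) : Commute (phiMode c n) A := by
  unfold phiMode
  split_ifs
  · exact commute_smul_one c A
  · exact (h _).1
  · exact (h _).2.smul_left _

theorem commute_betaMode {A : Op} (h : ∀ i, Commute (bosCreate i) A ∧ Commute (bosAnnih i) A)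
    (n : ℤ) : Commute (betaMode n) A := by
  unfold betaMode
  split_ifs
  exacts [(h _).1, (h _).2]

theorem commute_gammaMode {A : Op} (h : ∀ i, Commute (bosCreate i) A ∧ Commute (bosAnnih i) A)
    (n : ℤ) : Commute (gammaMode n) A := by
  unfold gammaMode
  split_ifs
  exacts [(h _).1, (h _).2.neg_left]

theorem commute_psiPlusMode {A : Op} (h : ∀ i, Commute (ferCreate i) A ∧ Commute (ferAnnih i) A)
    (n : ℤ) : Commute (psiPlusMode n) A := by
  unfold psiPlusMode
  split_ifs
  exacts [(h _).1, (h _).2]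

theorem commute_psiMode {A : Op} (h : ∀ i, Commute (ferCreate i) A ∧ Commute (ferAnnih i) A)
    (n : ℤ) : Commute (psiMode n) A := by
  unfold psiMode
  split_ifs
  exacts [(h _).1, (h _).2]

theorem brk_beta_psiPlus : Brk 1 beta psiPlus 0 0 := brk_of_commute fun m n =>
  commute_betaMode (fun i => ⟨(commute_psiPlusMode (fun a =>
      ⟨(commute_bos_fer i a).1.symm, (commute_bos_fer i a).2.1.symm⟩) n).symm,
    (commute_psiPlusMode (fun a =>
      ⟨(commute_bos_fer i a).2.2.1.symm, (commute_bos_fer i a).2.2.2.symm⟩) n).symm⟩) m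

theorem brk_gamma_psiPlus : Brk 1 gamma psiPlus 0 0 := brk_of_commute fun m n =>
  commute_gammaMode (fun i => ⟨(commute_psiPlusMode (fun a =>
      ⟨(commute_bos_fer i a).1.symm, (commute_bos_fer i a).2.1.symm⟩) n).symm,
    (commute_psiPlusMode (fun a =>
      ⟨(commute_bos_fer i a).2.2.1.symm, (commute_bos_fer i a).2.2.2.symm⟩) n).symm⟩) _

theorem brk_beta_psi : Brk 1 beta psi 0 0 := brk_of_commute fun m n =>
  commute_betaMode (fun i => ⟨(commute_psiMode (fun a =>
      ⟨(commute_bos_fer i a).1.symm, (commute_bos_fer i a).2.1.symm⟩) _).symm,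
    (commute_psiMode (fun a =>
      ⟨(commute_bos_fer i a).2.2.1.symm, (commute_bos_fer i a).2.2.2.symm⟩) _).symm⟩) m

theorem brk_gamma_psi : Brk 1 gamma psi 0 0 := brk_of_commute fun m n =>
  commute_gammaMode (fun i => ⟨(commute_psiMode (fun a =>
      ⟨(commute_bos_fer i a).1.symm, (commute_bos_fer i a).2.1.symm⟩) _).symm,
    (commute_psiMode (fun a =>
      ⟨(commute_bos_fer i a).2.2.1.symm, (commute_bos_fer i a).2.2.2.symm⟩) _).symm⟩) _

/-- The operators commuting with all oscillators `φ_n`. -/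
def NoOsc (A : Op) : Prop := ∀ i, Commute (oscCreate i) A ∧ Commute (oscAnnih i) A

theorem noOsc_beta (n : ℤ) : NoOsc (beta n) := fun i =>
  ⟨(commute_betaMode (fun a => ⟨(commute_bos_osc a i).1, (commute_bos_osc a i).2.2.1⟩) n).symm,
    (commute_betaMode (fun a => ⟨(commute_bos_osc a i).2.1, (commute_bos_osc a i).2.2.2⟩) n).symm⟩

theorem noOsc_gamma (n : ℤ) : NoOsc (gamma n) := fun i =>
  ⟨(commute_gammaMode (fun a => ⟨(commute_bos_osc a i).1, (commute_bos_osc a i).2.2.1⟩) _).symm,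
    (commute_gammaMode (fun a => ⟨(commute_bos_osc a i).2.1, (commute_bos_osc a i).2.2.2⟩) _).symm⟩

theorem noOsc_psiPlus (n : ℤ) : NoOsc (psiPlus n) := fun i =>
  ⟨(commute_psiPlusMode (fun a =>
      ⟨(commute_osc_fer i a).1.symm, (commute_osc_fer i a).2.1.symm⟩) n).symm,
    (commute_psiPlusMode (fun a =>
      ⟨(commute_osc_fer i a).2.2.1.symm, (commute_osc_fer i a).2.2.2.symm⟩) n).symm⟩

theorem noOsc_psi (n : ℤ) : NoOsc (psi n) := fun i =>
  ⟨(commute_psiMode (fun a =>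
      ⟨(commute_osc_fer i a).1.symm, (commute_osc_fer i a).2.1.symm⟩) _).symm,
    (commute_psiMode (fun a =>
      ⟨(commute_osc_fer i a).2.2.1.symm, (commute_osc_fer i a).2.2.2.symm⟩) _).symm⟩

theorem NoOsc.phiMode {A : Op} (h : NoOsc A) (c : ℂ) (n : ℤ) : Commute (phiMode c n) A :=
  commute_phiMode h c n

theorem brk_iDphi_of_noOsc {A : Modes} (h : ∀ n, NoOsc (A n)) (α j : ℂ) :
    Brk 1 (iDphi α j) A 0 0 := brk_of_commute fun m n => (h n).phiMode _ m

/-! ### Truncation of the free fields -/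

/-- A vector involves finitely many labels. One common bound for all of them yields the truncation
of all five free fields. -/
theorem occ_sup (v : Fock) : ∃ N : ℤ, ∀ s ∈ v.support, ∀ n : ℤ, N ≤ n →
    s.bos n = 0 ∧ s.bos (-n) = 0 ∧ s.osc (n.natAbs - 1) = 0 ∧ n ∉ s.fer ∧ -n ∉ s.fer := by
  let S : Finset ℤ := v.support.biUnion fun s => s.bos.support ∪ s.fer
    ∪ s.osc.support.image fun i : ℕ => ((i : ℤ) + 1)
  refine ⟨(∑ a ∈ S, |a|) + 2, fun s hs n hn => ?_⟩
  have hS : ∀ a ∈ S, |a| ≤ ∑ a ∈ S, |a| := fun a ha =>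
    Finset.single_le_sum (f := fun a => |a|) (fun _ _ => abs_nonneg _) ha
  have h0 : 0 ≤ ∑ a ∈ S, |a| := Finset.sum_nonneg fun _ _ => abs_nonneg _
  have key : ∀ a ∈ S, |a| < n - 1 := fun a ha => by have := hS a ha; omega
  have mem : ∀ a, a ∈ s.bos.support ∨ a ∈ s.fer ∨ (∃ i ∈ s.osc.support, (i : ℤ) + 1 = a)
      → a ∈ S := fun a ha => by
    simp only [S, Finset.mem_biUnion, Finset.mem_union, Finset.mem_image]
    exact ⟨s, hs, by tauto⟩
  refine ⟨?_, ?_, ?_, ?_, ?_⟩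
  · by_contra h
    have := key n (mem _ (Or.inl (Finsupp.mem_support_iff.2 h)))
    rw [abs_of_nonneg (by omega)] at this; omega
  · by_contra h
    have := key (-n) (mem _ (Or.inl (Finsupp.mem_support_iff.2 h)))
    rw [abs_of_nonpos (by omega)] at this; omega
  · by_contra h
    have := key _ (mem _ (Or.inr (Or.inr ⟨_, Finsupp.mem_support_iff.2 h, rfl⟩)))
    rw [abs_of_nonneg (by omega)] at this; omega
  · intro h
    have := key n (mem _ (Or.inr (Or.inl h)))
    rw [abs_of_nonneg (by omega)] at this; omega
  · intro h
    have := key (-n) (mem _ (Or.inr (Or.inl h)))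
    rw [abs_of_nonpos (by omega)] at this; omega

theorem op_eq_zero_of_support {A : Op} {v : Fock}
    (h : ∀ s ∈ v.support, A (Finsupp.single s 1) = 0) : A v = 0 := by
  rw [← Finsupp.sum_single v, Finsupp.sum, map_sum]
  refine Finset.sum_eq_zero fun s hs => ?_
  rw [← mul_one (v s), ← smul_eq_mul, ← Finsupp.smul_single, map_smul, h s hs, smul_zero]

instance : Fld beta := ⟨fun v => by
  obtain ⟨N, hN⟩ := occ_sup v
  refine ⟨max N 0, fun n hn => op_eq_zero_of_support fun s hs => ?_⟩
  have h := hN s hs n (le_trans (le_max_left _ _) hn)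
  have h0 := le_trans (le_max_right _ _) hn
  simp [beta, betaMode, not_lt.2 h0, bosAnnih, h.1]⟩

instance : Fld gamma := ⟨fun v => by
  obtain ⟨N, hN⟩ := occ_sup v
  refine ⟨max N 0, fun n hn => op_eq_zero_of_support fun s hs => ?_⟩
  have h := hN s hs (n + 1) (le_trans (le_trans (le_max_left _ _) hn) (by omega))
  have h0 := le_trans (le_max_right _ _) hn
  have h1 := h.2.1
  rw [neg_add_rev] at h1
  simp [gamma, gammaMode, show ¬ n + 1 ≤ 0 by omega, bosAnnih, h1]⟩

instance : Fld psiPlus := ⟨fun v => by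
  obtain ⟨N, hN⟩ := occ_sup v
  refine ⟨max N 0, fun n hn => op_eq_zero_of_support fun s hs => ?_⟩
  have h := hN s hs n (le_trans (le_max_left _ _) hn)
  have h0 := le_trans (le_max_right _ _) hn
  simp [psiPlus, psiPlusMode, not_lt.2 h0, ferAnnih, h.2.2.2.1]⟩

instance : Fld psi := ⟨fun v => by
  obtain ⟨N, hN⟩ := occ_sup v
  refine ⟨max N 0, fun n hn => op_eq_zero_of_support fun s hs => ?_⟩
  have h := hN s hs (n + 1) (le_trans (le_trans (le_max_left _ _) hn) (by omega))
  have h0 := le_trans (le_max_right _ _) hn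
  have h1 := h.2.2.2.2
  rw [neg_add_rev] at h1
  simp [psi, psiMode, show ¬ n + 1 ≤ 0 by omega, ferAnnih, h1]⟩

instance (α j : ℂ) : Fld (iDphi α j) := ⟨fun v => by
  obtain ⟨N, hN⟩ := occ_sup v
  refine ⟨max N 1, fun n hn => op_eq_zero_of_support fun s hs => ?_⟩
  have h := hN s hs n (le_trans (le_max_left _ _) hn)
  have h0 := le_trans (le_max_right _ _) hn
  simp [iDphi, phiMode, show n ≠ 0 by omega, show ¬ n < 0 by omega, oscAnnih, h.2.2.1]⟩

/-! ### Operator products of the currents -/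

theorem Brk.symm00 {ε : ℂ} {A B : Modes} (h : Brk ε A B 0 0) (hε : ε * ε = 1) : Brk ε B A 0 0 :=
  (h.symm0 hε).congr rfl (smul_zero _) rfl

/-- `Brk.wick` with normalized signs. -/
theorem Brk.wick' {A B C D0 D1 E0 E1 F : Modes} [Fld B] [Fld C] [Fld D0] [Fld D1] [Fld E0] [Fld E1]
    {εB εC σ s1 s2 s3 : ℂ} (hB : Brk εB A B D0 D1) (hC : Brk εC A C E0 E1)
    (hF : Brk s1 D0 C F 0) (hG : Brk s1 D1 C 0 0) (hε : εB * εB = 1) (h1 : σ * εC = s1)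
    (h2 : σ * εB = s2) (h3 : εB * εC = s3) :
    Brk s3 A (nP σ B C) (nP s1 D0 C + εB • nP s2 B E0) (nP s1 D1 C + εB • nP s2 B E1 + F) := by
  subst h1 h2 h3
  exact hB.wick hε hC hF hG

/-- The odd current `j⁺`. -/
def fP : Modes := psiPlus - nP 1 beta psi

instance : Fld fP := inferInstanceAs (Fld (psiPlus - nP 1 beta psi))

theorem koszul00 : koszul 0 0 = 1 := by simp [koszul]
theorem koszul01 : koszul 0 1 = 1 := by simp [koszul]
theorem koszul10 : koszul 1 0 = 1 := by simp [koszul]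
theorem koszul11 : koszul 1 1 = -1 := by simp [koszul]

theorem brk_psi_beta : Brk 1 psi beta 0 0 := brk_beta_psi.symm00 (by norm_num)
theorem brk_psi_gamma : Brk 1 psi gamma 0 0 := brk_gamma_psi.symm00 (by norm_num)
theorem brk_gamma_beta : Brk 1 gamma beta (-oneF) 0 :=
  (brk_beta_gamma.symm0 (by norm_num)).congr rfl (by simp) rfl
theorem brk_psi_psiPlus : Brk (-1) psi psiPlus oneF 0 :=
  (brk_psiPlus_psi.symm0 (by norm_num)).congr rfl (by simp) rfl

/-- By `nP_comm` the product equals its own negative. -/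
theorem nP_psi_psi : nP (-1) psi psi = 0 := by
  have h := nP_comm (by norm_num) brk_psi_psi
  rw [derivField_zero, sub_zero] at h
  have h2 : (2 : ℂ) • nP (-1) psi psi = 0 := by linear_combination (norm := module) h
  exact (smul_eq_zero.1 h2).resolve_left (by norm_num)

theorem nP_beta_psi_psi : nP (-1) (nP 1 beta psi) psi = 0 := by
  have h := nP_assoc (x := beta) (g := psi) (f := psi) (h := 0) (σ := 1) (τ := -1) (ε := 1)
    (by norm_num) (by norm_num) (by norm_num) brk_beta_psi brk_psi_psi
    ((brk_zero_left _ _).symm00 (by norm_num))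
  rw [nP_psi_psi, nP_zero_right, nP_zero_right, one_mul, smul_zero, add_zero] at h
  exact h

/-- As `:βψψ:` vanishes, `ψ⁺` may be replaced by the current `j⁺`. All currents are rewritten in
terms of `j⁺`, `β`, `γ`, `ψ` and `φ`, whose mutual brackets are short. -/
theorem nP_psiPlus_psi : nP (-1) psiPlus psi = nP (-1) fP psi := by
  rw [fP, nP_sub_left, nP_beta_psi_psi, sub_zero]

theorem brk_beta_P : Brk 1 beta fP 0 0 :=
  (brk_beta_psiPlus.sub_right (brk_beta_beta.wick' brk_beta_psi (brk_zero_left 1 _)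
    (brk_zero_left 1 _) (by norm_num) (by norm_num) (s2 := 1) (by norm_num) (by norm_num))).congr rfl
    (by simp [nP_zero_left, nP_zero_right]) (by simp [nP_zero_left, nP_zero_right])

theorem brk_gamma_P : Brk 1 gamma fP psi 0 :=
  (brk_gamma_psiPlus.sub_right (brk_gamma_beta.wick' brk_gamma_psi
    ((brk_one_left psi).neg_left.congr rfl neg_zero neg_zero) (brk_zero_left 1 _)
    (by norm_num) (by norm_num) (s2 := 1) (by norm_num) (by norm_num))).congr rfl
    (by simp [nP_zero_left, nP_zero_right, nP_neg_left, nP_one_left])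
    (by simp [nP_zero_left, nP_zero_right])

theorem brk_psi_P : Brk (-1) psi fP oneF 0 :=
  (brk_psi_psiPlus.sub_right (brk_psi_beta.wick' brk_psi_psi
    (brk_zero_left (-1) _) (brk_zero_left (-1) _)
    (by norm_num) (by norm_num) (s2 := 1) (by norm_num) (by norm_num))).congr rfl
    (by simp [nP_zero_left, nP_zero_right])
    (by simp [nP_zero_left, nP_zero_right])

theorem brk_psiPlus_P : Brk (-1) psiPlus fP (-beta) 0 :=
  (brk_psiPlus_psiPlus.sub_right ((brk_beta_psiPlus.symm00 (by norm_num)).wick' brk_psiPlus_psi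
    (brk_zero_left (-1) _) (brk_zero_left (-1) _)
    (by norm_num) (by norm_num) (s2 := 1) (by norm_num) (by norm_num))).congr rfl
    (by simp [nP_zero_left, nP_one_right])
    (by simp [nP_zero_left, nP_zero_right])

theorem brk_P_beta : Brk 1 fP beta 0 0 := brk_beta_P.symm00 (by norm_num)
theorem brk_P_gamma : Brk 1 fP gamma (-psi) 0 :=
  (brk_gamma_P.symm0 (by norm_num)).congr rfl (by simp) rfl
theorem brk_P_psi : Brk (-1) fP psi oneF 0 :=
  (brk_psi_P.symm0 (by norm_num)).congr rfl (by simp) rfl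

/-- The two halves `ψ⁺` and `-βψ` contribute `-β` each. For `ψ⁺ + βψ` the second contribution
changes sign and the two cancel; this is the reason for the form of `V` (`brk_P_S`). -/
theorem brk_P_P : Brk (-1) fP fP (-(2 : ℂ) • beta) 0 :=
  ((brk_psiPlus_P.symm0 (by norm_num)).sub_right (brk_P_beta.wick' brk_P_psi
    (brk_zero_left (-1) _) (brk_zero_left (-1) _)
    (by norm_num) (by norm_num) (s2 := 1) (by norm_num) (by norm_num))).congr rfl
    (by simp only [nP_zero_left, nP_one_right]; module)
    (by simp [nP_zero_left, nP_zero_right])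

theorem NoOsc.nP {A B : Modes} [Fld A] [Fld B] (hA : ∀ n, NoOsc (A n)) (hB : ∀ n, NoOsc (B n))
    (σ : ℂ) (n : ℤ) : NoOsc (nP σ A B n) := by
  have key : ∀ X : Op, (∀ n, Commute X (A n)) → (∀ n, Commute X (B n)) →
      Commute X (Osp12.nP σ A B n) := fun X h1 h2 => by
    have hl : LocFin (cutTerm σ 0 A B n) := locFin_cutTerm σ 0 n
    unfold Commute SemiconjBy
    rw [nP_apply, mul_locSum _ hl, locSum_mul _ hl]
    congr 1; funext l
    unfold cutTerm
    split_ifs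
    · exact ((h1 _).mul_right (h2 _)).eq
    · exact (((h2 _).mul_right (h1 _)).smul_right σ).eq
  exact fun i => ⟨key _ (fun n => (hA n i).1) fun n => (hB n i).1,
    key _ (fun n => (hA n i).2) fun n => (hB n i).2⟩

theorem noOsc_P (n : ℤ) : NoOsc (fP n) := fun i => by
  have h := NoOsc.nP noOsc_beta noOsc_psi 1 n i
  exact ⟨(noOsc_psiPlus n i).1.sub_right h.1, (noOsc_psiPlus n i).2.sub_right h.2⟩

section

variable (k α j : ℂ)

theorem brk_phi_beta : Brk 1 (iDphi α j) beta 0 0 := brk_iDphi_of_noOsc noOsc_beta α j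
theorem brk_phi_gamma : Brk 1 (iDphi α j) gamma 0 0 := brk_iDphi_of_noOsc noOsc_gamma α j
theorem brk_phi_psi : Brk 1 (iDphi α j) psi 0 0 := brk_iDphi_of_noOsc noOsc_psi α j
theorem brk_phi_P : Brk 1 (iDphi α j) fP 0 0 := brk_iDphi_of_noOsc noOsc_P α j
theorem brk_beta_phi : Brk 1 beta (iDphi α j) 0 0 := (brk_phi_beta α j).symm00 (by norm_num)
theorem brk_gamma_phi : Brk 1 gamma (iDphi α j) 0 0 := (brk_phi_gamma α j).symm00 (by norm_num)
theorem brk_psi_phi : Brk 1 psi (iDphi α j) 0 0 := (brk_phi_psi α j).symm00 (by norm_num)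
theorem brk_P_phi : Brk 1 fP (iDphi α j) 0 0 := (brk_phi_P α j).symm00 (by norm_num)

theorem current_jplus : current k α j .jplus = fP := by
  simp only [current, normalProd_eq, koszul01, fP]

/-- Moving `γ` to the right of `j⁺` costs one derivative of `ψ`, whence `2k + 2` in place of `2k +
1`. -/
theorem current_jminus : current k α j .jminus
    = nP 1 fP gamma + α • nP 1 (iDphi α j) psi + (2 * k + 2) • derivField 0 psi := by
  simp only [current, normalProd_eq, koszul01, koszul10]
  rw [← fP, nP_comm (by norm_num) brk_P_gamma, nP_comm (by norm_num) (brk_phi_psi α j),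
    derivField_zero, derivField_neg]
  module

theorem nP_psi_psiPlus : nP (-1) psi psiPlus = -nP (-1) fP psi := by
  rw [nP_comm (by norm_num) brk_psiPlus_psi, derivField_one, nP_psiPlus_psi]; module

theorem current_J3 : current k α j .J3
    = -nP 1 beta gamma + (α / 2) • iDphi α j + (1 / 2 : ℂ) • nP (-1) fP psi := by
  simp only [current, normalProd_eq, koszul00, koszul11, nP_psi_psiPlus]
  module

instance fld_current (a : Gen) : Fld (current k α j a) := by
  cases a <;> simp only [current, normalProd_eq] <;> infer_instance

theorem brk_beta_J3 : Brk 1 beta (current k α j .J3) (-beta) 0 := by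
  rw [current_J3]
  have h1 := brk_beta_beta.wick' brk_beta_gamma (σ := 1) (s1 := 1) (s2 := 1) (s3 := 1)
    (brk_zero_left 1 _) (brk_zero_left 1 _) (by norm_num) (by norm_num) (by norm_num) (by norm_num)
  have h2 := brk_beta_P.wick' brk_beta_psi (σ := -1) (s1 := -1) (s2 := -1) (s3 := 1)
    (brk_zero_left _ _) (brk_zero_left _ _) (by norm_num) (by norm_num) (by norm_num) (by norm_num)
  refine ((h1.neg_right.add_right ((brk_beta_phi α j).smul_right (α / 2))).add_right
    (h2.smul_right (1 / 2))).congr rfl ?_ ?_ <;>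
  simp [nP_zero_left, nP_zero_right, nP_one_right]

theorem brk_gamma_J3 : Brk 1 gamma (current k α j .J3) gamma 0 := by
  rw [current_J3]
  have h1 := brk_gamma_beta.wick' brk_gamma_gamma (σ := 1) (s1 := 1) (s2 := 1) (s3 := 1)
    ((brk_one_left _).neg_left.congr rfl neg_zero neg_zero) (brk_zero_left 1 _)
    (by norm_num) (by norm_num) (by norm_num) (by norm_num)
  have h2 := brk_gamma_P.wick' brk_gamma_psi (σ := -1) (s1 := -1) (s2 := -1) (s3 := 1)
    brk_psi_psi (brk_zero_left _ _) (by norm_num) (by norm_num) (by norm_num) (by norm_num)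
  refine ((h1.neg_right.add_right ((brk_gamma_phi α j).smul_right (α / 2))).add_right
    (h2.smul_right (1 / 2))).congr rfl ?_ ?_ <;>
  simp [nP_zero_left, nP_zero_right, nP_one_left, nP_neg_left, nP_psi_psi]

theorem brk_psi_J3 : Brk 1 psi (current k α j .J3) ((1 / 2 : ℂ) • psi) 0 := by
  rw [current_J3]
  have h1 := brk_psi_beta.wick' brk_psi_gamma (σ := 1) (s1 := 1) (s2 := 1) (s3 := 1)
    (brk_zero_left 1 _) (brk_zero_left 1 _)
    (by norm_num) (by norm_num) (by norm_num) (by norm_num)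
  have h2 := brk_psi_P.wick' brk_psi_psi (σ := -1) (s1 := 1) (s2 := 1) (s3 := 1)
    (brk_one_left _) (brk_zero_left _ _) (by norm_num) (by norm_num) (by norm_num) (by norm_num)
  refine ((h1.neg_right.add_right ((brk_psi_phi α j).smul_right (α / 2))).add_right
    (h2.smul_right (1 / 2))).congr rfl ?_ ?_ <;>
  simp [nP_zero_left, nP_zero_right, nP_one_left]

theorem brk_P_J3 : Brk 1 fP (current k α j .J3) (-(1 / 2 : ℂ) • fP) 0 := by
  rw [current_J3]
  have h1 := brk_P_beta.wick' brk_P_gamma (σ := 1) (s1 := 1) (s2 := 1) (s3 := 1)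
    (brk_zero_left 1 _) (brk_zero_left 1 _)
    (by norm_num) (by norm_num) (by norm_num) (by norm_num)
  have h2 := brk_P_P.wick' brk_P_psi (σ := -1) (s1 := 1) (s2 := 1) (s3 := 1)
    ((brk_beta_psi.smul_left _).congr rfl (smul_zero _) (smul_zero _)) (brk_zero_left _ _)
    (by norm_num) (by norm_num) (by norm_num) (by norm_num)
  refine ((h1.neg_right.add_right ((brk_P_phi α j).smul_right (α / 2))).add_right
    (h2.smul_right (1 / 2))).congr rfl ?_ ?_
  · simp only [nP_zero_left, nP_one_right, nP_neg_right, nP_smul_left]; module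
  · simp [nP_zero_left, nP_zero_right]

theorem brk_phi_J3 : Brk 1 (iDphi α j) (current k α j .J3) 0 ((α / 2) • oneF) := by
  rw [current_J3]
  have h1 := (brk_phi_beta α j).wick' (brk_phi_gamma α j) (σ := 1) (s1 := 1) (s2 := 1) (s3 := 1)
    (brk_zero_left 1 _) (brk_zero_left 1 _)
    (by norm_num) (by norm_num) (by norm_num) (by norm_num)
  have h2 := (brk_phi_P α j).wick' (brk_phi_psi α j) (σ := -1) (s1 := -1) (s2 := -1) (s3 := 1)
    (brk_zero_left _ _) (brk_zero_left _ _)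
    (by norm_num) (by norm_num) (by norm_num) (by norm_num)
  refine ((h1.neg_right.add_right ((brk_iDphi α j).smul_right (α / 2))).add_right
    (h2.smul_right (1 / 2))).congr rfl ?_ ?_ <;>
  simp [nP_zero_left, nP_zero_right]

theorem brk_J3_gamma : Brk 1 (current k α j .J3) gamma (-gamma) 0 :=
  ((brk_gamma_J3 k α j).symm0 (by norm_num)).congr rfl (by simp) rfl
theorem brk_J3_beta : Brk 1 (current k α j .J3) beta beta 0 :=
  ((brk_beta_J3 k α j).symm0 (by norm_num)).congr rfl (by simp) rfl
theorem brk_J3_psi : Brk 1 (current k α j .J3) psi (-(1 / 2 : ℂ) • psi) 0 :=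
  ((brk_psi_J3 k α j).symm0 (by norm_num)).congr rfl (by module) rfl
theorem brk_J3_P : Brk 1 (current k α j .J3) fP ((1 / 2 : ℂ) • fP) 0 :=
  ((brk_P_J3 k α j).symm0 (by norm_num)).congr rfl (by module) rfl
theorem brk_J3_phi : Brk 1 (current k α j .J3) (iDphi α j) 0 ((α / 2) • oneF) :=
  ((brk_phi_J3 k α j).symm (by norm_num)).congr rfl
    (by rw [derivField_smul, derivField_one]; simp) (by simp)

theorem brk_P_jminus : Brk (-1) fP (current k α j .jminus) ((2 : ℂ) • current k α j .J3)
    ((2 * k) • oneF) := by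
  rw [current_J3, current_jminus]
  have h1 := brk_P_P.wick' brk_P_gamma (σ := 1) (s1 := 1) (s2 := -1) (s3 := -1)
    (brk_beta_gamma.smul_left _|>.congr rfl rfl (smul_zero _)) (brk_zero_left 1 _)
    (by norm_num) (by norm_num) (by norm_num) (by norm_num)
  have h2 := (brk_P_phi α j).wick' brk_P_psi (σ := 1) (s1 := -1) (s2 := 1) (s3 := -1)
    (brk_zero_left _ _) (brk_zero_left _ _)
    (by norm_num) (by norm_num) (by norm_num) (by norm_num)
  refine ((h1.add_right (h2.smul_right α)).add_right
    (brk_P_psi.deriv.smul_right (2 * k + 2))).congr rfl ?_ ?_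
  · simp only [nP_zero_left, nP_one_right, nP_neg_right, nP_smul_left, derivField_one]; module
  -- The level: the double contraction with `:j⁺γ:` gives `-2`, and the derivative of `ψ` gives `2k
  -- + 2`.
  · simp only [nP_zero_left, nP_zero_right]; module

/-- There is no second-order pole because the three contributions to it, `-1/2` from `:j⁺γ:`, `α²/2`
from `:i∂φ ψ:` and `-(k+1)` from the derivative of `ψ`, add up to zero. -/
theorem brk_J3_jminus (hα : α ^ 2 = 2 * k + 3) :
    Brk 1 (current k α j .J3) (current k α j .jminus) (-(1 / 2 : ℂ) • current k α j .jminus) 0 := by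
  conv => enter [3]; rw [current_jminus]
  have h1 := (brk_J3_P k α j).wick' (brk_J3_gamma k α j) (σ := 1) (s1 := 1) (s2 := 1) (s3 := 1)
    (brk_P_gamma.smul_left _|>.congr rfl rfl (smul_zero _)) (brk_zero_left 1 _)
    (by norm_num) (by norm_num) (by norm_num) (by norm_num)
  have h2 := (brk_J3_phi k α j).wick' (brk_J3_psi k α j) (σ := 1) (s1 := 1) (s2 := 1) (s3 := 1)
    (brk_zero_left _ _) ((brk_one_left _).smul_left _|>.congr rfl (smul_zero _) (smul_zero _))
    (by norm_num) (by norm_num) (by norm_num) (by norm_num)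
  refine ((h1.add_right (h2.smul_right α)).add_right
    ((brk_J3_psi k α j).deriv.smul_right (2 * k + 2))).congr rfl ?_ ?_
  · rw [current_jminus]
    simp only [nP_zero_left, nP_neg_right, nP_smul_left, nP_smul_right, derivField_smul]
    module
  · simp only [nP_zero_left, nP_zero_right, nP_smul_left, nP_one_left]
    have : (α * (α / 2) : ℂ) = k + 3 / 2 := by linear_combination hα / 2
    simp only [smul_add, smul_smul, this, smul_zero]
    module

theorem brk_beta_jminus : Brk 1 beta (current k α j .jminus) fP 0 := by
  rw [current_jminus]
  have h1 := brk_beta_P.wick' brk_beta_gamma (σ := 1) (s1 := 1) (s2 := 1) (s3 := 1)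
    (brk_zero_left 1 _) (brk_zero_left 1 _)
    (by norm_num) (by norm_num) (by norm_num) (by norm_num)
  have h2 := (brk_beta_phi α j).wick' brk_beta_psi (σ := 1) (s1 := 1) (s2 := 1) (s3 := 1)
    (brk_zero_left _ _) (brk_zero_left _ _)
    (by norm_num) (by norm_num) (by norm_num) (by norm_num)
  refine ((h1.add_right (h2.smul_right α)).add_right
    (brk_beta_psi.deriv.smul_right (2 * k + 2))).congr rfl ?_ ?_ <;>
  simp [nP_zero_left, nP_zero_right, nP_one_right, derivField_zero]

theorem brk_gamma_jminus : Brk 1 gamma (current k α j .jminus) (nP 1 psi gamma) 0 := by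
  rw [current_jminus]
  have h1 := brk_gamma_P.wick' brk_gamma_gamma (σ := 1) (s1 := 1) (s2 := 1) (s3 := 1)
    brk_psi_gamma (brk_zero_left 1 _)
    (by norm_num) (by norm_num) (by norm_num) (by norm_num)
  have h2 := (brk_gamma_phi α j).wick' brk_gamma_psi (σ := 1) (s1 := 1) (s2 := 1) (s3 := 1)
    (brk_zero_left _ _) (brk_zero_left _ _)
    (by norm_num) (by norm_num) (by norm_num) (by norm_num)
  refine ((h1.add_right (h2.smul_right α)).add_right
    (brk_gamma_psi.deriv.smul_right (2 * k + 2))).congr rfl ?_ ?_ <;>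
  simp [nP_zero_left, nP_zero_right, derivField_zero]

theorem brk_psi_jminus : Brk (-1) psi (current k α j .jminus) gamma 0 := by
  rw [current_jminus]
  have h1 := brk_psi_P.wick' brk_psi_gamma (σ := 1) (s1 := 1) (s2 := -1) (s3 := -1)
    (brk_one_left _) (brk_zero_left 1 _)
    (by norm_num) (by norm_num) (by norm_num) (by norm_num)
  have h2 := (brk_psi_phi α j).wick' brk_psi_psi (σ := 1) (s1 := -1) (s2 := 1) (s3 := -1)
    (brk_zero_left _ _) (brk_zero_left _ _)
    (by norm_num) (by norm_num) (by norm_num) (by norm_num)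
  refine ((h1.add_right (h2.smul_right α)).add_right
    (brk_psi_psi.deriv.smul_right (2 * k + 2))).congr rfl ?_ ?_ <;>
  simp [nP_zero_left, nP_zero_right, nP_one_left, derivField_zero]

theorem brk_phi_jminus : Brk 1 (iDphi α j) (current k α j .jminus) 0 (α • psi) := by
  rw [current_jminus]
  have h1 := (brk_phi_P α j).wick' (brk_phi_gamma α j) (σ := 1) (s1 := 1) (s2 := 1) (s3 := 1)
    (brk_zero_left _ _) (brk_zero_left 1 _)
    (by norm_num) (by norm_num) (by norm_num) (by norm_num)
  have h2 := (brk_iDphi α j).wick' (brk_phi_psi α j) (σ := 1) (s1 := 1) (s2 := 1) (s3 := 1)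
    (brk_zero_left _ _) (brk_one_left _)
    (by norm_num) (by norm_num) (by norm_num) (by norm_num)
  refine ((h1.add_right (h2.smul_right α)).add_right
    ((brk_phi_psi α j).deriv.smul_right (2 * k + 2))).congr rfl ?_ ?_ <;>
  simp [nP_zero_left, nP_zero_right, nP_one_left, derivField_zero]

theorem brk_jminus_P : Brk (-1) (current k α j .jminus) fP ((2 : ℂ) • current k α j .J3)
    (-(2 * k) • oneF) :=
  ((brk_P_jminus k α j).symm (by norm_num)).congr rfl
    (by rw [derivField_smul, derivField_one]; module) (by module)
theorem brk_jminus_beta : Brk 1 (current k α j .jminus) beta (-fP) 0 :=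
  ((brk_beta_jminus k α j).symm0 (by norm_num)).congr rfl (by simp) rfl
theorem brk_jminus_gamma : Brk 1 (current k α j .jminus) gamma (-nP 1 psi gamma) 0 :=
  ((brk_gamma_jminus k α j).symm0 (by norm_num)).congr rfl (by simp) rfl
theorem brk_jminus_psi : Brk (-1) (current k α j .jminus) psi gamma 0 :=
  ((brk_psi_jminus k α j).symm0 (by norm_num)).congr rfl (by simp) rfl
theorem brk_jminus_phi : Brk 1 (current k α j .jminus) (iDphi α j) (α • derivField 0 psi)
    (α • psi) :=
  ((brk_phi_jminus k α j).symm (by norm_num)).congr rfl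
    (by rw [derivField_smul]; simp) (by simp)

theorem brk_Ppsi_gamma : Brk 1 (nP (-1) fP psi) gamma 0 0 := by
  have h := brk_gamma_P.wick' brk_gamma_psi (σ := -1) (s1 := -1) (s2 := -1) (s3 := 1)
    brk_psi_psi (brk_zero_left _ _) (by norm_num) (by norm_num) (by norm_num) (by norm_num)
  refine (h.congr rfl ?_ ?_).symm00 (by norm_num) <;>
  simp [nP_zero_left, nP_zero_right, nP_psi_psi]

theorem nP_Ppsi_gamma : nP 1 (nP (-1) fP psi) gamma
    = nP (-1) fP (nP 1 psi gamma) + nP (-1) (derivField 0 psi) psi := by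
  have h := nP_assoc (x := fP) (g := psi) (f := gamma) (h := -psi) (σ := -1) (τ := 1) (ε := 1)
    (by norm_num) (by norm_num) (by norm_num) brk_P_gamma brk_psi_gamma
    ((brk_psi_psi.neg_right).congr (by norm_num) neg_zero neg_zero)
  rw [nP_neg_right] at h
  simpa using h

theorem nP_betagamma_gamma : nP 1 (nP 1 beta gamma) gamma
    = nP 1 beta (nP 1 gamma gamma) + derivField 0 gamma := by
  have h := nP_assoc (x := beta) (g := gamma) (f := gamma) (h := oneF) (σ := 1) (τ := 1) (ε := 1)
    (by norm_num) (by norm_num) (by norm_num) brk_beta_gamma brk_gamma_gamma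
    ((brk_one_right _).congr (by norm_num) rfl rfl)
  simp only [mul_one, nP_one_right, one_smul] at h
  exact h

theorem brk_dpsi_psi : Brk (-1) (derivField 0 psi) psi 0 0 := brk_psi_psi.deriv_left

theorem current_Jminus : current k α j .Jminus
    = nP 1 beta (nP 1 gamma gamma) - α • nP 1 (iDphi α j) gamma - nP 1 (nP (-1) fP psi) gamma
      - k • derivField 0 gamma - (k + 1) • nP (-1) (derivField 0 psi) psi := by
  simp only [current, normalProd_eq, koszul00, koszul11, nP_psi_psiPlus]
  rw [nP_comm (by norm_num) (brk_phi_gamma α j), nP_neg_right,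
    nP_comm (by norm_num) brk_Ppsi_gamma, nP_comm (by norm_num) brk_dpsi_psi, derivField_zero]
  module

/-- The second-order poles `-2k γ`, `-2 γ` and `(2k+2) γ` cancel for every `α`; the relation for
`α²` enters in the coefficient of the derivative of `ψ` times `ψ` in the first-order pole. -/
theorem brk_jminus_jminus (hα : α ^ 2 = 2 * k + 3) :
    Brk (-1) (current k α j .jminus) (current k α j .jminus) (-(2 : ℂ) • current k α j .Jminus) 0 := by
  conv => enter [3]; rw [current_jminus]
  have h1 := (brk_jminus_P k α j).wick' (brk_jminus_gamma k α j)
    (σ := 1) (s1 := 1) (s2 := -1) (s3 := -1)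
    ((brk_J3_gamma k α j).smul_left 2|>.congr rfl rfl (smul_zero _))
    ((brk_one_left _).smul_left _|>.congr rfl (smul_zero _) (smul_zero _))
    (by norm_num) (by norm_num) (by norm_num) (by norm_num)
  have h2 := (brk_jminus_phi k α j).wick' (brk_jminus_psi k α j)
    (σ := 1) (s1 := -1) (s2 := 1) (s3 := -1)
    (brk_dpsi_psi.smul_left _|>.congr rfl (smul_zero _) (smul_zero _))
    (brk_psi_psi.smul_left _|>.congr rfl (smul_zero _) (smul_zero _))
    (by norm_num) (by norm_num) (by norm_num) (by norm_num)
  refine ((h1.add_right (h2.smul_right α)).add_right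
    ((brk_jminus_psi k α j).deriv.smul_right (2 * k + 2))).congr rfl ?_ ?_
  · have e : nP (-1) fP (nP 1 psi gamma)
        = nP 1 (nP (-1) fP psi) gamma - nP (-1) (derivField 0 psi) psi := by
      rw [nP_Ppsi_gamma]; module
    have e2 : (α * α : ℂ) = 2 * k + 3 := by linear_combination hα
    rw [current_Jminus, current_J3]
    simp only [nP_add_left, nP_neg_left, nP_neg_right, nP_smul_left, nP_betagamma_gamma, e,
      smul_add, smul_smul, e2]
    module
  · simp only [nP_zero_right, nP_smul_left, nP_one_left, nP_psi_psi]
    module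

/-- Only the absence of a second-order pole is needed, so the first-order pole is left unspecified.
Once the bracket depends on the sum of the indices alone, the Jacobi identity forces it to vanish
(`bracket_jminus_Jminus`). -/
theorem brk_jminus_Jminus (hα : α ^ 2 = 2 * k + 3) : ∃ C0, Brk 1 (current k α j .jminus)
    (current k α j .Jminus) C0 0 := by
  have hgg : nP 1 gamma psi = nP 1 psi gamma := by
    rw [nP_comm (by norm_num) brk_psi_gamma, derivField_zero]; module
  have hP : Brk 1 (-fP) (nP 1 gamma gamma) ((2 : ℂ) • nP 1 psi gamma) 0 := by
    have h := brk_P_gamma.wick' brk_P_gamma (σ := 1) (s1 := 1) (s2 := 1) (s3 := 1)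
      (F := 0) (brk_psi_gamma.neg_left.congr rfl neg_zero neg_zero) (brk_zero_left _ _)
      (by norm_num) (by norm_num) (by norm_num) (by norm_num)
    refine h.neg_left.congr rfl ?_ ?_
    · simp only [nP_neg_left, nP_neg_right, hgg]; module
    · simp [nP_zero_left, nP_zero_right]
  have h0 := (brk_jminus_gamma k α j).wick' (brk_jminus_gamma k α j)
    (σ := 1) (s1 := 1) (s2 := 1) (s3 := 1) (F := 0)
    ((brk_gamma_psi.wick' brk_gamma_gamma (σ := 1) (s1 := 1) (s2 := 1) (s3 := 1)
      (brk_zero_left _ _) (brk_zero_left _ _)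
      (by norm_num) (by norm_num) (by norm_num) (by norm_num)|>.congr rfl
        (by simp [nP_zero_left, nP_zero_right]) (by simp [nP_zero_left, nP_zero_right])|>.symm00
        (by norm_num)).neg_left.congr rfl neg_zero neg_zero) (brk_zero_left _ _)
    (by norm_num) (by norm_num) (by norm_num) (by norm_num)
  have h1 := (brk_jminus_beta k α j).wick' h0 (σ := 1) (s1 := 1) (s2 := 1) (s3 := 1)
    hP (brk_zero_left _ _) (by norm_num) (by norm_num) (by norm_num) (by norm_num)
  have h2 := (brk_jminus_phi k α j).wick' (brk_jminus_gamma k α j)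
    (σ := 1) (s1 := 1) (s2 := 1) (s3 := 1)
    (brk_psi_gamma.deriv_left.smul_left _|>.congr rfl (smul_zero _) (smul_zero _))
    (brk_psi_gamma.smul_left _|>.congr rfl (smul_zero _) (smul_zero _))
    (by norm_num) (by norm_num) (by norm_num) (by norm_num)
  have h3 := (brk_jminus_P k α j).wick' (brk_jminus_psi k α j)
    (σ := -1) (s1 := 1) (s2 := 1) (s3 := 1)
    ((brk_J3_psi k α j).smul_left 2|>.congr rfl rfl (smul_zero _))
    ((brk_one_left _).smul_left _|>.congr rfl (smul_zero _) (smul_zero _))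
    (by norm_num) (by norm_num) (by norm_num) (by norm_num)
  have hF : Brk 1 (nP 1 ((2 : ℂ) • current k α j .J3) psi + (-1 : ℂ) • nP 1 fP gamma) gamma
      (-nP 1 psi gamma) 0 := by
    have g1 := (brk_gamma_J3 k α j).wick' brk_gamma_psi (σ := 1) (s1 := 1) (s2 := 1) (s3 := 1)
      brk_gamma_psi (brk_zero_left _ _) (by norm_num) (by norm_num) (by norm_num) (by norm_num)
    have g2 := brk_gamma_P.wick' brk_gamma_gamma (σ := 1) (s1 := 1) (s2 := 1) (s3 := 1)
      brk_psi_gamma (brk_zero_left _ _) (by norm_num) (by norm_num) (by norm_num) (by norm_num)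
    have g := (g1.smul_right 2).add_right (g2.smul_right (-1))
    rw [← nP_smul_left] at g
    refine ((g.congr rfl rfl ?_).symm0 (by norm_num)).congr rfl ?_ rfl
    · simp [nP_zero_left, nP_zero_right]
    · simp only [nP_zero_right, hgg]; module
  have h4 := h3.wick' (brk_jminus_gamma k α j) (σ := 1) (s1 := 1) (s2 := 1) (s3 := 1) hF
    ((brk_psi_gamma.smul_left (-(2 * k + 1))).congr rfl (smul_zero _) (smul_zero _)|> fun h => by
      convert h using 1
      simp only [nP_zero_right, nP_smul_left, nP_one_left]; module)
    (by norm_num) (by norm_num) (by norm_num) (by norm_num)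
  have h5 := (brk_jminus_psi k α j).deriv.wick' (brk_jminus_psi k α j)
    (σ := -1) (s1 := 1) (s2 := 1) (s3 := 1)
    brk_gamma_psi.deriv_left brk_gamma_psi
    (by norm_num) (by norm_num) (by norm_num) (by norm_num)
  rw [current_Jminus]
  refine ⟨_, ((((h1.sub_right (h2.smul_right α)).sub_right h4).sub_right
    ((brk_jminus_gamma k α j).deriv.smul_right k)).sub_right (h5.smul_right (k + 1))).congr
      rfl rfl ?_⟩
  have e2 : (α * α : ℂ) = 2 * k + 3 := by linear_combination hα
  simp only [nP_zero_right, nP_zero_left, nP_add_left, nP_smul_left, nP_one_left, hgg, smul_smul,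
    smul_add, smul_zero, add_zero, zero_add, e2]
  module

end

/-! ### Gradings -/

/-- An additive function of the occupation numbers. -/
def occWeight (wb : ℤ → ℂ) (wo : ℕ → ℂ) (wf : ℤ → ℂ) (s : Occ) : ℂ :=
  (s.bos.sum fun a c => wb a * c) + (s.osc.sum fun i c => wo i * c) + ∑ a ∈ s.fer, wf a

/-- The diagonal operator with the given eigenvalues. -/
def diagOp (f : Occ → ℂ) : Op := basisOp fun s => Finsupp.single s (f s)

section

variable {wb : ℤ → ℂ} {wo : ℕ → ℂ} {wf : ℤ → ℂ}

theorem occWeight_add_bos (s : Occ) (a : ℤ) :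
    occWeight wb wo wf { s with bos := s.bos + Finsupp.single a 1 } = occWeight wb wo wf s + wb a := by
  simp only [occWeight]
  rw [Finsupp.sum_add_index' (by simp) (by intros; push_cast; ring), Finsupp.sum_single_index (by simp)]
  push_cast; ring

theorem occWeight_add_osc (s : Occ) (a : ℕ) :
    occWeight wb wo wf { s with osc := s.osc + Finsupp.single a 1 } = occWeight wb wo wf s + wo a := by
  simp only [occWeight]
  rw [Finsupp.sum_add_index' (by simp) (by intros; push_cast; ring), Finsupp.sum_single_index (by simp)]
  push_cast; ring

theorem occWeight_insert (s : Occ) {a : ℤ} (h : a ∉ s.fer) :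
    occWeight wb wo wf { s with fer := insert a s.fer } = occWeight wb wo wf s + wf a := by
  simp only [occWeight]
  rw [Finset.sum_insert h]; ring

/-- The eigenvalue relation is required only if the coefficient is nonzero, which excludes
annihilation operators acting on empty states. -/
theorem diagOp_bracket_single {f : Occ → ℂ} {A : Op} {s s' : Occ} {c x : ℂ}
    (hA : A (Finsupp.single s 1) = Finsupp.single s' c) (h : c ≠ 0 → f s' = f s + x) :
    (diagOp f * A - A * diagOp f) (Finsupp.single s 1) = (x • A) (Finsupp.single s 1) := by
  have e : diagOp f (Finsupp.single s 1) = f s • Finsupp.single s 1 := by simp [diagOp]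
  have e' : diagOp f (Finsupp.single s' c) = f s' • Finsupp.single s' c := by
    simp [diagOp, mul_comm]
  simp only [LinearMap.sub_apply, Module.End.mul_apply, LinearMap.smul_apply, e, map_smul, hA, e']
  by_cases hc : c = 0
  · simp [hc]
  · rw [h hc]; module

theorem diagOp_bosCreate (a : ℤ) : diagOp (occWeight wb wo wf) * bosCreate a
    - bosCreate a * diagOp (occWeight wb wo wf) = wb a • bosCreate a :=
  op_ext fun s => diagOp_bracket_single (by rw [bosCreate, basisOp_single, one_smul])
    fun _ => occWeight_add_bos s a

theorem diagOp_oscCreate (a : ℕ) : diagOp (occWeight wb wo wf) * oscCreate a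
    - oscCreate a * diagOp (occWeight wb wo wf) = wo a • oscCreate a :=
  op_ext fun s => diagOp_bracket_single (by rw [oscCreate, basisOp_single, one_smul])
    fun _ => occWeight_add_osc s a

theorem diagOp_ferCreate (a : ℤ) : diagOp (occWeight wb wo wf) * ferCreate a
    - ferCreate a * diagOp (occWeight wb wo wf) = wf a • ferCreate a := by
  refine op_ext fun s => ?_
  by_cases h : a ∈ s.fer
  · simp [diagOp, ferCreate, h]
  · exact diagOp_bracket_single (by rw [ferCreate, basisOp_single, one_smul, if_neg h])
      fun _ => occWeight_insert s h

theorem diagOp_bosAnnih (a : ℤ) : diagOp (occWeight wb wo wf) * bosAnnih a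
    - bosAnnih a * diagOp (occWeight wb wo wf) = -wb a • bosAnnih a := by
  refine op_ext fun s => diagOp_bracket_single (by rw [bosAnnih, basisOp_single, one_smul])
    fun h => ?_
  have := occWeight_add_bos (wb := wb) (wo := wo) (wf := wf)
    { s with bos := s.bos - Finsupp.single a 1 } a
  simp only [tsub_single_add_single _ (Nat.cast_ne_zero.1 h)] at this
  exact (sub_eq_of_eq_add this).symm.trans (sub_eq_add_neg _ _)

theorem diagOp_oscAnnih (a : ℕ) : diagOp (occWeight wb wo wf) * oscAnnih a
    - oscAnnih a * diagOp (occWeight wb wo wf) = -wo a • oscAnnih a := by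
  refine op_ext fun s => diagOp_bracket_single (by rw [oscAnnih, basisOp_single, one_smul])
    fun h => ?_
  have := occWeight_add_osc (wb := wb) (wo := wo) (wf := wf)
    { s with osc := s.osc - Finsupp.single a 1 } a
  simp only [tsub_single_add_single _ (Nat.cast_ne_zero.1 h)] at this
  exact (sub_eq_of_eq_add this).symm.trans (sub_eq_add_neg _ _)

theorem diagOp_ferAnnih (a : ℤ) : diagOp (occWeight wb wo wf) * ferAnnih a
    - ferAnnih a * diagOp (occWeight wb wo wf) = -wf a • ferAnnih a := by
  refine op_ext fun s => ?_
  by_cases h : a ∈ s.fer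
  · refine diagOp_bracket_single (by rw [ferAnnih, basisOp_single, one_smul, if_pos h])
      fun _ => ?_
    have := occWeight_insert (wb := wb) (wo := wo) (wf := wf)
      { s with fer := s.fer.erase a } (Finset.notMem_erase a s.fer)
    simp only [Finset.insert_erase h] at this
    exact (sub_eq_of_eq_add this).symm.trans (sub_eq_add_neg _ _)
  · simp [diagOp, ferAnnih, h]

end

/-- A field whose modes shift the eigenvalues of `D` by `c + lam (n + 1)`. -/
def Graded (D : Op) (lam c : ℂ) (A : Modes) : Prop :=
  ∀ n : ℤ, D * A n - A n * D = (c + lam * (n + 1)) • A n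

section

variable {D : Op} {lam c c' : ℂ} {A B : Modes}

theorem Graded.congr (h : Graded D lam c A) (hc : c = c') : Graded D lam c' A := hc ▸ h

theorem Graded.add (hA : Graded D lam c A) (hB : Graded D lam c B) : Graded D lam c (A + B) :=
  fun n => by
    simp only [Pi.add_apply, mul_add, add_mul]
    linear_combination (norm := module) hA n + hB n

theorem Graded.smul (x : ℂ) (hA : Graded D lam c A) : Graded D lam c (x • A) := fun n => by
  simp only [Pi.smul_apply, mul_smul_comm, smul_mul_assoc]
  linear_combination (norm := module) x • hA n

theorem Graded.neg (hA : Graded D lam c A) : Graded D lam c (-A) := by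
  simpa using hA.smul (-1)

theorem Graded.sub (hA : Graded D lam c A) (hB : Graded D lam c B) : Graded D lam c (A - B) := by
  rw [sub_eq_add_neg]; exact hA.add hB.neg

theorem Graded.deriv (μ : ℂ) (hA : Graded D lam c A) : Graded D lam (c - lam) (derivField μ A) :=
  fun n => by
    have h := hA (n - 1)
    simp only [derivField, mul_smul_comm, smul_mul_assoc]
    push_cast at h
    linear_combination (norm := module) (μ - n) • h

/-- The indices in each term satisfy `(l + 1) + (n - l) = n + 1`, so all terms shift the eigenvalue
by the same amount. -/
theorem Graded.nP [Fld A] [Fld B] (σ : ℂ) (hA : Graded D lam c A) (hB : Graded D lam c' B) :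
    Graded D lam (c + c') (nP σ A B) := fun n => by
  have hl : LocFin (cutTerm σ 0 A B n) := locFin_cutTerm σ 0 n
  rw [nP_apply, mul_locSum _ hl, locSum_mul _ hl, ← locSum_smul _ hl, sub_eq_iff_eq_add,
    ← locSum_add (hl.smul _) (hl.mul_right D)]
  congr 1; funext l
  have h1 := hA l
  have h2 := hB (n - l - 1)
  unfold cutTerm
  push_cast at h2
  split_ifs
  · have e1 := congrArg (· * B (n - l - 1)) h1
    have e2 := congrArg (A l * ·) h2
    simp only [sub_mul, mul_sub, smul_mul_assoc, mul_smul_comm, ← mul_assoc] at e1 e2 ⊢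
    linear_combination (norm := module) e1 + e2
  · have e1 := congrArg (B (n - l - 1) * ·) h1
    have e2 := congrArg (· * A l) h2
    simp only [sub_mul, mul_sub, smul_mul_assoc, mul_smul_comm, ← mul_assoc] at e1 e2 ⊢
    linear_combination (norm := module) σ • e1 + σ • e2

end

theorem graded_beta {wb : ℤ → ℂ} {wo : ℕ → ℂ} {wf : ℤ → ℂ} {lam c : ℂ}
    (h1 : ∀ n : ℤ, n < 0 → wb n = c + lam * (n + 1))
    (h2 : ∀ n : ℤ, 0 ≤ n → -wb n = c + lam * (n + 1)) :
    Graded (diagOp (occWeight wb wo wf)) lam c beta := fun n => by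
  unfold beta betaMode
  split_ifs with h
  · rw [diagOp_bosCreate, h1 n h]
  · rw [diagOp_bosAnnih, h2 n (not_lt.1 h)]

theorem graded_gamma {wb : ℤ → ℂ} {wo : ℕ → ℂ} {wf : ℤ → ℂ} {lam c : ℂ}
    (h1 : ∀ n : ℤ, n ≤ 0 → wb (-n) = c + lam * n)
    (h2 : ∀ n : ℤ, 0 < n → -wb (-n) = c + lam * n) :
    Graded (diagOp (occWeight wb wo wf)) lam c gamma := fun n => by
  unfold gamma gammaMode
  split_ifs with h
  · rw [diagOp_bosCreate, h1 _ h]; push_cast; rfl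
  · have := diagOp_bosAnnih (wb := wb) (wo := wo) (wf := wf) (-(n + 1))
    rw [h2 _ (not_le.1 h)] at this
    push_cast at this
    rw [mul_neg, neg_mul, smul_neg, ← this]; abel

theorem graded_psiPlus {wb : ℤ → ℂ} {wo : ℕ → ℂ} {wf : ℤ → ℂ} {lam c : ℂ}
    (h1 : ∀ n : ℤ, n < 0 → wf n = c + lam * (n + 1))
    (h2 : ∀ n : ℤ, 0 ≤ n → -wf n = c + lam * (n + 1)) :
    Graded (diagOp (occWeight wb wo wf)) lam c psiPlus := fun n => by
  unfold psiPlus psiPlusMode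
  split_ifs with h
  · rw [diagOp_ferCreate, h1 n h]
  · rw [diagOp_ferAnnih, h2 n (not_lt.1 h)]

theorem graded_psi {wb : ℤ → ℂ} {wo : ℕ → ℂ} {wf : ℤ → ℂ} {lam c : ℂ}
    (h1 : ∀ n : ℤ, n ≤ 0 → wf (-n) = c + lam * n)
    (h2 : ∀ n : ℤ, 0 < n → -wf (-n) = c + lam * n) :
    Graded (diagOp (occWeight wb wo wf)) lam c psi := fun n => by
  unfold psi psiMode
  split_ifs with h
  · rw [diagOp_ferCreate, h1 _ h]; push_cast; rfl
  · rw [diagOp_ferAnnih, h2 _ (not_le.1 h)]; push_cast; rfl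

theorem diagOp_phiMode {wb : ℤ → ℂ} {wo : ℕ → ℂ} {wf : ℤ → ℂ} {x : ℂ} (b : ℂ) {n : ℤ}
    (h0 : n = 0 → x = 0)
    (h1 : n < 0 → wo (n.natAbs - 1) = x)
    (h2 : 0 < n → -wo (n.natAbs - 1) = x) :
    diagOp (occWeight wb wo wf) * phiMode b n - phiMode b n * diagOp (occWeight wb wo wf)
      = x • phiMode b n := by
  unfold phiMode
  split_ifs with hn h
  · rw [(commute_smul_one b _).eq, sub_self, h0 hn, zero_smul]
  · rw [diagOp_oscCreate, h1 h]
  · rw [mul_smul_comm, smul_mul_assoc, ← smul_sub, diagOp_oscAnnih, h2 (by omega), smul_comm]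

/-- The energy operator. -/
def energyOp : Op := diagOp (occWeight (fun a => (a.natAbs : ℂ)) (fun i => (i : ℂ) + 1)
  fun a => (a.natAbs : ℂ))

theorem energyOp_eq : energyOp = diagOp fun s => (energy s : ℂ) := by
  unfold energyOp
  congr 1; funext s
  simp [occWeight, energy, Finsupp.sum]

theorem cast_natAbs_of_neg {n : ℤ} (h : n ≤ 0) : (n.natAbs : ℂ) = -n := by
  obtain ⟨m, rfl⟩ := Int.eq_ofNat_of_zero_le (neg_nonneg.2 h) |>.imp fun m hm => neg_eq_iff_eq_neg.1 hm
  simp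

theorem cast_natAbs_of_nonneg {n : ℤ} (h : 0 ≤ n) : (n.natAbs : ℂ) = n := by
  obtain ⟨m, rfl⟩ := Int.eq_ofNat_of_zero_le h
  simp

theorem energy_beta : Graded energyOp (-1) 1 beta :=
  graded_beta (fun n h => by rw [cast_natAbs_of_neg h.le]; ring)
    (fun n h => by rw [cast_natAbs_of_nonneg h]; ring)
theorem energy_gamma : Graded energyOp (-1) 0 gamma :=
  graded_gamma (fun n h => by rw [Int.natAbs_neg, cast_natAbs_of_neg h]; ring)
    (fun n h => by rw [Int.natAbs_neg, cast_natAbs_of_nonneg h.le]; ring)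
theorem energy_psiPlus : Graded energyOp (-1) 1 psiPlus :=
  graded_psiPlus (fun n h => by rw [cast_natAbs_of_neg h.le]; ring)
    (fun n h => by rw [cast_natAbs_of_nonneg h]; ring)
theorem energy_psi : Graded energyOp (-1) 0 psi :=
  graded_psi (fun n h => by rw [Int.natAbs_neg, cast_natAbs_of_neg h]; ring)
    (fun n h => by rw [Int.natAbs_neg, cast_natAbs_of_nonneg h.le]; ring)

theorem energy_phiMode (b : ℂ) (n : ℤ) :
    energyOp * phiMode b n - phiMode b n * energyOp = (-(n : ℂ)) • phiMode b n := by
  refine diagOp_phiMode b (fun h => by simp [h]) (fun h => ?_) fun h => ?_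
  · rw [← cast_natAbs_of_neg h.le, ← Nat.cast_add_one, Nat.sub_add_cancel (by omega)]
  · rw [← cast_natAbs_of_nonneg h.le, ← Nat.cast_add_one, Nat.sub_add_cancel (by omega)]

theorem energy_iDphi (α j : ℂ) : Graded energyOp (-1) 1 (iDphi α j) := fun n => by
  rw [iDphi, energy_phiMode]; congr 1; ring

/-- A field of definite parity. -/
def HasParity (e : ℂ) (A : Modes) : Prop := ∀ n, parityOp * A n = e • (A n * parityOp)

section

variable {e e' : ℂ} {A B : Modes}

theorem HasParity.congr (h : HasParity e A) (he : e = e') : HasParity e' A := he ▸ h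

theorem HasParity.add (hA : HasParity e A) (hB : HasParity e B) : HasParity e (A + B) :=
  fun n => by simp only [Pi.add_apply, mul_add, add_mul, hA n, hB n, smul_add]

theorem HasParity.smul (x : ℂ) (hA : HasParity e A) : HasParity e (x • A) := fun n => by
  simp only [Pi.smul_apply, mul_smul_comm, smul_mul_assoc, hA n]; exact smul_comm _ _ _

theorem HasParity.neg (hA : HasParity e A) : HasParity e (-A) := by
  simpa using hA.smul (-1)

theorem HasParity.sub (hA : HasParity e A) (hB : HasParity e B) : HasParity e (A - B) := by
  rw [sub_eq_add_neg]; exact hA.add hB.neg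

theorem HasParity.deriv (μ : ℂ) (hA : HasParity e A) : HasParity e (derivField μ A) := fun n => by
  simp only [derivField, mul_smul_comm, smul_mul_assoc, hA (n - 1)]; exact smul_comm _ _ _

theorem HasParity.nP [Fld A] [Fld B] (σ : ℂ) (hA : HasParity e A) (hB : HasParity e' B) :
    HasParity (e * e') (nP σ A B) := fun n => by
  have hl : LocFin (cutTerm σ 0 A B n) := locFin_cutTerm σ 0 n
  rw [nP_apply, mul_locSum _ hl, locSum_mul _ hl, ← locSum_smul _ (hl.mul_right _)]
  congr 1; funext l
  unfold cutTerm
  split_ifs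
  · rw [← mul_assoc, hA, smul_mul_assoc, mul_assoc, hB, mul_smul_comm, smul_smul, mul_assoc]
  · rw [mul_smul_comm, ← mul_assoc, hB, smul_mul_assoc, mul_assoc, hA, mul_smul_comm, smul_mul_assoc,
      smul_smul, smul_smul, smul_smul, mul_assoc]
    congr 1; ring

end

theorem parity_bosCreate (a : ℤ) : parityOp * bosCreate a = bosCreate a * parityOp := by
  refine op_ext fun s => ?_; simp [parityOp, bosCreate]
theorem parity_bosAnnih (a : ℤ) : parityOp * bosAnnih a = bosAnnih a * parityOp := by
  refine op_ext fun s => ?_; simp [parityOp, bosAnnih, mul_comm]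
theorem parity_oscCreate (a : ℕ) : parityOp * oscCreate a = oscCreate a * parityOp := by
  refine op_ext fun s => ?_; simp [parityOp, oscCreate]
theorem parity_oscAnnih (a : ℕ) : parityOp * oscAnnih a = oscAnnih a * parityOp := by
  refine op_ext fun s => ?_; simp [parityOp, oscAnnih, mul_comm]
theorem parity_ferCreate (a : ℤ) : parityOp * ferCreate a = -(ferCreate a * parityOp) := by
  refine op_ext fun s => ?_
  by_cases h : a ∈ s.fer
  · simp [parityOp, ferCreate, h]
  · simp only [parityOp, ferCreate, Module.End.mul_apply, basisOp_single, one_smul, if_neg h,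
      LinearMap.neg_apply, Finsupp.smul_single, ← Finsupp.single_neg, Finset.card_insert_of_notMem h]
    congr 1; simp [pow_succ, mul_comm]
theorem parity_ferAnnih (a : ℤ) : parityOp * ferAnnih a = -(ferAnnih a * parityOp) := by
  refine op_ext fun s => ?_
  by_cases h : a ∈ s.fer
  · have hc := Finset.card_erase_add_one h
    simp only [parityOp, ferAnnih, Module.End.mul_apply, basisOp_single, one_smul, if_pos h,
      LinearMap.neg_apply, smul_ite, smul_zero, Finsupp.smul_single, ← Finsupp.single_neg, ← hc]
    congr 1; simp [pow_succ, mul_comm]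
  · simp [parityOp, ferAnnih, h]

theorem parity_beta : HasParity 1 beta := fun n => by
  unfold beta betaMode; split_ifs <;> simp [parity_bosCreate, parity_bosAnnih]
theorem parity_gamma : HasParity 1 gamma := fun n => by
  unfold gamma gammaMode; split_ifs <;> simp [parity_bosCreate, parity_bosAnnih]
theorem parity_psiPlus : HasParity (-1) psiPlus := fun n => by
  unfold psiPlus psiPlusMode; split_ifs <;> simp [parity_ferCreate, parity_ferAnnih]
theorem parity_psi : HasParity (-1) psi := fun n => by
  unfold psi psiMode; split_ifs <;> simp [parity_ferCreate, parity_ferAnnih]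
theorem parity_phiMode (b : ℂ) (n : ℤ) : parityOp * phiMode b n = phiMode b n * parityOp := by
  unfold phiMode
  split_ifs
  · exact (commute_smul_one b parityOp).symm.eq
  · exact parity_oscCreate _
  · rw [mul_smul_comm, smul_mul_assoc, parity_oscAnnih]
theorem parity_iDphi (α j : ℂ) : HasParity 1 (iDphi α j) := fun n => by
  rw [one_smul]; exact parity_phiMode _ _

section

variable (k α j : ℂ)

theorem parity_P : HasParity (-1) fP :=
  parity_psiPlus.sub ((parity_beta.nP 1 parity_psi).congr (by norm_num))

theorem energy_P : Graded energyOp (-1) 1 fP :=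
  energy_psiPlus.sub ((energy_beta.nP 1 energy_psi).congr (by norm_num))

theorem parity_current (a : Gen) : HasParity ((-1) ^ a.parity) (current k α j a) := by
  cases a
  · exact parity_beta.neg.congr (by simp [Gen.parity])
  · rw [current_J3]
    exact ((((parity_beta.nP 1 parity_gamma).congr (by norm_num)).neg.add
      ((parity_iDphi α j).smul _)).add (((parity_P.nP _ parity_psi).congr (by norm_num)).smul
      _)).congr (by simp [Gen.parity])
  · rw [current_Jminus]
    refine HasParity.congr (e := 1) ?_ (by simp [Gen.parity])
    refine ((((?_ : HasParity 1 _).sub (HasParity.smul _ ?_)).sub ?_).sub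
      (HasParity.smul _ ?_)).sub (HasParity.smul _ ?_)
    · exact (parity_beta.nP 1 (parity_gamma.nP 1 parity_gamma)).congr (by norm_num)
    · exact ((parity_iDphi α j).nP 1 parity_gamma).congr (by norm_num)
    · exact ((parity_P.nP _ parity_psi).nP 1 parity_gamma).congr (by norm_num)
    · exact parity_gamma.deriv 0
    · exact ((parity_psi.deriv 0).nP _ parity_psi).congr (by norm_num)
  · rw [current_jplus]; exact parity_P.congr (by simp [Gen.parity])
  · rw [current_jminus]
    refine HasParity.congr (e := -1) ?_ (by simp [Gen.parity])
    exact (((parity_P.nP 1 parity_gamma).congr (by norm_num)).add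
      ((((parity_iDphi α j).nP 1 parity_psi).congr (by norm_num)).smul _)).add
      ((parity_psi.deriv 0).smul _)

theorem energy_current (a : Gen) : Graded energyOp (-1) 1 (current k α j a) := by
  cases a
  · exact energy_beta.neg
  · rw [current_J3]
    exact (((energy_beta.nP 1 energy_gamma).congr (by norm_num)).neg.add
      ((energy_iDphi α j).smul _)).add (((energy_P.nP _ energy_psi).congr (by norm_num)).smul _)
  · rw [current_Jminus]
    refine ((((?_ : Graded energyOp (-1) 1 _).sub (Graded.smul _ ?_)).sub ?_).sub
      (Graded.smul _ ?_)).sub (Graded.smul _ ?_)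
    · exact (energy_beta.nP 1 (energy_gamma.nP 1 energy_gamma)).congr (by norm_num)
    · exact ((energy_iDphi α j).nP 1 energy_gamma).congr (by norm_num)
    · exact ((energy_P.nP _ energy_psi).nP 1 energy_gamma).congr (by norm_num)
    · exact (energy_gamma.deriv 0).congr (by norm_num)
    · exact ((energy_psi.deriv 0).nP _ energy_psi).congr (by norm_num)
  · rw [current_jplus]; exact energy_P
  · rw [current_jminus]
    exact (((energy_P.nP 1 energy_gamma).congr (by norm_num)).add
      ((((energy_iDphi α j).nP 1 energy_psi).congr (by norm_num)).smul _)).add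
      (((energy_psi.deriv 0).congr (by norm_num)).smul _)

end

/-! ### The Wakimoto modules -/

/-- The super Jacobi identities. With `X` and `Y` modes of odd currents they express a bracket with
an even current through brackets with odd ones. -/
theorem anticomm_bracket_even (X Y Z : Op) : (X * Y + Y * X) * Z - Z * (X * Y + Y * X)
    = (X * Z - Z * X) * Y + Y * (X * Z - Z * X) + (X * (Y * Z - Z * Y) + (Y * Z - Z * Y) * X) := by
  noncomm_ring

theorem anticomm_bracket_odd (X Y Z : Op) : (X * Y + Y * X) * Z - Z * (X * Y + Y * X)
    = X * (Y * Z + Z * Y) - (X * Z + Z * X) * Y + Y * (X * Z + Z * X) - (Y * Z + Z * Y) * X := by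
  noncomm_ring

theorem central_eq (n m : ℤ) (c : ℂ) : central n m c = c • oneF (n + m - 1) := by
  unfold central oneF
  by_cases h : n + m = 0
  · rw [if_pos h, if_pos (by omega)]
  · rw [if_neg h, if_neg (by omega), smul_zero]

/-- A Kronecker symbol times its argument. It reconciles the central terms that arise from different
splittings of an index. -/
theorem smul_oneF (n : ℤ) : (n : ℂ) • oneF (n - 1) = 0 := by
  unfold oneF
  by_cases h : n = 0
  · simp [h]
  · rw [if_neg (by omega), smul_zero]

theorem oneF_mul (n : ℤ) (A : Op) : oneF n * A = A * oneF n := by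
  unfold oneF; split_ifs <;> simp

theorem wakimoto_d (k α j : ℂ) :
    (wakimoto k α j).d = -energyOp - (j * (2 * j + 1) / (2 * k + 3)) • 1 := by
  refine op_ext fun s => ?_
  rw [energyOp_eq]
  simp only [wakimoto, diagOp, basisOp_single, LinearMap.sub_apply, LinearMap.neg_apply, one_smul,
    LinearMap.smul_apply, Module.End.one_apply, Finsupp.smul_single, smul_eq_mul, mul_one,
    ← Finsupp.single_neg, ← Finsupp.single_sub]
  congr 1; ring

theorem parity_energyOp : parityOp * energyOp = energyOp * parityOp := by
  refine op_ext fun s => ?_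
  rw [energyOp_eq]
  simp [parityOp, diagOp, mul_comm]

/-! ### Brackets of the currents that follow from the Jacobi identity -/

section

variable {k : ℂ} {E H F P M C : Modes}

theorem bracket_Jminus_jplus
    (PM : ∀ r s, P r * M s + M s * P r = (2 : ℂ) • H (r + s) + (2 * r * k) • oneF (r + s - 1))
    (MM : ∀ r s, M r * M s + M s * M r = (-2 : ℂ) • F (r + s))
    (HM : ∀ n r, H n * M r - M r * H n = (-1 / 2 : ℂ) • M (n + r)) (n r : ℤ) :
    F n * P r - P r * F n = -M (n + r) := by
  have h := anticomm_bracket_odd (M n) (M 0) (P r)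
  have h1 := HM r n
  have h2 := HM (r + n) 0
  rw [MM, add_comm (M 0 * P r), PM, add_comm (M n * P r), PM] at h
  simp only [add_zero, mul_add, add_mul, smul_mul_assoc, mul_smul_comm, oneF_mul, add_comm r n]
    at h h1 h2 ⊢
  linear_combination (norm := module) (-1 / 2 : ℂ) • h + h1 + h2

/-- In the Jacobi identity for the modes `r`, `n` and `0` of `j⁻`, all three terms equal the same
operator up to a common factor, because the bracket depends on the sum of the indices only. So three
times this operator vanishes. -/
theorem bracket_jminus_Jminus (MM : ∀ r s, M r * M s + M s * M r = (-2 : ℂ) • F (r + s))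
    (MF : ∀ r n, M r * F n - F n * M r = C (r + n)) (r n : ℤ) : M r * F n - F n * M r = 0 := by
  have h := anticomm_bracket_odd (M r) (M n) (M 0)
  rw [MM, MM, MM] at h
  have h1 := MF r n
  have h2 := MF n r
  have h3 := MF 0 (r + n)
  simp only [add_zero, zero_add, smul_mul_assoc, mul_smul_comm, add_comm n r] at h h2 h3
  rw [h1]
  linear_combination (norm := module) (1 / 6 : ℂ) • h + (-1 / 3 : ℂ) • h1 + (-1 / 3 : ℂ) • h2
    + (-1 / 3 : ℂ) • h3

theorem bracket_Jplus_Jminus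
    (PM : ∀ r s, P r * M s + M s * P r = (2 : ℂ) • H (r + s) + (2 * r * k) • oneF (r + s - 1))
    (MM : ∀ r s, M r * M s + M s * M r = (-2 : ℂ) • F (r + s))
    (EM : ∀ n r, E n * M r - M r * E n = -P (n + r)) (n m : ℤ) :
    E n * F m - F m * E n = (2 : ℂ) • H (n + m) + (n * k) • oneF (n + m - 1) := by
  have h := anticomm_bracket_even (M m) (M 0) (E n)
  rw [← neg_sub (E n * M m), EM, ← neg_sub (E n * M 0), EM, MM, neg_neg, neg_neg,
    add_comm (M m * _), PM, PM] at h
  -- The central terms come with `n + m` and with `n`; the first of them is zero.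
  have h0 := smul_oneF (n + m)
  push_cast at h h0
  simp only [add_zero, smul_mul_assoc, mul_smul_comm] at h
  linear_combination (norm := module) (1 / 2 : ℂ) • h + k • h0

theorem bracket_J3_Jminus (MM : ∀ r s, M r * M s + M s * M r = (-2 : ℂ) • F (r + s))
    (HM : ∀ n r, H n * M r - M r * H n = (-1 / 2 : ℂ) • M (n + r)) (n m : ℤ) :
    H n * F m - F m * H n = -F (n + m) := by
  have h := anticomm_bracket_even (M m) (M 0) (H n)
  rw [← neg_sub (H n * M m), HM, ← neg_sub (H n * M 0), HM, MM] at h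
  have h1 := MM (n + m) 0
  have h2 := MM m n
  simp only [add_zero, smul_mul_assoc, mul_smul_comm, neg_mul, mul_neg, add_comm m n] at h h1 h2
  linear_combination (norm := module) (1 / 2 : ℂ) • h + (1 / 4 : ℂ) • h1 + (1 / 4 : ℂ) • h2

theorem bracket_J3_J3
    (PM : ∀ r s, P r * M s + M s * P r = (2 : ℂ) • H (r + s) + (2 * r * k) • oneF (r + s - 1))
    (HP : ∀ n r, H n * P r - P r * H n = (1 / 2 : ℂ) • P (n + r))
    (HM : ∀ n r, H n * M r - M r * H n = (-1 / 2 : ℂ) • M (n + r)) (n m : ℤ) :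
    H n * H m - H m * H n = (n * k / 2) • oneF (n + m - 1) := by
  have h := anticomm_bracket_even (P m) (M 0) (H n)
  rw [← neg_sub (H n * P m), HP, ← neg_sub (H n * M 0), HM, PM] at h
  have h1 := PM (n + m) 0
  have h2 := PM m n
  have h0 := smul_oneF (n + m)
  push_cast at h0 h1
  simp only [add_zero, smul_mul_assoc, mul_smul_comm, neg_mul, mul_neg, add_comm m n, add_mul,
    mul_add, oneF_mul] at h h1 h2
  linear_combination (norm := module) (-1 / 2 : ℂ) • h + (1 / 4 : ℂ) • h1 - (1 / 4 : ℂ) • h2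

theorem bracket_Jminus_Jminus (MM : ∀ r s, M r * M s + M s * M r = (-2 : ℂ) • F (r + s))
    (MF : ∀ r n, M r * F n - F n * M r = 0) (n m : ℤ) : F n * F m - F m * F n = 0 := by
  have h := anticomm_bracket_even (M n) (M 0) (F m)
  rw [MF, MF, MM] at h
  simp only [add_zero, smul_mul_assoc, mul_smul_comm, mul_zero, zero_mul] at h
  linear_combination (norm := module) (-1 / 2 : ℂ) • h

end

/-- Wick's theorem supplies the brackets among `j⁺` and `j⁻`, those of `J³` and `J⁺` with the odd
currents, and those of `J⁺` with `J⁺` and `J³`. Everything else involving `J⁻`, and the bracket of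
`J³` with itself, is obtained from these by the Jacobi identity. -/
theorem isAffineModule_wakimoto (k α j : ℂ) (hα : α ^ 2 = 2 * k + 3) :
    IsAffineModule k (wakimoto k α j) := by
  have PP : ∀ r s, current k α j .jplus r * current k α j .jplus s
      + current k α j .jplus s * current k α j .jplus r
      = (2 : ℂ) • current k α j .Jplus (r + s) := fun r s => by
    have h := brk_P_P r s
    rw [current_jplus]
    simp only [current, Pi.smul_apply, Pi.zero_apply, Pi.neg_apply] at h ⊢
    linear_combination (norm := module) h
  have PM : ∀ r s, current k α j .jplus r * current k α j .jminus s
      + current k α j .jminus s * current k α j .jplus r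
      = (2 : ℂ) • current k α j .J3 (r + s) + (2 * r * k) • oneF (r + s - 1) := fun r s => by
    have h := brk_P_jminus k α j r s
    rw [current_jplus]
    simp only [Pi.smul_apply] at h ⊢
    linear_combination (norm := module) h
  have MM : ∀ r s, current k α j .jminus r * current k α j .jminus s
      + current k α j .jminus s * current k α j .jminus r
      = (-2 : ℂ) • current k α j .Jminus (r + s) := fun r s => by
    have h := brk_jminus_jminus k α j hα r s
    simp only [Pi.smul_apply, Pi.zero_apply] at h ⊢
    linear_combination (norm := module) h
  have HP : ∀ n r, current k α j .J3 n * current k α j .jplus r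
      - current k α j .jplus r * current k α j .J3 n
      = (1 / 2 : ℂ) • current k α j .jplus (n + r) := fun n r => by
    have h := brk_J3_P k α j n r
    rw [current_jplus]
    simp only [Pi.smul_apply, Pi.zero_apply] at h ⊢
    linear_combination (norm := module) h
  have HM : ∀ n r, current k α j .J3 n * current k α j .jminus r
      - current k α j .jminus r * current k α j .J3 n
      = (-1 / 2 : ℂ) • current k α j .jminus (n + r) := fun n r => by
    have h := brk_J3_jminus k α j hα n r
    simp only [Pi.smul_apply, Pi.zero_apply] at h ⊢
    linear_combination (norm := module) h
  have EM : ∀ n r, current k α j .Jplus n * current k α j .jminus r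
      - current k α j .jminus r * current k α j .Jplus n
      = -current k α j .jplus (n + r) := fun n r => by
    have h := brk_beta_jminus k α j n r
    rw [current_jplus, show current k α j .Jplus = -beta from rfl]
    simp only [Pi.neg_apply, Pi.zero_apply, neg_mul, mul_neg] at h ⊢
    linear_combination (norm := module) -h
  have EP : ∀ n r, current k α j .Jplus n * current k α j .jplus r
      - current k α j .jplus r * current k α j .Jplus n = 0 := fun n r => by
    have h := brk_beta_P n r
    rw [current_jplus, show current k α j .Jplus = -beta from rfl]
    simp only [Pi.neg_apply, Pi.zero_apply, neg_mul, mul_neg] at h ⊢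
    linear_combination (norm := module) -h
  have EE : ∀ n r, current k α j .Jplus n * current k α j .Jplus r
      - current k α j .Jplus r * current k α j .Jplus n = 0 := fun n r => by
    have h := brk_beta_beta n r
    rw [show current k α j .Jplus = -beta from rfl]
    simp only [Pi.neg_apply, Pi.zero_apply, neg_mul, mul_neg] at h ⊢
    linear_combination (norm := module) h
  have HE : ∀ n r, current k α j .J3 n * current k α j .Jplus r
      - current k α j .Jplus r * current k α j .J3 n = current k α j .Jplus (n + r) := fun n r => by
    have h := brk_J3_beta k α j n r
    rw [show current k α j .Jplus = -beta from rfl]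
    simp only [Pi.neg_apply, Pi.zero_apply, neg_mul, mul_neg] at h ⊢
    linear_combination (norm := module) -h
  obtain ⟨C0, hC⟩ := brk_jminus_Jminus k α j hα
  have hC' : ∀ r n, current k α j .jminus r * current k α j .Jminus n
      - current k α j .Jminus n * current k α j .jminus r = C0 (r + n) := fun r n => by
    simpa using hC r n
  have MF := bracket_jminus_Jminus MM hC'
  constructor
  · exact fun a n => parity_current k α j a n
  · rw [wakimoto_d, mul_sub, sub_mul, mul_neg, neg_mul, parity_energyOp, mul_smul_comm,
      smul_mul_assoc, mul_one, one_mul]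
  all_goals
    simp only [superBracket, koszul00, koszul01, koszul11, central_eq, wakimoto, one_smul, neg_smul,
      sub_neg_eq_add]
  · exact PM
  · exact PP
  · simpa only [neg_smul] using MM
  · exact HP
  · exact HM
  · exact EM
  · exact bracket_Jminus_jplus PM MM HM
  · exact EP
  · exact fun n r => by rw [← neg_sub, MF, neg_zero]
  · exact bracket_Jplus_Jminus PM MM EM
  · exact HE
  · exact bracket_J3_Jminus MM HM
  · exact bracket_J3_J3 PM HP HM
  · exact EE
  · exact bracket_Jminus_Jminus MM MF
  · intro a n
    have h := energy_current k α j a n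
    have e : koszul 0 a.parity = 1 := by simp [koszul]
    have hd := wakimoto_d k α j
    simp only [wakimoto] at hd
    rw [e, hd, one_smul]
    simp only [sub_mul, mul_sub, neg_mul, mul_neg, smul_mul_assoc, mul_smul_comm, one_mul, mul_one]
    linear_combination (norm := module) -h

/-! ### Exponentials of power series -/

/-- A weighted sum over compositions. -/
def compSum (w : ℕ → ℂ) (x : ℕ → Op) (N : ℕ) : Op :=
  ∑ c : Composition N, w c.length • (c.blocks.map x).prod

/-- Splitting off the first block. -/
def compositionConsEquiv (N : ℕ) : (Σ i : Fin (N + 1), Composition (N - i)) ≃ Composition (N + 1) where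
  toFun p := ⟨(p.1 + 1) :: p.2.blocks, by
      intro i hi
      rcases List.mem_cons.1 hi with rfl | h
      · omega
      · exact p.2.blocks_pos h, by
      have := p.1.2
      rw [List.sum_cons, p.2.blocks_sum]; omega⟩
  invFun c := ⟨⟨c.blocks.headI - 1, by
      have h := c.blocks_sum
      rcases hb : c.blocks with _ | ⟨a, l⟩
      · simp [hb] at h
      · simp only [hb, List.sum_cons] at h; simp; omega⟩, ⟨c.blocks.tail, fun hi =>
        c.blocks_pos (List.mem_of_mem_tail hi), by
      change c.blocks.tail.sum = N - (c.blocks.headI - 1)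
      have h := c.blocks_sum
      have hp := @c.blocks_pos
      rcases hb : c.blocks with _ | ⟨a, l⟩
      · simp [hb] at h
      · have := @hp a (by simp [hb])
        simp only [hb, List.sum_cons] at h; simp; omega⟩⟩
  left_inv p := by
    rcases p with ⟨⟨i, hi⟩, c⟩
    simp
  right_inv c := by
    have h := c.blocks_sum
    have hp := @c.blocks_pos
    ext1
    rcases hb : c.blocks with _ | ⟨a, l⟩
    · simp [hb] at h
    · have := @hp a (by simp [hb])
      simp only [hb, List.headI_cons, List.tail_cons]
      rw [Nat.sub_add_cancel this]

theorem compSum_zero (w : ℕ → ℂ) (x : ℕ → Op) : compSum w x 0 = w 0 • 1 := by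
  unfold compSum
  have h : ∀ c : Composition 0, c.blocks = [] := fun c => by
    rcases hb : c.blocks with _ | ⟨a, l⟩
    · rfl
    · have h := c.blocks_sum
      have := c.blocks_pos (i := a) (by simp [hb])
      simp only [hb, List.sum_cons] at h; omega
  let u : Unique (Composition 0) := ⟨⟨⟨[], by simp, rfl⟩⟩, fun c => Composition.ext (by rw [h c, h])⟩
  rw [Fintype.sum_unique]
  simp [h, Composition.length]

theorem compSum_succ (w : ℕ → ℂ) (x : ℕ → Op) (N : ℕ) : compSum w x (N + 1)
    = ∑ i ∈ Finset.range (N + 1), x (i + 1) * compSum (fun l => w (l + 1)) x (N - i) := by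
  unfold compSum
  rw [← (compositionConsEquiv N).sum_comp, Fintype.sum_sigma, Finset.sum_range]
  refine Finset.sum_congr rfl fun i _ => ?_
  rw [Finset.mul_sum]
  refine Finset.sum_congr rfl fun c _ => ?_
  simp [compositionConsEquiv, Composition.length, mul_smul_comm]

theorem compSum_add (w w' : ℕ → ℂ) (x : ℕ → Op) (N : ℕ) :
    compSum (fun l => w l + w' l) x N = compSum w x N + compSum w' x N := by
  simp only [compSum, add_smul, Finset.sum_add_distrib]

/-- Coefficients of `t d/dt f(X) = f'(X) · t X'`, where `X = ∑ xₙ tⁿ` and `f(X) = ∑ w_l X^l`, so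
that `f'` has the weights `(l+1) w_(l+1)`. Commutativity allows the differentiated block to be
written first. -/
theorem smul_compSum {x : ℕ → Op} (hx : ∀ i l, Commute (x i) (x l)) (N : ℕ) : ∀ w : ℕ → ℂ,
    (N : ℂ) • compSum w x N = ∑ i ∈ Finset.range N,
      ((i : ℂ) + 1) • (x (i + 1) * compSum (fun l => (l + 1) * w (l + 1)) x (N - 1 - i)) := by
  induction N using Nat.strong_induction_on with
  | _ N ih =>
  intro w
  rcases N with _ | N
  · simp
  rw [compSum_succ, Finset.smul_sum, Nat.add_sub_cancel]
  have h1 : ∀ i ∈ Finset.range (N + 1), ((N + 1 : ℕ) : ℂ) •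
      (x (i + 1) * compSum (fun l => w (l + 1)) x (N - i))
      = ((i : ℂ) + 1) • (x (i + 1) * compSum (fun l => w (l + 1)) x (N - i))
        + ∑ p ∈ Finset.range (N - i), ((p : ℂ) + 1) • (x (p + 1) *
          (x (i + 1) * compSum (fun l => (l + 1) * w (l + 1 + 1)) x (N - i - 1 - p))) := by
    intro i hi
    have hi' := Finset.mem_range.1 hi
    have h := ih (N - i) (by omega) (fun l => w (l + 1))
    -- The degree splits into the size `i + 1` of the first block and the remaining degree, to which
    -- the induction hypothesis applies.
    have e : ((N + 1 : ℕ) : ℂ) = ((i : ℂ) + 1) + ((N - i : ℕ) : ℂ) := by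
      rw [Nat.cast_sub (by omega)]; push_cast; ring
    rw [e, add_smul, ← mul_smul_comm ((N - i : ℕ) : ℂ), h, Finset.mul_sum]
    congr 1
    refine Finset.sum_congr rfl fun p _ => ?_
    rw [mul_smul_comm, ← mul_assoc, ← mul_assoc, (hx _ _).eq]
  rw [Finset.sum_congr rfl h1, Finset.sum_add_distrib]
  rw [Finset.sum_comm' (t' := Finset.range (N + 1)) (s' := fun p => Finset.range (N - p))
    (by simp only [Finset.mem_range]; omega), ← Finset.sum_add_distrib]
  refine Finset.sum_congr rfl fun i hi => ?_
  have hi' := Finset.mem_range.1 hi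
  rw [← Finset.smul_sum, ← smul_add, ← Finset.mul_sum, ← mul_add]
  congr 2
  have h2 : (∑ p ∈ Finset.range (N - i),
      x (p + 1) * compSum (fun l => (l + 1) * w (l + 1 + 1)) x (N - p - 1 - i))
      = compSum (fun l => (l : ℂ) * w (l + 1)) x (N - i) := by
    rcases h : N - i with _ | M
    · simp [compSum_zero]
    · rw [compSum_succ]
      refine Finset.sum_congr rfl fun p _ => ?_
      rw [show N - p - 1 - i = M - p by omega]
      simp
  rw [h2, ← compSum_add]
  congr 1; funext l; ring

theorem expCoeff_zero (x : ℕ → Op) : expCoeff x 0 = 1 := by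
  have := compSum_zero (fun l => ((l.factorial : ℂ))⁻¹) x
  simpa [compSum, expCoeff] using this

/-- The exponential is its own derivative. This recursion determines the coefficients, and all
further identities for them are derived from it by induction. -/
theorem smul_expCoeff {x : ℕ → Op} (hx : ∀ i l, Commute (x i) (x l)) (N : ℕ) :
    (N : ℂ) • expCoeff x N
      = ∑ i ∈ Finset.range N, ((i : ℂ) + 1) • (x (i + 1) * expCoeff x (N - 1 - i)) := by
  have h := smul_compSum hx N (fun l => ((l.factorial : ℂ))⁻¹)
  have e : (fun l : ℕ => ((l : ℂ) + 1) * (((l + 1).factorial : ℂ))⁻¹)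
      = fun l : ℕ => ((l.factorial : ℂ))⁻¹ := by
    funext l
    have : ((l : ℂ) + 1) ≠ 0 := Nat.cast_add_one_ne_zero l
    rw [Nat.factorial_succ]; push_cast
    field_simp
  rw [e] at h
  exact h

/-- The coefficients of the exponential, with integer index. -/
def expZ (x : ℕ → Op) (n : ℤ) : Op := if 0 ≤ n then expCoeff x n.toNat else 0

section

variable {x : ℕ → Op}

theorem expZ_of_neg (x : ℕ → Op) {n : ℤ} (h : n < 0) : expZ x n = 0 := if_neg (by omega)

theorem expZ_zero (x : ℕ → Op) : expZ x 0 = 1 := by simp [expZ, expCoeff_zero]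

theorem smul_expZ (hx : ∀ i l, Commute (x i) (x l)) {n : ℤ} {K : ℕ} (hn : n ≤ K) :
    (n : ℂ) • expZ x n
      = ∑ i ∈ Finset.range K, ((i : ℂ) + 1) • (x (i + 1) * expZ x (n - 1 - i)) := by
  by_cases h : 0 ≤ n
  · obtain ⟨N, rfl⟩ := Int.eq_ofNat_of_zero_le h
    have hNK : N ≤ K := by exact_mod_cast hn
    rw [← Finset.sum_subset (Finset.range_mono hNK)]
    · rw [expZ, if_pos h, Int.toNat_natCast, Int.cast_natCast, smul_expCoeff hx]
      refine Finset.sum_congr rfl fun i hi => ?_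
      have := Finset.mem_range.1 hi
      rw [expZ, if_pos (by omega), show ((N : ℤ) - 1 - i).toNat = N - 1 - i by omega]
    · intro i _ hi
      have := Finset.mem_range.not.1 hi
      rw [expZ_of_neg _ (by omega), mul_zero, smul_zero]
  · rw [expZ_of_neg _ (by omega), smul_zero, Finset.sum_eq_zero]
    intro i _
    rw [expZ_of_neg _ (by omega), mul_zero, smul_zero]

/-- Induction along the recursion. Negative indices are included, with the value `0`, so that
shifted indices need no case distinctions. -/
theorem expZ_induction (hx : ∀ i l, Commute (x i) (x l)) {p : ℤ → Op → Prop}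
    (hneg : ∀ n < 0, p n 0) (h0 : p 0 1)
    (hs : ∀ n : ℤ, 0 < n → (∀ i : ℕ, p (n - 1 - i) (expZ x (n - 1 - i))) →
      (n : ℂ) • expZ x n
      = ∑ i ∈ Finset.range n.toNat, ((i : ℂ) + 1) • (x (i + 1) * expZ x (n - 1 - i)) →
      p n (expZ x n)) (n : ℤ) : p n (expZ x n) := by
  have key : ∀ N : ℕ, ∀ n : ℤ, n < N → p n (expZ x n) := fun N => by
    induction N with
    | zero => intro n hn; rw [expZ_of_neg _ (by simpa using hn)]; exact hneg n (by simpa using hn)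
    | succ N ih =>
      intro n hn
      push_cast at hn
      rcases lt_trichotomy n 0 with h | rfl | h
      · rw [expZ_of_neg _ h]; exact hneg n h
      · rw [expZ_zero]; exact h0
      · exact hs n h (fun i => ih _ (by omega)) (smul_expZ hx (by omega))
  exact key (n.toNat + 1) n (by omega)

theorem Commute.expZ {A : Op} (hx : ∀ i l, Commute (x i) (x l))
    (hA : ∀ i : ℕ, Commute A (x (i + 1))) (n : ℤ) : Commute A (expZ x n) := by
  induction n using expZ_induction hx with
  | hneg n h => exact Commute.zero_right A
  | h0 => exact Commute.one_right A
  | hs n hn ih h =>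
    have hn' : (n : ℂ) ≠ 0 := by exact_mod_cast hn.ne'
    have : Commute A ((n : ℂ) • Osp12.expZ x n) := by
      rw [h]
      exact Commute.sum_right _ _ _ fun i _ => ((hA i).mul_right (ih i)).smul_right _
    simpa [smul_smul, hn'] using this.smul_right (n : ℂ)⁻¹

/-- The bracket of `A` with the exponent is the scalar series `c t^(m+1)`, and bracketing is a
derivation; so the bracket with the exponential is `c t^(m+1)` times the exponential. -/
theorem expZ_bracket {A : Op} {c : ℂ} {m : ℕ} (hx : ∀ i l, Commute (x i) (x l))
    (hA : ∀ i : ℕ, A * x (i + 1) - x (i + 1) * A = if i = m then c • 1 else 0) (n : ℤ) :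
    A * expZ x n - expZ x n * A = c • expZ x (n - 1 - m) := by
  induction n using expZ_induction hx with
  | hneg n h => rw [expZ_of_neg _ (by omega)]; simp
  | h0 => rw [expZ_of_neg _ (by omega)]; simp
  | hs n hn ih h =>
    have hn' : (n : ℂ) ≠ 0 := by exact_mod_cast hn.ne'
    have h2 : (n : ℂ) • (A * expZ x n - expZ x n * A) = (n : ℂ) • (c • expZ x (n - 1 - m)) := by
      rw [smul_sub, ← mul_smul_comm, ← smul_mul_assoc, h, Finset.mul_sum, Finset.sum_mul,
        ← Finset.sum_sub_distrib]
      have h3 : ∀ i ∈ Finset.range n.toNat,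
          A * (((i : ℂ) + 1) • (x (i + 1) * expZ x (n - 1 - i)))
            - ((i : ℂ) + 1) • (x (i + 1) * expZ x (n - 1 - i)) * A
          = (if i = m then (((m : ℂ) + 1) * c) • expZ x (n - 1 - m) else 0)
            + c • (((i : ℂ) + 1) • (x (i + 1) * expZ x (n - 1 - m - 1 - i))) := fun i _ => by
        have e1 := ih i
        have e2 := congrArg (fun X => X * expZ x (n - 1 - i)) (hA i)
        have e3 := congrArg (fun X => x (i + 1) * X) e1
        rw [show n - 1 - (i : ℤ) - 1 - m = n - 1 - m - 1 - i by ring] at e3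
        simp only [sub_mul, mul_sub, mul_smul_comm, smul_mul_assoc, mul_assoc] at e2 e3 ⊢
        split_ifs at e2 ⊢ with him
        · subst him
          simp only [smul_mul_assoc, one_mul] at e2
          linear_combination (norm := module) ((i : ℂ) + 1) • e2 + ((i : ℂ) + 1) • e3
        · rw [zero_mul] at e2
          linear_combination (norm := module) ((i : ℂ) + 1) • e2 + ((i : ℂ) + 1) • e3
      rw [Finset.sum_congr rfl h3, Finset.sum_add_distrib, ← Finset.smul_sum,
        ← smul_expZ hx (K := n.toNat) (by omega), Finset.sum_ite_eq']
      push_cast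
      split_ifs with hm
      · module
      -- If the single contribution `i = m` is out of range, the index of the exponential on the
      -- other side is negative.
      · rw [expZ_of_neg _ (by simp at hm; omega)]; simp
    exact smul_right_injective _ hn' h2

/-- `D` acts on the exponent like `c · t d/dt`, hence on the exponential as well. -/
theorem expZ_grade {D : Op} {c : ℂ} (hx : ∀ i l, Commute (x i) (x l))
    (hD : ∀ i : ℕ, D * x (i + 1) - x (i + 1) * D = (((i : ℂ) + 1) * c) • x (i + 1)) (n : ℤ) :
    D * expZ x n - expZ x n * D = ((n : ℂ) * c) • expZ x n := by
  induction n using expZ_induction hx with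
  | hneg n h => simp
  | h0 => simp
  | hs n hn ih h =>
    have hn' : (n : ℂ) ≠ 0 := by exact_mod_cast hn.ne'
    have h2 : (n : ℂ) • (D * expZ x n - expZ x n * D) = (n : ℂ) • (((n : ℂ) * c) • expZ x n) := by
      rw [smul_sub, ← mul_smul_comm, ← smul_mul_assoc, smul_comm (n : ℂ), h, Finset.mul_sum,
        Finset.sum_mul, ← Finset.sum_sub_distrib, Finset.smul_sum]
      refine Finset.sum_congr rfl fun i _ => ?_
      have e2 := congrArg (fun X => X * expZ x (n - 1 - i)) (hD i)
      have e3 := congrArg (fun X => x (i + 1) * X) (ih i)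
      push_cast at e3
      simp only [sub_mul, mul_sub, mul_smul_comm, smul_mul_assoc, mul_assoc] at e2 e3 ⊢
      linear_combination (norm := module) ((i : ℂ) + 1) • e2 + ((i : ℂ) + 1) • e3
    exact smul_right_injective _ hn' h2

end

/-! ### The exponential field -/

theorem diagOp_apply (f : Occ → ℂ) (u : Fock) (t : Occ) : diagOp f u t = f t * u t := by
  classical
  induction u using Finsupp.induction_linear with
  | zero => simp
  | add f g hf hg => rw [map_add, Finsupp.add_apply, hf, hg, Finsupp.add_apply, mul_add]
  | single s c =>
    rw [diagOp, basisOp_single, Finsupp.smul_single, Finsupp.single_apply, Finsupp.single_apply]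
    split_ifs with h
    · subst h; simp [mul_comm]
    · simp

/-- An operator that lowers the energy a lot vanishes on a given vector. -/
theorem energy_bound (v : Fock) : ∃ K : ℤ, ∀ (A : Op) (c : ℤ),
    energyOp * A - A * energyOp = (c : ℂ) • A → c < -K → A v = 0 := by
  refine ⟨∑ s ∈ v.support, (energy s : ℤ), fun A c hA hc => op_eq_zero_of_support fun s hs => ?_⟩
  have hs' : (energy s : ℤ) ≤ ∑ s ∈ v.support, (energy s : ℤ) :=
    Finset.single_le_sum (f := fun s => (energy s : ℤ)) (fun _ _ => by positivity) hs
  have h := LinearMap.congr_fun hA (Finsupp.single s 1)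
  have e : energyOp (Finsupp.single s 1) = (energy s : ℂ) • Finsupp.single s 1 := by
    rw [energyOp_eq]; simp [diagOp]
  have e' : ∀ (u : Fock) t, energyOp u t = (energy t : ℂ) * u t := fun u t => by
    rw [energyOp_eq, diagOp_apply]
  simp only [LinearMap.sub_apply, Module.End.mul_apply, LinearMap.smul_apply, e, map_smul] at h
  ext t
  have ht := DFunLike.congr_fun h t
  simp only [Finsupp.sub_apply, Finsupp.smul_apply, e', smul_eq_mul] at ht
  have : ((energy t : ℂ) - energy s - c) * (A (Finsupp.single s 1)) t = 0 := by linear_combination ht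
  rcases mul_eq_zero.1 this with h0 | h0
  · exfalso
    have : (energy t : ℤ) - energy s - c = 0 := by exact_mod_cast h0
    have : 0 ≤ (energy t : ℤ) := by positivity
    omega
  · simpa using h0

section

variable (α : ℂ)

def expUp (n : ℤ) : Op := expZ (fun i => (alphaMinus α / i) • phiMode 0 (-(i : ℤ))) n
def expDown (n : ℤ) : Op := expZ (fun i => (-alphaMinus α / i) • phiMode 0 (i : ℤ)) n

theorem phiMode_commute {m n : ℤ} (h : m + n ≠ 0) (c : ℂ) : Commute (phiMode c m) (phiMode c n) := by
  have := phiMode_bracket c m n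
  rw [if_neg h, sub_eq_zero] at this
  exact this

theorem phiMode_zero_zero : phiMode 0 0 = 0 := by simp [phiMode]

theorem commute_up (i l : ℕ) : Commute ((alphaMinus α / i) • phiMode 0 (-(i : ℤ)))
    ((alphaMinus α / l) • phiMode 0 (-(l : ℤ))) := by
  by_cases h : -(i : ℤ) + -(l : ℤ) = 0
  · have hi : i = l := by omega
    subst hi; exact Commute.refl _
  · exact ((phiMode_commute h 0).smul_left _).smul_right _

theorem commute_down (i l : ℕ) : Commute ((-alphaMinus α / i) • phiMode 0 (i : ℤ))
    ((-alphaMinus α / l) • phiMode 0 (l : ℤ)) := by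
  by_cases h : (i : ℤ) + (l : ℤ) = 0
  · have hi : i = l := by omega
    subst hi; exact Commute.refl _
  · exact ((phiMode_commute h 0).smul_left _).smul_right _

theorem phiMode_expUp_of_nonpos {m : ℤ} (hm : m ≤ 0) (n : ℤ) :
    Commute (phiMode 0 m) (expUp α n) :=
  Commute.expZ (commute_up α) (fun i => (phiMode_commute (by push_cast; omega) 0).smul_right _) n

theorem phiMode_expDown_of_nonneg {m : ℤ} (hm : 0 ≤ m) (n : ℤ) :
    Commute (phiMode 0 m) (expDown α n) :=
  Commute.expZ (commute_down α) (fun i => (phiMode_commute (by push_cast; omega) 0).smul_right _) n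

theorem phiMode_expUp {m : ℤ} (hm : 0 < m) (n : ℤ) :
    phiMode 0 m * expUp α n - expUp α n * phiMode 0 m = alphaMinus α • expUp α (n - m) := by
  obtain ⟨p, rfl⟩ : ∃ p : ℕ, m = p + 1 := ⟨(m - 1).toNat, by omega⟩
  rw [expUp, expZ_bracket (c := alphaMinus α) (m := p) (commute_up α), expUp]
  · congr 2; ring
  · intro i
    have := phiMode_bracket 0 (p + 1) (-((i + 1 : ℕ) : ℤ))
    have hp : (i : ℂ) + 1 ≠ 0 := Nat.cast_add_one_ne_zero i
    rw [mul_smul_comm, smul_mul_assoc, ← smul_sub, this]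
    by_cases h : i = p
    · subst h
      rw [if_pos (by push_cast; ring), if_pos rfl, smul_smul]
      congr 1; push_cast; field_simp
    · rw [if_neg (by push_cast; omega), if_neg h, smul_zero]

theorem phiMode_expDown {m : ℤ} (hm : m < 0) (n : ℤ) :
    phiMode 0 m * expDown α n - expDown α n * phiMode 0 m = alphaMinus α • expDown α (n + m) := by
  obtain ⟨p, rfl⟩ : ∃ p : ℕ, m = -(p + 1) := ⟨(-m - 1).toNat, by omega⟩
  rw [expDown, expZ_bracket (c := alphaMinus α) (m := p) (commute_down α), expDown]
  · congr 2; ring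
  · intro i
    have := phiMode_bracket 0 (-((p : ℤ) + 1)) ((i + 1 : ℕ) : ℤ)
    have hp : (i : ℂ) + 1 ≠ 0 := Nat.cast_add_one_ne_zero i
    rw [mul_smul_comm, smul_mul_assoc, ← smul_sub, this]
    by_cases h : i = p
    · subst h
      rw [if_pos (by push_cast; ring), if_pos rfl, smul_smul]
      congr 1; push_cast; field_simp
    · rw [if_neg (by push_cast; omega), if_neg h, smul_zero]

/-- The factor `1/i` in the exponent cancels against the degree. Any upper limit `K ≥ n` may be
used, since the additional terms have negative index; this lets both halves of the vertex operator
share one range. -/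
theorem smul_expUp {n : ℤ} {K : ℕ} (hn : n ≤ K) : (n : ℂ) • expUp α n
    = alphaMinus α • ∑ i ∈ Finset.range K, phiMode 0 (-((i : ℤ) + 1)) * expUp α (n - 1 - i) := by
  rw [expUp, smul_expZ (commute_up α) hn, Finset.smul_sum]
  refine Finset.sum_congr rfl fun i _ => ?_
  have hp : (i : ℂ) + 1 ≠ 0 := Nat.cast_add_one_ne_zero i
  rw [smul_mul_assoc, smul_smul]
  push_cast
  rw [show ((i : ℂ) + 1) * (alphaMinus α / (i + 1)) = alphaMinus α by field_simp]; rfl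

theorem smul_expDown {n : ℤ} {K : ℕ} (hn : n ≤ K) : (n : ℂ) • expDown α n
    = -alphaMinus α • ∑ i ∈ Finset.range K, phiMode 0 ((i : ℤ) + 1) * expDown α (n - 1 - i) := by
  rw [expDown, smul_expZ (commute_down α) hn, Finset.smul_sum]
  refine Finset.sum_congr rfl fun i _ => ?_
  have hp : (i : ℂ) + 1 ≠ 0 := Nat.cast_add_one_ne_zero i
  rw [smul_mul_assoc, smul_smul]
  push_cast
  rw [show ((i : ℂ) + 1) * (-alphaMinus α / (i + 1)) = -alphaMinus α by field_simp]; rfl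

theorem energy_expUp (n : ℤ) :
    energyOp * expUp α n - expUp α n * energyOp = (n : ℂ) • expUp α n := by
  rw [expUp, expZ_grade (c := 1) (commute_up α), mul_one]
  intro i
  have := energy_phiMode 0 (-((i + 1 : ℕ) : ℤ))
  push_cast at this ⊢
  rw [mul_smul_comm, smul_mul_assoc, ← smul_sub, this, smul_comm]
  congr 1; ring

theorem energy_expDown (n : ℤ) :
    energyOp * expDown α n - expDown α n * energyOp = ((-n : ℤ) : ℂ) • expDown α n := by
  rw [expDown, expZ_grade (c := -1) (commute_down α)]
  · congr 1; push_cast; ring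
  intro i
  have := energy_phiMode 0 ((i + 1 : ℕ) : ℤ)
  push_cast at this ⊢
  rw [mul_smul_comm, smul_mul_assoc, ← smul_sub, this, smul_comm]
  congr 1; ring

end

theorem locSum_nat_eq_int {T : ℤ → Op} (hT : LocFin T) (h : ∀ n < 0, T n = 0) :
    locSum (fun n : ℕ => T n) = locSum T := by
  classical
  refine op_ext fun s => ?_
  rw [locSum_apply (hT.comp Nat.cast_injective), locSum_apply hT,
    ← finsum_mem_range (g := fun n : ℕ => (n : ℤ)) (f := fun n => T n (Finsupp.single s 1))
      Nat.cast_injective]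
  refine finsum_congr fun n => ?_
  by_cases hn : n ∈ Set.range fun n : ℕ => (n : ℤ)
  · rw [finsum_eq_if, if_pos hn]
  · have : n < 0 := by
      by_contra h'
      exact hn ⟨n.toNat, by simp; omega⟩
    simp [h n this]

section

variable (α : ℂ)

/-- The terms of a mode of the exponential field. -/
def vertexTerm (n l : ℤ) : Op := expUp α (l - n - 1) * expDown α l

theorem vertexTerm_of_neg (n : ℤ) {l : ℤ} (h : l < 0) : vertexTerm α n l = 0 := by
  rw [vertexTerm, expDown, expZ_of_neg _ h, mul_zero]

theorem energy_mul {A B : Op} {a b : ℂ} (hA : energyOp * A - A * energyOp = a • A)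
    (hB : energyOp * B - B * energyOp = b • B) :
    energyOp * (A * B) - A * B * energyOp = (a + b) • (A * B) := by
  have h1 := congrArg (fun X => X * B) hA
  have h2 := congrArg (fun X => A * X) hB
  simp only [sub_mul, mul_sub, smul_mul_assoc, mul_smul_comm, mul_assoc] at h1 h2 ⊢
  linear_combination (norm := module) h1 + h2

theorem locFin_vertexTerm (n : ℤ) : LocFin (vertexTerm α n) := fun v => by
  obtain ⟨K, hK⟩ := energy_bound v
  refine (Set.finite_Icc 0 K).subset fun l hl => ?_
  simp only [Set.mem_ofPred_eq] at hl
  by_contra h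
  simp only [Set.mem_Icc, not_and_or, not_le] at h
  rcases h with h | h
  · exact hl (by rw [vertexTerm_of_neg α n h]; rfl)
  · refine hl ?_
    rw [vertexTerm, Module.End.mul_apply, hK _ _ (energy_expDown α l) (by omega), map_zero]

theorem vertexExp_apply (n : ℤ) : vertexExp α n = locSum (vertexTerm α n) := by
  rw [← locSum_nat_eq_int (locFin_vertexTerm α n) fun l h => vertexTerm_of_neg α n h]
  unfold vertexExp
  congr 1; funext N
  unfold vertexTerm expUp expDown expZ
  by_cases h : n + 1 ≤ (N : ℤ)
  · rw [if_pos h, if_pos (by omega), if_pos (by omega), Int.toNat_natCast]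
  · rw [if_neg h, if_neg (by omega), zero_mul]

theorem energy_vertexExp : Graded energyOp (-1) 0 (vertexExp α) := fun n => by
  have hl := locFin_vertexTerm α n
  rw [vertexExp_apply, mul_locSum _ hl, locSum_mul _ hl, ← locSum_smul _ hl, sub_eq_iff_eq_add,
    ← locSum_add (hl.smul _) (hl.mul_right _)]
  congr 1; funext l
  rw [← sub_eq_iff_eq_add, vertexTerm, energy_mul (energy_expUp α _) (energy_expDown α _)]
  congr 1; push_cast; ring

instance : Fld (vertexExp α) := ⟨fun v => by
  obtain ⟨K, hK⟩ := energy_bound v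
  refine ⟨K, fun n hn => hK _ (-(n + 1)) ?_ (by omega)⟩
  rw [energy_vertexExp α n]; congr 1; push_cast; ring⟩

theorem commute_vertexExp {A : Op} (h : ∀ n ≠ 0, Commute A (phiMode 0 n)) (n : ℤ) :
    Commute A (vertexExp α n) := by
  have hl := locFin_vertexTerm α n
  rw [vertexExp_apply]
  change _ = _
  rw [mul_locSum _ hl, locSum_mul _ hl]
  congr 1; funext l
  exact ((Commute.expZ (commute_up α) (fun i => (h _ (by push_cast; omega)).smul_right _) _).mul_right
    (Commute.expZ (commute_down α) (fun i => (h _ (by push_cast; omega)).smul_right _) _)).eq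

theorem NoOsc.vertexExp {A : Op} (h : NoOsc A) (n : ℤ) : Commute A (vertexExp α n) :=
  commute_vertexExp α (fun n _ => (h.phiMode 0 n).symm) n

theorem brk_vertexExp {A : Modes} (h : ∀ n, NoOsc (A n)) : Brk 1 A (vertexExp α) 0 0 :=
  brk_of_commute fun m n => (h m).vertexExp α n

theorem parity_vertexExp : HasParity 1 (vertexExp α) := fun n => by
  rw [one_smul]
  exact (commute_vertexExp α (fun n _ => parity_phiMode 0 n) n).eq

theorem phiMode_of_ne {n : ℤ} (h : n ≠ 0) (c : ℂ) : phiMode c n = phiMode 0 n := by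
  simp [phiMode, h]

theorem phiMode_self (c : ℂ) : phiMode c 0 = c • 1 := if_pos rfl

/-- Positive modes of `φ` see only the creation half of the vertex operator, negative modes only the
annihilation half. The zero mode takes the value `c` on the source and `c + α₋` on the target, and
with this shift the same formula holds for all three. -/
theorem phiMode_vertexExp (c : ℂ) (m n : ℤ) :
    phiMode (c + alphaMinus α) m * vertexExp α n - vertexExp α n * phiMode c m
      = alphaMinus α • vertexExp α (m + n) := by
  rcases lt_trichotomy m 0 with h | rfl | h
  · have hl := locFin_vertexTerm α n
    have hl' := locFin_vertexTerm α (m + n)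
    have hs := (locFin_vertexTerm α (m + n)).comp (Equiv.addRight m).injective
    rw [phiMode_of_ne h.ne (c + _), phiMode_of_ne h.ne c, vertexExp_apply, vertexExp_apply, mul_locSum _ hl,
      locSum_mul _ hl, ← locSum_equiv (Equiv.addRight m) hl', ← locSum_smul _ hs,
      sub_eq_iff_eq_add, ← locSum_add (hs.smul _) (hl.mul_right _)]
    congr 1; funext l
    have h1 := (phiMode_expUp_of_nonpos α h.le (l - n - 1)).eq
    have h2 := congrArg (fun X => expUp α (l - n - 1) * X) (phiMode_expDown α h l)
    simp only [vertexTerm, Equiv.coe_addRight, mul_sub, mul_smul_comm,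
      show l + m - (m + n) - 1 = l - n - 1 by ring] at h2 ⊢
    rw [← mul_assoc, h1, mul_assoc, mul_assoc, ← h2, sub_add_cancel]
  · rw [phiMode_self, phiMode_self]
    simp only [smul_mul_assoc, mul_smul_comm, one_mul, mul_one, zero_add]; module
  · have hl := locFin_vertexTerm α n
    have hl' := locFin_vertexTerm α (m + n)
    rw [phiMode_of_ne h.ne' (c + _), phiMode_of_ne h.ne' c, vertexExp_apply, vertexExp_apply, mul_locSum _ hl,
      locSum_mul _ hl, ← locSum_smul _ hl', sub_eq_iff_eq_add,
      ← locSum_add (hl'.smul _) (hl.mul_right _)]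
    congr 1; funext l
    have h1 := (phiMode_expDown_of_nonneg α h.le l).eq
    have h2 := congrArg (fun X => X * expDown α l) (phiMode_expUp α h (l - n - 1))
    simp only [vertexTerm, sub_mul, smul_mul_assoc,
      show l - n - 1 - m = l - (m + n) - 1 by ring] at h2 ⊢
    rw [← mul_assoc, mul_assoc (expUp α _) (expDown α _), ← h1, ← mul_assoc, ← h2, sub_add_cancel]

instance (c : ℂ) : Fld (phiMode c) := by
  have h : phiMode c = iDphi 1 (c / 2) := by
    funext n; rw [iDphi]; congr 1; ring
  rw [h]; infer_instance

/-- The terms of `:i∂φ e^{iα₋φ}:`, rearranged. -/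
def phiVertexTerm (n : ℤ) (p : ℤ × ℤ) : Op :=
  if p.2 < 0 then phiMode 0 p.2 * expUp α (p.1 - n + p.2) * expDown α p.1
  else expUp α (p.1 - n) * phiMode 0 p.2 * expDown α (p.1 - p.2)

theorem locFin_phiVertexTerm (n : ℤ) : LocFin (phiVertexTerm α n) := fun v => by
  obtain ⟨K, hK⟩ := energy_bound v
  refine ((Set.finite_Icc 0 K).prod (Set.finite_Icc (n - K) K)).subset ?_
  rintro ⟨N, l⟩ hp
  simp only [Set.mem_ofPred_eq, phiVertexTerm] at hp
  have h0 : 0 ≤ N := by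
    by_contra h
    split_ifs at hp
    · exact hp (by rw [expDown, expZ_of_neg _ (by omega), mul_zero]; rfl)
    · exact hp (by rw [expDown, expZ_of_neg _ (by omega), mul_zero]; rfl)
  have h1 : N ≤ K := by
    by_contra h
    split_ifs at hp
    · exact hp (by rw [Module.End.mul_apply, hK _ _ (energy_expDown α N) (by omega), map_zero])
    · refine hp ?_
      rw [mul_assoc, Module.End.mul_apply, hK (phiMode 0 l * expDown α (N - l)) (-N) ?_ (by omega),
        map_zero]
      rw [energy_mul (energy_phiMode 0 l) (energy_expDown α (N - l))]
      congr 1; push_cast; ring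
  refine ⟨⟨h0, h1⟩, ?_, ?_⟩
  · by_contra h
    split_ifs at hp
    · exact hp (by rw [expUp, expZ_of_neg _ (by simp only at h; omega), mul_zero, zero_mul]; rfl)
    · exact hp (by rw [expUp, expZ_of_neg _ (by simp only at h; omega), zero_mul, zero_mul]; rfl)
  · by_contra h
    split_ifs at hp
    · simp only at h; omega
    · exact hp (by rw [expDown, expZ_of_neg _ (by simp only at h; omega), mul_zero]; rfl)

-- The negative `l` collect to the logarithmic derivative of the creation half, the positive `l` to
-- that of the annihilation half, and `l = 0` drops out because `φ_0` is set to zero. Terms outside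
-- `[-K, K]` contain an exponential coefficient of negative index.
set_option maxHeartbeats 400000 in
theorem locSum_phiVertexTerm {n N : ℤ} {K : ℕ} (hN : N ≤ K) (hNn : N - n ≤ K) :
    locSum (fun l => phiVertexTerm α n (N, l))
      = (∑ i ∈ Finset.range K, phiMode 0 (-((i : ℤ) + 1)) * expUp α (N - n - 1 - i)) * expDown α N
        + expUp α (N - n) *
          ∑ i ∈ Finset.range K, phiMode 0 ((i : ℤ) + 1) * expDown α (N - 1 - i) := by
  rw [locSum_eq_sum (Finset.Icc (-(K : ℤ)) K)]
  · have hu : Finset.Icc (-(K : ℤ)) K = ((Finset.range K).image fun i : ℕ => -((i : ℤ) + 1)) ∪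
        ({0} ∪ (Finset.range K).image fun i : ℕ => ((i : ℤ) + 1)) := by
      ext l
      simp only [Finset.mem_Icc, Finset.mem_union, Finset.mem_image, Finset.mem_range,
        Finset.mem_singleton]
      constructor
      · intro h
        rcases lt_trichotomy l 0 with h' | h' | h'
        · exact Or.inl ⟨(-l - 1).toNat, by omega, by omega⟩
        · exact Or.inr (Or.inl h')
        · exact Or.inr (Or.inr ⟨(l - 1).toNat, by omega, by omega⟩)
      · rintro (⟨i, hi, rfl⟩ | rfl | ⟨i, hi, rfl⟩) <;> omega
    rw [hu, Finset.sum_union, Finset.sum_union, Finset.sum_singleton, Finset.sum_image,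
      Finset.sum_image, Finset.sum_mul, Finset.mul_sum]
    · have h0 : phiVertexTerm α n (N, 0) = 0 := by
        simp [phiVertexTerm, phiMode_zero_zero]
      rw [h0, zero_add]
      congr 1
      · refine Finset.sum_congr rfl fun i _ => ?_
        rw [phiVertexTerm, if_pos (by simp only; omega)]
        simp only
        rw [show N - n + -((i : ℤ) + 1) = N - n - 1 - i by ring]
      · refine Finset.sum_congr rfl fun i _ => ?_
        rw [phiVertexTerm, if_neg (by simp only; omega)]
        simp only
        rw [show N - ((i : ℤ) + 1) = N - 1 - i by ring, mul_assoc]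
    · intro a _ b _ h; simpa using h
    · intro a _ b _ h; simpa using h
    · rw [Finset.disjoint_left]
      intro a ha hb
      simp only [Finset.mem_singleton, Finset.mem_image, Finset.mem_range] at ha hb
      obtain ⟨i, _, rfl⟩ := hb
      omega
    · rw [Finset.disjoint_left]
      intro a ha hb
      simp only [Finset.mem_union, Finset.mem_singleton, Finset.mem_image, Finset.mem_range] at ha hb
      obtain ⟨i, _, rfl⟩ := ha
      rcases hb with hb | ⟨i', _, hb⟩ <;> omega
  · intro l hl
    simp only [Finset.mem_Icc, not_and_or, not_le] at hl
    unfold phiVertexTerm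
    split_ifs with h
    · rw [expUp, expZ_of_neg _ (by simp only at h ⊢; omega), mul_zero, zero_mul]
    · rw [expDown, expZ_of_neg _ (by simp only at h ⊢; omega), mul_zero]

/-- The recursions for the two halves give the degrees `N - n` and `-N`, whose sum `-n` does not
depend on `N`, as a derivative requires. -/
theorem smul_locSum_phiVertexTerm (n N : ℤ) :
    alphaMinus α • locSum (fun l => phiVertexTerm α n (N, l))
      = (-(n : ℂ)) • vertexTerm α (n - 1) N := by
  obtain ⟨K, hK⟩ : ∃ K : ℕ, N ≤ K ∧ N - n ≤ K :=
    ⟨(max N (N - n)).toNat, (le_max_left _ _).trans (Int.self_le_toNat _),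
      (le_max_right _ _).trans (Int.self_le_toNat _)⟩
  have h1 : ((N - n : ℤ) : ℂ) • (expUp α (N - n) * expDown α N)
      = alphaMinus α • ((∑ i ∈ Finset.range K, phiMode 0 (-((i : ℤ) + 1)) * expUp α (N - n - 1 - i))
        * expDown α N) := by
    rw [← smul_mul_assoc, smul_expUp α hK.2]; exact smul_mul_assoc _ _ _
  have h2 : (N : ℂ) • (expUp α (N - n) * expDown α N)
      = -alphaMinus α • (expUp α (N - n) *
          ∑ i ∈ Finset.range K, phiMode 0 ((i : ℤ) + 1) * expDown α (N - 1 - i)) := by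
    rw [← mul_smul_comm, smul_expDown α hK.1]; exact mul_smul_comm _ _ _
  have e := locSum_phiVertexTerm α hK.1 hK.2
  rw [e, vertexTerm, show N - (n - 1) - 1 = N - n by ring]
  rw [Int.cast_sub] at h1
  linear_combination (norm := module) h2 - h1

/-- The derivative of the exponential field. -/
theorem nP_phi_vertexExp : alphaMinus α • nP 1 (phiMode 0) (vertexExp α)
    = derivField 0 (vertexExp α) := by
  funext n
  have hl := locFin_phiVertexTerm α n
  have h1 : nP 1 (phiMode 0) (vertexExp α) n = locSum (phiVertexTerm α n) := by
    rw [← locSum_equiv (Equiv.prodComm ℤ ℤ) hl, ← locSum_prod (hl.comp (Equiv.injective _)), nP_apply]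
    congr 1; funext l
    unfold cutTerm
    have hv := locFin_vertexTerm α (n - l - 1)
    split_ifs with h
    · rw [vertexExp_apply, mul_locSum _ hv]
      congr 1; funext N
      simp only [vertexTerm, phiVertexTerm, Equiv.prodComm_apply, Prod.swap_prod_mk, if_pos h,
        mul_assoc, show N - (n - l - 1) - 1 = N - n + l by ring]
    -- Here `φ_l` lowers the energy too, so `N` is shifted by `l` to measure the total energy
    -- removed on the right.
    · rw [vertexExp_apply, locSum_mul _ hv, one_smul,
        ← locSum_equiv (Equiv.subRight l) (hv.mul_right _)]
      congr 1; funext N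
      simp only [vertexTerm, phiVertexTerm, Equiv.prodComm_apply, Prod.swap_prod_mk, if_neg h,
        mul_assoc, Equiv.subRight_apply, show N - l - (n - l - 1) - 1 = N - n by ring,
        (phiMode_expDown_of_nonneg α (not_lt.1 h) (N - l)).eq]
  have hl1 : LocFin fun N => locSum fun l => phiVertexTerm α n (N, l) := fun v => by
    refine ((hl v).image Prod.fst).subset fun N hN => ?_
    simp only [Set.mem_ofPred_eq, locSum_apply (hl.comp (Prod.mk_right_injective N))] at hN
    by_contra h
    refine hN (finsum_eq_zero_of_forall_eq_zero fun j => ?_)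
    by_contra hj
    exact h ⟨(N, j), hj, rfl⟩
  have h2 : (fun N => alphaMinus α • locSum fun l => phiVertexTerm α n (N, l))
      = fun N => (-(n : ℂ)) • vertexTerm α (n - 1) N := funext (smul_locSum_phiVertexTerm α n)
  have h3 : locSum (phiVertexTerm α n) = locSum fun N => locSum fun l => phiVertexTerm α n (N, l) :=
    (locSum_prod hl).symm
  rw [Pi.smul_apply, h1, h3, ← locSum_smul _ hl1, h2, locSum_smul _ (locFin_vertexTerm α _), ← vertexExp_apply, derivField, zero_sub]

end

/-! ### The screening field -/

/-- The field `ψ⁺ + βψ`. -/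
def fS : Modes := psiPlus + nP 1 beta psi

instance : Fld fS := inferInstanceAs (Fld (psiPlus + nP 1 beta psi))

theorem fS_eq : fS = fP + (2 : ℂ) • nP 1 beta psi := by
  rw [fS, fP]; module

theorem brk_P_S : Brk (-1) fP fS 0 0 := by
  rw [fS_eq]
  exact (brk_P_P.add_right ((brk_P_beta.wick' brk_P_psi
    (brk_zero_left (-1) _) (brk_zero_left (-1) _)
    (by norm_num) (by norm_num) (s2 := 1) (by norm_num) (by norm_num)).smul_right 2)).congr rfl
    (by simp only [nP_zero_left, nP_one_right]; module)
    (by simp [nP_zero_left, nP_zero_right])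

theorem brk_gamma_S : Brk 1 gamma fS (-psi) 0 :=
  (brk_gamma_psiPlus.add_right (brk_gamma_beta.wick' brk_gamma_psi
    ((brk_one_left psi).neg_left.congr rfl neg_zero neg_zero) (brk_zero_left 1 _)
    (by norm_num) (by norm_num) (s2 := 1) (by norm_num) (by norm_num))).congr rfl
    (by simp [nP_zero_right, nP_neg_left, nP_one_left])
    (by simp [nP_zero_left, nP_zero_right])

theorem brk_psi_S : Brk (-1) psi fS oneF 0 :=
  (brk_psi_psiPlus.add_right (brk_psi_beta.wick' brk_psi_psi
    (brk_zero_left (-1) _) (brk_zero_left (-1) _)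
    (by norm_num) (by norm_num) (s2 := 1) (by norm_num) (by norm_num))).congr rfl
    (by simp [nP_zero_left, nP_zero_right])
    (by simp [nP_zero_left, nP_zero_right])

theorem noOsc_S (n : ℤ) : NoOsc (fS n) := fun i => by
  have h := NoOsc.nP noOsc_beta noOsc_psi 1 n i
  exact ⟨(noOsc_psiPlus n i).1.add_right h.1, (noOsc_psiPlus n i).2.add_right h.2⟩

theorem nP_S_psi : nP (-1) fS psi = nP (-1) fP psi := by
  rw [fS_eq, nP_add_left, nP_smul_left, nP_beta_psi_psi, smul_zero, add_zero]

theorem brk_Pgamma_S : Brk (-1) (nP 1 fP gamma) fS (-nP (-1) fP psi) 0 := by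
  have h1 : Brk (-1) fS fP 0 0 := brk_P_S.symm00 (by norm_num)
  have h2 : Brk 1 fS gamma psi 0 := (brk_gamma_S.symm0 (by norm_num)).congr rfl (by simp) rfl
  have h := h1.wick' h2 (σ := 1) (s1 := 1) (s2 := -1) (s3 := -1) (brk_zero_left _ _)
    (brk_zero_left _ _) (by norm_num) (by norm_num) (by norm_num) (by norm_num)
  refine ((h.congr rfl rfl ?_).symm0 (by norm_num)).congr rfl ?_ rfl
  · simp [nP_zero_left, nP_zero_right]
  · simp only [nP_zero_left]; module

theorem brk_dpsi_S : Brk (-1) (derivField 0 psi) fS 0 (-oneF) := by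
  have h : Brk (-1) fS psi oneF 0 := (brk_psi_S.symm0 (by norm_num)).congr rfl (by simp) rfl
  refine (h.deriv.symm (by norm_num)).congr rfl ?_ (by simp)
  rw [derivField_one]; simp

section

variable (α : ℂ)

theorem screening_eq : screening α = nP 1 fS (vertexExp α) := by
  simp only [screening, normalProd_eq, koszul01, koszul10, fS]

instance : Fld (screening α) := by rw [screening_eq]; infer_instance

theorem brk_S_vertexExp : Brk 1 fS (vertexExp α) 0 0 := brk_vertexExp α noOsc_S
theorem brk_P_vertexExp : Brk 1 fP (vertexExp α) 0 0 := brk_vertexExp α noOsc_P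
theorem brk_psi_vertexExp : Brk 1 psi (vertexExp α) 0 0 := brk_vertexExp α noOsc_psi

theorem brk_P_screening : Brk (-1) fP (screening α) 0 0 := by
  rw [screening_eq]
  refine (brk_P_S.wick' (brk_P_vertexExp α) (σ := 1) (s1 := 1) (s2 := -1) (s3 := -1)
    (brk_zero_left _ _) (brk_zero_left _ _)
    (by norm_num) (by norm_num) (by norm_num) (by norm_num)).congr rfl ?_ ?_ <;>
  simp [nP_zero_left, nP_zero_right]

theorem brk_psi_screening : Brk (-1) psi (screening α) (vertexExp α) 0 := by
  rw [screening_eq]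
  refine (brk_psi_S.wick' (brk_psi_vertexExp α) (σ := 1) (s1 := 1) (s2 := -1) (s3 := -1)
    (brk_one_left _) (brk_zero_left _ _)
    (by norm_num) (by norm_num) (by norm_num) (by norm_num)).congr rfl ?_ ?_ <;>
  simp [nP_zero_left, nP_zero_right, nP_one_left]

theorem brk_screening_psi : Brk (-1) (screening α) psi (vertexExp α) 0 :=
  ((brk_psi_screening α).symm0 (by norm_num)).congr rfl (by simp) rfl

theorem noOsc_Ppsi (n : ℤ) : NoOsc (nP (-1) fP psi n) := NoOsc.nP noOsc_P noOsc_psi _ n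

/-- The part of `j⁻` without `φ`. -/
def jminusFree (k : ℂ) : Modes := nP 1 fP gamma + (2 * k + 2) • derivField 0 psi

theorem noOsc_jminusFree (k : ℂ) (n : ℤ) : NoOsc (jminusFree k n) := fun i => by
  have h := NoOsc.nP noOsc_P noOsc_gamma 1 n i
  have h2 := noOsc_psi (n - 1) i
  have e : jminusFree k n = nP 1 fP gamma n + ((2 * k + 2) * (0 - n)) • psi (n - 1) := by
    rw [mul_smul]; rfl
  rw [e]
  exact ⟨h.1.add_right (h2.1.smul_right _), h.2.add_right (h2.2.smul_right _)⟩

/-- The summand of `j⁻` with `φ` is treated separately, since its zero mode acts by different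
scalars before and after `V`, while `Brk` uses the same modes on both sides. The second-order pole
stems from the derivative of `ψ`. -/
theorem brk_jminusFree_screening (k : ℂ) : Brk (-1) (jminusFree k) (screening α)
    (-nP 1 (nP (-1) fP psi) (vertexExp α)) (-(2 * k + 2) • vertexExp α) := by
  rw [screening_eq]
  have h := brk_Pgamma_S.add_left (brk_dpsi_S.smul_left (2 * k + 2))
  refine (h.wick' (brk_vertexExp α (noOsc_jminusFree k)) (σ := 1) (s1 := 1) (s2 := -1) (s3 := -1)
    (F := 0) ?_ ?_ (by norm_num) (by norm_num) (by norm_num) (by norm_num)).congr rfl ?_ ?_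
  · rw [smul_zero, add_zero]
    exact ((brk_vertexExp α noOsc_Ppsi).neg_left).congr rfl neg_zero neg_zero
  · rw [zero_add, smul_neg]
    exact (((brk_one_left (vertexExp α)).smul_left (2 * k + 2)).neg_left).congr rfl (by simp) (by simp)
  · rw [smul_zero, add_zero, nP_zero_right, nP_neg_left]; simp
  · rw [zero_add, smul_neg, nP_zero_right, nP_neg_left, nP_smul_left, nP_one_left, smul_zero, add_zero]; module

theorem phiMode_screening (c : ℂ) (m n : ℤ) :
    phiMode (c + alphaMinus α) m * screening α n - screening α n * phiMode c m
      = alphaMinus α • screening α (m + n) := by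
  have hl := locFin_cutTerm (A := fS) (B := vertexExp α) 1 0 n
  have hl' := locFin_cutTerm (A := fS) (B := vertexExp α) 1 0 (m + n)
  rw [screening_eq, nP_apply, nP_apply, mul_locSum _ hl, locSum_mul _ hl, ← locSum_smul _ hl',
    sub_eq_iff_eq_add, ← locSum_add (hl'.smul _) (hl.mul_right _)]
  congr 1; funext l
  have h := phiMode_vertexExp α c m (n - l - 1)
  have h1 := ((noOsc_S l).phiMode (c + alphaMinus α) m).eq
  have h2 := ((noOsc_S l).phiMode c m).eq
  rw [show m + (n - l - 1) = m + n - l - 1 by ring] at h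
  unfold cutTerm
  split_ifs with hl0
  · rw [← mul_assoc, h1, mul_assoc, mul_assoc, ← mul_smul_comm, ← h, mul_sub, sub_add_cancel]
  · rw [one_smul, one_smul, ← mul_assoc, mul_assoc (vertexExp α _) (fS l), ← h2,
      ← smul_mul_assoc, ← h, sub_mul, mul_assoc (vertexExp α _) (phiMode c m), sub_add_cancel]

/-- `:i∂φ ψ:` on a Fock space with the given value of `φ₀`. -/
theorem nP_phi_psi_screening (c : ℂ) (n m : ℤ) :
    nP 1 (phiMode (c + alphaMinus α)) psi n * screening α m
        + screening α m * nP 1 (phiMode c) psi n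
      = nP 1 (phiMode c) (vertexExp α) (n + m)
        - alphaMinus α • (nP (-1) (screening α) psi (n + m) + (m : ℂ) • vertexExp α (n + m - 1)) := by
  have hl := locFin_cutTerm (A := phiMode (c + alphaMinus α)) (B := psi) 1 0 n
  have hl' := locFin_cutTerm (A := phiMode c) (B := psi) 1 0 n
  have hE := locFin_cutTerm (A := phiMode c) (B := vertexExp α) 1 0 (n + m)
  have hV := locFin_cutTerm (A := screening α) (B := psi) (-1) m (n + m)
  -- Moving `φ_l` past `V_m` yields `V_(l+m)`, so the product of `V` and `ψ` appears with its cut at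
  -- `m`; moving the cut to `0` accounts for the term with the factor `m`.
  rw [← locSum_cutTerm (brk_screening_psi α), ← locSum_equiv (Equiv.addRight m) hV, nP_apply,
    nP_apply, nP_apply, mul_locSum _ hl', locSum_mul _ hl,
    ← locSum_add (hl.mul_right _) (hl'.mul_left _), ← locSum_smul _ (hV.comp (Equiv.injective _)),
    eq_sub_iff_add_eq, ← locSum_add ((hl.mul_right _).add (hl'.mul_left _))
      ((hV.comp (Equiv.injective _)).smul _)]
  congr 1; funext l
  have h := phiMode_screening α c l m
  have hp := brk_psi_screening α (n - l - 1) m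
  simp only [neg_smul, one_smul, sub_neg_eq_add, Pi.zero_apply, smul_zero, add_zero] at hp
  simp only [cutTerm, Equiv.coe_addRight, show n + m - (l + m) - 1 = n - l - 1 by ring,
    show n + m - l - 1 = n - l - 1 + m by ring, ← hp, show (l + m < m) = (l < 0) from propext (by omega)] at h ⊢
  split_ifs with h0
  · have e : phiMode c l = phiMode (c + alphaMinus α) l := by
      rw [phiMode_of_ne h0.ne c, phiMode_of_ne h0.ne (c + _)]
    rw [← smul_mul_assoc, ← h, e]; noncomm_ring
  · simp only [one_smul, neg_smul, smul_neg]
    rw [← mul_smul_comm, ← h]; noncomm_ring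

theorem nP_phi_psi_vertexExp (c : ℂ) (n m : ℤ) :
    nP 1 (phiMode (c + alphaMinus α)) psi n * vertexExp α m
        - vertexExp α m * nP 1 (phiMode c) psi n
      = alphaMinus α • nP 1 (vertexExp α) psi (n + m) := by
  have hl := locFin_cutTerm (A := phiMode (c + alphaMinus α)) (B := psi) 1 0 n
  have hl' := locFin_cutTerm (A := phiMode c) (B := psi) 1 0 n
  have hV := locFin_cutTerm (A := vertexExp α) (B := psi) 1 m (n + m)
  have hb : Brk 1 (vertexExp α) psi 0 0 := (brk_psi_vertexExp α).symm00 (by norm_num)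
  have e := locSum_cutTerm hb m (n + m)
  rw [Pi.zero_apply, smul_zero, add_zero] at e
  rw [← e, ← locSum_equiv (Equiv.addRight m) hV, nP_apply, nP_apply, mul_locSum _ hl',
    locSum_mul _ hl, ← locSum_smul _ (hV.comp (Equiv.injective _)), sub_eq_iff_eq_add,
    ← locSum_add ((hV.comp (Equiv.injective _)).smul _) (hl'.mul_left _)]
  congr 1; funext l
  have h := phiMode_vertexExp α c l m
  have hp := ((brk_psi_vertexExp α).commute (n - l - 1) m).eq
  simp only [cutTerm, Equiv.coe_addRight, show n + m - (l + m) - 1 = n - l - 1 by ring,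
    show (l + m < m) = (l < 0) from propext (by omega), one_smul]
  split_ifs with h0
  · rw [← smul_mul_assoc, ← h, mul_assoc, hp]; noncomm_ring
  · rw [← mul_smul_comm, ← h, mul_sub, ← mul_assoc _ (vertexExp α m), hp]; noncomm_ring

theorem nP_phi_vertexExp_apply (c : ℂ) (n : ℤ) : nP 1 (phiMode c) (vertexExp α) n
    = nP 1 (phiMode 0) (vertexExp α) n + c • vertexExp α (n - 1) := by
  -- The field `1/z`, through which the value of `φ_0` enters.
  let z : Modes := fun n => if n = 0 then 1 else 0
  have hz : Fld z := ⟨fun v => ⟨1, fun n hn => by simp [z, show n ≠ 0 by omega]⟩⟩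
  have e : phiMode c = phiMode 0 + c • z := by
    funext n
    by_cases h : n = 0
    · subst h; simp [phiMode_self, z]
    · simp [phiMode_of_ne h c, z, h]
  rw [e, nP_add_left, nP_smul_left, Pi.add_apply, Pi.smul_apply]
  congr 2
  rw [nP_apply, locSum_eq_sum {0}]
  · simp [cutTerm, z]
  · intro l hl
    simp only [Finset.mem_singleton] at hl
    simp [cutTerm, z, hl]

/-- `V` is itself a product of two fields. Reassociating in two ways brings `ψ` next to `ψ⁺ + βψ`;
the contraction of these two leaves the derivative of the exponential. -/
theorem nP_screening_psi : nP (-1) (screening α) psi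
    = nP 1 (nP (-1) fP psi) (vertexExp α) + derivField 0 (vertexExp α) := by
  have hEp : Brk 1 (vertexExp α) psi 0 0 := (brk_psi_vertexExp α).symm00 (by norm_num)
  have hSp : Brk (-1) fS psi oneF 0 := (brk_psi_S.symm0 (by norm_num)).congr rfl (by simp) rfl
  have h1 := nP_assoc (x := fS) (g := vertexExp α) (f := psi) (h := oneF) (σ := 1) (τ := 1)
    (ε := -1) (by norm_num) (by norm_num) (by norm_num) hSp hEp
    ((brk_one_right _).congr (by norm_num) rfl rfl)
  have h2 := nP_assoc (x := fS) (g := psi) (f := vertexExp α) (h := 0) (σ := -1) (τ := 1)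
    (ε := 1) (by norm_num) (by norm_num) (by norm_num) (brk_S_vertexExp α) (brk_psi_vertexExp α)
    ((brk_zero_left _ _).symm00 (by norm_num))
  have h3 := nP_comm (by norm_num) (brk_psi_vertexExp α)
  rw [derivField_zero, sub_zero, one_smul] at h3
  norm_num only at h1 h2
  rw [nP_S_psi, nP_zero_right, smul_zero, add_zero] at h2
  rw [nP_one_right, one_smul, h3, ← h2] at h1
  rw [screening_eq, h1]

end

section

variable (k α j : ℂ)

theorem jminus_eq : current k α j .jminus
    = jminusFree k + α • nP 1 (iDphi α j) psi := by
  rw [current_jminus, jminusFree]; abel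

theorem iDphi_shift : iDphi α (j - 1 / 2) = phiMode (2 * j / α + alphaMinus α) := by
  funext n; rw [iDphi, alphaMinus]; congr 1; ring

/-- The derivative formula on a Fock space where `φ_0 = c`: the extra term is the derivative of the
split-off factor `z^(α₋ c)`. -/
theorem alphaMinus_smul_nP (c : ℂ) (n : ℤ) : alphaMinus α • nP 1 (phiMode c) (vertexExp α) n
    = (alphaMinus α * c - n) • vertexExp α (n - 1) := by
  have h := congrFun (nP_phi_vertexExp α) n
  simp only [Pi.smul_apply, derivField] at h
  rw [nP_phi_vertexExp_apply, smul_add, h]; module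

/-- The fields `U` in the operator product expansions of the currents with the screening field. -/
def screeningU : Gen → Modes
  | .jminus => -(α ^ 2) • vertexExp α
  | .Jminus => -(α ^ 2) • nP 1 psi (vertexExp α)
  | _ => 0

variable {k α}

theorem jplus_screening (m n : ℤ) : current k α (j - 1 / 2) .jplus m * screening α n
    + screening α n * current k α j .jplus m = 0 := by
  rw [current_jplus, current_jplus]
  exact (brk_P_screening α).anticommute m n

/-- The terms with `:j⁺ψ e^{iα₋φ}:` from the two parts of `j⁻` cancel. What remains is a multiple of
one mode of the exponential, with coefficient `-α² (μ - m) + (α² - 2k - 3) n`, where `μ` is the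
exponent; the second summand vanishes exactly because of the relation between `α` and `k`. -/
theorem jminus_screening (hα0 : α ≠ 0) (hα : α ^ 2 = 2 * k + 3) (n m : ℤ) :
    current k α (j - 1 / 2) .jminus n * screening α m + screening α m * current k α j .jminus n
      = ((exponent α j - m) * -(α ^ 2)) • vertexExp α (n + m - 1) := by
  have hc : α * alphaMinus α = -1 := by rw [alphaMinus]; field_simp
  rw [jminus_eq, jminus_eq, iDphi_shift]
  change (jminusFree k n + α • nP 1 (phiMode (2 * j / α + alphaMinus α)) psi n) * screening α m +
    screening α m * (jminusFree k n + α • nP 1 (phiMode (2 * j / α)) psi n) = _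
  have h1 := brk_jminusFree_screening α k n m
  have h2 := nP_phi_psi_screening α (2 * j / α) n m
  have h3 := alphaMinus_smul_nP α (2 * j / α) (n + m)
  have h4 := congrFun (nP_screening_psi α) (n + m)
  simp only [Pi.add_apply, derivField, Pi.neg_apply, Pi.smul_apply] at h1 h4
  have e1 : α ^ 2 * alphaMinus α = -α := by linear_combination α * hc
  have hk2 : (2 : ℂ) * k = α ^ 2 - 3 := by linear_combination -hα
  have e2 : α • nP 1 (phiMode (2 * j / α)) (vertexExp α) (n + m) = (-(α ^ 2) *
      (alphaMinus α * (2 * j / α) - (n + m : ℤ))) • vertexExp α (n + m - 1) := by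
    rw [mul_smul, ← h3, smul_smul]; congr 1; linear_combination e1
  rw [h4] at h2
  have h2' := congrArg (fun X => α • X) h2
  simp only [smul_sub, smul_add, smul_smul, ← mul_assoc, hc, e2] at h2'
  simp only [add_mul, mul_add, smul_mul_assoc, mul_smul_comm]
  rw [exponent]
  push_cast at h2'
  linear_combination (norm := (simp only [hk2]; module)) h1 + h2'

theorem jplus_vertexExp (m n : ℤ) : current k α (j - 1 / 2) .jplus m * vertexExp α n
    = vertexExp α n * current k α j .jplus m := by
  rw [current_jplus, current_jplus]
  exact ((noOsc_P m).vertexExp α n).eq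

theorem jminus_vertexExp (hα0 : α ≠ 0) (n m : ℤ) :
    current k α (j - 1 / 2) .jminus n * vertexExp α m - vertexExp α m * current k α j .jminus n
      = -nP 1 psi (vertexExp α) (n + m) := by
  have hc : α * alphaMinus α = -1 := by rw [alphaMinus]; field_simp
  rw [jminus_eq, jminus_eq, iDphi_shift]
  change (jminusFree k n + α • nP 1 (phiMode (2 * j / α + alphaMinus α)) psi n) * vertexExp α m -
    vertexExp α m * (jminusFree k n + α • nP 1 (phiMode (2 * j / α)) psi n) = _
  have h1 := ((noOsc_jminusFree k n).vertexExp α m).eq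
  have h2 := congrArg (fun X => α • X) (nP_phi_psi_vertexExp α (2 * j / α) n m)
  have h3 := nP_comm (by norm_num) (brk_psi_vertexExp α)
  rw [derivField_zero, sub_zero, one_smul] at h3
  simp only [smul_sub, smul_smul, hc, h3] at h2
  simp only [add_mul, mul_add, smul_mul_assoc, mul_smul_comm]
  linear_combination (norm := module) h1 + h2

theorem two_smul_inj {A B : Op} (h : (2 : ℂ) • A = (2 : ℂ) • B) : A = B :=
  smul_right_injective _ (two_ne_zero) h

/-- The odd currents were treated directly. An even current is half an anticommutator of odd ones,
up to sign and a central term, so its bracket with `V` follows from theirs; for `J³` and `J⁻` the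
brackets of odd currents with the exponential enter as well. -/
theorem current_screening (hα0 : α ≠ 0) (hα : α ^ 2 = 2 * k + 3) (a : Gen) (m n : ℤ) :
    current k α (j - 1 / 2) a m * screening α n
        - koszul a.parity 1 • (screening α n * current k α j a m)
      = (exponent α j - n) • screeningU α a (m + n - 1) := by
  have mod := fun j => isAffineModule_wakimoto k α j hα
  have PP := fun j => (mod j).jplus_jplus m 0
  have PM := fun j => (mod j).jplus_jminus m 0
  have MM := fun j => (mod j).jminus_jminus m 0
  simp only [superBracket, koszul11, neg_smul, one_smul, sub_neg_eq_add, wakimoto, add_zero,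
    central_eq] at PP PM MM
  have P0 := jplus_screening (k := k) (α := α) j 0 n
  have Pm := jplus_screening (k := k) (α := α) j m n
  have M0 := jminus_screening j hα0 hα 0 n
  have Mm := jminus_screening j hα0 hα m n
  cases a with
  | jplus =>
    rw [show koszul Gen.jplus.parity 1 = -1 from koszul11]
    simp only [screeningU, Pi.zero_apply, smul_zero, neg_smul, one_smul, sub_neg_eq_add, Pm]
  | jminus =>
    rw [show koszul Gen.jminus.parity 1 = -1 from koszul11]
    simp only [screeningU, Pi.smul_apply, smul_smul, neg_smul, one_smul, sub_neg_eq_add] at Mm ⊢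
    rw [Mm]; module
  | Jplus =>
    rw [show koszul Gen.Jplus.parity 1 = 1 from koszul01, one_smul]
    refine two_smul_inj ?_
    simp only [screeningU, Pi.zero_apply, smul_zero]
    rw [smul_sub, ← smul_mul_assoc, ← mul_smul_comm, ← PP, ← PP]
    have h1 := congrArg (fun X => current k α (j - 1 / 2) .jplus m * X) P0
    have h2 := congrArg (fun X => X * current k α j .jplus 0) Pm
    have h3 := congrArg (fun X => current k α (j - 1 / 2) .jplus 0 * X) Pm
    have h4 := congrArg (fun X => X * current k α j .jplus m) P0
    simp only [mul_add, add_mul, mul_zero, zero_mul, mul_assoc] at h1 h2 h3 h4 ⊢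
    linear_combination (norm := module) h1 - h2 + h3 - h4
  | J3 =>
    rw [show koszul Gen.J3.parity 1 = 1 from koszul01, one_smul]
    refine two_smul_inj ?_
    simp only [screeningU, Pi.zero_apply, smul_zero]
    have e := fun j => eq_sub_of_add_eq (PM j).symm
    rw [smul_sub, ← smul_mul_assoc, ← mul_smul_comm, e, e]
    have h1 := congrArg (fun X => current k α (j - 1 / 2) .jplus m * X) M0
    have h2 := congrArg (fun X => X * current k α j .jminus 0) Pm
    have h3 := congrArg (fun X => current k α (j - 1 / 2) .jminus 0 * X) Pm
    have h4 := congrArg (fun X => X * current k α j .jplus m) M0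
    have h5 := jplus_vertexExp (k := k) (α := α) j m (0 + n - 1)
    simp only [mul_add, add_mul, mul_zero, zero_mul, mul_assoc, sub_mul, mul_sub, smul_mul_assoc,
      mul_smul_comm, oneF_mul, h5] at h1 h2 h3 h4 ⊢
    linear_combination (norm := module) h1 - h2 + h3 - h4
  | Jminus =>
    rw [show koszul Gen.Jminus.parity 1 = 1 from koszul01, one_smul]
    refine two_smul_inj ?_
    have e : ∀ j, (2 : ℂ) • current k α j .Jminus m = -(current k α j .jminus m * current k α j .jminus 0
      + current k α j .jminus 0 * current k α j .jminus m) := fun j => by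
      rw [MM, neg_neg]
    rw [smul_sub, ← smul_mul_assoc, ← mul_smul_comm, e, e]
    have h1 := congrArg (fun X => current k α (j - 1 / 2) .jminus m * X) M0
    have h2 := congrArg (fun X => X * current k α j .jminus 0) Mm
    have h3 := congrArg (fun X => current k α (j - 1 / 2) .jminus 0 * X) Mm
    have h4 := congrArg (fun X => X * current k α j .jminus m) M0
    have h5 := jminus_vertexExp (k := k) j hα0 m (0 + n - 1)
    have h6 := jminus_vertexExp (k := k) j hα0 0 (m + n - 1)
    rw [show m + (0 + n - 1) = m + n - 1 by ring] at h5
    rw [show 0 + (m + n - 1) = m + n - 1 by ring] at h6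
    simp only [screeningU, Pi.smul_apply]
    simp only [mul_add, add_mul, mul_assoc, sub_mul, mul_sub, smul_mul_assoc, neg_mul, mul_neg,
      mul_smul_comm] at h1 h2 h3 h4 ⊢
    linear_combination (norm := module) -h1 + h2 - h3 + h4
      + ((exponent α j - n) * (α ^ 2)) • h5 + ((exponent α j - n) * (α ^ 2)) • h6

theorem isField_screeningU (a : Gen) : IsField (screeningU α a) := by
  cases a <;> unfold screeningU <;> exact Fld.trunc

/-- The two poles of a total derivative contribute `μ - (m + n)` and `m`, together `μ - n`, to the
coefficient of `U_(m+n-1)`, where `μ` is the exponent. -/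
theorem isScreening (hα0 : α ≠ 0) (hα : α ^ 2 = 2 * k + 3) :
    IsScreening k α (screening α) := by
  refine ⟨Fld.trunc, fun a => ⟨screeningU α a, isField_screeningU a, fun j m n => ?_⟩⟩
  rw [current_screening j hα0 hα, Finset.sum_range_succ, Finset.sum_range_one]
  beta_reduce
  rw [if_pos rfl, if_neg one_ne_zero, Ring.choose_zero_right, Ring.choose_one_right, derivField]
  simp only [Nat.cast_zero, sub_zero, Nat.cast_one, Int.cast_one, one_smul, Int.cast_add]
  module

theorem parity_S : HasParity (-1) fS :=
  parity_psiPlus.add ((parity_beta.nP 1 parity_psi).congr (by norm_num))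

theorem energy_S : Graded energyOp (-1) 1 fS :=
  energy_psiPlus.add ((energy_beta.nP 1 energy_psi).congr (by norm_num))

theorem parity_screening : HasParity (-1) (screening α) := by
  rw [screening_eq]
  exact (parity_S.nP 1 (parity_vertexExp α)).congr (by norm_num)

theorem energy_screening : Graded energyOp (-1) 1 (screening α) := by
  rw [screening_eq]
  exact (energy_S.nP 1 (energy_vertexExp α)).congr (by norm_num)

theorem exponent_eq (hα0 : α ≠ 0) : exponent α j = -(2 * j) / α ^ 2 := by
  rw [exponent, alphaMinus]; field_simp

/-- The factor `μ - n` in the brackets with the currents is zero for `n = p = μ`. For `d`: the mode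
`p` lowers the energy level by `p`, and the energies of the two highest weight vectors differ by
exactly this amount. -/
theorem isAffineHom_zeroMode (hα0 : α ≠ 0) (hα : α ^ 2 = 2 * k + 3) (p : ℤ)
    (hp : exponent α j = p) :
    IsAffineHom 1 (wakimoto k α j) (wakimoto k α (j - 1 / 2)) (screening α p) := by
  refine ⟨?_, fun a n => ?_, ?_⟩
  · simpa using parity_screening p
  · have h := current_screening j hα0 hα a n p
    rw [hp, sub_self, zero_smul, sub_eq_zero] at h
    change screening α p * current k α j a n = koszul 1 a.parity •
      (current k α (j - 1 / 2) a n * screening α p)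
    rw [h, smul_smul, koszul, koszul, mul_comm a.parity, ← mul_pow]
    norm_num
  · rw [wakimoto_d, wakimoto_d]
    have h := energy_screening (α := α) p
    rw [exponent_eq j hα0, hα] at hp
    have hk : 2 * k + 3 ≠ 0 := by rw [← hα]; exact pow_ne_zero 2 hα0
    have e : j * (2 * j + 1) / (2 * k + 3)
      - (j - 1 / 2) * (2 * (j - 1 / 2) + 1) / (2 * k + 3) = -p := by
      rw [← hp]; field_simp; ring
    have e' := congrArg (fun x => x • screening α p) e
    simp only [mul_sub, sub_mul, neg_mul, mul_neg, mul_smul_comm, smul_mul_assoc, one_mul, mul_one]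
    simp only [sub_smul] at e'
    linear_combination (norm := module) h - e'

end

/-! ### Coefficients of products of powers of differences -/

/-- The coefficients of `(1 - x) ^ (ρ - 1)`. -/
def coeffOne (ρ : ℂ) (n : ℕ) : ℂ := ∏ k ∈ Finset.range n, (1 - ρ / (k + 1))

/-- The coefficients of `(1 - x) ^ ρ`. -/
def coeffZero (ρ : ℂ) : ℕ → ℂ
  | 0 => 1
  | n + 1 => -ρ / (n + 1) * coeffOne ρ n

theorem coeffOne_succ (ρ : ℂ) (n : ℕ) : coeffOne ρ (n + 1) = coeffOne ρ n + coeffZero ρ (n + 1) := by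
  rw [coeffOne, Finset.prod_range_succ, ← coeffOne, coeffZero]; ring

/-- Division of a power series by `1 - x` forms the partial sums of its coefficients. -/
theorem sum_coeffZero (ρ : ℂ) (n : ℕ) :
    ∑ k ∈ Finset.range (n + 1), coeffZero ρ k = coeffOne ρ n := by
  induction n with
  | zero => simp [coeffZero, coeffOne]
  | succ n ih => rw [Finset.sum_range_succ, ih, coeffOne_succ]

section

variable {m : ℕ}

/-- The exponents of the monomial `∏ (z_j / z_i) ^ a (i, j)`, with the sign reversed. -/
def netShift (a : Fin m × Fin m → ℕ) (i : Fin m) : ℤ := ∑ j, (a (i, j) : ℤ) - ∑ j, (a (j, i) : ℤ)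

/-- The factors of the coefficients of `∏_{i<j} (1 - z_j / z_i) ^ (ρ - [(i, j) ∈ M])`. -/
def pairFactor (M : Finset (Fin m × Fin m)) (ρ : ℂ) (e : Fin m × Fin m) (k : ℕ) : ℂ :=
  if e.1 < e.2 then if e ∈ M then coeffOne ρ k else coeffZero ρ k else if k = 0 then 1 else 0

/-- The coefficients of `∏_{i<j} (1 - z_j / z_i) ^ (ρ - [(i, j) ∈ M])`, before collecting equal
monomials. -/
def pairWeight (M : Finset (Fin m × Fin m)) (ρ : ℂ) (a : Fin m × Fin m → ℕ) : ℂ :=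
  ∏ e, pairFactor M ρ e (a e)

/-- The coefficients of `∏_{i<j} (1 - z_j / z_i) ^ (ρ - [(i, j) ∈ M])`. -/
def pairCoeff (M : Finset (Fin m × Fin m)) (ρ : ℂ) (n : Fin m → ℤ) : ℂ :=
  ∑' a : Fin m × Fin m → ℕ, if netShift a = n then pairWeight M ρ a else 0

theorem pairWeight_ne_zero {M : Finset (Fin m × Fin m)} {ρ : ℂ} {a : Fin m × Fin m → ℕ}
    (h : pairWeight M ρ a ≠ 0) {e : Fin m × Fin m} (he : ¬ e.1 < e.2) : a e = 0 := by
  have := Finset.prod_ne_zero_iff.1 h e (Finset.mem_univ e)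
  rw [pairFactor, if_neg he] at this
  by_contra h'
  exact this (if_neg h')

theorem sum_mul_netShift (x : Fin m → ℤ) (a : Fin m × Fin m → ℕ) :
    ∑ i, x i * netShift a i = ∑ e : Fin m × Fin m, (x e.1 - x e.2) * a e := by
  simp only [netShift, mul_sub, Finset.sum_sub_distrib, Finset.mul_sum, sub_mul]
  rw [Fintype.sum_prod_type, Fintype.sum_prod_type, Finset.sum_comm (f := fun i j => x i * (a (j, i) : ℤ))]

/-- A factor `z_j/z_i` with `i < j` changes the weighted degree `∑ i n_i` by at least one, always in
the same direction. The weighted degree therefore bounds every entry of the matrix, and the sum in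
`pairCoeff` is finite. -/
theorem finite_netShift (n : Fin m → ℤ) :
    {a : Fin m × Fin m → ℕ | netShift a = n ∧ ∀ e : Fin m × Fin m, ¬ e.1 < e.2 → a e = 0}.Finite := by
  refine (Set.finite_Iic fun _ => (∑ i : Fin m, -((i : ℕ) : ℤ) * n i).toNat).subset ?_
  rintro a ⟨ha, h0⟩ e
  by_cases he : e.1 < e.2
  · have h := sum_mul_netShift (fun i : Fin m => -((i : ℕ) : ℤ)) a
    rw [ha] at h
    have h1 : (a e : ℤ) ≤ ∑ i : Fin m, -((i : ℕ) : ℤ) * n i := by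
      rw [h]
      calc (a e : ℤ) ≤ (-((e.1 : ℕ) : ℤ) - -((e.2 : ℕ) : ℤ)) * a e := by
            have : (1 : ℤ) ≤ -((e.1 : ℕ) : ℤ) - -((e.2 : ℕ) : ℤ) := by
              have : (e.1 : ℕ) < e.2 := he
              omega
            nlinarith [(Nat.cast_nonneg (a e) : (0 : ℤ) ≤ a e)]
        _ ≤ _ := by
            refine Finset.single_le_sum (f := fun e : Fin m × Fin m =>
              (-((e.1 : ℕ) : ℤ) - -((e.2 : ℕ) : ℤ)) * a e) (fun e _ => ?_) (Finset.mem_univ e)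
            by_cases he : e.1 < e.2
            · have : (e.1 : ℕ) < e.2 := he
              have h2 : (0 : ℤ) ≤ -((e.1 : ℕ) : ℤ) - -((e.2 : ℕ) : ℤ) := by omega
              positivity
            · simp [h0 e he]
    change a e ≤ Int.toNat _
    omega
  · simp [h0 e he]

theorem finite_pairWeight (M : Finset (Fin m × Fin m)) (ρ : ℂ) (n : Fin m → ℤ) :
    (Function.support fun a : Fin m × Fin m → ℕ =>
      if netShift a = n then pairWeight M ρ a else 0).Finite := by
  refine (finite_netShift n).subset fun a ha => ?_
  rw [Function.mem_support, ite_ne_right_iff] at ha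
  exact ⟨ha.1, fun e he => pairWeight_ne_zero ha.2 he⟩

theorem netShift_add_single (a : Fin m × Fin m → ℕ) (p q : Fin m) (l : ℕ) :
    netShift (a + Pi.single (p, q) l) = netShift a + Pi.single p (l : ℤ) - Pi.single q (l : ℤ) := by
  funext i
  simp only [netShift, Pi.add_apply, Pi.sub_apply, Nat.cast_add, Finset.sum_add_distrib]
  have h1 : ∑ j, (((Pi.single (p, q) l : Fin m × Fin m → ℕ) (i, j) : ℕ) : ℤ) = (Pi.single p (l : ℤ) : Fin m → ℤ) i := by
    by_cases h : i = p
    · subst h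
      rw [Finset.sum_eq_single q] <;> simp +contextual [Pi.single_apply]
    · rw [Finset.sum_eq_zero] <;> simp [Pi.single_apply, h]
  have h2 : ∑ j, (((Pi.single (p, q) l : Fin m × Fin m → ℕ) (j, i) : ℕ) : ℤ) = (Pi.single q (l : ℤ) : Fin m → ℤ) i := by
    by_cases h : i = q
    · subst h
      rw [Finset.sum_eq_single p] <;> simp +contextual [Pi.single_apply]
    · rw [Finset.sum_eq_zero] <;> simp [Pi.single_apply, h]
  rw [h1, h2]; ring

/-- Only the factor of the pair `(p, q)` varies, and the partial sums of its coefficients are those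
for the exponent `ρ - 1`. -/
theorem sum_pairWeight {M : Finset (Fin m × Fin m)} {p q : Fin m} (hpq : p < q) (hM : (p, q) ∉ M)
    (ρ : ℂ) (a : Fin m × Fin m → ℕ) :
    ∑ l ∈ Finset.range (a (p, q) + 1), pairWeight M ρ (a - Pi.single (p, q) l)
      = pairWeight (insert (p, q) M) ρ a := by
  have h3 : ∀ l ∈ Finset.range (a (p, q) + 1), pairWeight M ρ (a - Pi.single (p, q) l)
      = coeffZero ρ (a (p, q) + 1 - 1 - l) *
        ∏ e ∈ Finset.univ.erase (p, q), pairFactor M ρ e (a e) := by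
    intro l hl
    rw [pairWeight, ← Finset.mul_prod_erase _ _ (Finset.mem_univ (p, q))]
    congr 1
    · rw [pairFactor, if_pos hpq, if_neg hM, Pi.sub_apply, Pi.single_eq_same, Nat.add_sub_cancel]
    · refine Finset.prod_congr rfl fun e he => ?_
      rw [Pi.sub_apply, Pi.single_eq_of_ne (Finset.mem_erase.1 he).1, tsub_zero]
  rw [Finset.sum_congr rfl h3, ← Finset.sum_mul, Finset.sum_range_reflect, sum_coeffZero, pairWeight,
    ← Finset.mul_prod_erase _ _ (Finset.mem_univ (p, q))]
  congr 1
  · rw [pairFactor, if_pos hpq, if_pos (Finset.mem_insert_self _ _)]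
  · refine Finset.prod_congr rfl fun e he => ?_
    simp only [pairFactor, Finset.mem_insert, or_iff_right (Finset.mem_erase.1 he).1]

/-- Dividing by a difference of variables, expanded as a geometric series. -/
theorem tsum_pairCoeff {M : Finset (Fin m × Fin m)} {p q : Fin m} (hpq : p < q) (hM : (p, q) ∉ M)
    (ρ : ℂ) (n : Fin m → ℤ) :
    ∑' l : ℕ, pairCoeff M ρ (n - Pi.single p (l : ℤ) + Pi.single q (l : ℤ))
      = pairCoeff (insert (p, q) M) ρ n := by
  obtain ⟨F, hF⟩ : ∃ F : ℕ × (Fin m × Fin m → ℕ) → ℂ, ∀ l a, F (l, a) =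
      if netShift a = n - Pi.single p (l : ℤ) + Pi.single q (l : ℤ) then pairWeight M ρ a else 0 :=
    ⟨fun x => if netShift x.2 = n - Pi.single p (x.1 : ℤ) + Pi.single q (x.1 : ℤ) then
      pairWeight M ρ x.2 else 0, fun _ _ => by dsimp only⟩
  -- The power of `z_q/z_p` from the geometric series is absorbed into the entry `(p, q)` of the
  -- matrix. In these coordinates the support is visibly finite, and `l` runs up to that entry.
  obtain ⟨G, hG⟩ : ∃ G : ℕ × (Fin m × Fin m → ℕ) → ℂ, ∀ l a, G (l, a) =
      if l ≤ a (p, q) ∧ netShift a = n then pairWeight M ρ (a - Pi.single (p, q) l) else 0 :=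
    ⟨fun x => if x.1 ≤ x.2 (p, q) ∧ netShift x.2 = n then
      pairWeight M ρ (x.2 - Pi.single (p, q) x.1) else 0, fun _ _ => by dsimp only⟩
  have hGF : ∀ x : ℕ × (Fin m × Fin m → ℕ), G (x.1, x.2 + Pi.single (p, q) x.1) = F x := by
    rintro ⟨l, a⟩
    have e : (netShift a + Pi.single p (l : ℤ) - Pi.single q (l : ℤ) = n)
        ↔ netShift a = n - Pi.single p (l : ℤ) + Pi.single q (l : ℤ) := by
      constructor
      · rintro rfl; abel
      · intro h; rw [h]; abel
    simp [hF, hG, netShift_add_single, e]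
  have hinj : Function.Injective fun x : ℕ × (Fin m × Fin m → ℕ) =>
      (x.1, x.2 + Pi.single (p, q) x.1) := by
    rintro ⟨l, a⟩ ⟨l', a'⟩ h
    simp only [Prod.mk.injEq] at h
    obtain ⟨rfl, h⟩ := h
    simpa using h
  have hsub : Function.support G ⊆ Set.range fun x : ℕ × (Fin m × Fin m → ℕ) =>
      (x.1, x.2 + Pi.single (p, q) x.1) := by
    rintro ⟨l, a⟩ h
    simp only [hG, Function.mem_support, ite_ne_right_iff] at h
    refine ⟨(l, a - Pi.single (p, q) l), ?_⟩
    simp only [Prod.mk.injEq, true_and]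
    refine tsub_add_cancel_of_le fun e => ?_
    by_cases he : e = (p, q)
    · subst he; simpa using h.1.1
    · simp [he]
  have hGfin : (Function.support G).Finite := by
    refine (((finite_netShift n).biUnion (t := fun a => (Set.Iic (a (p, q))) ×ˢ {a})
      fun a _ => (Set.finite_Iic _).prod (Set.finite_singleton a))).subset ?_
    rintro ⟨l, a⟩ h
    simp only [hG, Function.mem_support, ite_ne_right_iff] at h
    simp only [Set.mem_iUnion]
    refine ⟨a, ⟨h.1.2, fun e he => ?_⟩, h.1.1, rfl⟩
    have h2 := pairWeight_ne_zero h.2 he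
    have h3 : e ≠ (p, q) := by rintro rfl; exact he hpq
    simpa [h3] using h2
  have hGs : Summable G := summable_of_finite_support hGfin
  have hFs : Summable F := by
    have := hGs.comp_injective hinj
    simpa only [Function.comp_def, hGF] using this
  have h1 : ∑' l : ℕ, pairCoeff M ρ (n - Pi.single p (l : ℤ) + Pi.single q (l : ℤ)) = ∑' x, F x := by
    rw [hFs.tsum_prod]; simp only [hF, pairCoeff]
  have h2 : ∑' x, F x = ∑' x, G x := by
    rw [← hinj.tsum_eq hsub]; simp only [hGF]
  have h0 : ∑' x, G x = ∑' a, ∑' l, G (l, a) := by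
    have hs : Summable fun x : (Fin m × Fin m → ℕ) × ℕ => G (x.2, x.1) :=
      (Equiv.prodComm _ _).summable_iff.2 hGs
    rw [← hs.tsum_prod]
    exact ((Equiv.prodComm _ _).tsum_eq G).symm
  rw [h1, h2, h0, pairCoeff]
  refine tsum_congr fun a => ?_
  simp only [hG]
  by_cases hn : netShift a = n
  · simp only [hn, and_true, if_true]
    rw [tsum_eq_sum (s := Finset.range (a (p, q) + 1)) (fun l hl => if_neg (by
      simpa [Nat.lt_succ_iff] using hl)), ← sum_pairWeight hpq hM]
    refine Finset.sum_congr rfl fun l hl => if_pos (by simpa [Nat.lt_succ_iff] using hl)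
  · simp [hn]

/-- A set of disjoint increasing pairs of elements of `U`. -/
def IsMatching (U : Finset (Fin m)) (M : Finset (Fin m × Fin m)) : Prop :=
  (∀ e ∈ M, e.1 < e.2 ∧ e.1 ∈ U ∧ e.2 ∈ U) ∧
    ∀ e ∈ M, ∀ f ∈ M, e ≠ f → e.1 ≠ f.1 ∧ e.1 ≠ f.2 ∧ e.2 ≠ f.1 ∧ e.2 ≠ f.2

theorem IsMatching.mono {U U' : Finset (Fin m)} {M : Finset (Fin m × Fin m)}
    (h : IsMatching U M) (hU : U ⊆ U') : IsMatching U' M :=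
  ⟨fun e he => ⟨(h.1 e he).1, hU (h.1 e he).2.1, hU (h.1 e he).2.2⟩, h.2⟩

theorem IsMatching.insert {U U' : Finset (Fin m)} {M : Finset (Fin m × Fin m)}
    (h : IsMatching U M) {p q : Fin m} (hpq : p < q) (hp : p ∉ U) (hq : q ∉ U) (hU : U ⊆ U')
    (hp' : p ∈ U') (hq' : q ∈ U') : IsMatching U' (insert (p, q) M) := by
  have key : ∀ e ∈ M, e.1 ≠ p ∧ e.1 ≠ q ∧ e.2 ≠ p ∧ e.2 ≠ q := fun e he => by
    obtain ⟨_, h1, h2⟩ := h.1 e he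
    exact ⟨fun h => hp (h ▸ h1), fun h => hq (h ▸ h1), fun h => hp (h ▸ h2), fun h => hq (h ▸ h2)⟩
  refine ⟨fun e he => ?_, fun e he f hf hef => ?_⟩
  · rcases Finset.mem_insert.1 he with rfl | he
    · exact ⟨hpq, hp', hq'⟩
    · exact (h.mono hU).1 e he
  · rcases Finset.mem_insert.1 he with rfl | he <;> rcases Finset.mem_insert.1 hf with rfl | hf
    · exact absurd rfl hef
    · obtain ⟨h1, h2, h3, h4⟩ := key f hf
      exact ⟨h1.symm, h3.symm, h2.symm, h4.symm⟩
    · obtain ⟨h1, h2, h3, h4⟩ := key e he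
      exact ⟨h1, h2, h3, h4⟩
    · exact h.2 e he f hf hef

/-- The functions on `ℤ^m` that are combinations of translates of coefficients of products of powers
of differences, with matched pairs in `U`. -/
def pairSpan (ρ : ℂ) (U : Finset (Fin m)) : Submodule ℂ ((Fin m → ℤ) → ℂ) :=
  Submodule.span ℂ {f | ∃ M b, IsMatching U M ∧ f = fun n => pairCoeff M ρ (n - b)}

theorem pairCoeff_mem {ρ : ℂ} {U : Finset (Fin m)} {M : Finset (Fin m × Fin m)} (b : Fin m → ℤ)
    (hM : IsMatching U M) : (fun n => pairCoeff M ρ (n - b)) ∈ pairSpan ρ U :=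
  Submodule.subset_span ⟨M, b, hM, rfl⟩

theorem pairSpan_induction {ρ : ℂ} {U : Finset (Fin m)} {p : ((Fin m → ℤ) → ℂ) → Prop}
    (h0 : p 0) (hadd : ∀ f g, f ∈ pairSpan ρ U → g ∈ pairSpan ρ U → p f → p g → p (f + g))
    (hsmul : ∀ (c : ℂ) f, p f → p (c • f))
    (hbasic : ∀ M b, IsMatching U M → p fun n => pairCoeff M ρ (n - b)) {f : (Fin m → ℤ) → ℂ}
    (hf : f ∈ pairSpan ρ U) : p f := by
  refine Submodule.span_induction (p := fun f _ => p f) ?_ h0 (fun f g hf hg => hadd f g hf hg)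
    (fun c f _ => hsmul c f) hf
  rintro f ⟨M, b, hM, rfl⟩
  exact hbasic M b hM

theorem pairSpan_mono {ρ : ℂ} {U U' : Finset (Fin m)} (hU : U ⊆ U') : pairSpan ρ U ≤ pairSpan ρ U' :=
  Submodule.span_mono fun _ ⟨M, b, hM, h⟩ => ⟨M, b, hM.mono hU, h⟩

theorem shift_mem_pairSpan {ρ : ℂ} {U : Finset (Fin m)} {f : (Fin m → ℤ) → ℂ}
    (h : f ∈ pairSpan ρ U) (c : Fin m → ℤ) : (fun n => f (n + c)) ∈ pairSpan ρ U := by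
  refine pairSpan_induction (p := fun f => (fun n => f (n + c)) ∈ pairSpan ρ U)
    (zero_mem _) (fun f g _ _ hf hg => add_mem hf hg) (fun c f hf => Submodule.smul_mem _ c hf)
    (fun M b hM => ?_) h
  simp only [show ∀ n : Fin m → ℤ, n + c - b = n - (b - c) from fun n => by abel]
  exact pairCoeff_mem (b - c) hM

/-- The expansion is in the region `|z_0| > |z_1| > …`, so only powers of `z_j/z_i` with `i < j`
occur. The vanishing in a half-space makes division by `1 - z_q/z_p` a finite operation on each
coefficient. -/
theorem pairCoeff_eq_zero {M : Finset (Fin m × Fin m)} {ρ : ℂ} {n : Fin m → ℤ}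
    (h : ∑ i : Fin m, ((i : ℕ) : ℤ) * n i > 0) : pairCoeff M ρ n = 0 := by
  rw [pairCoeff]
  refine (tsum_congr fun a => ?_).trans tsum_zero
  rw [ite_eq_right_iff]
  intro ha
  by_contra hw
  rw [← ha, sum_mul_netShift] at h
  refine absurd h (not_lt.2 (Finset.sum_nonpos fun e _ => ?_))
  by_cases he : e.1 < e.2
  · have : (e.1 : ℕ) < e.2 := he
    exact mul_nonpos_of_nonpos_of_nonneg (by omega) (by positivity)
  · simp [pairWeight_ne_zero hw he]

/-- The functions in the class vanish in a half-space. -/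
theorem exists_eq_zero_of_mem_pairSpan {ρ : ℂ} {U : Finset (Fin m)} {f : (Fin m → ℤ) → ℂ}
    (h : f ∈ pairSpan ρ U) : ∃ B : ℤ, ∀ n, B < ∑ i : Fin m, ((i : ℕ) : ℤ) * n i → f n = 0 := by
  refine pairSpan_induction (p := fun f => ∃ B : ℤ, ∀ n, B < ∑ i : Fin m, ((i : ℕ) : ℤ) * n i → f n = 0)
    ⟨0, fun _ _ => rfl⟩ ?_ ?_ (fun M b hM => ?_) h
  · rintro f g _ _ ⟨B1, h1⟩ ⟨B2, h2⟩
    refine ⟨max B1 B2, fun n h => ?_⟩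
    rw [Pi.add_apply, h1 n (by omega), h2 n (by omega), add_zero]
  · rintro c f ⟨B, h⟩
    exact ⟨B, fun n hn => by rw [Pi.smul_apply, h n hn, smul_zero]⟩
  · refine ⟨∑ i : Fin m, ((i : ℕ) : ℤ) * b i, fun n h => pairCoeff_eq_zero ?_⟩
    simp only [Pi.sub_apply, mul_sub, Finset.sum_sub_distrib]
    omega

theorem sum_mul_shift_pair (n : Fin m → ℤ) (p q : Fin m) (l : ℤ) :
    ∑ i : Fin m, ((i : ℕ) : ℤ) * (n - Pi.single p l + Pi.single q l : Fin m → ℤ) i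
      = ∑ i : Fin m, ((i : ℕ) : ℤ) * n i + l * ((q : ℕ) - (p : ℕ)) := by
  simp only [Pi.add_apply, Pi.sub_apply, mul_add, mul_sub, Finset.sum_add_distrib,
    Finset.sum_sub_distrib]
  have h : ∀ p : Fin m, ∑ i : Fin m, ((i : ℕ) : ℤ) * (Pi.single p l : Fin m → ℤ) i = (p : ℕ) * l :=
    fun p => by
    rw [Finset.sum_eq_single p] <;> simp +contextual [Pi.single_apply]
  rw [h, h]; ring

theorem finite_support_divide {ρ : ℂ} {U : Finset (Fin m)} {f : (Fin m → ℤ) → ℂ}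
    (h : f ∈ pairSpan ρ U) {p q : Fin m} (hpq : p < q) (n : Fin m → ℤ) :
    (Function.support fun l : ℕ => f (n - Pi.single p (l : ℤ) + Pi.single q (l : ℤ))).Finite := by
  obtain ⟨B, hB⟩ := exists_eq_zero_of_mem_pairSpan h
  refine (Set.finite_Iic (B - ∑ i : Fin m, ((i : ℕ) : ℤ) * n i).toNat).subset fun l hl => ?_
  by_contra h'
  refine hl (hB _ ?_)
  rw [sum_mul_shift_pair]
  have : (p : ℕ) < q := hpq
  simp only [Set.mem_Iic, not_le] at h'
  have h2 : (l : ℤ) * 1 ≤ l * ((q : ℕ) - (p : ℕ)) :=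
    mul_le_mul_of_nonneg_left (by omega) (by positivity)
  omega

/-- Dividing by a difference of two unmatched variables. -/
theorem divide_mem_pairSpan {ρ : ℂ} {U U' : Finset (Fin m)} {f : (Fin m → ℤ) → ℂ}
    (h : f ∈ pairSpan ρ U) {p q : Fin m} (hpq : p < q) (hp : p ∉ U) (hq : q ∉ U) (hU : U ⊆ U')
    (hp' : p ∈ U') (hq' : q ∈ U') :
    (fun n => ∑' l : ℕ, f (n - Pi.single p (l : ℤ) + Pi.single q (l : ℤ))) ∈ pairSpan ρ U' := by
  refine pairSpan_induction (p := fun f => (fun n => ∑' l : ℕ,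
    f (n - Pi.single p (l : ℤ) + Pi.single q (l : ℤ))) ∈ pairSpan ρ U') ?_ ?_ ?_ ?_ h
  · have : (fun n : Fin m → ℤ => ∑' l : ℕ,
        (0 : (Fin m → ℤ) → ℂ) (n - Pi.single p (l : ℤ) + Pi.single q (l : ℤ))) = 0 := by
      funext n; simp
    rw [this]; exact zero_mem _
  · intro f g hf hg h1 h2
    convert add_mem h1 h2 using 1
    funext n
    exact (summable_of_finite_support (finite_support_divide hf hpq n)).tsum_add
      (summable_of_finite_support (finite_support_divide hg hpq n))
  · intro c f hf
    convert Submodule.smul_mem _ c hf using 1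
    funext n
    exact tsum_mul_left
  · intro M b hM
    convert pairCoeff_mem (ρ := ρ) b (hM.insert hpq hp hq hU hp' hq') using 1
    funext n
    rw [← tsum_pairCoeff hpq fun h => hp (hM.1 _ h).2.1]
    refine tsum_congr fun l => ?_
    beta_reduce
    rw [show n - Pi.single p (l : ℤ) + Pi.single q (l : ℤ) - b
      = n - b - Pi.single p (l : ℤ) + Pi.single q (l : ℤ) by abel]

end

/-! ### Vacuum expectation values of products of exponentials -/

section

variable (α : ℂ)

/-- The coefficients of the differential equation `x f' = -ρ x f / (1 - x)` for `f = (1-x)^ρ`. -/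
theorem coeffZero_mul (ρ : ℂ) (b : ℕ) :
    (b : ℂ) * coeffZero ρ b = -ρ * ∑ a ∈ Finset.range b, coeffZero ρ a := by
  cases b with
  | zero => simp
  | succ b =>
    rw [sum_coeffZero, coeffZero]
    have : (b : ℂ) + 1 ≠ 0 := Nat.cast_add_one_ne_zero b
    push_cast
    field_simp

theorem sum_range_triangle {M : Type*} [AddCommMonoid M] (f : ℕ → ℕ → M) (L : ℕ) :
    ∑ a ∈ Finset.range (L + 1), ∑ i ∈ Finset.range (L - a), f a (a + 1 + i)
      = ∑ b ∈ Finset.range (L + 1), ∑ a ∈ Finset.range b, f a b := by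
  have : ∀ a ∈ Finset.range (L + 1), ∑ i ∈ Finset.range (L - a), f a (a + 1 + i)
      = ∑ b ∈ Finset.Ico (a + 1) (L + 1), f a b := fun a _ => by
    rw [Finset.sum_Ico_eq_sum_range, Nat.add_sub_add_right]
  rw [Finset.sum_congr rfl this]
  refine Finset.sum_comm' fun a b => ?_
  simp only [Finset.mem_range, Finset.mem_Ico]
  omega

theorem expDown_of_neg {n : ℤ} (h : n < 0) : expDown α n = 0 := expZ_of_neg _ h

theorem expDown_zero : expDown α 0 = 1 := expZ_zero _

theorem phiMode_mul_vertexExp {m : ℤ} (hm : m ≠ 0) (n : ℤ) :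
    phiMode 0 m * vertexExp α n
      = vertexExp α n * phiMode 0 m + alphaMinus α • vertexExp α (m + n) := by
  have h := phiMode_vertexExp α 0 m n
  rw [phiMode_of_ne hm (0 + alphaMinus α), sub_eq_iff_eq_add'] at h
  exact h

/-- Moving `exp (-α₋ ∑ φ_n z⁻ⁿ/n)` past a vertex operator. -/
theorem expDown_mul_vertexExp (L : ℕ) (n : ℤ) : expDown α L * vertexExp α n
    = ∑ a ∈ Finset.range (L + 1),
      coeffZero (alphaMinus α ^ 2) a • (vertexExp α (n + a) * expDown α ((L : ℤ) - a)) := by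
  induction L using Nat.strong_induction_on with
  | _ L ih =>
  rcases Nat.eq_zero_or_pos L with rfl | hL
  · simp [coeffZero, expDown_zero]
  set ρ := alphaMinus α ^ 2 with hρ
  have hL0 : (L : ℂ) ≠ 0 := by exact_mod_cast hL.ne'
  -- Multiplication by `L` makes the recursion for the annihilation half applicable, with strong
  -- induction on `L`.
  refine smul_right_injective Op hL0 ?_
  change (L : ℂ) • (expDown α L * vertexExp α n) = (L : ℂ) • _
  have h1 : (L : ℂ) • expDown α L = _ := smul_expDown α (n := L) (K := L) le_rfl
  rw [← smul_mul_assoc, h1, smul_mul_assoc, Finset.sum_mul]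
  have h2 : ∀ i ∈ Finset.range L,
      phiMode 0 ((i : ℤ) + 1) * expDown α ((L : ℤ) - 1 - i) * vertexExp α n
      = ∑ a ∈ Finset.range (L - i), (coeffZero ρ a •
          (vertexExp α (n + a) * (phiMode 0 ((i : ℤ) + 1) * expDown α (((L : ℤ) - a) - 1 - i)))
        + (alphaMinus α * coeffZero ρ a) •
          (vertexExp α (n + (a + 1 + i : ℕ)) * expDown α ((L : ℤ) - (a + 1 + i : ℕ)))) := by
    intro i hi
    have hi' := Finset.mem_range.1 hi
    have h3 := ih (L - 1 - i) (by omega)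
    rw [show ((L - 1 - i : ℕ) : ℤ) = (L : ℤ) - 1 - i by omega, show L - 1 - i + 1 = L - i by omega] at h3
    rw [mul_assoc, h3, Finset.mul_sum]
    refine Finset.sum_congr rfl fun a _ => ?_
    rw [mul_smul_comm, ← mul_assoc, phiMode_mul_vertexExp α (by omega : (i : ℤ) + 1 ≠ 0), add_mul,
      smul_add, smul_mul_assoc, smul_smul, mul_comm (coeffZero ρ a), mul_assoc,
      show (L : ℤ) - 1 - i - a = (L : ℤ) - a - 1 - i by ring,
      show (i : ℤ) + 1 + (n + a) = n + (a + 1 + i : ℕ) by push_cast; ring,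
      show (L : ℤ) - a - 1 - i = L - (a + 1 + i : ℕ) by push_cast; ring]
  have h4 : ∑ i ∈ Finset.range L, ∑ a ∈ Finset.range (L - i), coeffZero ρ a •
          (vertexExp α (n + a) * (phiMode 0 ((i : ℤ) + 1) * expDown α (((L : ℤ) - a) - 1 - i)))
      = ∑ a ∈ Finset.range (L + 1), ∑ i ∈ Finset.range (L - a), coeffZero ρ a •
          (vertexExp α (n + a) * (phiMode 0 ((i : ℤ) + 1) * expDown α (((L : ℤ) - a) - 1 - i))) := by
    refine Finset.sum_comm' fun a b => ?_
    simp only [Finset.mem_range]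
    omega
  have h5 : ∑ i ∈ Finset.range L, ∑ a ∈ Finset.range (L - i), (alphaMinus α * coeffZero ρ a) •
          (vertexExp α (n + (a + 1 + i : ℕ)) * expDown α ((L : ℤ) - (a + 1 + i : ℕ)))
      = ∑ a ∈ Finset.range (L + 1), ∑ i ∈ Finset.range (L - a), (alphaMinus α * coeffZero ρ a) •
          (vertexExp α (n + (a + 1 + i : ℕ)) * expDown α ((L : ℤ) - (a + 1 + i : ℕ))) := by
    refine Finset.sum_comm' fun a b => ?_
    simp only [Finset.mem_range]
    omega
  have h6 := sum_range_triangle (fun a b => (alphaMinus α * coeffZero ρ a) •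
          (vertexExp α (n + (b : ℕ)) * expDown α ((L : ℤ) - (b : ℕ)))) L
  rw [Finset.sum_congr rfl h2]
  simp only [Finset.sum_add_distrib]
  rw [h4, h5, h6, smul_add, Finset.smul_sum, Finset.smul_sum, ← Finset.sum_add_distrib,
    Finset.smul_sum]
  refine Finset.sum_congr rfl fun b hb => ?_
  have hb' := Finset.mem_range.1 hb
  have h7 := smul_expDown α (n := (L : ℤ) - b) (K := L - b) (by omega)
  rw [← Finset.smul_sum, ← Finset.mul_sum, ← Finset.sum_smul, ← Finset.mul_sum, smul_smul, smul_smul,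
    mul_comm (-alphaMinus α) (coeffZero ρ b), mul_smul, ← mul_smul_comm, ← h7, mul_smul_comm, smul_smul,
    smul_smul, ← add_smul]
  congr 1
  -- The partial sums collected from the commutators with `φ` are those in the differential equation
  -- for `(1-x)^ρ`, with `ρ = α₋²`.
  have h8 := coeffZero_mul ρ b
  push_cast
  linear_combination -h8 + (∑ a ∈ Finset.range b, coeffZero ρ a) * hρ

/-- Products of vertex operators. -/
def expWord {m : ℕ} (n : Fin m → ℤ) : Op := (List.ofFn fun i => vertexExp α (n i)).prod

theorem expWord_succ {m : ℕ} (n : Fin (m + 1) → ℤ) :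
    expWord α n = vertexExp α (n 0) * expWord α (Fin.tail n) := by
  rw [expWord, List.ofFn_succ, List.prod_cons]; rfl

end

/-- The vacuum vector. -/
def vac : Occ := ⟨0, 0, ∅⟩

theorem energy_vac : energy vac = 0 := by simp [energy, vac]

/-- Matrix coefficients of graded operators. -/
theorem eq_add_of_coeff_ne_zero {f : Occ → ℂ} {A : Op} {c : ℂ}
    (h : diagOp f * A - A * diagOp f = c • A) {s t : Occ} (ht : A (Finsupp.single s 1) t ≠ 0) :
    f t = f s + c := by
  have h1 := congrArg (fun B : Op => B (Finsupp.single s 1) t) h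
  have h2 : diagOp f (Finsupp.single s 1) = f s • Finsupp.single s 1 := by
    rw [diagOp, basisOp, Finsupp.linearCombination_single, one_smul, Finsupp.smul_single, smul_eq_mul,
      mul_one]
  simp only [LinearMap.sub_apply, Module.End.mul_apply, LinearMap.smul_apply, h2, map_smul,
    Finsupp.sub_apply, Finsupp.smul_apply, diagOp_apply, smul_eq_mul] at h1
  have h3 : (f t - f s - c) * A (Finsupp.single s 1) t = 0 := by linear_combination h1
  linear_combination (mul_eq_zero.1 h3).resolve_right ht

/-- An operator that has no matrix coefficients with a given basis vector. -/
theorem coeff_eq_zero {A : Op} {t : Occ} (h : ∀ s, A (Finsupp.single s 1) t = 0) (u : Fock) :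
    A u t = 0 := by
  induction u using Finsupp.induction_linear with
  | zero => simp
  | add f g hf hg => rw [map_add, Finsupp.add_apply, hf, hg, add_zero]
  | single s c =>
    rw [← mul_one c, ← smul_eq_mul, ← Finsupp.smul_single, map_smul, Finsupp.smul_apply, h, smul_zero]

theorem natCast_energy_eq {A : Op} {c : ℂ} (h : energyOp * A - A * energyOp = c • A) {s t : Occ}
    (ht : A (Finsupp.single s 1) t ≠ 0) : (energy t : ℂ) = energy s + c := by
  rw [energyOp_eq] at h
  exact eq_add_of_coeff_ne_zero h ht

theorem expUp_coeff_vac (α : ℂ) {n : ℤ} (hn : n ≠ 0) (u : Fock) : expUp α n u vac = 0 := by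
  refine coeff_eq_zero (fun s => ?_) u
  by_contra h
  have h1 := natCast_energy_eq (energy_expUp α n) h
  rw [energy_vac] at h1
  have h2 : (0 : ℤ) = energy s + n := by exact_mod_cast h1
  rw [expUp, expZ_of_neg _ (by omega)] at h
  exact h rfl

theorem expDown_vac (α : ℂ) {n : ℤ} (hn : n ≠ 0) : expDown α n (Finsupp.single vac 1) = 0 := by
  ext t
  by_contra h
  have h1 := natCast_energy_eq (energy_expDown α n) h
  rw [energy_vac] at h1
  have h2 : (energy t : ℤ) = (0 : ℕ) + -n := by exact_mod_cast h1
  rw [expDown, expZ_of_neg _ (by omega)] at h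
  exact h rfl

theorem expUp_zero (α : ℂ) : expUp α 0 = 1 := expZ_zero _

/-- A creation part of nonzero degree has no vacuum component, so only the term `l = n + 1`
survives. -/
theorem vertexExp_coeff_vac (α : ℂ) (n : ℤ) (u : Fock) :
    vertexExp α n u vac = expDown α (n + 1) u vac := by
  rw [vertexExp_apply, locSum_apply (locFin_vertexTerm α n)]
  have h := (Finsupp.applyAddHom (M := ℂ) vac).map_finsum (f := fun l => vertexTerm α n l u)
    (locFin_vertexTerm α n u)
  change (∑ᶠ l, vertexTerm α n l u) vac = ∑ᶠ l, (vertexTerm α n l u) vac at h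
  rw [h, finsum_eq_single _ (n + 1), vertexTerm, show n + 1 - n - 1 = 0 by ring, expUp_zero, one_mul]
  intro l hl
  exact expUp_coeff_vac α (by omega) _

/-- The annihilation half is moved through all exponentials, leaving a share `r i` of its degree at
each. On the vacuum only degree zero survives, so the shares add up to `L`. -/
theorem expDown_mul_expWord_vac (α : ℂ) {m : ℕ} (L : ℕ) (n : Fin m → ℤ) :
    expDown α L (expWord α n (Finsupp.single vac 1))
      = ∑ r ∈ Finset.Nat.antidiagonalTuple m L, (∏ i, coeffZero (alphaMinus α ^ 2) (r i)) •
        expWord α (n + fun i => (r i : ℤ)) (Finsupp.single vac 1) := by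
  induction m generalizing L with
  | zero =>
    rcases Nat.eq_zero_or_pos L with rfl | hL
    · simp [expDown_zero, expWord]
    · obtain ⟨L, rfl⟩ := Nat.exists_eq_succ_of_ne_zero hL.ne'
      have := expDown_vac α (n := ((L + 1 : ℕ) : ℤ)) (by omega)
      simpa [expWord] using this
  | succ m ih =>
    rw [expWord_succ, ← Module.End.mul_apply, ← mul_assoc, expDown_mul_vertexExp, Module.End.mul_apply,
      LinearMap.sum_apply]
    have h1 : ∀ a ∈ Finset.range (L + 1), (coeffZero (alphaMinus α ^ 2) a •
        (vertexExp α (n 0 + a) * expDown α ((L : ℤ) - a))) (expWord α (Fin.tail n) (Finsupp.single vac 1))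
        = ∑ r ∈ Finset.Nat.antidiagonalTuple m (L - a),
          (coeffZero (alphaMinus α ^ 2) a * ∏ i, coeffZero (alphaMinus α ^ 2) (r i)) •
          vertexExp α (n 0 + a) (expWord α (Fin.tail n + fun i => (r i : ℤ)) (Finsupp.single vac 1)) := by
      intro a ha
      have := Finset.mem_range.1 ha
      rw [LinearMap.smul_apply, Module.End.mul_apply, show (L : ℤ) - a = (L - a : ℕ) by omega, ih,
        map_sum, Finset.smul_sum]
      refine Finset.sum_congr rfl fun r _ => ?_
      rw [map_smul, smul_smul]
    rw [Finset.sum_congr rfl h1, Finset.sum_sigma']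
    refine Finset.sum_bij' (fun x _ => Fin.cons x.1 x.2) (fun r _ => ⟨r 0, Fin.tail r⟩) ?_ ?_ ?_ ?_ ?_
    · rintro ⟨a, r⟩ h
      simp only [Finset.mem_sigma, Finset.mem_range, Finset.Nat.mem_antidiagonalTuple] at h ⊢
      rw [Fin.sum_cons, h.2]; omega
    · intro r h
      rw [Finset.Nat.mem_antidiagonalTuple, Fin.sum_univ_succ] at h
      simp only [Finset.mem_sigma, Finset.mem_range, Finset.Nat.mem_antidiagonalTuple, Fin.tail]
      omega
    · rintro ⟨a, r⟩ _; simp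
    · intro r _; simp
    · rintro ⟨a, r⟩ _
      rw [Fin.prod_univ_succ, expWord_succ]
      rfl

theorem expWord_vac_of_neg (α : ℂ) {m : ℕ} (n : Fin (m + 1) → ℤ) (h : n 0 + 1 < 0) :
    expWord α n (Finsupp.single vac 1) vac = 0 := by
  rw [expWord_succ, Module.End.mul_apply, vertexExp_coeff_vac, expDown_of_neg α h]; rfl

theorem expWord_vac_succ (α : ℂ) {m : ℕ} (n : Fin (m + 1) → ℤ) (L : ℕ) (h : n 0 + 1 = L) :
    expWord α n (Finsupp.single vac 1) vac
      = ∑ r ∈ Finset.Nat.antidiagonalTuple m L, (∏ i, coeffZero (alphaMinus α ^ 2) (r i)) *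
        expWord α (Fin.tail n + fun i => (r i : ℤ)) (Finsupp.single vac 1) vac := by
  rw [expWord_succ, Module.End.mul_apply, vertexExp_coeff_vac, h, expDown_mul_expWord_vac,
    Finsupp.finsetSum_apply]
  rfl

/-- Prepending a row and a zero column to a matrix. -/
def consMatrix {m : ℕ} (r : Fin m → ℕ) (a : Fin m × Fin m → ℕ) : Fin (m + 1) × Fin (m + 1) → ℕ :=
  fun e => Fin.cases (Fin.cases 0 r e.2) (fun i => Fin.cases 0 (fun j => a (i, j)) e.2) e.1

section

variable {m : ℕ} (r : Fin m → ℕ) (a : Fin m × Fin m → ℕ)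

theorem consMatrix_zero_zero : consMatrix r a (0, 0) = 0 := rfl
theorem consMatrix_zero_succ (j : Fin m) : consMatrix r a (0, j.succ) = r j := rfl
theorem consMatrix_succ_zero (i : Fin m) : consMatrix r a (i.succ, 0) = 0 := rfl
theorem consMatrix_succ_succ (i j : Fin m) : consMatrix r a (i.succ, j.succ) = a (i, j) := rfl

theorem netShift_consMatrix_zero : netShift (consMatrix r a) 0 = ∑ j, (r j : ℤ) := by
  simp [netShift, Fin.sum_univ_succ, consMatrix_zero_zero, consMatrix_zero_succ, consMatrix_succ_zero]

theorem netShift_consMatrix_succ (i : Fin m) :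
    netShift (consMatrix r a) i.succ = netShift a i - r i := by
  simp only [netShift, Fin.sum_univ_succ, consMatrix_succ_zero, consMatrix_zero_succ,
    consMatrix_succ_succ]
  push_cast; ring

theorem pairWeight_consMatrix (ρ : ℂ) :
    pairWeight ∅ ρ (consMatrix r a) = (∏ j, coeffZero ρ (r j)) * pairWeight ∅ ρ a := by
  simp only [pairWeight, Fintype.prod_prod_type, Fin.prod_univ_succ, consMatrix_zero_zero,
    consMatrix_succ_zero, consMatrix_zero_succ, consMatrix_succ_succ, pairFactor,
    Finset.notMem_empty, if_false, Fin.succ_lt_succ_iff, Fin.succ_pos, if_true, lt_irrefl, one_mul,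
    Fin.not_lt_zero]
  rfl

end

theorem consMatrix_injective {m : ℕ} : Function.Injective
    fun x : (Fin m → ℕ) × (Fin m × Fin m → ℕ) => consMatrix x.1 x.2 := by
  rintro ⟨r, a⟩ ⟨r', a'⟩ h
  refine Prod.ext (funext fun j => congrFun h (0, j.succ)) (funext fun e => congrFun h (e.1.succ, e.2.succ))

/-- The first row of the matrix belongs to the factors `(1 - z_j/z_0)^ρ`. Summing over the rest
first gives the recursion that moving the annihilation half of the leftmost exponential to the right
also produces. -/
theorem pairCoeff_succ {m : ℕ} (ρ : ℂ) (n : Fin (m + 1) → ℤ) :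
    pairCoeff ∅ ρ n = ∑' r : Fin m → ℕ, if ∑ j, (r j : ℤ) = n 0 then
      (∏ j, coeffZero ρ (r j)) * pairCoeff ∅ ρ (Fin.tail n + fun j => (r j : ℤ)) else 0 := by
  have hs : (Function.support fun a : Fin (m + 1) × Fin (m + 1) → ℕ =>
      if netShift a = n then pairWeight ∅ ρ a else 0) ⊆ Set.range
      fun x : (Fin m → ℕ) × (Fin m × Fin m → ℕ) => consMatrix x.1 x.2 := by
    intro a ha
    rw [Function.mem_support, ite_ne_right_iff] at ha
    refine ⟨(fun j => a (0, j.succ), fun e => a (e.1.succ, e.2.succ)), ?_⟩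
    funext ⟨i, j⟩
    refine Fin.cases ?_ (fun i => ?_) i <;> refine Fin.cases ?_ (fun j => ?_) j
    · exact (pairWeight_ne_zero ha.2 (lt_irrefl _)).symm
    · rfl
    · exact (pairWeight_ne_zero ha.2 (e := (i.succ, 0)) (Fin.not_lt_zero _)).symm
    · rfl
  have hsum : Summable fun a : Fin (m + 1) × Fin (m + 1) → ℕ =>
      if netShift a = n then pairWeight ∅ ρ a else 0 :=
    summable_of_finite_support (finite_pairWeight _ _ _)
  rw [pairCoeff, ← consMatrix_injective.tsum_eq hs]
  refine (hsum.comp_injective consMatrix_injective).tsum_prod.trans (tsum_congr fun r => ?_)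
  have hiff : ∀ a, netShift (consMatrix r a) = n
      ↔ ∑ j, (r j : ℤ) = n 0 ∧ netShift a = Fin.tail n + fun j => (r j : ℤ) := by
    intro a
    rw [funext_iff, Fin.forall_fin_succ, netShift_consMatrix_zero, funext_iff]
    refine and_congr_right fun _ => forall_congr' fun i => ?_
    rw [netShift_consMatrix_succ, sub_eq_iff_eq_add]; rfl
  simp only [Function.comp_def, hiff, pairWeight_consMatrix]
  split_ifs with h
  · simp only [h, true_and]
    rw [pairCoeff, ← tsum_mul_left]
    exact tsum_congr fun a => by rw [mul_ite, mul_zero]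
  · simp [h]

/-- The expectation value is `∏_{i<j} (1 - z_j/z_i)^(α₋²)`. The index is shifted by one because the
mode `n` goes with `z^(-n-1)`. -/
theorem expWord_vac (α : ℂ) {m : ℕ} (n : Fin m → ℤ) :
    expWord α n (Finsupp.single vac 1) vac = pairCoeff ∅ (alphaMinus α ^ 2) (n + 1) := by
  induction m with
  | zero =>
    rw [pairCoeff, tsum_eq_single default fun a ha => absurd (Subsingleton.elim _ _) ha,
      if_pos (Subsingleton.elim _ _)]
    simp [expWord, pairWeight]
  | succ m ih =>
    rw [pairCoeff_succ]
    by_cases h : n 0 + 1 < 0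
    · rw [expWord_vac_of_neg α n h]
      refine ((tsum_congr fun r => if_neg ?_).trans tsum_zero).symm
      have : (0 : ℤ) ≤ ∑ j, (r j : ℤ) := Finset.sum_nonneg fun _ _ => by positivity
      rw [Pi.add_apply, Pi.one_apply]; omega
    · obtain ⟨L, hL⟩ := Int.eq_ofNat_of_zero_le (not_lt.1 h)
      rw [expWord_vac_succ α n L hL, tsum_eq_sum (s := Finset.Nat.antidiagonalTuple m L)]
      · refine Finset.sum_congr rfl fun r hr => ?_
        rw [Finset.Nat.mem_antidiagonalTuple] at hr
        rw [if_pos, ih]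
        · congr 2; funext j; simp only [Pi.add_apply, Fin.tail, Pi.one_apply]; ring
        · rw [Pi.add_apply, Pi.one_apply, hL, ← hr]; push_cast; rfl
      · intro r hr
        refine if_neg fun h' => hr ?_
        rw [Pi.add_apply, Pi.one_apply, hL] at h'
        rw [Finset.Nat.mem_antidiagonalTuple]
        exact_mod_cast h'

/-! ### Words in the screening field and its descendants -/

/-- Labels of the fields obtained from `V` by taking brackets with the free fields. -/
inductive Letter
  | V | B | P | E

/-- The fields `V`, `βe^{iα₋φ}`, `ψe^{iα₋φ}` and `e^{iα₋φ}`. -/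
def Letter.field (α : ℂ) : Letter → Modes
  | .V => screening α
  | .B => nP 1 beta (vertexExp α)
  | .P => nP 1 psi (vertexExp α)
  | .E => vertexExp α

/-- The sign in the bracket with an odd field. -/
def Letter.sign : Letter → ℂ
  | .V => -1
  | .B => 1
  | .P => -1
  | .E => 1

/-- `A` is a mode of index `l` that acts on the letters by superderivations. -/
structure Acts (α : ℂ) (A : Op) (l : ℤ) (ε c : Letter → ℂ) (d : Letter → Letter) : Prop where
  sq : ∀ X, ε X * ε X = 1
  letter : ∀ X, d X ≠ .E → X ≠ .E
  bracket : ∀ X n, A * X.field α n = ε X • (X.field α n * A) + c X • (d X).field α (n + l)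

theorem Brk.acts {α : ℂ} {x : Modes} {ε c : Letter → ℂ} {d : Letter → Letter}
    (h1 : ∀ X, ε X * ε X = 1) (h2 : ∀ X, d X ≠ .E → X ≠ .E)
    (h : ∀ X, Brk (ε X) x (X.field α) (c X • (d X).field α) 0) (l : ℤ) : Acts α (x l) l ε c d :=
  ⟨h1, h2, fun X n => by
    have := h X l n
    rw [Pi.zero_apply, smul_zero, add_zero, sub_eq_iff_eq_add'] at this
    rw [this, add_comm n l]; rfl⟩

section

variable (α : ℂ)

theorem brk_beta_S : Brk 1 beta fS 0 0 :=
  (brk_beta_psiPlus.add_right (brk_beta_beta.wick' brk_beta_psi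
    (brk_zero_left _ _) (brk_zero_left 1 _)
    (by norm_num) (by norm_num) (s2 := 1) (by norm_num) (by norm_num))).congr rfl
    (by simp [nP_zero_right, nP_zero_left]) (by simp [nP_zero_left, nP_zero_right])

theorem brk_psiPlus_beta : Brk 1 psiPlus beta 0 0 := brk_beta_psiPlus.symm00 (by norm_num)

theorem brk_psiPlus_S : Brk (-1) psiPlus fS beta 0 :=
  (brk_psiPlus_psiPlus.add_right (brk_psiPlus_beta.wick' brk_psiPlus_psi
    (brk_zero_left (-1) _) (brk_zero_left (-1) _)
    (by norm_num) (by norm_num) (s2 := 1) (by norm_num) (by norm_num))).congr rfl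
    (by simp [nP_zero_left, nP_one_right])
    (by simp [nP_zero_left, nP_zero_right])

theorem acts_beta (l : ℤ) : Acts α (beta l) l (fun _ => 1) (fun _ => 0) (fun _ => .E) := by
  refine Brk.acts (fun _ => by norm_num) (fun X h => absurd rfl h) (fun X => ?_) l
  cases X
  · simp only [Letter.field, screening_eq]
    exact (brk_beta_S.wick' (brk_vertexExp α noOsc_beta) (σ := 1) (s1 := 1) (s2 := 1) (s3 := 1)
      (brk_zero_left _ _) (brk_zero_left _ _) (by norm_num) (by norm_num) (by norm_num)
      (by norm_num)).congr rfl (by simp [nP_zero_left, nP_zero_right])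
      (by simp [nP_zero_left, nP_zero_right])
  · exact (brk_beta_beta.wick' (brk_vertexExp α noOsc_beta) (σ := 1) (s1 := 1) (s2 := 1) (s3 := 1)
      (brk_zero_left _ _) (brk_zero_left _ _) (by norm_num) (by norm_num) (by norm_num)
      (by norm_num)).congr rfl (by simp [nP_zero_left, nP_zero_right])
      (by simp [nP_zero_left, nP_zero_right])
  · exact (brk_beta_psi.wick' (brk_vertexExp α noOsc_beta) (σ := 1) (s1 := 1) (s2 := 1) (s3 := 1)
      (brk_zero_left _ _) (brk_zero_left _ _) (by norm_num) (by norm_num) (by norm_num)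
      (by norm_num)).congr rfl (by simp [nP_zero_left, nP_zero_right])
      (by simp [nP_zero_left, nP_zero_right])
  · exact (brk_vertexExp α noOsc_beta).congr rfl (by simp) rfl

theorem acts_gamma (l : ℤ) : Acts α (gamma l) l (fun _ => 1)
    (fun X => match X with | .V => -1 | .B => -1 | _ => 0)
    (fun X => match X with | .V => .P | _ => .E) := by
  refine Brk.acts (fun _ => by norm_num) (fun X h => by rintro rfl; exact h rfl) (fun X => ?_) l
  cases X
  · simp only [Letter.field, screening_eq]
    exact (brk_gamma_S.wick' (brk_vertexExp α noOsc_gamma) (σ := 1) (s1 := 1) (s2 := 1) (s3 := 1)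
      (((brk_vertexExp α noOsc_psi).neg_left).congr rfl neg_zero neg_zero)
      (brk_zero_left _ _) (by norm_num) (by norm_num) (by norm_num)
      (by norm_num)).congr rfl (by simp [nP_neg_left, nP_zero_right])
      (by simp [nP_zero_left, nP_zero_right])
  · exact (brk_gamma_beta.wick' (brk_vertexExp α noOsc_gamma) (σ := 1) (s1 := 1) (s2 := 1) (s3 := 1)
      ((brk_one_left _).neg_left.congr rfl neg_zero neg_zero) (brk_zero_left _ _)
      (by norm_num) (by norm_num) (by norm_num)
      (by norm_num)).congr rfl (by simp [nP_neg_left, nP_one_left, nP_zero_right, Letter.field])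
      (by simp [nP_zero_left, nP_zero_right])
  · exact (brk_gamma_psi.wick' (brk_vertexExp α noOsc_gamma) (σ := 1) (s1 := 1) (s2 := 1) (s3 := 1)
      (brk_zero_left _ _) (brk_zero_left _ _) (by norm_num) (by norm_num) (by norm_num)
      (by norm_num)).congr rfl (by simp [nP_zero_left, nP_zero_right])
      (by simp [nP_zero_left, nP_zero_right])
  · exact (brk_vertexExp α noOsc_gamma).congr rfl (by simp) rfl

theorem sign_sq (X : Letter) : X.sign * X.sign = 1 := by cases X <;> norm_num [Letter.sign]

theorem acts_psiPlus (l : ℤ) : Acts α (psiPlus l) l Letter.sign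
    (fun X => match X with | .V => 1 | .P => 1 | _ => 0)
    (fun X => match X with | .V => .B | _ => .E) := by
  refine Brk.acts sign_sq (fun X h => by rintro rfl; exact h rfl) (fun X => ?_) l
  cases X
  · simp only [Letter.field, screening_eq]
    exact (brk_psiPlus_S.wick' (brk_vertexExp α noOsc_psiPlus) (σ := 1) (s1 := 1) (s2 := -1) (s3 := -1)
      (brk_vertexExp α noOsc_beta)
      (brk_zero_left _ _) (by norm_num) (by norm_num) (by norm_num)
      (by norm_num)).congr rfl (by simp [nP_zero_right])
      (by simp [nP_zero_left, nP_zero_right])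
  · exact (brk_psiPlus_beta.wick' (brk_vertexExp α noOsc_psiPlus) (σ := 1) (s1 := 1) (s2 := 1) (s3 := 1)
      (brk_zero_left _ _) (brk_zero_left _ _)
      (by norm_num) (by norm_num) (by norm_num)
      (by norm_num)).congr rfl (by simp [nP_zero_left, nP_zero_right])
      (by simp [nP_zero_left, nP_zero_right])
  · exact (brk_psiPlus_psi.wick' (brk_vertexExp α noOsc_psiPlus) (σ := 1) (s1 := 1) (s2 := -1) (s3 := -1)
      (brk_one_left _) (brk_zero_left _ _) (by norm_num) (by norm_num) (by norm_num)
      (by norm_num)).congr rfl (by simp [nP_one_left, nP_zero_right, Letter.field])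
      (by simp [nP_zero_left, nP_zero_right])
  · exact (brk_vertexExp α noOsc_psiPlus).congr rfl (by simp) rfl

theorem acts_psi (l : ℤ) : Acts α (psi l) l Letter.sign
    (fun X => match X with | .V => 1 | _ => 0) (fun _ => .E) := by
  refine Brk.acts sign_sq (fun X h => absurd rfl h) (fun X => ?_) l
  cases X
  · exact (brk_psi_screening α).congr rfl (by simp [Letter.field]) rfl
  · exact (brk_psi_beta.wick' (brk_vertexExp α noOsc_psi) (σ := 1) (s1 := 1) (s2 := 1) (s3 := 1)
      (brk_zero_left _ _) (brk_zero_left _ _)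
      (by norm_num) (by norm_num) (by norm_num)
      (by norm_num)).congr rfl (by simp [nP_zero_left, nP_zero_right])
      (by simp [nP_zero_left, nP_zero_right])
  · exact (brk_psi_psi.wick' (brk_vertexExp α noOsc_psi) (σ := 1) (s1 := 1) (s2 := -1) (s3 := -1)
      (brk_zero_left _ _) (brk_zero_left _ _) (by norm_num) (by norm_num) (by norm_num)
      (by norm_num)).congr rfl (by simp [nP_zero_left, nP_zero_right])
      (by simp [nP_zero_left, nP_zero_right])
  · exact (brk_vertexExp α noOsc_psi).congr rfl (by simp) rfl

theorem phiMode_mul_nP {A : Modes} [Fld A] (hA : ∀ n, NoOsc (A n)) {l : ℤ} (hl : l ≠ 0) (n : ℤ) :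
    phiMode 0 l * nP 1 A (vertexExp α) n
      = nP 1 A (vertexExp α) n * phiMode 0 l + alphaMinus α • nP 1 A (vertexExp α) (n + l) := by
  have h1 := locFin_cutTerm (A := A) (B := vertexExp α) 1 0 n
  have h2 := locFin_cutTerm (A := A) (B := vertexExp α) 1 0 (n + l)
  rw [nP_apply, nP_apply, mul_locSum _ h1, locSum_mul _ h1, ← locSum_smul _ h2,
    ← locSum_add (h1.mul_right _) (h2.smul _)]
  congr 1; funext i
  have hc : Commute (phiMode 0 l) (A i) := (hA i).phiMode 0 l
  simp only [cutTerm, one_smul]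
  split_ifs
  · rw [← mul_assoc, hc.eq, mul_assoc, phiMode_mul_vertexExp α hl, mul_add, mul_smul_comm,
      mul_assoc (A i), show l + (n - i - 1) = n + l - i - 1 by ring]
  · rw [← mul_assoc, phiMode_mul_vertexExp α hl, add_mul, smul_mul_assoc, mul_assoc, hc.eq, mul_assoc,
      show l + (n - i - 1) = n + l - i - 1 by ring]

theorem acts_phi {l : ℤ} (hl : l ≠ 0) : Acts α (phiMode 0 l) l (fun _ => 1)
    (fun _ => alphaMinus α) id := by
  refine ⟨fun _ => by norm_num, fun X h => h, fun X n => ?_⟩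
  rw [one_smul]
  cases X
  · simp only [Letter.field, screening_eq, id]
    exact phiMode_mul_nP α noOsc_S hl n
  · exact phiMode_mul_nP α noOsc_beta hl n
  · exact phiMode_mul_nP α noOsc_psi hl n
  · rw [add_comm n l]; exact phiMode_mul_vertexExp α hl n

end

/-- Moving operators past a product. -/
theorem mul_prod_ofFn {m : ℕ} (A : ℕ → Op) (X Y : Fin m → Op) (ε : Fin m → ℂ)
    (h : ∀ i : Fin m, A i * X i = ε i • (X i * A (i + 1)) + Y i) :
    A 0 * (List.ofFn X).prod = (∏ i, ε i) • ((List.ofFn X).prod * A m)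
      + ∑ i, (∏ k ∈ Finset.univ.filter (· < i), ε k) • (List.ofFn (Function.update X i (Y i))).prod := by
  induction m generalizing A with
  | zero => simp
  | succ m ih =>
    have h0 := h 0
    have h1 := ih (fun n => A (n + 1)) (Fin.tail X) (Fin.tail Y) (Fin.tail ε) fun i => h i.succ
    rw [Fin.val_zero] at h0
    have e0 : (List.ofFn X).prod = X 0 * (List.ofFn (Fin.tail X)).prod := by
      rw [List.ofFn_succ, List.prod_cons]; rfl
    have e1 : (List.ofFn (Function.update X 0 (Y 0))).prod = Y 0 * (List.ofFn (Fin.tail X)).prod := by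
      rw [List.ofFn_succ, List.prod_cons, Function.update_self]; rfl
    have e2 : ∀ i : Fin m, (List.ofFn (Function.update X i.succ (Y i.succ))).prod
        = X 0 * (List.ofFn (Function.update (Fin.tail X) i (Fin.tail Y i))).prod := fun i => by
      rw [List.ofFn_succ, List.prod_cons, Function.update_of_ne (Fin.succ_ne_zero i).symm,
        ← Fin.tail_update_succ]; rfl
    have e3 : ∀ i : Fin m, (∏ k ∈ Finset.univ.filter (· < i.succ), ε k)
        = ε 0 * ∏ k ∈ Finset.univ.filter (· < i), Fin.tail ε k := fun i => by
      rw [Finset.prod_filter, Finset.prod_filter, Fin.prod_univ_succ, if_pos (Fin.succ_pos i)]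
      simp only [Fin.succ_lt_succ_iff, Fin.tail]
    have e4 : (Finset.univ.filter fun k : Fin (m + 1) => k < 0) = ∅ := by
      ext k; simp
    rw [Fin.sum_univ_succ, e0, e1, e4, Finset.prod_empty, one_smul, Fin.prod_univ_succ]
    simp only [e2, e3]
    rw [← mul_assoc, h0, add_mul, smul_mul_assoc, mul_assoc, h1, mul_add, smul_add, mul_smul_comm,
      Finset.mul_sum, Finset.smul_sum, smul_smul, mul_assoc]
    have e5 : ∀ i : Fin m, ε 0 • (X 0 * ((∏ k ∈ Finset.univ.filter (· < i), Fin.tail ε k) •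
        (List.ofFn (Function.update (Fin.tail X) i (Fin.tail Y i))).prod))
        = (ε 0 * ∏ k ∈ Finset.univ.filter (· < i), Fin.tail ε k) •
        (X 0 * (List.ofFn (Function.update (Fin.tail X) i (Fin.tail Y i))).prod) := fun i => by
      rw [mul_smul_comm, smul_smul]
    simp only [e5]
    rw [add_assoc, add_comm (∑ i, _)]
    rfl

theorem exists_prod_ofFn_update {m : ℕ} (X : Fin m → Op) (p : Fin m) : ∃ x y : Op,
    (∀ Z, (List.ofFn (Function.update X p Z)).prod = x * Z * y) ∧
    (∀ A, (∀ i < p, Commute A (X i)) → Commute A x) ∧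
    ∀ A, (∀ i > p, Commute A (X i)) → Commute A y := by
  induction m with
  | zero => exact p.elim0
  | succ m ih =>
    refine Fin.cases ?_ (fun p => ?_) p
    · refine ⟨1, (List.ofFn (Fin.tail X)).prod, fun Z => ?_, fun A _ => Commute.one_right A,
        fun A h => ?_⟩
      · rw [List.ofFn_succ, List.prod_cons, Function.update_self, one_mul]; rfl
      · refine Commute.list_prod_right _ _ fun B hB => ?_
        obtain ⟨i, rfl⟩ := (List.mem_ofFn' _ _).1 hB
        exact h i.succ (Fin.succ_pos i)
    · obtain ⟨x, y, h1, h2, h3⟩ := ih (Fin.tail X) p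
      refine ⟨X 0 * x, y, fun Z => ?_, fun A h => ?_, fun A h => ?_⟩
      · rw [List.ofFn_succ, List.prod_cons, Function.update_of_ne (Fin.succ_ne_zero p).symm,
          mul_assoc, mul_assoc, ← mul_assoc x, ← h1, ← Fin.tail_update_succ]; rfl
      · exact (h 0 (Fin.succ_pos p)).mul_right (h2 A fun i hi => h i.succ (Fin.succ_lt_succ_iff.2 hi))
      · exact h3 A fun i hi => h i.succ (Fin.succ_lt_succ_iff.2 hi)

theorem prod_update_smul {m : ℕ} (X : Fin m → Op) (p : Fin m) (c : ℂ) (Z : Op) :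
    (List.ofFn (Function.update X p (c • Z))).prod
      = c • (List.ofFn (Function.update X p Z)).prod := by
  obtain ⟨x, y, h, _⟩ := exists_prod_ofFn_update X p
  rw [h, h, mul_smul_comm, smul_mul_assoc]

/-- Products of modes of the fields. -/
def word (α : ℂ) {m : ℕ} (L : Fin m → Letter) (n : Fin m → ℤ) : Op :=
  (List.ofFn fun i => (L i).field α (n i)).prod

theorem word_update (α : ℂ) {m : ℕ} (L : Fin m → Letter) (n : Fin m → ℤ) (i : Fin m) (d : Letter)
    (l : ℤ) : (List.ofFn (Function.update (fun i => (L i).field α (n i)) i (d.field α (n i + l)))).prod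
      = word α (Function.update L i d) (n + Pi.single i l) := by
  rw [word]
  congr 2
  funext k
  by_cases h : k = i
  · subst h; simp
  · simp [h]

/-- The letters different from `e^{iα₋φ}`. -/
def support {m : ℕ} (L : Fin m → Letter) : Finset (Fin m) := by
  classical exact Finset.univ.filter fun i => L i ≠ .E

theorem mem_support {m : ℕ} {L : Fin m → Letter} {i : Fin m} : i ∈ support L ↔ L i ≠ .E := by
  simp [support]

/-- The super Leibniz rule: the sign of a term comes from the letters to its left. -/
theorem Acts.mul_word {α : ℂ} {A : Op} {l : ℤ} {ε c : Letter → ℂ} {d : Letter → Letter}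
    (h : Acts α A l ε c d) {m : ℕ} (L : Fin m → Letter) (n : Fin m → ℤ) :
    A * word α L n = (∏ i, ε (L i)) • (word α L n * A)
      + ∑ i, ((∏ k ∈ Finset.univ.filter (· < i), ε (L k)) * c (L i)) •
        word α (Function.update L i (d (L i))) (n + Pi.single i l) := by
  have := mul_prod_ofFn (fun _ => A) (fun i => (L i).field α (n i))
    (fun i => c (L i) • (d (L i)).field α (n i + l)) (fun i => ε (L i)) fun i : Fin m => h.bracket (L i) (n i)
  refine this.trans ?_
  congr 1
  refine Finset.sum_congr rfl fun i _ => ?_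
  rw [mul_smul, ← word_update, prod_update_smul]

/-! ### Reduction of matrix coefficients to vacuum expectation values -/

theorem coeff_eq_mul {A : Op} {t s : Occ} {x : ℂ} (h1 : A (Finsupp.single s 1) t = x)
    (h2 : ∀ r ≠ s, A (Finsupp.single r 1) t = 0) (u : Fock) : A u t = x * u s := by
  induction u using Finsupp.induction_linear with
  | zero => simp
  | add f g hf hg => rw [map_add, Finsupp.add_apply, hf, hg, Finsupp.add_apply, mul_add]
  | single r c =>
    rw [← mul_one c, ← smul_eq_mul, ← Finsupp.smul_single, map_smul, Finsupp.smul_apply,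
      Finsupp.smul_apply, smul_eq_mul, smul_eq_mul]
    by_cases h : r = s
    · subst h; rw [h1, Finsupp.single_eq_same]; ring
    · rw [h2 r h, Finsupp.single_eq_of_ne (Ne.symm h)]; ring

/-- The basis vector `s` is obtained from `s'` by a creation operator. -/
structure Covers (α : ℂ) (s s' : Occ) : Prop where
  down : ∃ A l ε c d, Acts α A l ε c d ∧ (∃ x : ℂ, x ≠ 0 ∧ ∀ u, A u s' = x * u s) ∧
    ∀ v : Occ, ∃ (y : ℂ) (v' : Occ), A (Finsupp.single v 1) = Finsupp.single v' y
  up : ∃ A l ε c d, Acts α A l ε c d ∧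
    (∃ x : ℂ, x ≠ 0 ∧ A (Finsupp.single s' 1) = Finsupp.single s x) ∧ ∀ u, A u vac = 0

section

variable (α : ℂ)

theorem bosAnnih_apply (s : Occ) (a : ℤ) (u : Fock) :
    bosAnnih a u s = (s.bos a + 1 : ℂ) * u { s with bos := s.bos + Finsupp.single a 1 } := by
  refine coeff_eq_mul ?_ (fun r hr => ?_) u
  · simp [bosAnnih]
  · rw [bosAnnih, basisOp_single, one_smul]
    by_cases h : r.bos a = 0
    · simp [h]
    · refine Finsupp.single_eq_of_ne fun h' => hr ?_
      rw [h']
      exact Occ.ext (tsub_single_add_single r.bos h).symm rfl rfl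

theorem oscAnnih_apply (s : Occ) (a : ℕ) (u : Fock) :
    oscAnnih a u s = (s.osc a + 1 : ℂ) * u { s with osc := s.osc + Finsupp.single a 1 } := by
  refine coeff_eq_mul ?_ (fun r hr => ?_) u
  · simp [oscAnnih]
  · rw [oscAnnih, basisOp_single, one_smul]
    by_cases h : r.osc a = 0
    · simp [h]
    · refine Finsupp.single_eq_of_ne fun h' => hr ?_
      rw [h']
      exact Occ.ext rfl (tsub_single_add_single r.osc h).symm rfl

theorem ferAnnih_apply (s : Occ) {a : ℤ} (ha : a ∉ s.fer) (u : Fock) :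
    ferAnnih a u s = ferSign a (insert a s.fer) * u { s with fer := insert a s.fer } := by
  refine coeff_eq_mul ?_ (fun r hr => ?_) u
  · simp [ferAnnih, ha]
  · rw [ferAnnih, basisOp_single, one_smul]
    split_ifs with h
    · refine Finsupp.single_eq_of_ne fun h' => hr ?_
      rw [h']
      simp [Finset.insert_erase h]
    · rfl

theorem bosCreate_coeff_vac (a : ℤ) (u : Fock) : bosCreate a u vac = 0 := by
  refine coeff_eq_zero (fun s => ?_) u
  rw [bosCreate, basisOp_single, one_smul]
  refine Finsupp.single_eq_of_ne fun h => ?_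
  have := congrArg (fun s : Occ => s.bos a) h
  simp [vac] at this

theorem oscCreate_coeff_vac (a : ℕ) (u : Fock) : oscCreate a u vac = 0 := by
  refine coeff_eq_zero (fun s => ?_) u
  rw [oscCreate, basisOp_single, one_smul]
  refine Finsupp.single_eq_of_ne fun h => ?_
  have := congrArg (fun s : Occ => s.osc a) h
  simp [vac] at this

theorem ferCreate_coeff_vac (a : ℤ) (u : Fock) : ferCreate a u vac = 0 := by
  refine coeff_eq_zero (fun s => ?_) u
  rw [ferCreate, basisOp_single, one_smul]
  split_ifs
  · rfl
  refine Finsupp.single_eq_of_ne fun h => ?_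
  have := congrArg (fun s : Occ => s.fer) h
  exact (Finset.insert_ne_empty _ _) this.symm

/-- The creation operator with label `a` is a mode of `β` if `a < 0` and of `γ` otherwise; the
corresponding annihilation operator is, up to sign, a mode of the other field. -/
theorem covers_bos (s : Occ) (a : ℤ) :
    Covers α { s with bos := s.bos + Finsupp.single a 1 } s := by
  have h0 : (s.bos a + 1 : ℂ) ≠ 0 := Nat.cast_add_one_ne_zero _
  by_cases ha : a < 0
  · refine ⟨⟨gamma (-a - 1), _, _, _, _, acts_gamma α _, ⟨_, neg_ne_zero.2 h0, fun u => ?_⟩,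
      fun v => ⟨-(v.bos a : ℂ), { v with bos := v.bos - Finsupp.single a 1 }, ?_⟩⟩, ⟨beta a, _, _, _, _, acts_beta α _, ⟨1, one_ne_zero, ?_⟩, fun u => ?_⟩⟩
    · rw [gamma, gammaMode, if_neg (by omega), show -(-a - 1 + 1) = a by ring, LinearMap.neg_apply,
        Finsupp.neg_apply, bosAnnih_apply, neg_mul]
    · rw [gamma, gammaMode, if_neg (by omega), show -(-a - 1 + 1) = a by ring, LinearMap.neg_apply,
        bosAnnih, basisOp_single, one_smul, Finsupp.single_neg]
    · rw [beta, betaMode, if_pos ha, bosCreate, basisOp_single, one_smul]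
    · rw [beta, betaMode, if_pos ha, bosCreate_coeff_vac]
  · refine ⟨⟨beta a, _, _, _, _, acts_beta α _, ⟨_, h0, fun u => ?_⟩,
      fun v => ⟨(v.bos a : ℂ), { v with bos := v.bos - Finsupp.single a 1 }, ?_⟩⟩,
      ⟨gamma (-a - 1), _, _, _, _, acts_gamma α _, ⟨1, one_ne_zero, ?_⟩, fun u => ?_⟩⟩
    · rw [beta, betaMode, if_neg ha, bosAnnih_apply]
    · rw [beta, betaMode, if_neg ha, bosAnnih, basisOp_single, one_smul]
    · rw [gamma, gammaMode, if_pos (by omega), show -(-a - 1 + 1) = a by ring, bosCreate,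
        basisOp_single, one_smul]
    · rw [gamma, gammaMode, if_pos (by omega), bosCreate_coeff_vac]

theorem covers_osc (s : Occ) (a : ℕ) :
    Covers α { s with osc := s.osc + Finsupp.single a 1 } s := by
  have h0 : (s.osc a + 1 : ℂ) ≠ 0 := Nat.cast_add_one_ne_zero _
  have h1 : (a + 1 : ℂ) ≠ 0 := Nat.cast_add_one_ne_zero _
  refine ⟨⟨phiMode 0 (a + 1), _, _, _, _, acts_phi α (by omega), ⟨_, mul_ne_zero h1 h0, fun u => ?_⟩,
      fun v => ⟨(a + 1) * (v.osc a : ℂ), { v with osc := v.osc - Finsupp.single a 1 }, ?_⟩⟩,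
      ⟨phiMode 0 (-(a + 1)), _, _, _, _, acts_phi α (by omega), ⟨1, one_ne_zero, ?_⟩, fun u => ?_⟩⟩
  · rw [phiMode, if_neg (by omega), if_neg (by omega), show ((a : ℤ) + 1).natAbs - 1 = a by omega,
      LinearMap.smul_apply, Finsupp.smul_apply, oscAnnih_apply, smul_eq_mul, mul_assoc]
    push_cast; rfl
  · rw [phiMode, if_neg (by omega), if_neg (by omega), show ((a : ℤ) + 1).natAbs - 1 = a by omega,
      LinearMap.smul_apply, oscAnnih, basisOp_single, one_smul, Finsupp.smul_single, smul_eq_mul]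
    push_cast; rfl
  · rw [phiMode, if_neg (by omega), if_pos (by omega), show (-((a : ℤ) + 1)).natAbs - 1 = a by omega,
      oscCreate, basisOp_single, one_smul]
  · rw [phiMode, if_neg (by omega), if_pos (by omega), oscCreate_coeff_vac]

theorem ferSign_ne_zero (a : ℤ) (f : Finset ℤ) : ferSign a f ≠ 0 :=
  pow_ne_zero _ (by norm_num)

theorem ferAnnih_single (a : ℤ) (v : Occ) :
    ∃ (y : ℂ) (v' : Occ), ferAnnih a (Finsupp.single v 1) = Finsupp.single v' y := by
  rw [ferAnnih, basisOp_single, one_smul]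
  split_ifs
  · exact ⟨_, _, rfl⟩
  · exact ⟨0, v, by simp⟩

theorem covers_fer (s : Occ) {a : ℤ} (ha : a ∉ s.fer) :
    Covers α { s with fer := insert a s.fer } s := by
  by_cases h : a < 0
  · refine ⟨⟨psi (-a - 1), _, _, _, _, acts_psi α _, ⟨_, ferSign_ne_zero a (insert a s.fer), fun u => ?_⟩,
      fun v => ?_⟩, ⟨psiPlus a, _, _, _, _, acts_psiPlus α _, ⟨_, ferSign_ne_zero a s.fer, ?_⟩, fun u => ?_⟩⟩
    · rw [psi, psiMode, if_neg (by omega), show -(-a - 1 + 1) = a by ring, ferAnnih_apply s ha]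
    · rw [psi, psiMode, if_neg (by omega)]
      exact ferAnnih_single _ v
    · rw [psiPlus, psiPlusMode, if_pos h, ferCreate, basisOp_single, one_smul, if_neg ha]
    · rw [psiPlus, psiPlusMode, if_pos h, ferCreate_coeff_vac]
  · refine ⟨⟨psiPlus a, _, _, _, _, acts_psiPlus α _, ⟨_, ferSign_ne_zero a (insert a s.fer), fun u => ?_⟩,
      fun v => ?_⟩, ⟨psi (-a - 1), _, _, _, _, acts_psi α _, ⟨_, ferSign_ne_zero a s.fer, ?_⟩, fun u => ?_⟩⟩
    · rw [psiPlus, psiPlusMode, if_neg h, ferAnnih_apply s ha]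
    · rw [psiPlus, psiPlusMode, if_neg h]
      exact ferAnnih_single _ v
    · rw [psi, psiMode, if_pos (by omega), show -(-a - 1 + 1) = a by ring, ferCreate, basisOp_single,
        one_smul, if_neg ha]
    · rw [psi, psiMode, if_pos (by omega), ferCreate_coeff_vac]

end

theorem finsupp_nat_induction {ι : Type} {p : (ι →₀ ℕ) → Prop} (h0 : p 0)
    (h1 : ∀ f a, p f → p (f + Finsupp.single a 1)) (f : ι →₀ ℕ) : p f := by
  induction f using Finsupp.induction with
  | zero => exact h0
  | single_add a b f _ _ ih =>
    rename_i hb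
    clear hb
    induction b with
    | zero => simpa using ih
    | succ b ihb =>
      rw [Finsupp.single_add, add_right_comm]
      exact h1 _ _ ihb

theorem Covers.induction (α : ℂ) {p : Occ → Prop} (h0 : p vac)
    (h1 : ∀ s s', Covers α s s' → p s' → p s) (s : Occ) : p s := by
  obtain ⟨b, o, f⟩ := s
  induction b using finsupp_nat_induction with
  | h1 b a ih => exact h1 _ _ (covers_bos α ⟨b, o, f⟩ a) ih
  | h0 =>
  induction o using finsupp_nat_induction with
  | h1 o a ih => exact h1 _ _ (covers_osc α ⟨0, o, f⟩ a) ih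
  | h0 =>
  induction f using Finset.induction_on with
  | empty => exact h0
  | insert a f ha ih => exact h1 _ _ (covers_fer α ⟨0, 0, f⟩ ha) ih

/-- A bracket never turns the bare exponential into another letter, so the set of letters that can
cause poles does not grow. -/
theorem support_update {α : ℂ} {A : Op} {l : ℤ} {ε c : Letter → ℂ} {d : Letter → Letter}
    (h : Acts α A l ε c d) {m : ℕ} (L : Fin m → Letter) (i : Fin m) :
    support (Function.update L i (d (L i))) ⊆ support L := fun k hk => by
  rw [mem_support] at hk ⊢
  by_cases hki : k = i
  · subst hki
    rw [Function.update_self] at hk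
    exact h.letter _ hk
  · rwa [Function.update_of_ne hki] at hk

/-- Matrix coefficients of words. -/
def wordCoeff (α : ℂ) {m : ℕ} (L : Fin m → Letter) (v w : Occ) (n : Fin m → ℤ) : ℂ :=
  word α L n (Finsupp.single v 1) w

/-- To shorten `w`, the coefficient is read off after an annihilation operator, which is moved to
the right and sends `v` to a multiple of a basis vector. Once `w` is the vacuum, a creation operator
in `v` is moved to the left, where the vacuum coefficient kills it. The commutators are words with
no larger support and shifted indices, for the shorter of the basis vectors. -/
theorem wordCoeff_mem_of_vac {α : ℂ} {m : ℕ}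
    (hv : ∀ L : Fin m → Letter, wordCoeff α L vac vac ∈ pairSpan (alphaMinus α ^ 2) (support L))
    (L : Fin m → Letter) (v w : Occ) : wordCoeff α L v w ∈ pairSpan (alphaMinus α ^ 2) (support L) := by
  induction w using Covers.induction α generalizing L v with
  | h0 =>
    induction v using Covers.induction α generalizing L with
    | h0 => exact hv L
    | h1 v v' hc ih =>
      obtain ⟨A, l, ε, c, d, hA, ⟨x, hx, hxv⟩, hvac⟩ := hc.up
      -- The signs square to one, so the relation can be solved for the coefficient with `v`.
      have hP : (∏ i, ε (L i)) ≠ 0 := Finset.prod_ne_zero_iff.2 fun i _ => by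
        intro h
        have := hA.sq (L i)
        rw [h] at this
        norm_num at this
      have key : wordCoeff α L v vac = (-(x * ∏ i, ε (L i))⁻¹) •
          ∑ i, ((∏ k ∈ Finset.univ.filter (· < i), ε (L k)) * c (L i)) •
            fun n => wordCoeff α (Function.update L i (d (L i))) v' vac (n + Pi.single i l) := by
        funext n
        have h1 := congrArg (fun B : Op => B (Finsupp.single v' 1) vac) (hA.mul_word L n)
        have h2 : word α L n (Finsupp.single v x) = x • word α L n (Finsupp.single v 1) := by
          rw [← map_smul, Finsupp.smul_single, smul_eq_mul, mul_one]
        simp only [Module.End.mul_apply, hvac, LinearMap.add_apply, LinearMap.smul_apply, hxv, h2,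
          Finsupp.add_apply, Finsupp.smul_apply, LinearMap.sum_apply, Finsupp.finsetSum_apply,
          smul_eq_mul] at h1
        simp only [Pi.smul_apply, Finset.sum_apply, smul_eq_mul, wordCoeff]
        have h3 : x * ∏ i, ε (L i) ≠ 0 := mul_ne_zero hx hP
        rw [neg_mul, eq_neg_iff_add_eq_zero, ← mul_right_inj' h3, mul_zero, mul_add, ← mul_assoc _ _⁻¹,
          mul_inv_cancel₀ h3, one_mul]
        linear_combination -h1
      rw [key]
      refine Submodule.smul_mem _ _ (Submodule.sum_mem _ fun i _ => Submodule.smul_mem _ _ ?_)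
      exact shift_mem_pairSpan (pairSpan_mono (support_update hA L i) (ih _)) _
  | h1 w w' hc ih =>
    obtain ⟨A, l, ε, c, d, hA, ⟨x, hx, hxw⟩, hsingle⟩ := hc.down
    obtain ⟨y, v', hy⟩ := hsingle v
    have key : wordCoeff α L v w = x⁻¹ • (((∏ i, ε (L i)) * y) • wordCoeff α L v' w' +
        ∑ i, ((∏ k ∈ Finset.univ.filter (· < i), ε (L k)) * c (L i)) •
          fun n => wordCoeff α (Function.update L i (d (L i))) v w' (n + Pi.single i l)) := by
      funext n
      have h1 := congrArg (fun B : Op => B (Finsupp.single v 1) w') (hA.mul_word L n)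
      have h2 : word α L n (Finsupp.single v' y) = y • word α L n (Finsupp.single v' 1) := by
        rw [← map_smul, Finsupp.smul_single, smul_eq_mul, mul_one]
      simp only [Module.End.mul_apply, hxw, LinearMap.add_apply, LinearMap.smul_apply, hy, h2,
        Finsupp.add_apply, Finsupp.smul_apply, LinearMap.sum_apply, Finsupp.finsetSum_apply,
        smul_eq_mul] at h1
      simp only [Pi.smul_apply, Pi.add_apply, Finset.sum_apply, smul_eq_mul, wordCoeff]
      rw [← mul_right_inj' hx, ← mul_assoc, mul_inv_cancel₀ hx, one_mul, h1]
      ring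
    rw [key]
    refine Submodule.smul_mem _ _ (add_mem (Submodule.smul_mem _ _ (ih _ _))
      (Submodule.sum_mem _ fun i _ => Submodule.smul_mem _ _ ?_))
    exact shift_mem_pairSpan (pairSpan_mono (support_update hA L i) (ih _ _)) _

/-! ### Contractions in vacuum expectation values -/

section

variable {α : ℂ}

/-- Vacuum expectation values of normally ordered products. -/
theorem vac_nP {z Y : Modes} [Fld z] [Fld Y] (x y : Op) (hx : ∀ l < 0, ∀ u, (x * z l) u vac = 0)
    (n : ℤ) : (x * nP 1 z Y n * y) (Finsupp.single vac 1) vac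
      = ∑' l : ℕ, (x * Y (n - l - 1) * z l * y) (Finsupp.single vac 1) vac := by
  have hl := locFin_cutTerm (A := z) (B := Y) 1 0 n
  have hl2 : LocFin fun l => x * cutTerm 1 0 z Y n l * y := (hl.mul_left x).mul_right y
  rw [nP_apply, mul_locSum _ hl, locSum_mul _ (hl.mul_left x), locSum_apply hl2]
  have h := (Finsupp.applyAddHom (M := ℂ) vac).map_finsum (hl2 (Finsupp.single vac 1))
  change (∑ᶠ l, (x * cutTerm 1 0 z Y n l * y) (Finsupp.single vac 1)) vac
    = ∑ᶠ l, (x * cutTerm 1 0 z Y n l * y) (Finsupp.single vac 1) vac at h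
  have hs : ∀ l : ℤ, l < 0 → (x * cutTerm 1 0 z Y n l * y) (Finsupp.single vac 1) vac = 0 := by
    intro l hl
    rw [cutTerm, if_pos hl, ← mul_assoc x, mul_assoc (x * z l), Module.End.mul_apply, hx l hl]
  rw [h, ← tsum_eq_finsum (L := SummationFilter.unconditional ℤ), ← (Nat.cast_injective (R := ℤ)).tsum_eq]
  · refine tsum_congr fun l => ?_
    rw [cutTerm, if_neg (by omega), one_smul, ← mul_assoc x]
  · intro l hl
    refine ⟨l.toNat, Int.toNat_of_nonneg ?_⟩
    by_contra h'
    exact hl (hs l (not_le.1 h'))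
  · refine (hl2 (Finsupp.single vac 1)).subset fun l hl h' => hl ?_
    change (x * cutTerm 1 0 z Y n l * y) (Finsupp.single vac 1) vac = 0
    rw [h']; rfl

theorem beta_coeff_vac {l : ℤ} (h : l < 0) (u : Fock) : beta l u vac = 0 := by
  rw [beta, betaMode, if_pos h, bosCreate_coeff_vac]

theorem beta_vac {l : ℤ} (h : 0 ≤ l) : beta l (Finsupp.single vac 1) = 0 := by
  rw [beta, betaMode, if_neg (by omega), bosAnnih, basisOp_single]
  simp [vac]

theorem psiPlus_coeff_vac {l : ℤ} (h : l < 0) (u : Fock) : psiPlus l u vac = 0 := by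
  rw [psiPlus, psiPlusMode, if_pos h, ferCreate_coeff_vac]

theorem psiPlus_vac {l : ℤ} (h : 0 ≤ l) : psiPlus l (Finsupp.single vac 1) = 0 := by
  rw [psiPlus, psiPlusMode, if_neg (by omega), ferAnnih, basisOp_single]
  simp [vac]

theorem psi_coeff_vac {l : ℤ} (h : l < 0) (u : Fock) : psi l u vac = 0 := by
  rw [psi, psiMode, if_pos (by omega), ferCreate_coeff_vac]

theorem psi_vac {l : ℤ} (h : 0 ≤ l) : psi l (Finsupp.single vac 1) = 0 := by
  rw [psi, psiMode, if_neg (by omega), ferAnnih, basisOp_single]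
  simp [vac]

theorem commute_beta_field (X : Letter) (l n : ℤ) : Commute (beta l) (X.field α n) := by
  have := (acts_beta α l).bracket X n
  rw [one_smul, zero_smul, add_zero] at this
  exact this

/-- No letter contains `γ`, so every mode of `β` can be moved to one of the two vacua: negative
modes to the left, the others to the right. -/
theorem vac_nP_beta {Y : Modes} [Fld Y] {x y : Op} (hx : ∀ l, Commute (beta l) x)
    (hy : ∀ l, Commute (beta l) y) (n : ℤ) :
    (x * nP 1 beta Y n * y) (Finsupp.single vac 1) vac = 0 := by
  rw [vac_nP x y fun l hl u => by rw [← (hx l).eq, Module.End.mul_apply, beta_coeff_vac hl]]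
  refine (tsum_congr fun l => ?_).trans tsum_zero
  rw [mul_assoc, (hy l).eq, ← mul_assoc, Module.End.mul_apply, beta_vac (Int.natCast_nonneg l), map_zero]
  rfl

theorem exists_word_eq (α : ℂ) {m : ℕ} (L : Fin m → Letter) (n : Fin m → ℤ) (p : Fin m) :
    ∃ x y : Op, word α L n = x * (L p).field α (n p) * y ∧
      (∀ (X : Letter) (k : ℤ), word α (Function.update L p X) (Function.update n p k)
        = x * X.field α k * y) ∧
      (∀ A, (∀ i < p, Commute A ((L i).field α (n i))) → Commute A x) ∧
      ∀ A, (∀ i > p, Commute A ((L i).field α (n i))) → Commute A y := by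
  obtain ⟨x, y, h1, h2, h3⟩ := exists_prod_ofFn_update (fun i => (L i).field α (n i)) p
  have h4 : ∀ (X : Letter) (k : ℤ), word α (Function.update L p X) (Function.update n p k)
        = x * X.field α k * y := fun X k => by
    rw [← h1, word]
    congr 2
    funext i
    by_cases h : i = p
    · subst h; simp
    · simp [h]
  refine ⟨x, y, ?_, h4, h2, h3⟩
  rw [← h4, Function.update_eq_self, Function.update_eq_self]

theorem wordCoeff_vac_of_B {m : ℕ} {L : Fin m → Letter} {p : Fin m} (hp : L p = .B) :
    wordCoeff α L vac vac = 0 := by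
  funext n
  obtain ⟨x, y, h, _, hx, hy⟩ := exists_word_eq α L n p
  rw [wordCoeff, h, hp]
  exact vac_nP_beta (fun l => hx _ fun i _ => commute_beta_field _ _ _)
    (fun l => hy _ fun i _ => commute_beta_field _ _ _) _

instance : Fld (nP 1 psi (vertexExp α)) := inferInstance

/-- With `β` split off as the first factor, `V` may be replaced by `:ψ⁺ e^{iα₋φ}:` in vacuum
expectation values. -/
theorem screening_eq_add : screening α
    = nP 1 psiPlus (vertexExp α) + nP 1 beta (nP 1 psi (vertexExp α)) := by
  have h := nP_assoc (x := beta) (g := psi) (f := vertexExp α) (h := 0) (σ := 1) (τ := 1) (ε := 1)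
    (by norm_num) (by norm_num) (by norm_num) (brk_vertexExp α noOsc_beta) (brk_psi_vertexExp α)
    (by rw [mul_one]; exact (brk_zero_left 1 psi).symm00 (by norm_num))
  simp only [mul_one, one_mul, nP_zero_right, smul_zero, add_zero] at h
  rw [screening_eq, fS, nP_add_left, h]

/-- Contracting the leftmost letter. -/
theorem wordCoeff_vac_contract {z : Modes} [Fld z] {ε c : Letter → ℂ} {d : Letter → Letter}
    (hz : ∀ l, Acts α (z l) l ε c d) (hE : c .E = 0) (hc : ∀ l n, Commute (z l) (vertexExp α n))
    (hl : ∀ l < 0, ∀ u, z l u vac = 0) (hr : ∀ l : ℕ, z l (Finsupp.single vac 1) = 0)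
    {m : ℕ} {L : Fin m → Letter} {p : Fin m} (hp : ∀ i < p, L i = .E)
    (hL : ∀ (x y : Op) (n : Fin m → ℤ), (∀ l, Commute (beta l) x) → (∀ l, Commute (beta l) y) →
      (x * (L p).field α (n p) * y) (Finsupp.single vac 1) vac
        = (x * nP 1 z (vertexExp α) (n p) * y) (Finsupp.single vac 1) vac) (n : Fin m → ℤ) :
    wordCoeff α L vac vac n = ∑' l : ℕ, ∑ i ∈ Finset.univ.filter (p < ·),
      (∏ k ∈ Finset.univ.filter (· < i), ε (Function.update L p .E k)) * c (Function.update L p .E i) *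
        wordCoeff α (Function.update (Function.update L p .E) i (d (Function.update L p .E i))) vac vac
          (n - Pi.single p 1 - Pi.single p (l : ℤ) + Pi.single i (l : ℤ)) := by
  obtain ⟨x, y, h, h', hx, hy⟩ := exists_word_eq α L n p
  have hzx : ∀ l, Commute (z l) x := fun l => hx _ fun i hi => by rw [hp i hi]; exact hc l _
  rw [wordCoeff, h, hL x y n (fun l => hx _ fun i _ => commute_beta_field _ _ _)
    (fun l => hy _ fun i _ => commute_beta_field _ _ _),
    vac_nP x y fun l hl' u => by rw [← (hzx l).eq, Module.End.mul_apply, hl l hl']]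
  refine tsum_congr fun l => ?_
  -- To the left of `p` there are only exponentials, which commute with `z`. So `z_l` can be put in
  -- front of the word with `p` replaced by an exponential, and then be moved to the right, where
  -- the vacuum kills it.
  have e1 : x * vertexExp α (n p - l - 1) * z l * y
      = z l * word α (Function.update L p .E) (Function.update n p (n p - l - 1)) := by
    rw [h', ← mul_assoc, ← mul_assoc, (hzx l).eq, mul_assoc x (z l)]
    change _ = x * (z l * vertexExp α _) * y
    rw [(hc l _).eq, mul_assoc x]
  rw [e1, (hz l).mul_word, LinearMap.add_apply, LinearMap.smul_apply, Module.End.mul_apply, hr, map_zero,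
    smul_zero, zero_add, LinearMap.sum_apply, Finsupp.finsetSum_apply, Finset.sum_filter]
  refine Finset.sum_congr rfl fun i _ => ?_
  rw [LinearMap.smul_apply, Finsupp.smul_apply, smul_eq_mul]
  split_ifs with hi
  · rw [wordCoeff]
    congr 4
    funext k
    by_cases hk : k = p
    · subst hk
      simp [hi.ne]; ring
    · simp [hk]
  · have : Function.update L p Letter.E i = .E := by
      rcases eq_or_lt_of_le (not_lt.1 hi) with rfl | h
      · simp
      · rw [Function.update_of_ne h.ne, hp i h]
    rw [this, hE, mul_zero, zero_mul]

/-- Contracting the leftmost letter. -/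
theorem wordCoeff_vac_mem_of_contract {z : Modes} [Fld z] {ε c : Letter → ℂ} {d : Letter → Letter}
    (hz : ∀ l, Acts α (z l) l ε c d) (hE : c .E = 0) (hc : ∀ l n, Commute (z l) (vertexExp α n))
    (hd : ∀ X, d X = .E ∨ d X = .B)
    (hl : ∀ l < 0, ∀ u, z l u vac = 0) (hr : ∀ l : ℕ, z l (Finsupp.single vac 1) = 0)
    {m : ℕ} {L : Fin m → Letter} {p : Fin m} (hp : ∀ i < p, L i = .E) (hpL : L p ≠ .E)
    (hL : ∀ (x y : Op) (n : Fin m → ℤ), (∀ l, Commute (beta l) x) → (∀ l, Commute (beta l) y) →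
      (x * (L p).field α (n p) * y) (Finsupp.single vac 1) vac
        = (x * nP 1 z (vertexExp α) (n p) * y) (Finsupp.single vac 1) vac)
    (ih : ∀ L' : Fin m → Letter, support L' ⊆ (support L).erase p →
      wordCoeff α L' vac vac ∈ pairSpan (alphaMinus α ^ 2) (support L')) :
    wordCoeff α L vac vac ∈ pairSpan (alphaMinus α ^ 2) (support L) := by
  set ρ := alphaMinus α ^ 2
  set f : Fin m → (Fin m → ℤ) → ℂ := fun i =>
    wordCoeff α (Function.update (Function.update L p .E) i (d (Function.update L p .E i))) vac vac
    with hf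
  -- A contracted letter becomes an exponential, which leaves the support, or it becomes `:β
  -- e^{iα₋φ}:`, and then the expectation value is zero. So both variables are free for a new
  -- matched pair.
  have hf' : ∀ i, f i ∈ pairSpan ρ (((support L).erase p).erase i) := by
    intro i
    rcases hd (Function.update L p .E i) with h | h
    · have hs : support (Function.update (Function.update L p .E) i
          (d (Function.update L p .E i))) ⊆ ((support L).erase p).erase i := fun k hk => by
        rw [mem_support, h] at hk
        have hki : k ≠ i := by rintro rfl; rw [Function.update_self] at hk; exact hk rfl
        rw [Function.update_of_ne hki] at hk
        have hkp : k ≠ p := by rintro rfl; rw [Function.update_self] at hk; exact hk rfl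
        rw [Function.update_of_ne hkp] at hk
        rw [Finset.mem_erase, Finset.mem_erase, mem_support]
        exact ⟨hki, hkp, hk⟩
      exact pairSpan_mono hs (ih _ (hs.trans (Finset.erase_subset _ _)))
    · rw [hf]
      dsimp only
      rw [wordCoeff_vac_of_B (p := i) (by rw [Function.update_self, h])]
      exact zero_mem _
  set s : Fin m → ℂ := fun i => (∏ k ∈ Finset.univ.filter (· < i), ε (Function.update L p .E k))
    * c (Function.update L p .E i) with hs
  have key : wordCoeff α L vac vac = ∑ i ∈ Finset.univ.filter (p < ·), s i • fun n : Fin m → ℤ =>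
      (fun n => ∑' l : ℕ, f i (n - Pi.single p (l : ℤ) + Pi.single i (l : ℤ))) (n + -Pi.single p 1) := by
    funext n
    rw [wordCoeff_vac_contract hz hE hc hl hr hp hL n, Finset.sum_apply]
    rw [Summable.tsum_finsetSum]
    · refine Finset.sum_congr rfl fun i _ => ?_
      rw [Pi.smul_apply, smul_eq_mul, tsum_mul_left]
      simp only [← sub_eq_add_neg]
      rfl
    · intro i hi
      exact (summable_of_finite_support (finite_support_divide (hf' i) (Finset.mem_filter.1 hi).2
        (n - Pi.single p 1))).mul_left _
  rw [key]
  refine Submodule.sum_mem _ fun i hi => ?_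
  have hpi := (Finset.mem_filter.1 hi).2
  -- Exponentials are not contracted. Otherwise `p` and `i` both lie in the support, and the sum
  -- over `l` divides by `1 - z_i/z_p`.
  by_cases hi0 : L i = .E
  · have : s i = 0 := by
      simp only [hs]
      rw [Function.update_of_ne hpi.ne', hi0, hE, mul_zero]
    rw [this, zero_smul]; exact zero_mem _
  refine Submodule.smul_mem _ _ (shift_mem_pairSpan
    (divide_mem_pairSpan (hf' i) hpi ?_ ?_ ?_ ?_ ?_) (-Pi.single p 1))
  · simp
  · simp
  · exact (Finset.erase_subset _ _).trans (Finset.erase_subset _ _)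
  · exact mem_support.2 hpL
  · exact mem_support.2 hi0

/-- Induction on the number of letters other than exponentials. The leftmost one acts as `ψ⁺` or `ψ`
times the exponential and is contracted with a later letter; both drop out afterwards, which is why
each variable occurs in at most one pole. -/
theorem wordCoeff_vac_mem {m : ℕ} (L : Fin m → Letter) :
    wordCoeff α L vac vac ∈ pairSpan (alphaMinus α ^ 2) (support L) := by
  obtain ⟨N, hN⟩ : ∃ N, (support L).card = N := ⟨_, rfl⟩
  induction N using Nat.strong_induction_on generalizing L with
  | _ N ih =>
  by_cases hB : ∃ p, L p = .B
  · obtain ⟨p, hp⟩ := hB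
    rw [wordCoeff_vac_of_B hp]; exact zero_mem _
  rcases (support L).eq_empty_or_nonempty with h | h
  · have h1 : L = fun _ => .E := by
      funext i
      by_contra h'
      have := mem_support.2 h'
      rw [h] at this
      exact absurd this (Finset.notMem_empty _)
    have h2 : wordCoeff α L vac vac = fun n => pairCoeff ∅ (alphaMinus α ^ 2) (n - (-1)) := by
      funext n
      rw [sub_neg_eq_add, ← expWord_vac, wordCoeff, h1]; rfl
    rw [h2]
    exact pairCoeff_mem _ ⟨fun e he => absurd he (Finset.notMem_empty _),
      fun e he => absurd he (Finset.notMem_empty _)⟩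
  · set p := (support L).min' h with hpdef
    have hpL : L p ≠ .E := mem_support.1 ((support L).min'_mem h)
    have hp : ∀ i < p, L i = .E := fun i hi => by
      by_contra h'
      exact absurd ((support L).min'_le i (mem_support.2 h')) (not_le.2 hi)
    have ih' : ∀ L' : Fin m → Letter, support L' ⊆ (support L).erase p →
        wordCoeff α L' vac vac ∈ pairSpan (alphaMinus α ^ 2) (support L') := fun L' hL' =>
      ih _ (lt_of_le_of_lt (Finset.card_le_card hL')
        (by rw [← hN]; exact Finset.card_erase_lt_of_mem (mem_support.2 hpL))) L' rfl
    have hcases : L p = .V ∨ L p = .P := by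
      rcases hLp : L p with _ | _ | _ | _
      · exact .inl rfl
      · exact absurd ⟨p, hLp⟩ hB
      · exact .inr rfl
      · exact absurd hLp hpL
    rcases hcases with hV | hP
    · refine wordCoeff_vac_mem_of_contract (acts_psiPlus α) rfl
        (fun l n => NoOsc.vertexExp α (noOsc_psiPlus l) n) (fun X => by cases X <;> simp)
        (fun l hl => psiPlus_coeff_vac hl) (fun l => psiPlus_vac (Int.natCast_nonneg l)) hp hpL ?_ ih'
      intro x y n hx hy
      rw [hV]
      change (x * screening α (n p) * y) _ _ = _
      rw [screening_eq_add, Pi.add_apply, mul_add, add_mul, LinearMap.add_apply, Finsupp.add_apply,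
        vac_nP_beta hx hy, add_zero]
    · refine wordCoeff_vac_mem_of_contract (acts_psi α) rfl
        (fun l n => NoOsc.vertexExp α (noOsc_psi l) n) (fun X => by cases X <;> simp)
        (fun l hl => psi_coeff_vac hl) (fun l => psi_vac (Int.natCast_nonneg l)) hp hpL ?_ ih'
      intro x y n hx hy
      rw [hP]; rfl

/-- The matrix coefficients of words are combinations of coefficients of products of powers of
differences. -/
theorem wordCoeff_mem {m : ℕ} (L : Fin m → Letter) (v w : Occ) :
    wordCoeff α L v w ∈ pairSpan (alphaMinus α ^ 2) (support L) :=
  wordCoeff_mem_of_vac wordCoeff_vac_mem L v w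

end

/-! ### Growth of the coefficients -/

/-- The squared modulus is `1 - 2 Re ρ / x + |ρ|²/x²`, to which `1 + y ≤ exp y` applies. -/
theorem norm_one_sub_div_le (ρ : ℂ) {x : ℝ} (hx : 0 < x) :
    ‖1 - ρ / x‖ ≤ Real.exp (-ρ.re / x + ‖ρ‖ ^ 2 / 2 * (1 / x ^ 2)) := by
  have h1 : ‖1 - ρ / x‖ ^ 2 = 1 - 2 * ρ.re / x + ‖ρ‖ ^ 2 / x ^ 2 := by
    rw [← Complex.normSq_eq_norm_sq, ← Complex.normSq_eq_norm_sq, Complex.normSq_apply,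
      Complex.normSq_apply, Complex.sub_re, Complex.sub_im, Complex.div_ofReal_re,
      Complex.div_ofReal_im, Complex.one_re, Complex.one_im]
    field_simp
    ring
  have h2 : ‖1 - ρ / x‖ ^ 2 ≤ Real.exp (-ρ.re / x + ‖ρ‖ ^ 2 / 2 * (1 / x ^ 2)) ^ 2 := by
    rw [h1, ← Real.exp_nat_mul]
    have := Real.add_one_le_exp (-2 * ρ.re / x + ‖ρ‖ ^ 2 / x ^ 2)
    calc _ = -2 * ρ.re / x + ‖ρ‖ ^ 2 / x ^ 2 + 1 := by ring
      _ ≤ _ := this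
      _ = _ := by congr 1; push_cast; ring
  exact le_of_sq_le_sq h2 (Real.exp_pos _).le

/-- In the product of the factors the terms `1/x²` are summable, and the harmonic sum is at least
`log (1 + n)`; positivity of `Re ρ` turns this into an upper bound. -/
theorem exists_norm_coeffOne_le (ρ : ℂ) (hρ : 0 < ρ.re) :
    ∃ C : ℝ, 0 < C ∧ ∀ n : ℕ, ‖coeffOne ρ n‖ ≤ C * (1 + n : ℝ) ^ (-ρ.re) := by
  have hs : Summable fun n : ℕ => 1 / ((n : ℝ) + 1) ^ 2 := by
    have := (summable_nat_add_iff 1).2 (Real.summable_one_div_nat_pow.2 (by norm_num : 1 < 2))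
    exact this.congr fun n => by push_cast; rfl
  refine ⟨Real.exp (‖ρ‖ ^ 2 / 2 * ∑' n : ℕ, 1 / ((n : ℝ) + 1) ^ 2), Real.exp_pos _, fun n => ?_⟩
  have h1 : ‖coeffOne ρ n‖ ≤ Real.exp (∑ k ∈ Finset.range n,
      (-ρ.re / (k + 1) + ‖ρ‖ ^ 2 / 2 * (1 / ((k : ℝ) + 1) ^ 2))) := by
    rw [coeffOne, norm_prod, Real.exp_sum]
    refine Finset.prod_le_prod (fun _ _ => norm_nonneg _) fun k _ => ?_
    have := norm_one_sub_div_le ρ (x := (k : ℝ) + 1) (by positivity)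
    push_cast at this
    exact this
  refine h1.trans ?_
  rw [Real.rpow_def_of_pos (by positivity), ← Real.exp_add, Finset.sum_add_distrib, ← Finset.mul_sum]
  refine Real.exp_le_exp.2 ?_
  have h2 : ∑ k ∈ Finset.range n, 1 / ((k : ℝ) + 1) ^ 2 ≤ ∑' n : ℕ, 1 / ((n : ℝ) + 1) ^ 2 :=
    hs.sum_le_tsum _ fun _ _ => by positivity
  have h3 : Real.log (1 + n) ≤ ∑ k ∈ Finset.range n, 1 / ((k : ℝ) + 1) := by
    have := log_add_one_le_harmonic n
    rw [harmonic] at this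
    push_cast at this
    simpa [add_comm] using this
  have h4 : ∑ k ∈ Finset.range n, -ρ.re / ((k : ℝ) + 1)
      = -ρ.re * ∑ k ∈ Finset.range n, 1 / ((k : ℝ) + 1) := by
    rw [Finset.mul_sum]
    exact Finset.sum_congr rfl fun k _ => by ring
  rw [h4]
  have h5 : ‖ρ‖ ^ 2 / 2 * ∑ k ∈ Finset.range n, 1 / ((k : ℝ) + 1) ^ 2
      ≤ ‖ρ‖ ^ 2 / 2 * ∑' n : ℕ, 1 / ((n : ℝ) + 1) ^ 2 := by gcongr
  nlinarith

/-- The extra factor `ρ/n` improves the exponent by one. The power of `2` in the constant accounts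
for the shift from `n` to `n + 1`. -/
theorem exists_norm_coeffZero_le (ρ : ℂ) (hρ : 0 < ρ.re) :
    ∃ C : ℝ, 0 < C ∧ ∀ n : ℕ, ‖coeffZero ρ n‖ ≤ C * (1 + n : ℝ) ^ (-1 - ρ.re) := by
  obtain ⟨C, hC, h⟩ := exists_norm_coeffOne_le ρ hρ
  refine ⟨1 + ‖ρ‖ * C * 2 ^ (1 + ρ.re), by positivity, fun n => ?_⟩
  cases n with
  | zero =>
    simp only [coeffZero, norm_one, Nat.cast_zero, add_zero, Real.one_rpow, mul_one]
    have : 0 ≤ ‖ρ‖ * C * 2 ^ (1 + ρ.re) := by positivity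
    linarith
  | succ n =>
    have hn : (0 : ℝ) < n + 1 := by positivity
    have e1 : ‖coeffZero ρ (n + 1)‖ = ‖ρ‖ / (n + 1) * ‖coeffOne ρ n‖ := by
      rw [coeffZero, norm_mul, norm_div, norm_neg]
      congr 2
      rw [← Nat.cast_add_one, Complex.norm_natCast]; push_cast; rfl
    have e2 : ((n : ℝ) + 1) ^ (-1 - ρ.re) ≤ 2 ^ (1 + ρ.re) * (1 + (n + 1 : ℕ) : ℝ) ^ (-1 - ρ.re) := by
      have h2 : (1 + (n + 1 : ℕ) : ℝ) ≤ 2 * (n + 1) := by push_cast; linarith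
      have h3 : (2 * ((n : ℝ) + 1)) ^ (-1 - ρ.re) ≤ (1 + (n + 1 : ℕ) : ℝ) ^ (-1 - ρ.re) :=
        Real.rpow_le_rpow_of_nonpos (by positivity) h2 (by linarith)
      rw [Real.mul_rpow (by norm_num) hn.le] at h3
      calc ((n : ℝ) + 1) ^ (-1 - ρ.re)
          = 2 ^ (1 + ρ.re) * (2 ^ (-1 - ρ.re) * ((n : ℝ) + 1) ^ (-1 - ρ.re)) := by
            rw [← mul_assoc, ← Real.rpow_add (by norm_num), show 1 + ρ.re + (-1 - ρ.re) = 0 by ring,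
              Real.rpow_zero, one_mul]
        _ ≤ _ := by gcongr
    calc ‖coeffZero ρ (n + 1)‖ ≤ ‖ρ‖ / (n + 1) * (C * (1 + n : ℝ) ^ (-ρ.re)) := by
          rw [e1]; gcongr; exact h n
      _ = ‖ρ‖ * C * ((n : ℝ) + 1) ^ (-1 - ρ.re) := by
          rw [show -1 - ρ.re = -ρ.re - 1 by ring, Real.rpow_sub_one hn.ne', add_comm (1 : ℝ)]
          field_simp
      _ ≤ ‖ρ‖ * C * (2 ^ (1 + ρ.re) * (1 + (n + 1 : ℕ) : ℝ) ^ (-1 - ρ.re)) := by gcongr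
      _ ≤ _ := by
          rw [add_mul, ← mul_assoc]
          have : 0 ≤ 1 * (1 + (n + 1 : ℕ) : ℝ) ^ (-1 - ρ.re) := by positivity
          linarith

theorem summable_one_add_rpow {s : ℝ} (hs : 0 < s) : Summable fun n : ℕ => (1 + n : ℝ) ^ (-1 - s) := by
  have := (summable_nat_add_iff 1).2 (Real.summable_nat_rpow.2 (by linarith : -1 - s < -1))
  exact this.congr fun n => by push_cast; rw [add_comm]

theorem summable_norm_coeffZero (ρ : ℂ) (hρ : 0 < ρ.re) : Summable fun n => ‖coeffZero ρ n‖ := by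
  obtain ⟨C, _, h⟩ := exists_norm_coeffZero_le ρ hρ
  exact Summable.of_nonneg_of_le (fun _ => norm_nonneg _) h ((summable_one_add_rpow hρ).mul_left C)

/-- The value of `(1-x)^ρ` at `x = 1`: the partial sums are the coefficients of `(1-x)^(ρ-1)`, which
tend to zero. The vanishing of all boundary terms rests on this. -/
theorem tsum_coeffZero (ρ : ℂ) (hρ : 0 < ρ.re) : ∑' n, coeffZero ρ n = 0 := by
  have h1 := (summable_norm_coeffZero ρ hρ).of_norm.hasSum.tendsto_sum_nat
  have h2 := h1.comp (tendsto_add_atTop_nat 1)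
  simp only [Function.comp_def, sum_coeffZero] at h2
  refine tendsto_nhds_unique h2 ?_
  obtain ⟨C, _, h⟩ := exists_norm_coeffOne_le ρ hρ
  refine squeeze_zero_norm h ?_
  rw [← mul_zero C]
  refine Tendsto.const_mul C ((tendsto_rpow_neg_atTop hρ).comp ?_)
  exact tendsto_atTop_add_const_left _ _ tendsto_natCast_atTop_atTop

/-! ### Summation over matrices -/

open scoped ENNReal

section Tsum

variable {ι : Type} [Fintype ι] [DecidableEq ι]

theorem funSplitAt_symm_eq_update (e : ι) (k l : ℕ) (x : {j // j ≠ e} → ℕ) :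
    (Equiv.funSplitAt e ℕ).symm (k, x)
      = Function.update ((Equiv.funSplitAt e ℕ).symm (l, x)) e k := by
  funext i
  by_cases h : i = e
  · subst h; simp [Equiv.funSplitAt, Equiv.piSplitAt]
  · simp [Equiv.funSplitAt, Equiv.piSplitAt, h]

theorem funSplitAt_symm_self (e : ι) (k : ℕ) (x : {j // j ≠ e} → ℕ) :
    (Equiv.funSplitAt e ℕ).symm (k, x) e = k := by
  simp [Equiv.funSplitAt, Equiv.piSplitAt]

/-- Summing over one coordinate first. -/
theorem tsum_update (e : ι) (G : (ι → ℕ) → ℝ≥0∞) :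
    ∑' a, G a = ∑' a, if a e = 0 then ∑' k, G (Function.update a e k) else 0 := by
  have hp : ∀ F : ℕ × ({j // j ≠ e} → ℕ) → ℝ≥0∞, ∑' c, F c = ∑' k, ∑' x, F (k, x) := fun F =>
    ENNReal.tsum_prod (f := fun k x => F (k, x))
  rw [← (Equiv.funSplitAt e ℕ).symm.tsum_eq G, ← (Equiv.funSplitAt e ℕ).symm.tsum_eq, hp,
    ENNReal.tsum_comm, hp]
  refine Eq.trans ?_ (tsum_eq_single 0 ?_).symm
  · refine tsum_congr fun x => ?_
    rw [if_pos (funSplitAt_symm_self e 0 x)]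
    exact tsum_congr fun k => by rw [funSplitAt_symm_eq_update e k 0]
  · intro k hk
    refine (tsum_congr fun x => if_neg ?_).trans tsum_zero
    rwa [funSplitAt_symm_self]

/-- Summing over one coordinate first, with a factor independent of it. -/
theorem tsum_mul_le (e : ι) {F R : (ι → ℕ) → ℝ≥0∞} {K : ℝ≥0∞}
    (hR : ∀ a k, R (Function.update a e k) = R a)
    (hF : ∀ a, ∑' k, F (Function.update a e k) ≤ K) :
    ∑' a, F a * R a ≤ K * ∑' a, if a e = 0 then R a else 0 := by
  rw [tsum_update e, ← ENNReal.tsum_mul_left]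
  refine ENNReal.tsum_le_tsum fun a => ?_
  split_ifs
  · simp only [hR]
    rw [ENNReal.tsum_mul_right]
    gcongr
    exact hF a
  · simp

/-- The partial sums over the matrices supported on `s`. -/
def partialSum (t : ι → (ι → ℕ) → ℝ≥0∞) (s : Finset ι) : ℝ≥0∞ :=
  ∑' a, (∏ e ∈ s, t e a) * ∏ e ∈ sᶜ, if a e = 0 then 1 else 0

theorem partialSum_empty (t : ι → (ι → ℕ) → ℝ≥0∞) : partialSum t ∅ = 1 := by
  rw [partialSum, tsum_eq_single 0]
  · simp
  · intro a ha
    obtain ⟨e, he⟩ := Function.ne_iff.1 ha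
    have : ∏ e ∈ (∅ : Finset ι)ᶜ, (if a e = 0 then (1 : ℝ≥0∞) else 0) = 0 :=
      Finset.prod_eq_zero (i := e) (by simp) (if_neg he)
    rw [this, mul_zero]

/-- The coordinate `e` is summed first; this is legitimate as a bound when no factor in `s` depends
on it. -/
theorem partialSum_insert_le {t : ι → (ι → ℕ) → ℝ≥0∞} {s : Finset ι} {e : ι} (he : e ∉ s) {K : ℝ≥0∞}
    (ht : ∀ e' ∈ s, ∀ a k, t e' (Function.update a e k) = t e' a)
    (hK : ∀ a, ∑' k, t e (Function.update a e k) ≤ K) :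
    partialSum t (insert e s) ≤ K * partialSum t s := by
  have h1 : ∀ a : ι → ℕ, (∏ e' ∈ insert e s, t e' a) * ∏ e' ∈ (insert e s)ᶜ, (if a e' = 0 then 1 else 0)
      = t e a * ((∏ e' ∈ s, t e' a) * ∏ e' ∈ (insert e s)ᶜ, (if a e' = 0 then (1 : ℝ≥0∞) else 0)) := by
    intro a; rw [Finset.prod_insert he, mul_assoc]
  rw [partialSum]
  simp only [h1]
  refine (tsum_mul_le e (fun a k => ?_) hK).trans ?_
  · congr 1
    · exact Finset.prod_congr rfl fun e' he' => ht e' he' a k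
    · refine Finset.prod_congr rfl fun e' he' => ?_
      have : e' ≠ e := by
        rintro rfl
        exact (Finset.mem_compl.1 he') (Finset.mem_insert_self _ _)
      rw [Function.update_of_ne this]
  · rw [partialSum]
    gcongr with a
    have h2 : sᶜ = insert e (insert e s)ᶜ := by
      ext i
      by_cases h : i = e
      · subst h; simp [he]
      · simp [h]
    rw [h2, Finset.prod_insert (by simp)]
    split_ifs <;> simp

/-- Bounding a sum over all coordinates, where the coordinates in `M` are summed first. -/
theorem tsum_prod_lt_top {t : ι → (ι → ℕ) → ℝ≥0∞} {K : ℝ≥0∞} (hK : K ≠ ⊤) (M : Finset ι)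
    (h1 : ∀ e ∉ M, ∀ e', e' ≠ e → ∀ a k, t e (Function.update a e' k) = t e a)
    (h2 : ∀ e ∈ M, ∀ e' ∈ M, e' ≠ e → ∀ a k, t e (Function.update a e' k) = t e a)
    (h3 : ∀ e a, ∑' k, t e (Function.update a e k) ≤ K) : ∑' a, ∏ e, t e a < ⊤ := by
  -- The coordinates are added in the reverse of the order of summation: first those outside `M`,
  -- whose factors depend on nothing else.
  have A : ∀ s : Finset ι, Disjoint s M → partialSum t s < ⊤ := by
    intro s
    induction s using Finset.induction_on with
    | empty => intro _; rw [partialSum_empty]; exact ENNReal.one_lt_top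
    | insert e s he ih =>
      intro hs
      rw [Finset.disjoint_insert_left] at hs
      refine (partialSum_insert_le he (fun e' he' a k => h1 e' (Finset.disjoint_left.1 hs.2 he') e ?_ a k)
        (h3 e)).trans_lt (ENNReal.mul_lt_top hK.lt_top (ih hs.2))
      rintro rfl; exact he he'
  -- The factors in `M` may depend on the coordinates outside `M`, but not on each other, so they
  -- come last here and are summed first.
  have B : ∀ s : Finset ι, s ⊆ M → partialSum t (s ∪ Mᶜ) < ⊤ := by
    intro s
    induction s using Finset.induction_on with
    | empty =>
      intro _
      rw [Finset.empty_union]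
      exact A _ disjoint_compl_left
    | insert e s he ih =>
      intro hs
      rw [Finset.insert_subset_iff] at hs
      rw [Finset.insert_union]
      have he' : e ∉ s ∪ Mᶜ := by simp [he, hs.1]
      refine (partialSum_insert_le he' (fun e' h' a k => ?_) (h3 e)).trans_lt
        (ENNReal.mul_lt_top hK.lt_top (ih hs.2))
      have hne : e ≠ e' := by rintro rfl; exact he' h'
      by_cases hM : e' ∈ M
      · exact h2 e' hM e hs.1 hne a k
      · exact h1 e' hM e hne a k
  have h := B M subset_rfl
  rw [Finset.union_compl, partialSum] at h
  simpa using h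

end Tsum

/-- Summability of a family of products, coordinate by coordinate. -/
theorem summable_prod_of_coordinates {ι : Type} [Fintype ι] [DecidableEq ι] {t : ι → (ι → ℕ) → ℝ}
    {K : ℝ} (M : Finset ι) (h0 : ∀ e a, 0 ≤ t e a)
    (h1 : ∀ e ∉ M, ∀ e', e' ≠ e → ∀ a k, t e (Function.update a e' k) = t e a)
    (h2 : ∀ e ∈ M, ∀ e' ∈ M, e' ≠ e → ∀ a k, t e (Function.update a e' k) = t e a)
    (h3 : ∀ e a, Summable (fun k => t e (Function.update a e k)) ∧
      ∑' k, t e (Function.update a e k) ≤ K) : Summable fun a => ∏ e, t e a := by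
  have h := tsum_prod_lt_top (t := fun e a => ENNReal.ofReal (t e a)) (K := ENNReal.ofReal K)
    ENNReal.ofReal_ne_top M (fun e he e' hee a k => by rw [h1 e he e' hee])
    (fun e he e' he' hee a k => by rw [h2 e he e' he' hee]) fun e a => by
      rw [← ENNReal.ofReal_tsum_of_nonneg (fun k => h0 e _) (h3 e a).1]
      exact ENNReal.ofReal_le_ofReal (h3 e a).2
  have h4 : ∀ a, ∏ e, ENNReal.ofReal (t e a) = ENNReal.ofReal (∏ e, t e a) := fun a =>
    (ENNReal.ofReal_prod_of_nonneg fun e _ => h0 e a).symm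
  simp only [h4] at h
  have h5 := ENNReal.summable_toReal h.ne
  exact h5.congr fun a => ENNReal.toReal_ofReal (Finset.prod_nonneg fun e _ => h0 e a)

section

variable {m : ℕ}

/-- If `u ≤ v`, replace `v⁻¹` by `u⁻¹`; otherwise replace `u^(-s)` by `v^(-s)`. -/
theorem rpow_mul_le {s u v : ℝ} (hs : 0 < s) (hu : 0 < u) (hv : 0 < v) :
    u ^ (-s) * v⁻¹ ≤ u ^ (-1 - s) + v ^ (-1 - s) := by
  have e : ∀ x : ℝ, 0 < x → x ^ (-1 - s) = x ^ (-s) * x⁻¹ := fun x hx => by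
    rw [show -1 - s = -s - 1 by ring, Real.rpow_sub_one hx.ne', div_eq_mul_inv]
  rcases le_total u v with h | h
  · have : u ^ (-s) * v⁻¹ ≤ u ^ (-1 - s) := by
      rw [e u hu]
      gcongr
    linarith [Real.rpow_pos_of_pos hv (-1 - s)]
  · have : u ^ (-s) * v⁻¹ ≤ v ^ (-1 - s) := by
      rw [e v hv]
      have := Real.rpow_le_rpow_of_nonpos hv h (neg_nonpos.2 hs.le)
      gcongr
    linarith [Real.rpow_pos_of_pos hu (-1 - s)]

theorem summable_int_rpow {s : ℝ} (hs : 0 < s) : Summable fun n : ℤ => (1 + |(n : ℝ)|) ^ (-1 - s) := by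
  refine Summable.of_nat_of_neg ?_ ?_
  · exact (summable_one_add_rpow hs).congr fun n => by simp
  · exact (summable_one_add_rpow hs).congr fun n => by simp

/-- The sum over a matched coordinate. -/
theorem exists_tsum_coeffOne_le (ρ : ℂ) (hρ : 0 < ρ.re) : ∃ K : ℝ, ∀ (x ε : ℤ), ε ≠ 0 →
    Summable (fun k : ℕ => ‖coeffOne ρ k‖ * (1 + |((x + ε * k : ℤ) : ℝ)|)⁻¹) ∧
      ∑' k : ℕ, ‖coeffOne ρ k‖ * (1 + |((x + ε * k : ℤ) : ℝ)|)⁻¹ ≤ K := by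
  obtain ⟨C, hC, h⟩ := exists_norm_coeffOne_le ρ hρ
  refine ⟨C * (∑' k : ℕ, (1 + k : ℝ) ^ (-1 - ρ.re) + ∑' n : ℤ, (1 + |(n : ℝ)|) ^ (-1 - ρ.re)),
    fun x ε hε => ?_⟩
  have hinj : Function.Injective fun k : ℕ => x + ε * k := by
    intro k l hkl
    have := mul_left_cancel₀ hε (add_left_cancel hkl)
    exact_mod_cast this
  have s1 := summable_one_add_rpow hρ
  have s2 := (summable_int_rpow hρ).comp_injective hinj
  have s3 := (s1.add s2).mul_left C
  have hle : ∀ k : ℕ, ‖coeffOne ρ k‖ * (1 + |((x + ε * k : ℤ) : ℝ)|)⁻¹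
      ≤ C * ((1 + k : ℝ) ^ (-1 - ρ.re) + (1 + |((x + ε * k : ℤ) : ℝ)|) ^ (-1 - ρ.re)) := fun k => by
    calc _ ≤ C * (1 + k : ℝ) ^ (-ρ.re) * (1 + |((x + ε * k : ℤ) : ℝ)|)⁻¹ := by
          gcongr
          exact h k
      _ = C * ((1 + k : ℝ) ^ (-ρ.re) * (1 + |((x + ε * k : ℤ) : ℝ)|)⁻¹) := mul_assoc _ _ _
      _ ≤ _ := by
          gcongr
          exact rpow_mul_le hρ (by positivity) (by positivity)
  have s4 := Summable.of_nonneg_of_le (fun k => by positivity) hle s3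
  refine ⟨s4, (s4.tsum_le_tsum hle s3).trans ?_⟩
  have s5 := s1.tsum_add s2
  simp only [Function.comp_def] at s5
  rw [tsum_mul_left, s5]
  gcongr
  exact tsum_comp_le_tsum_of_inj (summable_int_rpow hρ) (fun _ => by positivity) hinj

theorem netShift_update (a : Fin m × Fin m → ℕ) (e : Fin m × Fin m) (k : ℕ) :
    netShift (Function.update a e k) = netShift (Function.update a e 0) + Pi.single e.1 (k : ℤ)
      - Pi.single e.2 (k : ℤ) := by
  have : Function.update a e k = Function.update a e 0 + Pi.single (e.1, e.2) k := by
    funext i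
    by_cases h : i = e
    · subst h; simp
    · rw [Function.update_of_ne h, Pi.add_apply, Function.update_of_ne h, Pi.single_eq_of_ne h, add_zero]
  rw [this, netShift_add_single]

theorem netShift_update_of_ne (a : Fin m × Fin m → ℕ) (e : Fin m × Fin m) (k : ℕ) {i : Fin m}
    (h1 : i ≠ e.1) (h2 : i ≠ e.2) : netShift (Function.update a e k) i = netShift a i := by
  have h := fun k => congrFun (netShift_update a e k) i
  simp only [Pi.add_apply, Pi.sub_apply, Pi.single_eq_of_ne h1, Pi.single_eq_of_ne h2, add_zero,
    sub_zero] at h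
  rw [h k, ← h (a e), Function.update_eq_self]

theorem summable_indicator : Summable (fun k : ℕ => ‖if k = 0 then (1 : ℂ) else 0‖) ∧
    ∑' k : ℕ, ‖if k = 0 then (1 : ℂ) else 0‖ = 1 := by
  have : ∀ k : ℕ, ‖if k = 0 then (1 : ℂ) else 0‖ = if k = 0 then 1 else 0 := fun k => by
    split_ifs <;> simp
  simp only [this]
  exact ⟨(hasSum_ite_eq 0 1).summable, tsum_ite_eq 0 _⟩

/-- Decay in one variable of each matched pair makes the sum over matrices absolutely convergent. -/
theorem summable_pairWeight_mul {ρ : ℂ} (hρ : 0 < ρ.re) {U : Finset (Fin m)}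
    {M : Finset (Fin m × Fin m)} (hM : IsMatching U M) {τ : Fin m × Fin m → Fin m}
    (hτ : ∀ e ∈ M, τ e = e.1 ∨ τ e = e.2) {W : (Fin m → ℤ) → ℂ} {C : ℝ}
    (hW : ∀ n, ‖W n‖ ≤ C * ∏ e ∈ M, (1 + |(n (τ e) : ℝ)|)⁻¹) (b : Fin m → ℤ) :
    Summable fun a : Fin m × Fin m → ℕ => pairWeight M ρ a * W (netShift a + b) := by
  obtain ⟨K, hK⟩ := exists_tsum_coeffOne_le ρ hρ
  set t : Fin m × Fin m → (Fin m × Fin m → ℕ) → ℝ := fun e a => ‖pairFactor M ρ e (a e)‖ *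
    if e ∈ M then (1 + |(((netShift a + b) (τ e) : ℤ) : ℝ)|)⁻¹ else 1 with ht
  have hs : Summable fun a => ∏ e, t e a := by
    refine summable_prod_of_coordinates (K := max K (max (∑' n, ‖coeffZero ρ n‖) 1)) M
      (fun e a => by simp only [ht]; positivity) ?_ ?_ ?_
    · intro e he e' hee a k
      simp only [ht, if_neg he, Function.update_of_ne hee.symm]
    · intro e he e' he' hee a k
      have h := hM.2 e he e' he' hee.symm
      have hi : τ e ≠ e'.1 ∧ τ e ≠ e'.2 := by
        rcases hτ e he with h' | h' <;> rw [h']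
        · exact ⟨h.1, h.2.1⟩
        · exact ⟨h.2.2.1, h.2.2.2⟩
      simp only [ht, if_pos he, Function.update_of_ne hee.symm, Pi.add_apply,
        netShift_update_of_ne a e' k hi.1 hi.2]
    · intro e a
      by_cases he : e ∈ M
      · have hlt := (hM.1 e he).1
        -- Raising the entry `e` by `k` moves the index of the chosen end of the pair by `k` or
        -- `-k`, so decay in that index becomes decay in `k`, uniformly in the other entries.
        obtain ⟨ε, hε, hx⟩ : ∃ ε : ℤ, ε ≠ 0 ∧ ∀ k : ℕ, (netShift (Function.update a e k) + b) (τ e)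
            = (netShift (Function.update a e 0) + b) (τ e) + ε * k := by
          rcases hτ e he with h' | h' <;> rw [h']
          · refine ⟨1, one_ne_zero, fun k => ?_⟩
            rw [netShift_update a e k]
            simp only [Pi.add_apply, Pi.sub_apply, Pi.single_eq_same, Pi.single_eq_of_ne hlt.ne]
            ring
          · refine ⟨-1, by norm_num, fun k => ?_⟩
            rw [netShift_update a e k]
            simp only [Pi.add_apply, Pi.sub_apply, Pi.single_eq_same, Pi.single_eq_of_ne hlt.ne']
            ring
        have h := hK ((netShift (Function.update a e 0) + b) (τ e)) ε hε
        have e1 : ∀ k : ℕ, t e (Function.update a e k) = ‖coeffOne ρ k‖ *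
            (1 + |(((netShift (Function.update a e 0) + b) (τ e) + ε * k : ℤ) : ℝ)|)⁻¹ := fun k => by
          simp only [ht, if_pos he, Function.update_self, pairFactor, if_pos hlt]
          rw [hx k]
        simp only [e1]
        exact ⟨h.1, h.2.trans (le_max_left _ _)⟩
      · simp only [ht, if_neg he, Function.update_self, pairFactor, mul_one]
        by_cases hlt : e.1 < e.2
        · simp only [if_pos hlt]
          exact ⟨summable_norm_coeffZero ρ hρ, (le_max_left _ _).trans (le_max_right _ _)⟩
        · simp only [if_neg hlt]
          have := summable_indicator
          exact ⟨this.1, this.2.le.trans ((le_max_right _ _).trans (le_max_right _ _))⟩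
  refine Summable.of_norm_bounded (hs.mul_left C) fun a => ?_
  rw [norm_mul, pairWeight, norm_prod]
  calc _ ≤ (∏ e, ‖pairFactor M ρ e (a e)‖) *
        (C * ∏ e ∈ M, (1 + |(((netShift a + b) (τ e) : ℤ) : ℝ)|)⁻¹) := by
        gcongr
        exact hW _
    _ = _ := by
        simp only [ht]
        rw [Finset.prod_mul_distrib, Finset.prod_ite_mem, Finset.univ_inter]
        ring

/-- Collecting equal monomials. -/
theorem hasSum_pairCoeff_mul {M : Finset (Fin m × Fin m)} {ρ : ℂ} {b : Fin m → ℤ}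
    {g : (Fin m → ℤ) → ℂ}
    (h : Summable fun a : Fin m × Fin m → ℕ => pairWeight M ρ a * g (netShift a + b)) :
    HasSum (fun n => pairCoeff M ρ (n - b) * g n) (∑' a, pairWeight M ρ a * g (netShift a + b)) := by
  obtain ⟨H, hH⟩ : ∃ H : (Fin m → ℤ) × (Fin m × Fin m → ℕ) → ℂ, ∀ n a, H (n, a)
      = if netShift a = n - b then pairWeight M ρ a * g n else 0 :=
    ⟨fun x => if netShift x.2 = x.1 - b then pairWeight M ρ x.2 * g x.1 else 0,
      fun _ _ => by dsimp only⟩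
  have hinj : Function.Injective fun a : Fin m × Fin m → ℕ => (netShift a + b, a) :=
    fun a a' haa => (Prod.mk.inj haa).2
  have hsub : ∀ x ∉ Set.range fun a : Fin m × Fin m → ℕ => (netShift a + b, a), H x = 0 := by
    rintro ⟨n, a⟩ hx
    rw [hH, if_neg]
    intro h
    exact hx ⟨a, by simp [h]⟩
  have hHa : ∀ a, H (netShift a + b, a) = pairWeight M ρ a * g (netShift a + b) := fun a => by
    rw [hH, if_pos (add_sub_cancel_right _ _).symm]
  have hs : HasSum H (∑' a, pairWeight M ρ a * g (netShift a + b)) := by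
    refine (hinj.hasSum_iff hsub).1 ?_
    simp only [Function.comp_def, hHa]
    exact h.hasSum
  refine (hs.prod_fiberwise (g := fun n => pairCoeff M ρ (n - b) * g n) fun n => ?_)
  have hfin := finite_pairWeight M ρ (n - b)
  have h0 : Summable fun a => if netShift a = n - b then pairWeight M ρ a else 0 :=
    summable_of_finite_support hfin
  have h1 := h0.hasSum.mul_right (g n)
  simp only [ite_mul, zero_mul] at h1
  simp only [hH]
  exact h1

end

/-! ### Vanishing at coinciding points and Abel limits -/

section

variable {m : ℕ}

theorem pairWeight_update {M : Finset (Fin m × Fin m)} {ρ : ℂ} {p q : Fin m} (hpq : p < q)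
    (hM : (p, q) ∉ M) (a : Fin m × Fin m → ℕ) (k : ℕ) :
    pairWeight M ρ (Function.update a (p, q) k)
      = coeffZero ρ k * ∏ e ∈ Finset.univ.erase (p, q), pairFactor M ρ e (a e) := by
  rw [pairWeight, ← Finset.mul_prod_erase _ _ (Finset.mem_univ (p, q)), Function.update_self]
  congr 1
  · rw [pairFactor, if_pos hpq, if_neg hM]
  · exact Finset.prod_congr rfl fun e he => by rw [Function.update_of_ne (Finset.mem_erase.1 he).1]

/-- The sum over an unmatched pair vanishes, as a power with positive exponent vanishes at `0`. -/
theorem tsum_pairWeight_mul_eq_zero {M : Finset (Fin m × Fin m)} {ρ : ℂ} (hρ : 0 < ρ.re)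
    {p q : Fin m} (hpq : p < q) (hM : (p, q) ∉ M) {G : (Fin m → ℤ) → ℂ}
    (hG : ∀ (n : Fin m → ℤ) (k : ℤ), G (n + Pi.single p k - Pi.single q k) = G n) (b : Fin m → ℤ)
    (hs : Summable fun a : Fin m × Fin m → ℕ => pairWeight M ρ a * G (netShift a + b)) :
    ∑' a : Fin m × Fin m → ℕ, pairWeight M ρ a * G (netShift a + b) = 0 := by
  set S := (Equiv.funSplitAt (p, q) ℕ).symm
  set F : (Fin m × Fin m → ℕ) → ℂ := fun a => pairWeight M ρ a * G (netShift a + b) with hF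
  have h1 : Summable fun x : {j // j ≠ (p, q)} → ℕ × ℕ => (0 : ℂ) := summable_zero
  have h2 : Summable fun x : ({j // j ≠ (p, q)} → ℕ) × ℕ => F (S (x.2, x.1)) :=
    ((Equiv.prodComm _ _).trans S).summable_iff.2 hs
  have h3 : ∑' a, F a = ∑' x : ({j // j ≠ (p, q)} → ℕ) × ℕ, F (S (x.2, x.1)) :=
    (((Equiv.prodComm _ _).trans S).tsum_eq F).symm
  rw [h3, h2.tsum_prod]
  refine (tsum_congr fun x => ?_).trans tsum_zero
  -- By invariance `G` does not see the entry `(p, q)`, so the inner sum is a constant times the sum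
  -- of all coefficients of `(1-x)^ρ`.
  have h4 : ∀ k, F (S (k, x)) = coeffZero ρ k *
      ((∏ e ∈ Finset.univ.erase (p, q), pairFactor M ρ e (S (0, x) e)) *
        G (netShift (Function.update (S (0, x)) (p, q) 0) + b)) := fun k => by
    simp only [hF]
    rw [funSplitAt_symm_eq_update (p, q) k 0 x, pairWeight_update hpq hM, netShift_update,
      show netShift (Function.update (S (0, x)) (p, q) 0) + Pi.single p (k : ℤ) - Pi.single q (k : ℤ) + b
        = netShift (Function.update (S (0, x)) (p, q) 0) + b + Pi.single p (k : ℤ)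
          - Pi.single q (k : ℤ) by abel, hG, mul_assoc]
  simp only [h4]
  rw [tsum_mul_right, tsum_coeffZero ρ hρ, zero_mul]

/-- The weight of the radial variables. -/
def height (n : Fin m → ℤ) : ℤ := ∑ i : Fin m, ((i : ℕ) : ℤ) * n i

theorem height_add (n n' : Fin m → ℤ) : height (n + n') = height n + height n' := by
  simp [height, mul_add, Finset.sum_add_distrib]

theorem neg_height_netShift (a : Fin m × Fin m → ℕ) :
    -height (netShift a) = ∑ e : Fin m × Fin m, (((e.2 : ℕ) : ℤ) - (e.1 : ℕ)) * a e := by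
  rw [height, sum_mul_netShift (fun i : Fin m => ((i : ℕ) : ℤ)), ← Finset.sum_neg_distrib]
  exact Finset.sum_congr rfl fun e _ => by ring

/-- With `|z_i| = r^i` the modulus of a power of `z_j/z_i` for `i < j` is at most one; this is what
dominates the series as `r` tends to `1`. -/
theorem height_netShift_nonpos {M : Finset (Fin m × Fin m)} {ρ : ℂ} {a : Fin m × Fin m → ℕ}
    (h : pairWeight M ρ a ≠ 0) : height (netShift a) ≤ 0 := by
  rw [← neg_nonneg, neg_height_netShift]
  refine Finset.sum_nonneg fun e _ => ?_
  by_cases he : e.1 < e.2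
  · have : (e.1 : ℕ) < e.2 := he
    exact mul_nonneg (by omega) (by positivity)
  · simp [pairWeight_ne_zero h he]

theorem exists_norm_pairFactor_le (M : Finset (Fin m × Fin m)) {ρ : ℂ} (hρ : 0 < ρ.re) :
    ∃ C : ℝ, 0 < C ∧ ∀ e k, ‖pairFactor M ρ e k‖ ≤ C := by
  obtain ⟨C, hC, h⟩ := exists_norm_coeffOne_le ρ hρ
  obtain ⟨C', hC', h'⟩ := exists_norm_coeffZero_le ρ hρ
  have hle : ∀ (k : ℕ) (s : ℝ), s ≤ 0 → (1 + k : ℝ) ^ s ≤ 1 := fun k s hs =>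
    Real.rpow_le_one_of_one_le_of_nonpos (by linarith [(Nat.cast_nonneg k : (0 : ℝ) ≤ k)]) hs
  refine ⟨C + C' + 1, by positivity, fun e k => ?_⟩
  rw [pairFactor]
  split_ifs
  · have := mul_le_mul_of_nonneg_left (hle k (-ρ.re) (by linarith)) hC.le
    linarith [h k]
  · have := mul_le_mul_of_nonneg_left (hle k (-1 - ρ.re) (by linarith)) hC'.le
    linarith [h' k]
  · rw [norm_one]; linarith
  · rw [norm_zero]; linarith

/-- Convergence of the product expansions for radially ordered variables. -/
theorem summable_pairWeight_exp (M : Finset (Fin m × Fin m)) {ρ : ℂ} (hρ : 0 < ρ.re) {x : ℝ}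
    (hx : x < 0) (b : Fin m → ℤ) : Summable fun a : Fin m × Fin m → ℕ =>
      pairWeight M ρ a * ((Real.exp (-x * height (netShift a + b)) : ℝ) : ℂ) := by
  obtain ⟨C, hC, hle⟩ := exists_norm_pairFactor_le M hρ
  set y : Fin m × Fin m → ℝ := fun e => (((e.2 : ℕ) : ℝ) - (e.1 : ℕ)) with hy
  set t : Fin m × Fin m → (Fin m × Fin m → ℕ) → ℝ := fun e a =>
    ‖pairFactor M ρ e (a e)‖ * Real.exp (x * (y e * a e)) with ht
  have hgeo : Summable fun k : ℕ => Real.exp (x * k) := by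
    have := summable_geometric_of_lt_one (Real.exp_pos x).le (by rw [← Real.exp_zero]; exact Real.exp_lt_exp.2 hx)
    exact this.congr fun k => by rw [← Real.exp_nat_mul, mul_comm]
  have hs : Summable fun a => ∏ e, t e a := by
    refine summable_prod_of_coordinates (K := max (∑' k : ℕ, C * Real.exp (x * k)) 1) ∅
      (fun e a => by simp only [ht]; positivity) ?_ (fun e he => absurd he (Finset.notMem_empty _)) ?_
    · intro e _ e' hee a k
      simp only [ht, Function.update_of_ne hee.symm]
    · intro e a
      simp only [ht, Function.update_self]
      by_cases hlt : e.1 < e.2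
      · have h1 : 1 ≤ y e := by
          have : (e.1 : ℕ) + 1 ≤ e.2 := hlt
          have : ((e.1 : ℕ) : ℝ) + 1 ≤ (e.2 : ℕ) := by exact_mod_cast this
          simp only [hy]; linarith
        have h2 : ∀ k : ℕ, ‖pairFactor M ρ e k‖ * Real.exp (x * (y e * k)) ≤ C * Real.exp (x * k) := by
          intro k
          have : x * (y e * k) ≤ x * k := by
            have : (k : ℝ) ≤ y e * k := le_mul_of_one_le_left (Nat.cast_nonneg k) h1
            exact mul_le_mul_of_nonpos_left this hx.le
          exact mul_le_mul (hle e k) (Real.exp_le_exp.2 this) (Real.exp_pos _).le hC.le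
        have h3 := Summable.of_nonneg_of_le (fun k => by positivity) h2 (hgeo.mul_left C)
        exact ⟨h3, (h3.tsum_le_tsum h2 (hgeo.mul_left C)).trans (le_max_left _ _)⟩
      · have h1 : ∀ k : ℕ, ‖pairFactor M ρ e k‖ * Real.exp (x * (y e * k))
            = ‖if k = 0 then (1 : ℂ) else 0‖ := fun k => by
          rw [pairFactor, if_neg hlt]
          split_ifs with hk
          · simp [hk]
          · simp
        simp only [h1]
        exact ⟨summable_indicator.1, summable_indicator.2.le.trans (le_max_right _ _)⟩
  refine Summable.of_norm ((hs.mul_right (Real.exp (-x * height b))).congr fun a => ?_)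
  rw [norm_mul, Complex.norm_real, Real.norm_of_nonneg (Real.exp_pos _).le, pairWeight, norm_prod]
  simp only [ht]
  rw [Finset.prod_mul_distrib, ← Real.exp_sum, mul_assoc, ← Real.exp_add, height_add]
  congr 2
  have := congrArg (Int.cast : ℤ → ℝ) (neg_height_netShift a)
  push_cast at this ⊢
  rw [← Finset.mul_sum, ← this]
  ring

theorem summable_mul_exp {ρ : ℂ} (hρ : 0 < ρ.re) {U : Finset (Fin m)} {f : (Fin m → ℤ) → ℂ}
    (hf : f ∈ pairSpan ρ U) {x : ℝ} (hx : x < 0) :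
    Summable fun n => f n * ((Real.exp (-x * height n) : ℝ) : ℂ) := by
  refine pairSpan_induction (p := fun f => Summable fun n => f n * ((Real.exp (-x * height n) : ℝ) : ℂ))
    ?_ ?_ ?_ ?_ hf
  · simpa using summable_zero
  · intro f g _ _ h1 h2
    exact (h1.add h2).congr fun n => (add_mul _ _ _).symm
  · intro c f h
    exact (h.mul_left c).congr fun n => (mul_assoc _ _ _).symm
  · intro M b _
    exact (hasSum_pairCoeff_mul (g := fun n => ((Real.exp (-x * height n) : ℝ) : ℂ))
      (summable_pairWeight_exp M hρ hx b)).summable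

/-- Decay of a function in one variable of each matched pair. -/
def Decays (U : Finset (Fin m)) (W : (Fin m → ℤ) → ℂ) : Prop :=
  ∀ M, IsMatching U M → ∃ (τ : Fin m × Fin m → Fin m) (C : ℝ), (∀ e ∈ M, τ e = e.1 ∨ τ e = e.2) ∧
    ∀ n, ‖W n‖ ≤ C * ∏ e ∈ M, (1 + |(n (τ e) : ℝ)|)⁻¹

theorem Decays.summable_pairWeight {ρ : ℂ} (hρ : 0 < ρ.re) {U : Finset (Fin m)}
    {W : (Fin m → ℤ) → ℂ} (hW : Decays U W) {M : Finset (Fin m × Fin m)} (hM : IsMatching U M)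
    (b : Fin m → ℤ) :
    Summable fun a : Fin m × Fin m → ℕ => pairWeight M ρ a * W (netShift a + b) := by
  obtain ⟨τ, C, hτ, hC⟩ := hW M hM
  exact summable_pairWeight_mul hρ hM hτ hC b

theorem Decays.summable {ρ : ℂ} (hρ : 0 < ρ.re) {U : Finset (Fin m)} {W : (Fin m → ℤ) → ℂ}
    (hW : Decays U W) {f : (Fin m → ℤ) → ℂ} (hf : f ∈ pairSpan ρ U) :
    Summable fun n => f n * W n := by
  refine pairSpan_induction (p := fun f => Summable fun n => f n * W n) ?_ ?_ ?_ ?_ hf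
  · simpa using summable_zero
  · intro f g _ _ h1 h2
    exact (h1.add h2).congr fun n => (add_mul _ _ _).symm
  · intro c f h
    exact (h.mul_left c).congr fun n => (mul_assoc _ _ _).symm
  · intro M b hM
    exact (hasSum_pairCoeff_mul (hW.summable_pairWeight hρ hM b)).summable

/-- Since one of `p`, `q` is outside `U`, the pair is unmatched in every spanning function and
carries the exponent `ρ`, not `ρ - 1`. -/
theorem Decays.tsum_eq_zero {ρ : ℂ} (hρ : 0 < ρ.re) {U : Finset (Fin m)} {W : (Fin m → ℤ) → ℂ}
    (hW : Decays U W) {p q : Fin m} (hpq : p < q) (hU : p ∉ U ∨ q ∉ U)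
    (hG : ∀ (n : Fin m → ℤ) (k : ℤ), W (n + Pi.single p k - Pi.single q k) = W n)
    {f : (Fin m → ℤ) → ℂ} (hf : f ∈ pairSpan ρ U) : ∑' n, f n * W n = 0 := by
  refine pairSpan_induction (p := fun f => ∑' n, f n * W n = 0) ?_ ?_ ?_ ?_ hf
  · simp
  · intro f g h1 h2 h3 h4
    simp only [Pi.add_apply, add_mul]
    rw [(hW.summable hρ h1).tsum_add (hW.summable hρ h2), h3, h4, add_zero]
  · intro c f h
    simp only [Pi.smul_apply, smul_eq_mul, mul_assoc]
    rw [tsum_mul_left, h, mul_zero]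
  · intro M b hM
    have hs := hW.summable_pairWeight hρ hM b
    rw [(hasSum_pairCoeff_mul hs).tsum_eq]
    refine tsum_pairWeight_mul_eq_zero hρ hpq (fun h => ?_) hG b hs
    have := (hM.1 _ h).2
    rcases hU with hU | hU
    · exact hU this.1
    · exact hU this.2

/-- Abel's theorem by dominated convergence: wherever the weight is nonzero the radial factor of the
matrix part is at most one. The factor from the translation `b` is split off and tends to one by
itself. -/
theorem tendsto_tsum_pairWeight_exp {ρ : ℂ} {M : Finset (Fin m × Fin m)} {W : (Fin m → ℤ) → ℂ}
    {b : Fin m → ℤ}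
    (hs : Summable fun a : Fin m × Fin m → ℕ => pairWeight M ρ a * W (netShift a + b)) :
    Tendsto (fun x : ℝ => ∑' a : Fin m × Fin m → ℕ, pairWeight M ρ a *
        (W (netShift a + b) * ((Real.exp (-x * height (netShift a + b)) : ℝ) : ℂ)))
      (𝓝[<] 0) (𝓝 (∑' a : Fin m × Fin m → ℕ, pairWeight M ρ a * W (netShift a + b))) := by
  have h1 : Tendsto (fun x : ℝ => ∑' a : Fin m × Fin m → ℕ, pairWeight M ρ a * W (netShift a + b) *
      ((Real.exp (-x * height (netShift a)) : ℝ) : ℂ))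
      (𝓝[<] 0) (𝓝 (∑' a : Fin m × Fin m → ℕ, pairWeight M ρ a * W (netShift a + b))) := by
    refine tendsto_tsum_of_dominated_convergence
      (bound := fun a => ‖pairWeight M ρ a * W (netShift a + b)‖) hs.norm (fun a => ?_) ?_
    · have : Tendsto (fun x : ℝ => pairWeight M ρ a * W (netShift a + b) *
        ((Real.exp (-x * height (netShift a)) : ℝ) : ℂ)) (𝓝 0)
        (𝓝 (pairWeight M ρ a * W (netShift a + b) *
          ((Real.exp (-0 * height (netShift a)) : ℝ) : ℂ))) := by
        refine Continuous.tendsto ?_ 0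
        fun_prop
      simp only [neg_zero, zero_mul, Real.exp_zero, Complex.ofReal_one, mul_one] at this
      exact this.mono_left nhdsWithin_le_nhds
    · filter_upwards [self_mem_nhdsWithin] with x hx a
      by_cases hw : pairWeight M ρ a = 0
      · simp [hw]
      · rw [norm_mul, Complex.norm_real, Real.norm_of_nonneg (Real.exp_pos _).le]
        refine mul_le_of_le_one_right (norm_nonneg _) (Real.exp_le_one_iff.2 ?_)
        have h : ((height (netShift a) : ℤ) : ℝ) ≤ 0 := by exact_mod_cast height_netShift_nonpos hw
        have hx' : x < 0 := hx
        nlinarith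
  have h2 : Tendsto (fun x : ℝ => ((Real.exp (-x * height b) : ℝ) : ℂ)) (𝓝[<] 0) (𝓝 1) := by
    have : Tendsto (fun x : ℝ => ((Real.exp (-x * height b) : ℝ) : ℂ)) (𝓝 0)
        (𝓝 ((Real.exp (-0 * height b) : ℝ) : ℂ)) := by
      refine Continuous.tendsto ?_ 0
      fun_prop
    simp only [neg_zero, zero_mul, Real.exp_zero, Complex.ofReal_one] at this
    exact this.mono_left nhdsWithin_le_nhds
  have h3 := h1.mul h2
  rw [mul_one] at h3
  refine h3.congr fun x => ?_
  rw [← tsum_mul_right]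
  refine tsum_congr fun a => ?_
  rw [height_add]
  push_cast
  rw [mul_add, Complex.exp_add]
  ring

theorem Decays.tendsto {ρ : ℂ} (hρ : 0 < ρ.re) {U : Finset (Fin m)} {W : (Fin m → ℤ) → ℂ}
    (hW : Decays U W) {f : (Fin m → ℤ) → ℂ} (hf : f ∈ pairSpan ρ U) :
    (∀ x < 0, Summable fun n => f n * (W n * ((Real.exp (-x * height n) : ℝ) : ℂ))) ∧
    Tendsto (fun x : ℝ => ∑' n, f n * (W n * ((Real.exp (-x * height n) : ℝ) : ℂ)))
      (𝓝[<] 0) (𝓝 (∑' n, f n * W n)) := by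
  refine pairSpan_induction (p := fun f =>
    (∀ x < 0, Summable fun n => f n * (W n * ((Real.exp (-x * height n) : ℝ) : ℂ))) ∧
    Tendsto (fun x : ℝ => ∑' n, f n * (W n * ((Real.exp (-x * height n) : ℝ) : ℂ)))
      (𝓝[<] 0) (𝓝 (∑' n, f n * W n))) ?_ ?_ ?_ ?_ hf
  · refine ⟨fun x _ => by simpa using summable_zero, by simp⟩
  · rintro f g hf hg ⟨h1, h2⟩ ⟨h3, h4⟩
    simp only [Pi.add_apply, add_mul]
    refine ⟨fun x hx => (h1 x hx).add (h3 x hx), ?_⟩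
    rw [(hW.summable hρ hf).tsum_add (hW.summable hρ hg)]
    refine (h2.add h4).congr' ?_
    filter_upwards [self_mem_nhdsWithin] with x hx
    exact ((h1 x hx).tsum_add (h3 x hx)).symm
  · rintro c f ⟨h1, h2⟩
    simp only [Pi.smul_apply, smul_eq_mul, mul_assoc, tsum_mul_left]
    exact ⟨fun x hx => (h1 x hx).mul_left c, h2.const_mul c⟩
  · intro M b hM
    have hs := hW.summable_pairWeight hρ hM b
    have h1 : ∀ x < 0, Summable fun a : Fin m × Fin m → ℕ => pairWeight M ρ a *
        (W (netShift a + b) * ((Real.exp (-x * height (netShift a + b)) : ℝ) : ℂ)) := by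
      intro x hx
      refine Summable.of_norm_bounded (hs.norm.mul_right (Real.exp (-x * height b))) fun a => ?_
      by_cases hw : pairWeight M ρ a = 0
      · simp [hw]
      · rw [← mul_assoc, norm_mul, Complex.norm_real, Real.norm_of_nonneg (Real.exp_pos _).le]
        refine mul_le_mul_of_nonneg_left (Real.exp_le_exp.2 ?_) (norm_nonneg _)
        have h : ((height (netShift a) : ℤ) : ℝ) ≤ 0 := by exact_mod_cast height_netShift_nonpos hw
        rw [height_add]
        push_cast
        nlinarith
    refine ⟨fun x hx => (hasSum_pairCoeff_mul
      (g := fun n => W n * ((Real.exp (-x * height n) : ℝ) : ℂ)) (h1 x hx)).summable, ?_⟩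
    rw [(hasSum_pairCoeff_mul hs).tsum_eq]
    refine (tendsto_tsum_pairWeight_exp hs).congr' ?_
    filter_upwards [self_mem_nhdsWithin] with x hx
    exact (hasSum_pairCoeff_mul (g := fun n => W n * ((Real.exp (-x * height n) : ℝ) : ℂ))
      (h1 x hx)).tsum_eq.symm

end

/-! ### The contour integral of a monomial -/

/-- The integral of `z ^ (lam - 1)` once around the unit circle, up to a factor. -/
def circleInt (lam : ℂ) : ℂ :=
  ∫ θ in Set.Icc (0 : ℝ) (2 * Real.pi), Complex.exp (lam * (θ * Complex.I))

/-- The multiplied form also covers `lam = 0`, and for integer exponents it says that the integral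
vanishes unless the exponent is zero. -/
theorem mul_circleInt (lam : ℂ) : lam * circleInt lam
    = (Complex.exp (2 * Real.pi * Complex.I * lam) - 1) / Complex.I := by
  by_cases h : lam = 0
  · simp [h]
  have hc : lam * Complex.I ≠ 0 := mul_ne_zero h Complex.I_ne_zero
  rw [circleInt, integral_Icc_eq_integral_Ioc,
    ← intervalIntegral.integral_of_le (by positivity : (0 : ℝ) ≤ 2 * Real.pi)]
  have e : ∀ θ : ℝ, lam * (θ * Complex.I) = lam * Complex.I * θ := fun θ => by ring
  simp only [e]
  rw [integral_exp_mul_complex hc]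
  push_cast
  rw [mul_zero, Complex.exp_zero,
    show lam * Complex.I * (2 * Real.pi) = 2 * Real.pi * Complex.I * lam by ring]
  field_simp

theorem norm_circleInt_le (lam : ℂ) :
    ‖circleInt lam‖ ≤ 2 * Real.pi * Real.exp (2 * Real.pi * |lam.im|) := by
  have hv : volume.real (Set.Icc (0 : ℝ) (2 * Real.pi)) = 2 * Real.pi := by
    rw [Real.volume_real_Icc_of_le (by positivity), sub_zero]
  have h := norm_setIntegral_le_of_norm_le_const (μ := volume) (s := Set.Icc (0 : ℝ) (2 * Real.pi))
    (f := fun θ : ℝ => Complex.exp (lam * (θ * Complex.I))) (C := Real.exp (2 * Real.pi * |lam.im|))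
    measure_Icc_lt_top fun θ hθ => ?_
  · rw [hv] at h
    exact h.trans_eq (mul_comm _ _)
  · rw [Complex.norm_exp]
    refine Real.exp_le_exp.2 ?_
    have : (lam * (θ * Complex.I)).re = -lam.im * θ := by simp
    rw [this]
    calc -lam.im * θ ≤ |lam.im| * θ := mul_le_mul_of_nonneg_right (neg_le_abs _) hθ.1
      _ ≤ |lam.im| * (2 * Real.pi) := mul_le_mul_of_nonneg_left hθ.2 (abs_nonneg _)
      _ = _ := mul_comm _ _

theorem circleInt_int_mul (N : ℤ) : (N : ℂ) * circleInt N = 0 := by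
  rw [mul_circleInt, show 2 * Real.pi * Complex.I * (N : ℂ) = N * (2 * Real.pi * Complex.I) by ring,
    Complex.exp_int_mul_two_pi_mul_I, sub_self, zero_div]

theorem exp_sub_int (μ : ℂ) (n : ℤ) : Complex.exp (2 * Real.pi * Complex.I * (μ - n))
    = Complex.exp (2 * Real.pi * Complex.I * μ) := by
  rw [mul_sub, Complex.exp_sub, show 2 * Real.pi * Complex.I * (n : ℂ) = n * (2 * Real.pi * Complex.I) by ring,
    Complex.exp_int_mul_two_pi_mul_I, div_one]

/-- By periodicity the numerator `exp (2πi(μ - n)) - 1` is independent of `n`, which gives the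
decay; the trivial bound takes care of small `μ - n`. -/
theorem exists_norm_circleInt_le (μ : ℂ) :
    ∃ C : ℝ, 0 ≤ C ∧ ∀ n : ℤ, ‖circleInt (μ - n)‖ ≤ C * (1 + |(n : ℝ)|)⁻¹ := by
  refine ⟨(1 + ‖μ‖) * (2 * Real.pi * Real.exp (2 * Real.pi * |μ.im|)) +
    ‖(Complex.exp (2 * Real.pi * Complex.I * μ) - 1) / Complex.I‖, by positivity, fun n => ?_⟩
  have h1 := norm_circleInt_le (μ - n)
  have h2 := congrArg norm (mul_circleInt (μ - n))
  rw [exp_sub_int, norm_mul] at h2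
  simp only [Complex.sub_im, Complex.intCast_im, sub_zero] at h1
  have h3 : |(n : ℝ)| ≤ ‖μ‖ + ‖μ - n‖ := by
    have : ((n : ℝ) : ℂ) = μ - (μ - n) := by push_cast; ring
    rw [← Real.norm_eq_abs, ← Complex.norm_real, this]
    exact norm_sub_le _ _
  rw [← div_eq_mul_inv, le_div_iff₀ (by positivity), ← h2]
  calc ‖circleInt (μ - n)‖ * (1 + |(n : ℝ)|)
      ≤ ‖circleInt (μ - n)‖ * (1 + (‖μ‖ + ‖μ - n‖)) := by gcongr
    _ = (1 + ‖μ‖) * ‖circleInt (μ - n)‖ + ‖μ - n‖ * ‖circleInt (μ - n)‖ := by ring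
    _ ≤ _ := by gcongr

/-! ### Decay of the contour weights and vanishing of total derivatives -/

section

variable {m : ℕ}

/-- Each matched pair is assigned an end in `S`. Matched pairs are disjoint, so the assignment is
injective, and the remaining factors, at most one, are dropped. -/
theorem decays_of_norm_le {U S : Finset (Fin m)} {W : (Fin m → ℤ) → ℂ} {A : ℝ} (hA : 0 ≤ A)
    (hW : ∀ n, ‖W n‖ ≤ A * ∏ i ∈ S, (1 + |(n i : ℝ)|)⁻¹)
    (hS : ∀ p q, p < q → p ∈ U → q ∈ U → p ∈ S ∨ q ∈ S) : Decays U W := by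
  intro M hM
  set τ : Fin m × Fin m → Fin m := fun e => if e.2 ∈ S then e.2 else e.1 with hτ
  have hτS : ∀ e ∈ M, τ e ∈ S := fun e he => by
    simp only [hτ]
    split_ifs with h
    · exact h
    · obtain ⟨h1, h2, h3⟩ := hM.1 e he
      exact (hS _ _ h1 h2 h3).resolve_right h
  have hτ2 : ∀ e, τ e = e.1 ∨ τ e = e.2 := fun e => by
    simp only [hτ]
    split_ifs
    · exact .inr rfl
    · exact .inl rfl
  have hinj : Set.InjOn τ M := fun e he f hf hef => by
    by_contra h
    obtain ⟨h1, h2, h3, h4⟩ := hM.2 e he f hf h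
    rcases hτ2 e with h5 | h5 <;> rcases hτ2 f with h6 | h6 <;> rw [h5, h6] at hef
    exacts [h1 hef, h2 hef, h3 hef, h4 hef]
  refine ⟨τ, A, fun e _ => hτ2 e, fun n => (hW n).trans (mul_le_mul_of_nonneg_left ?_ hA)⟩
  rw [← Finset.prod_image (s := M) (g := τ) (f := fun i => (1 + |(n i : ℝ)|)⁻¹) hinj]
  have hsub : M.image τ ⊆ S := Finset.image_subset_iff.2 hτS
  rw [← Finset.prod_sdiff hsub]
  refine mul_le_of_le_one_left (Finset.prod_nonneg fun _ _ => by positivity)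
    (Finset.prod_le_one (fun _ _ => by positivity) fun i _ => ?_)
  exact inv_le_one_of_one_le₀ (by linarith [abs_nonneg (n i : ℝ)])

variable [NeZero m]

/-- The contour integral of `∏ z_i ^ (μ_i - n_i - 1)`, up to a factor. -/
def contourWeight (μ : Fin m → ℂ) (n : Fin m → ℤ) : ℂ :=
  circleInt (∑ i, (μ i - n i)) * ∏ i ∈ Finset.univ.erase 0, circleInt (μ i - n i)

theorem sum_sub_eq (μ : Fin m → ℂ) (n : Fin m → ℤ) :
    ∑ i, (μ i - n i) = ∑ i, μ i - ((∑ i, n i : ℤ) : ℂ) := by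
  rw [Finset.sum_sub_distrib]; push_cast; rfl

theorem exists_norm_contour_le (μ : Fin m → ℂ) (S : Finset (Fin m)) : ∃ A : ℝ, 0 ≤ A ∧
    ∀ n : Fin m → ℤ, ‖circleInt (∑ i, (μ i - n i)) * ∏ i ∈ S, circleInt (μ i - n i)‖
      ≤ A * ∏ i ∈ S, (1 + |(n i : ℝ)|)⁻¹ := by
  choose C hC0 hC using fun i => exists_norm_circleInt_le (μ i)
  obtain ⟨D, hD0, hD⟩ := exists_norm_circleInt_le (∑ i, μ i)
  refine ⟨D * ∏ i ∈ S, C i, mul_nonneg hD0 (Finset.prod_nonneg fun i _ => hC0 i), fun n => ?_⟩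
  rw [norm_mul, norm_prod, mul_assoc, ← Finset.prod_mul_distrib]
  have h1 : ‖circleInt (∑ i, (μ i - n i))‖ ≤ D := by
    rw [sum_sub_eq]
    refine (hD _).trans (mul_le_of_le_one_right hD0 (inv_le_one_of_one_le₀ ?_))
    linarith [abs_nonneg ((∑ i, n i : ℤ) : ℝ)]
  exact mul_le_mul h1 (Finset.prod_le_prod (fun _ _ => norm_nonneg _) fun i _ => hC i (n i))
    (Finset.prod_nonneg fun _ _ => norm_nonneg _) hD0

/-- Decay is available in every variable except the one with index `0`, and the larger index of a
pair is never `0`. -/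
theorem decays_contourWeight (μ : Fin m → ℂ) (U : Finset (Fin m)) : Decays U (contourWeight μ) := by
  obtain ⟨A, hA, h⟩ := exists_norm_contour_le μ (Finset.univ.erase 0)
  refine decays_of_norm_le hA h fun p q hpq _ _ => .inr ?_
  rw [Finset.mem_erase]
  refine ⟨?_, Finset.mem_univ _⟩
  rintro rfl
  exact absurd hpq (Fin.not_lt_zero p)

/-- The factor of a derivative in `z_q` cancels the integral over `z_q` and leaves the boundary
values, which do not depend on `n q` except through the total degree. -/
theorem mul_contourWeight (μ : Fin m → ℂ) {q : Fin m} (hq : q ≠ 0) (n : Fin m → ℤ) :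
    (μ q - n q) * contourWeight μ n
      = (Complex.exp (2 * Real.pi * Complex.I * μ q) - 1) / Complex.I *
        (circleInt (∑ i, (μ i - n i)) * ∏ i ∈ (Finset.univ.erase 0).erase q, circleInt (μ i - n i)) := by
  have hq' : q ∈ (Finset.univ.erase 0 : Finset (Fin m)) := Finset.mem_erase.2 ⟨hq, Finset.mem_univ _⟩
  rw [contourWeight, ← Finset.mul_prod_erase _ _ hq', ← exp_sub_int (μ q) (n q), ← mul_circleInt]
  ring

/-- Decay in the variable `q` is lost as well. A pair with larger end `q` then uses its smaller end,
which is not `0` because `0` and `q` are not both in `U`. -/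
theorem decays_mul_contourWeight (μ : Fin m → ℂ) {U : Finset (Fin m)} {q : Fin m} (hq : q ≠ 0)
    (hU : 0 ∉ U ∨ q ∉ U) : Decays U fun n => (μ q - n q) * contourWeight μ n := by
  obtain ⟨A, hA, h⟩ := exists_norm_contour_le μ ((Finset.univ.erase 0).erase q)
  refine decays_of_norm_le
    (A := ‖(Complex.exp (2 * Real.pi * Complex.I * μ q) - 1) / Complex.I‖ * A)
    (S := (Finset.univ.erase 0).erase q) (by positivity) (fun n => ?_) fun p p' hpp hp hp' => ?_
  · rw [mul_contourWeight μ hq, norm_mul]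
    exact (mul_le_mul_of_nonneg_left (h n) (norm_nonneg
      ((Complex.exp (2 * Real.pi * Complex.I * μ q) - 1) / Complex.I))).trans_eq (mul_assoc _ _ _).symm
  · simp only [Finset.mem_erase, Finset.mem_univ, and_true]
    have hp0 : p' ≠ 0 := by rintro rfl; exact absurd hpp (Fin.not_lt_zero p)
    by_cases h : p' = q
    · subst h
      refine .inl ⟨hpp.ne, ?_⟩
      rintro rfl
      rcases hU with hU | hU
      exacts [hU hp, hU hp']
    · exact .inr ⟨h, hp0⟩

/-- Total derivatives have vanishing contour integral. -/
theorem tsum_mul_contourWeight {ρ : ℂ} (hρ : 0 < ρ.re) {μ : Fin m → ℂ} {N : ℤ}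
    (hN : ∑ i, μ i = N) {U : Finset (Fin m)} {p : Fin m} (hp : p ∉ U) {f : (Fin m → ℤ) → ℂ}
    (hf : f ∈ pairSpan ρ U) : Summable (fun n => f n * ((μ p - n p) * contourWeight μ n)) ∧
      ∑' n, f n * ((μ p - n p) * contourWeight μ n) = 0 := by
  -- The boundary values have `z_q` at `z_0`: the weight depends on `n 0` and `n q` through their
  -- sum only, so the sum over the unmatched pair `(0, q)` is `(1-x)^ρ` at `x = 1`.
  have key : ∀ q : Fin m, q ≠ 0 → (0 ∉ U ∨ q ∉ U) →
      Summable (fun n => f n * ((μ q - n q) * contourWeight μ n)) ∧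
      ∑' n, f n * ((μ q - n q) * contourWeight μ n) = 0 := by
    intro q hq hU
    have hd := decays_mul_contourWeight μ hq hU
    refine ⟨hd.summable hρ hf, hd.tsum_eq_zero hρ (Fin.pos_iff_ne_zero.2 hq) hU (fun n k => ?_) hf⟩
    rw [mul_contourWeight μ hq, mul_contourWeight μ hq]
    congr 2
    · rw [sum_sub_eq, sum_sub_eq]
      congr 3
      simp [Finset.sum_add_distrib, Finset.sum_sub_distrib]
    · refine Finset.prod_congr rfl fun i hi => ?_
      simp only [Finset.mem_erase] at hi
      simp [hi.1, hi.2.1]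
  by_cases h0 : p = 0
  · subst h0
    -- The Euler operator in all variables annihilates the weight, because the total exponent is an
    -- integer and `z_0` carries it around a full circle. So the derivative in `z_0` is minus the
    -- sum of the others.
    have e : ∀ n, f n * ((μ 0 - n 0) * contourWeight μ n)
        = -∑ q ∈ Finset.univ.erase 0, f n * ((μ q - n q) * contourWeight μ n) := fun n => by
      have h1 : (∑ i, (μ i - n i)) * contourWeight μ n = 0 := by
        rw [contourWeight, ← mul_assoc, sum_sub_eq, hN, ← Int.cast_sub, circleInt_int_mul, zero_mul]
      rw [← Finset.add_sum_erase _ _ (Finset.mem_univ (0 : Fin m)), add_mul, Finset.sum_mul] at h1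
      rw [← Finset.mul_sum, ← mul_neg]
      congr 1
      linear_combination h1
    have hs : ∀ q ∈ (Finset.univ.erase 0 : Finset (Fin m)),
        Summable (fun n => f n * ((μ q - n q) * contourWeight μ n)) := fun q hq =>
      (key q (Finset.mem_erase.1 hq).1 (.inl hp)).1
    simp only [e]
    refine ⟨(summable_sum hs).neg, ?_⟩
    rw [tsum_neg, Summable.tsum_finsetSum hs, Finset.sum_eq_zero, neg_zero]
    exact fun q hq => (key q (Finset.mem_erase.1 hq).1 (.inl hp)).2
  · exact key p h0 (.inr hp)

/-- The matrix of the change of angles. -/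
def shearMatrix (m : ℕ) [NeZero m] : Matrix (Fin m) (Fin m) ℝ := fun i k =>
  if i = k then 1 else if k = 0 then 1 else 0

theorem det_shearMatrix : (shearMatrix m).det = 1 := by
  rw [Matrix.det_of_isLowerTriangular]
  · simp [shearMatrix]
  · intro i k hik
    have hik : i < k := hik
    rw [shearMatrix, if_neg hik.ne, if_neg]
    rintro rfl
    exact absurd hik (Fin.not_lt_zero i)

theorem toLin'_shearMatrix (θ : Fin m → ℝ) (i : Fin m) :
    Matrix.toLin' (shearMatrix m) θ i = if i = 0 then θ 0 else θ i + θ 0 := by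
  rw [Matrix.toLin'_apply, Matrix.mulVec, dotProduct]
  split_ifs with h
  · subst h
    rw [Finset.sum_eq_single 0]
    · simp [shearMatrix]
    · intro k _ hk; simp [shearMatrix, hk.symm, hk]
    · simp
  · rw [← Finset.add_sum_erase _ _ (Finset.mem_univ i),
      ← Finset.add_sum_erase _ _ (Finset.mem_erase.2 ⟨Ne.symm h, Finset.mem_univ (0 : Fin m)⟩),
      Finset.sum_eq_zero]
    · simp [shearMatrix, h]
    · intro k hk
      simp only [Finset.mem_erase] at hk
      simp [shearMatrix, hk.1, hk.2.1.symm]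

theorem measurePreserving_shear :
    MeasurePreserving (Matrix.toLin' (shearMatrix m)) (volume : Measure (Fin m → ℝ)) volume := by
  refine ⟨(LinearMap.continuous_of_finiteDimensional _).measurable, ?_⟩
  rw [Real.map_matrix_volume_pi_eq_smul_volume_pi (by rw [det_shearMatrix]; exact one_ne_zero),
    det_shearMatrix]
  simp

theorem measurableEmbedding_shear : MeasurableEmbedding (Matrix.toLin' (shearMatrix m)) := by
  have hdet : IsUnit (LinearMap.det (Matrix.toLin' (shearMatrix m))) := by
    rw [LinearMap.det_toLin', det_shearMatrix]; exact isUnit_one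
  have hinj : Function.Injective (Matrix.toLin' (shearMatrix m)) := by
    intro x y h
    have h0 : x 0 = y 0 := by
      have := congrFun h 0
      rwa [toLin'_shearMatrix, toLin'_shearMatrix, if_pos rfl, if_pos rfl] at this
    funext i
    have := congrFun h i
    rw [toLin'_shearMatrix, toLin'_shearMatrix] at this
    split_ifs at this with hi
    · rw [hi, h0]
    · linarith
  exact (LinearMap.continuous_of_finiteDimensional _).measurableEmbedding hinj

theorem preimage_contourDomain : Matrix.toLin' (shearMatrix m) ⁻¹' contourDomain m
    = Set.pi Set.univ fun _ => Set.Icc (0 : ℝ) (2 * Real.pi) := by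
  ext θ
  simp only [contourDomain, Set.mem_preimage, Set.mem_ofPred_eq, toLin'_shearMatrix, if_true,
    Set.mem_pi, Set.mem_univ, true_implies, Set.mem_Icc]
  constructor
  · rintro ⟨h0, h⟩ i
    by_cases hi : i = 0
    · rw [hi]; exact h0
    · have := h i
      rw [if_neg hi] at this
      constructor <;> linarith [this.1, this.2]
  · intro h
    refine ⟨h 0, fun i => ?_⟩
    split_ifs with hi
    · constructor <;> linarith [Real.pi_pos]
    · constructor <;> linarith [(h i).1, (h i).2]

/-- Measuring the other angles from that of `z_0` preserves the measure and turns the domain into a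
cube. The common rotation then carries the sum of all exponents, and the integral factorizes. -/
theorem integral_contourDomain (lam : Fin m → ℂ) :
    ∫ θ in contourDomain m, Complex.exp (∑ i, lam i * (θ i * Complex.I))
      = circleInt (∑ i, lam i) * ∏ i ∈ Finset.univ.erase 0, circleInt (lam i) := by
  rw [← measurePreserving_shear.setIntegral_preimage_emb measurableEmbedding_shear,
    preimage_contourDomain]
  have e : ∀ θ : Fin m → ℝ, Complex.exp (∑ i, lam i * ((Matrix.toLin' (shearMatrix m) θ i : ℝ) * Complex.I))
      = ∏ i, Complex.exp ((if i = 0 then ∑ k, lam k else lam i) * (θ i * Complex.I)) := fun θ => by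
    rw [← Complex.exp_sum]
    congr 1
    rw [← Finset.add_sum_erase _ _ (Finset.mem_univ (0 : Fin m)),
      ← Finset.add_sum_erase (a := (0 : Fin m)) _ (fun i => (if i = 0 then ∑ k, lam k else lam i) * _)
        (Finset.mem_univ (0 : Fin m)),
      if_pos rfl, toLin'_shearMatrix, if_pos rfl,
      ← Finset.add_sum_erase (a := (0 : Fin m)) _ lam (Finset.mem_univ (0 : Fin m)), add_mul,
      Finset.sum_mul, add_assoc, ← Finset.sum_add_distrib]
    congr 1
    refine Finset.sum_congr rfl fun i hi => ?_
    rw [toLin'_shearMatrix, if_neg (Finset.mem_erase.1 hi).1, if_neg (Finset.mem_erase.1 hi).1]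
    push_cast; ring
  simp only [e]
  rw [volume_pi, Measure.restrict_pi_pi, integral_fintype_prod_eq_prod
    (f := fun i (t : ℝ) => Complex.exp ((if i = 0 then ∑ k, lam k else lam i) * (t * Complex.I))),
    ← Finset.mul_prod_erase _ _ (Finset.mem_univ (0 : Fin m)), if_pos rfl]
  congr 1
  refine Finset.prod_congr rfl fun i hi => ?_
  rw [if_neg (Finset.mem_erase.1 hi).1]; rfl

end

/-! ### Integration of the correlators term by term -/

section

variable {m : ℕ} [NeZero m] {α j : ℂ}

theorem word_mem {m : ℕ} (L : Fin m → Letter) (v : Fock) (w : Occ) :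
    (fun n => word α L n v w) ∈ pairSpan (alphaMinus α ^ 2) (support L) := by
  induction v using Finsupp.induction_linear with
  | zero => simp only [map_zero]; exact zero_mem _
  | add f g hf hg =>
    simp only [map_add, Finsupp.add_apply]
    exact add_mem hf hg
  | single s c =>
    have h : (fun n => word α L n (Finsupp.single s c) w) = c • wordCoeff α L s w := by
      funext n
      rw [← mul_one c, ← smul_eq_mul, ← Finsupp.smul_single, map_smul]
      simp [wordCoeff]
    rw [h]
    exact Submodule.smul_mem _ _ (wordCoeff_mem L s w)

/-- The exponents of the factors of `V(z_0) ⋯ V(z_{m-1})` on `F_j`. -/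
def exponents (α j : ℂ) (m : ℕ) (i : Fin m) : ℂ := exponent α (j - ((m : ℂ) - 1 - (i : ℕ)) / 2)

/-- Products of modes of the screening field. -/
abbrev screeningWord (α : ℂ) {m : ℕ} (n : Fin m → ℤ) : Op := word α (fun _ => Letter.V) n

/-- The exponents form an arithmetic progression, as every factor to the right lowers `j` by `1/2`.
-/
theorem sum_exponents (hα0 : α ≠ 0) :
    ∑ i, exponents α j m i = (m : ℂ) * (m - 1 - 4 * j) / (2 * α ^ 2) := by
  have h : ∑ i : Fin m, ((i : ℕ) : ℂ) = (m : ℂ) * (m - 1) / 2 := by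
    rw [Fin.sum_univ_eq_sum_range (fun i => (i : ℂ)), ← Nat.cast_sum, Finset.sum_range_id,
      Nat.cast_div_charZero, Nat.cast_mul]
    · cases m with
      | zero => simp
      | succ m => push_cast; ring
    · exact even_iff_two_dvd.1 (Nat.even_mul_pred_self m)
  have e : ∀ i : Fin m, exponents α j m i = (((m : ℂ) - 1 - 2 * j) - (i : ℕ)) / α ^ 2 := fun i => by
    rw [exponents, exponent_eq _ hα0]; ring
  simp only [e]
  rw [← Finset.sum_div, Finset.sum_sub_distrib, h, Finset.sum_const, Finset.card_univ, Fintype.card_fin,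
    nsmul_eq_mul]
  field_simp
  ring

/-- The radial and angular parts of a monomial. -/
theorem exp_logPoint (μ : Fin m → ℂ) (r : ℝ) (θ : Fin m → ℝ) (n : Fin m → ℤ) :
    ∏ i, Complex.exp ((μ i - n i) * logPoint r θ i)
      = ((Real.exp (-Real.log r * height n) : ℝ) : ℂ) *
        (Complex.exp (Real.log r * ∑ i : Fin m, ((i : ℕ) : ℂ) * μ i) *
          Complex.exp (∑ i, (μ i - n i) * (θ i * Complex.I))) := by
  rw [← Complex.exp_sum, Complex.ofReal_exp, ← Complex.exp_add, ← Complex.exp_add]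
  congr 1
  simp only [logPoint, height]
  push_cast
  rw [Finset.mul_sum, Finset.mul_sum, ← Finset.sum_add_distrib, ← Finset.sum_add_distrib]
  refine Finset.sum_congr rfl fun i _ => ?_
  ring

theorem correlatorTerm_eq (v : Fock) (w : Occ) (r : ℝ) (θ : Fin m → ℝ) (n : Fin m → ℤ) :
    correlatorTerm α j m v w (logPoint r θ) n * ∏ i : Fin m, (Complex.I * Complex.exp (logPoint r θ i))
      = (screeningWord α n v w * ((Real.exp (-Real.log r * height n) : ℝ) : ℂ)) *
        (Complex.I ^ m * Complex.exp (Real.log r * ∑ i : Fin m, ((i : ℕ) : ℂ) * exponents α j m i)) *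
          Complex.exp (∑ i, (exponents α j m i - n i) * (θ i * Complex.I)) := by
  have h : (∏ i : Fin m, Complex.exp ((exponent α (j - ((m : ℂ) - 1 - (i : ℕ)) / 2) - n i - 1) *
      logPoint r θ i)) * ∏ i : Fin m, (Complex.I * Complex.exp (logPoint r θ i))
      = Complex.I ^ m * ∏ i, Complex.exp ((exponents α j m i - n i) * logPoint r θ i) := by
    rw [Finset.prod_mul_distrib, Finset.prod_const, Finset.card_univ, Fintype.card_fin, mul_left_comm,
      ← Finset.prod_mul_distrib]
    congr 1
    refine Finset.prod_congr rfl fun i _ => ?_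
    rw [← Complex.exp_add, exponents]
    congr 1; ring
  rw [correlatorTerm, mul_assoc, h, exp_logPoint]
  change screeningWord α n v w * _ = _
  ring

theorem prod_exp_ne_zero (r : ℝ) (θ : Fin m → ℝ) :
    ∏ i : Fin m, (Complex.I * Complex.exp (logPoint r θ i)) ≠ 0 :=
  Finset.prod_ne_zero_iff.2 fun _ _ => mul_ne_zero Complex.I_ne_zero (Complex.exp_ne_zero _)

/-- The integers `n i` contribute only a phase, so the modulus is bounded on the domain uniformly in
`n`. -/
theorem norm_exp_sub (μ : Fin m → ℂ) (n : Fin m → ℤ) (θ : Fin m → ℝ) :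
    ‖Complex.exp (∑ i, (μ i - n i) * (θ i * Complex.I))‖ = Real.exp (-∑ i, (μ i).im * θ i) := by
  rw [Complex.norm_exp, Complex.re_sum, ← Finset.sum_neg_distrib]
  congr 1
  refine Finset.sum_congr rfl fun i _ => ?_
  simp

theorem isCompact_contourDomain : IsCompact (contourDomain m) := by
  have hc : IsClosed (contourDomain m) := by
    have e : contourDomain m = (fun θ : Fin m → ℝ => θ 0) ⁻¹' Set.Icc 0 (2 * Real.pi) ∩
        ⋂ i, ({θ | θ 0 ≤ θ i} ∩ {θ | θ i ≤ θ 0 + 2 * Real.pi}) := by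
      ext θ
      simp [contourDomain]
    rw [e]
    refine (isClosed_Icc.preimage (continuous_apply 0)).inter (isClosed_iInter fun i => ?_)
    exact (isClosed_le (continuous_apply 0) (continuous_apply i)).inter
      (isClosed_le (continuous_apply i) ((continuous_apply 0).add continuous_const))
  refine (isCompact_univ_pi fun _ : Fin m => isCompact_Icc (a := (0 : ℝ))
    (b := 4 * Real.pi)).of_isClosed_subset hc ?_
  rintro θ ⟨h0, h⟩ i _
  have := h i
  constructor <;> linarith [h0.1, h0.2, this.1, this.2]

theorem summable_correlatorTerm (hρ : 0 < (alphaMinus α ^ 2).re) (v : Fock) (w : Occ) {r : ℝ}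
    (hr : r ∈ Set.Ioo (0 : ℝ) 1) (θ : Fin m → ℝ) :
    Summable (correlatorTerm α j m v w (logPoint r θ)) := by
  have h1 := summable_mul_exp hρ (word_mem (α := α) (fun _ : Fin m => Letter.V) v w)
    (Real.log_neg hr.1 hr.2)
  refine (summable_mul_right_iff (prod_exp_ne_zero r θ)).1 ?_
  simp only [correlatorTerm_eq]
  refine Summable.of_norm_bounded ((h1.norm.mul_right ‖Complex.I ^ m *
    Complex.exp (Real.log r * ∑ i : Fin m, ((i : ℕ) : ℂ) * exponents α j m i)‖).mul_right
      (Real.exp (-∑ i, (exponents α j m i).im * θ i))) fun n => ?_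
  rw [norm_mul, norm_mul, norm_exp_sub]

theorem contourIntegrand_eq (v : Fock) (w : Occ) (r : ℝ) (θ : Fin m → ℝ) :
    contourIntegrand α j m v w r θ = ∑' n : Fin m → ℤ,
      (screeningWord α n v w * ((Real.exp (-Real.log r * height n) : ℝ) : ℂ)) *
        (Complex.I ^ m * Complex.exp (Real.log r * ∑ i : Fin m, ((i : ℕ) : ℂ) * exponents α j m i)) *
          Complex.exp (∑ i, (exponents α j m i - n i) * (θ i * Complex.I)) := by
  rw [contourIntegrand, ← tsum_mul_right]
  exact tsum_congr fun n => correlatorTerm_eq v w r θ n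

/-- For fixed `r < 1` the radial factors make the series of sup norms over the compact domain
converge; this gives continuity of the integrand and allows the exchange of sum and integral. -/
theorem integral_contourIntegrand (hρ : 0 < (alphaMinus α ^ 2).re) (v : Fock) (w : Occ) {r : ℝ}
    (hr : r ∈ Set.Ioo (0 : ℝ) 1) : IntegrableOn (contourIntegrand α j m v w r) (contourDomain m) ∧
      ∫ θ in contourDomain m, contourIntegrand α j m v w r θ
        = Complex.I ^ m * Complex.exp (Real.log r * ∑ i : Fin m, ((i : ℕ) : ℂ) * exponents α j m i) *
          ∑' n, screeningWord α n v w * (contourWeight (exponents α j m) n *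
            ((Real.exp (-Real.log r * height n) : ℝ) : ℂ)) := by
  have h1 := summable_mul_exp hρ (word_mem (α := α) (fun _ : Fin m => Letter.V) v w)
    (Real.log_neg hr.1 hr.2)
  set μ := exponents α j m
  set κ := Complex.I ^ m * Complex.exp (Real.log r * ∑ i : Fin m, ((i : ℕ) : ℂ) * μ i)
  set u : (Fin m → ℤ) → ℂ := fun n => screeningWord α n v w *
    ((Real.exp (-Real.log r * height n) : ℝ) : ℂ) with hu
  obtain ⟨B, hB⟩ := (isCompact_contourDomain (m := m)).exists_bound_of_continuousOn
    (f := fun θ : Fin m → ℝ => Real.exp (-∑ i, (μ i).im * θ i)) (by fun_prop)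
  have hcont : ∀ n : Fin m → ℤ, Continuous fun θ : Fin m → ℝ =>
      u n * κ * Complex.exp (∑ i, (μ i - n i) * (θ i * Complex.I)) := fun n => by fun_prop
  have hbound : ∀ (n : Fin m → ℤ), ∀ θ ∈ contourDomain m,
      ‖u n * κ * Complex.exp (∑ i, (μ i - n i) * (θ i * Complex.I))‖ ≤ ‖u n‖ * ‖κ‖ * B := by
    intro n θ hθ
    rw [norm_mul, norm_mul, norm_exp_sub]
    refine mul_le_mul_of_nonneg_left ?_ (by positivity)
    have := hB θ hθ
    rwa [Real.norm_of_nonneg (Real.exp_pos _).le] at this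
  have hs : Summable fun n => ‖u n‖ * ‖κ‖ * B := (h1.norm.mul_right _).mul_right _
  have hfin : volume (contourDomain m) < ⊤ := isCompact_contourDomain.measure_lt_top
  have e : contourIntegrand α j m v w r = fun θ => ∑' n : Fin m → ℤ,
      u n * κ * Complex.exp (∑ i, (μ i - n i) * (θ i * Complex.I)) :=
    funext fun θ => contourIntegrand_eq v w r θ
  have hmeas : MeasurableSet (contourDomain m) := isCompact_contourDomain.isClosed.measurableSet
  rw [e]
  refine ⟨(continuousOn_tsum (fun n => (hcont n).continuousOn) hs hbound).integrableOn_compact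
    isCompact_contourDomain, ?_⟩
  have : IsFiniteMeasure (volume.restrict (contourDomain m)) := ⟨by simpa using hfin⟩
  have h2 : HasSum (fun n : Fin m → ℤ => ∫ θ in contourDomain m,
      u n * κ * Complex.exp (∑ i, (μ i - n i) * (θ i * Complex.I)))
      (∫ θ in contourDomain m, ∑' n : Fin m → ℤ,
        u n * κ * Complex.exp (∑ i, (μ i - n i) * (θ i * Complex.I))) := by
    refine hasSum_integral_of_dominated_convergence (fun n _ => ‖u n‖ * ‖κ‖ * B)
      (fun n => (hcont n).aestronglyMeasurable) (fun n => ?_) (.of_forall fun _ => hs)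
      (integrable_const _) ?_
    · exact (ae_restrict_iff' hmeas).2 (.of_forall fun θ hθ => hbound n θ hθ)
    · refine (ae_restrict_iff' hmeas).2 (.of_forall fun θ hθ => ?_)
      exact (Summable.of_norm_bounded hs fun n => hbound n θ hθ).hasSum
  rw [← h2.tsum_eq, ← tsum_mul_left]
  refine tsum_congr fun n => ?_
  rw [integral_const_mul, integral_contourDomain, contourWeight]
  simp only [hu]
  ring

/-- The matrix coefficients of the multiple integral. -/
def integralCoeff (α j : ℂ) (m : ℕ) [NeZero m] (v : Fock) (w : Occ) : ℂ :=
  Complex.I ^ m * ∑' n, screeningWord α n v w * contourWeight (exponents α j m) n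

/-- With `x = log r` tending to `0` from below this is the Abel limit of the integrated series; the
remaining prefactor tends to the constant from `dz_i = i z_i dθ_i`. -/
theorem tendsto_integral_contourIntegrand (hρ : 0 < (alphaMinus α ^ 2).re) (v : Fock) (w : Occ) :
    Tendsto (fun r : ℝ => ∫ θ in contourDomain m, contourIntegrand α j m v w r θ)
      (𝓝[<] 1) (𝓝 (integralCoeff α j m v w)) := by
  have hlog : Tendsto Real.log (𝓝[<] 1) (𝓝[<] 0) := by
    refine tendsto_nhdsWithin_iff.2 ⟨?_, ?_⟩
    · have := (Real.continuousAt_log one_ne_zero).tendsto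
      rw [Real.log_one] at this
      exact this.mono_left nhdsWithin_le_nhds
    · filter_upwards [Ioo_mem_nhdsLT (zero_lt_one : (0 : ℝ) < 1)] with r hr
      exact Real.log_neg hr.1 hr.2
  have h1 := ((decays_contourWeight (exponents α j m) (support fun _ : Fin m => Letter.V)).tendsto hρ
    (word_mem (α := α) (fun _ => Letter.V) v w)).2.comp hlog
  have h2 : Tendsto (fun r : ℝ => Complex.I ^ m *
      Complex.exp (Real.log r * ∑ i : Fin m, ((i : ℕ) : ℂ) * exponents α j m i)) (𝓝[<] 1) (𝓝 (Complex.I ^ m)) := by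
    have h3 : Tendsto (fun x : ℝ => Complex.I ^ m *
        Complex.exp (x * ∑ i : Fin m, ((i : ℕ) : ℂ) * exponents α j m i)) (𝓝 0)
        (𝓝 (Complex.I ^ m * Complex.exp ((0 : ℝ) * ∑ i : Fin m, ((i : ℕ) : ℂ) * exponents α j m i))) := by
      refine Continuous.tendsto ?_ 0
      fun_prop
    rw [Complex.ofReal_zero, zero_mul, Complex.exp_zero, mul_one] at h3
    exact (h3.mono_left nhdsWithin_le_nhds).comp hlog
  refine (h2.mul h1).congr' ?_
  filter_upwards [Ioo_mem_nhdsLT (zero_lt_one : (0 : ℝ) < 1)] with r hr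
  exact (integral_contourIntegrand hρ v w hr).2.symm

end

/-! ### Weight spaces -/

theorem Graded.prod_ofFn {D : Op} {lam c : ℂ} {A : Modes} (h : Graded D lam c A) {m : ℕ}
    (n : Fin m → ℤ) :
    D * (List.ofFn fun i => A (n i)).prod - (List.ofFn fun i => A (n i)).prod * D
      = (∑ i, (c + lam * (n i + 1))) • (List.ofFn fun i => A (n i)).prod := by
  have h1 := mul_prod_ofFn (fun _ => D) (fun i => A (n i))
    (fun i => (c + lam * (n i + 1)) • A (n i)) (fun _ => 1) fun i => by
      rw [one_smul, ← h (n i)]; abel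
  simp only [Finset.prod_const_one, one_smul] at h1
  rw [h1, add_sub_cancel_left, Finset.sum_smul]
  refine Finset.sum_congr rfl fun i _ => ?_
  rw [prod_update_smul, Function.update_eq_self i (fun i => A (n i))]

theorem HasParity.prod_ofFn {e : ℂ} {A : Modes} (h : HasParity e A) {m : ℕ} (n : Fin m → ℤ) :
    parityOp * (List.ofFn fun i => A (n i)).prod
      = e ^ m • ((List.ofFn fun i => A (n i)).prod * parityOp) := by
  have h1 := mul_prod_ofFn (fun _ => parityOp) (fun i => A (n i))
    (fun i => (0 : ℂ) • A (n i)) (fun _ => e) fun i => by rw [zero_smul, add_zero, h (n i)]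
  rw [h1, Finset.prod_const, Finset.card_univ, Fintype.card_fin, add_eq_left]
  refine Finset.sum_eq_zero fun i _ => ?_
  rw [prod_update_smul, zero_smul, smul_zero]

/-- The charge of a basis vector. -/
abbrev charge : Occ → ℂ := occWeight (fun a => if a < 0 then 1 else -1) (fun _ => 0)
  fun a => if a < 0 then 1 / 2 else -1 / 2

theorem charge_vertexExp (α : ℂ) : Graded (diagOp charge) 0 0 (vertexExp α) := fun n => by
  have h := commute_vertexExp α (A := diagOp charge) (fun n _ => ?_) n
  · rw [h.eq, sub_self, zero_mul, add_zero, zero_smul]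
  · have h1 := diagOp_phiMode (wb := fun a : ℤ => if a < 0 then 1 else -1) (wo := fun _ => 0)
      (wf := fun a : ℤ => if a < 0 then 1 / 2 else -1 / 2) (x := 0) 0 (n := n) (fun _ => rfl)
      (fun _ => rfl) fun _ => neg_zero
    rw [zero_smul, sub_eq_zero] at h1
    exact h1

/-- The mode `γ_0` has energy zero, so the energy levels are infinite-dimensional. The charge is a
second grading, respected by `V`, that cuts the possible images down to finitely many basis vectors.
-/
theorem charge_screening (α : ℂ) : Graded (diagOp charge) 0 (1 / 2) (screening α) := by
  have h1 : Graded (diagOp charge) 0 1 beta := graded_beta (fun n h => by simp [h])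
    fun n h => by simp [h.not_gt]
  have h2 : Graded (diagOp charge) 0 (1 / 2) psiPlus := graded_psiPlus (fun n h => by simp [h])
    fun n h => by simp [h.not_gt]; norm_num
  have h3 : Graded (diagOp charge) 0 (-1 / 2) psi :=
    graded_psi (fun n h => by simp [h.not_gt]) fun n h => by simp [h]; norm_num
  rw [screening_eq]
  exact ((h2.add ((h1.nP 1 h3).congr (by norm_num))).nP 1 (charge_vertexExp α)).congr (by norm_num)

theorem energy_bos_le (t : Occ) (a : ℤ) : a.natAbs * t.bos a ≤ energy t := by
  have h : a.natAbs * t.bos a ≤ t.bos.sum fun a c => a.natAbs * c := by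
    by_cases ha : a ∈ t.bos.support
    · exact Finset.single_le_sum (f := fun a => a.natAbs * t.bos a) (fun _ _ => Nat.zero_le _) ha
    · simp [Finsupp.notMem_support_iff.1 ha]
  exact h.trans ((Nat.le_add_right _ _).trans (Nat.le_add_right _ _))

theorem energy_osc_le (t : Occ) (i : ℕ) : (i + 1) * t.osc i ≤ energy t := by
  have h : (i + 1) * t.osc i ≤ t.osc.sum fun i c => (i + 1) * c := by
    by_cases ha : i ∈ t.osc.support
    · exact Finset.single_le_sum (f := fun i => (i + 1) * t.osc i) (fun _ _ => Nat.zero_le _) ha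
    · simp [Finsupp.notMem_support_iff.1 ha]
  exact h.trans ((Nat.le_add_left _ _).trans (Nat.le_add_right _ _))

theorem energy_fer_le (t : Occ) {a : ℤ} (ha : a ∈ t.fer) : a.natAbs ≤ energy t :=
  (Finset.single_le_sum (f := fun a : ℤ => a.natAbs) (fun _ _ => Nat.zero_le _) ha).trans
    (Nat.le_add_left _ _)

/-- There are finitely many basis vectors of given charge and bounded energy. -/
theorem finite_weight (E : ℕ) (c : ℂ) : {t : Occ | energy t ≤ E ∧ charge t = c}.Finite := by
  -- Bounded energy controls all occupation numbers except that of `γ_0`, with label `0`. It is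
  -- removed here, and the charge recovers it.
  let f : Occ → (ℤ →₀ ℕ) × (ℕ →₀ ℕ) × Finset ℤ := fun t => (t.bos.erase 0, t.osc, t.fer)
  refine Set.Finite.of_injOn (f := f) (t := Set.Iic (Finsupp.indicator (Finset.Icc (-E : ℤ) E) fun _ _ => E) ×ˢ
    (Set.Iic (Finsupp.indicator (Finset.range (E + 1)) fun _ _ => E) ×ˢ
      Set.Iic (Finset.Icc (-E : ℤ) E))) ?_ ?_
    ((Set.finite_Iic _).prod ((Set.finite_Iic _).prod (Set.finite_Iic _)))
  · rintro t ⟨ht, -⟩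
    refine ⟨fun a => ?_, fun i => ?_, fun a ha => ?_⟩
    · by_cases ha : a = 0
      · simp [f, ha]
      · have h := (energy_bos_le t a).trans ht
        have ha' : 1 ≤ a.natAbs := by omega
        by_cases hb : t.bos a = 0
        · simp [f, Finsupp.erase_ne ha, hb]
        · have h1 : a.natAbs ≤ E := (Nat.le_mul_of_pos_right _ (Nat.pos_of_ne_zero hb)).trans h
          have h2 : t.bos a ≤ E := (Nat.le_mul_of_pos_left _ ha').trans h
          have h3 : a ∈ Finset.Icc (-E : ℤ) E := by rw [Finset.mem_Icc]; omega
          rw [Finsupp.indicator_of_mem h3]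
          simpa [f, Finsupp.erase_ne ha] using h2
    · have h := (energy_osc_le t i).trans ht
      by_cases hb : t.osc i = 0
      · simp [f, hb]
      · have h1 : i + 1 ≤ E := (Nat.le_mul_of_pos_right _ (Nat.pos_of_ne_zero hb)).trans h
        have h2 : t.osc i ≤ E := (Nat.le_mul_of_pos_left _ i.succ_pos).trans h
        have h3 : i ∈ Finset.range (E + 1) := by rw [Finset.mem_range]; omega
        rw [Finsupp.indicator_of_mem h3]
        exact h2
    · have h := (energy_fer_le t ha).trans ht
      rw [Finset.mem_Icc]; omega
  · rintro t ⟨-, ht⟩ t' ⟨-, ht'⟩ h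
    simp only [f, Prod.mk.injEq] at h
    obtain ⟨h1, h2, h3⟩ := h
    have e : ∀ u : ℤ →₀ ℕ, (u.sum fun a c => (if a < 0 then 1 else -1 : ℂ) * c)
        = -(u 0) + (u.erase 0).sum fun a c => (if a < 0 then 1 else -1 : ℂ) * c := fun u => by
      rw [← Finsupp.add_sum_erase' u 0 _ (by simp)]; simp
    have h4 := ht.trans ht'.symm
    rw [charge, occWeight, occWeight, e t.bos, e t'.bos, h1, h2, h3] at h4
    have h5 : t.bos 0 = t'.bos 0 := by
      have : (t.bos 0 : ℂ) = t'.bos 0 := by linear_combination -h4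
      exact_mod_cast this
    refine Occ.ext (Finsupp.ext fun a => ?_) h2 h3
    by_cases ha : a = 0
    · rw [ha, h5]
    · rw [← Finsupp.erase_ne ha (f := t.bos), h1, Finsupp.erase_ne ha]

section

variable {m : ℕ} [NeZero m] {k α j : ℂ}

/-! ### The multiple integral -/

theorem summable_screeningWord (hρ : 0 < (alphaMinus α ^ 2).re) (v : Fock) (w : Occ) :
    Summable fun n => screeningWord α n v w * contourWeight (exponents α j m) n :=
  (decays_contourWeight (exponents α j m) (support fun _ : Fin m => Letter.V)).summable hρ
    (word_mem (fun _ => .V) v w)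

/-- Basis vectors that occur in the multiple integral. -/
def targets (m : ℕ) (N : ℤ) (s : Occ) : Finset Occ :=
  (finite_weight ((energy s : ℤ) - N).toNat (charge s + m / 2)).toFinset

/-- The common rotation integrates a monomial of nonzero integral degree to zero. Only products of
modes with one fixed total index contribute, so energy and charge change by fixed amounts. -/
theorem contourWeight_eq_zero {N : ℤ} {μ : Fin m → ℂ} (hN : ∑ i, μ i = N) {n : Fin m → ℤ}
    (h : ∑ i, n i ≠ N) : contourWeight μ n = 0 := by
  rw [contourWeight, sum_sub_eq, hN, ← Int.cast_sub]
  refine mul_eq_zero_of_left ?_ _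
  exact (mul_eq_zero.1 (circleInt_int_mul (N - ∑ i, n i))).resolve_left fun h' =>
    h (sub_eq_zero.1 (Int.cast_eq_zero.1 h')).symm

theorem mem_targets {N : ℤ} {n : Fin m → ℤ} {s t : Occ} (hn : ∑ i, n i = N)
    (h : screeningWord α n (Finsupp.single s 1) t ≠ 0) : t ∈ targets m N s := by
  have h1 := energy_screening (α := α).prod_ofFn n
  have h2 := (charge_screening α).prod_ofFn n
  have h3 := natCast_energy_eq h1 h
  have h4 := eq_add_of_coeff_ne_zero h2 h
  have h5 : ∑ i, ((1 : ℂ) + -1 * (n i + 1)) = -(N : ℂ) := by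
    rw [← hn, Int.cast_sum, ← Finset.sum_neg_distrib]
    exact Finset.sum_congr rfl fun i _ => by ring
  rw [targets, Set.Finite.mem_toFinset]
  refine ⟨?_, ?_⟩
  · rw [h5] at h3
    have h6 : (energy t : ℤ) = energy s + -N := by exact_mod_cast h3
    omega
  · rw [h4]
    simp [div_eq_mul_inv]

theorem mem_targets_of_integralCoeff {N : ℤ} (hN : ∑ i, exponents α j m i = N) {s t : Occ}
    (h : integralCoeff α j m (Finsupp.single s 1) t ≠ 0) : t ∈ targets m N s := by
  by_contra ht
  refine h ?_
  rw [integralCoeff]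
  refine mul_eq_zero_of_right _ ?_
  rw [← tsum_zero]
  refine tsum_congr fun n => ?_
  by_cases hn : ∑ i, n i = N
  · by_cases hc : screeningWord α n (Finsupp.single s 1) t = 0
    · rw [hc, zero_mul]
    · exact absurd (mem_targets hn hc) ht
  · rw [contourWeight_eq_zero hN hn, mul_zero]

/-- The multiple integral of the screening field. -/
def multipleIntegral {N : ℤ} (hN : ∑ i, exponents α j m i = N) : Op :=
  basisOp fun s => Finsupp.onFinset (targets m N s) (integralCoeff α j m (Finsupp.single s 1))
    fun _ => mem_targets_of_integralCoeff hN

variable {N : ℤ} (hN : ∑ i, exponents α j m i = N)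

theorem multipleIntegral_single (s t : Occ) : multipleIntegral hN (Finsupp.single s 1) t
    = integralCoeff α j m (Finsupp.single s 1) t := by
  rw [multipleIntegral, basisOp, Finsupp.linearCombination_single, one_smul, Finsupp.onFinset_apply]

theorem multipleIntegral_apply (hρ : 0 < (alphaMinus α ^ 2).re) (v : Fock) (w : Occ) :
    multipleIntegral hN v w = integralCoeff α j m v w := by
  induction v using Finsupp.induction_linear with
  | zero => simp [integralCoeff]
  | add f g hf hg =>
    rw [map_add, Finsupp.add_apply, hf, hg, integralCoeff, integralCoeff, integralCoeff, ← mul_add,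
      ← (summable_screeningWord hρ f w).tsum_add (summable_screeningWord hρ g w)]
    congr 1
    refine tsum_congr fun n => ?_
    rw [map_add, Finsupp.add_apply, add_mul]
  | single s c =>
    rw [← mul_one c, ← smul_eq_mul, ← Finsupp.smul_single, map_smul, Finsupp.smul_apply,
      multipleIntegral_single, integralCoeff, integralCoeff, smul_eq_mul, mul_left_comm, ← tsum_mul_left]
    congr 1
    refine tsum_congr fun n => ?_
    rw [map_smul, Finsupp.smul_apply, smul_eq_mul, mul_assoc]

/-- Operators can be applied under the integral. -/
theorem mul_multipleIntegral (hρ : 0 < (alphaMinus α ^ 2).re) (A : Op) (s w : Occ) :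
    A (multipleIntegral hN (Finsupp.single s 1)) w = Complex.I ^ m *
      ∑' n, (A * screeningWord α n) (Finsupp.single s 1) w * contourWeight (exponents α j m) n := by
  -- All vectors involved are supported on one finite set of basis vectors, so the operator acts by
  -- a finite sum, which may be exchanged with the infinite one.
  have expand : ∀ u : Fock, (∀ t, u t ≠ 0 → t ∈ targets m N s) →
      A u w = ∑ t ∈ targets m N s, u t * A (Finsupp.single t 1) w := fun u hu => by
    conv_lhs => rw [← Finsupp.sum_single u]
    rw [Finsupp.sum, map_sum, Finsupp.finsetSum_apply]
    have h : ∀ t, A (Finsupp.single t (u t)) w = u t * A (Finsupp.single t 1) w := fun t => by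
      rw [← smul_eq_mul, ← Finsupp.smul_apply, ← map_smul, Finsupp.smul_single, smul_eq_mul, mul_one]
    simp only [h]
    refine Finset.sum_subset (fun t ht => hu t (Finsupp.mem_support_iff.1 ht)) fun t _ ht => ?_
    rw [Finsupp.notMem_support_iff.1 ht, zero_mul]
  have hs := fun t => summable_screeningWord (j := j) (m := m) hρ (Finsupp.single s 1) t
  rw [expand _ fun t ht => mem_targets_of_integralCoeff hN (by rwa [multipleIntegral_single] at ht)]
  simp only [multipleIntegral_single, integralCoeff, mul_assoc]
  rw [← Finset.mul_sum]
  congr 1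
  simp only [← tsum_mul_right]
  rw [← Summable.tsum_finsetSum fun t _ => (hs t).mul_right _]
  refine tsum_congr fun n => ?_
  by_cases hn : ∑ i, n i = N
  · rw [Module.End.mul_apply, expand _ fun t ht => mem_targets hn ht, Finset.sum_mul]
    exact Finset.sum_congr rfl fun t _ => by ring
  · simp [contourWeight_eq_zero hN hn]

theorem isMultipleIntegral (hρ : 0 < (alphaMinus α ^ 2).re) :
    IsMultipleIntegral α j m (multipleIntegral hN) := by
  refine fun v w => ⟨fun r hr => ⟨summable_correlatorTerm hρ v w hr,
    (integral_contourIntegrand hρ v w hr).1⟩, ?_⟩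
  rw [multipleIntegral_apply hN hρ]
  exact tendsto_integral_contourIntegrand hρ v w

theorem op_ext_coeff {A B : Op} (h : ∀ s w, A (Finsupp.single s 1) w = B (Finsupp.single s 1) w) :
    A = B := by
  refine Finsupp.lhom_ext' fun s => LinearMap.ext_ring (Finsupp.ext fun w => ?_)
  exact h s w

/-- Relations for the products of modes that hold on all of their support pass to the integral. -/
theorem multipleIntegral_comm (hρ : 0 < (alphaMinus α ^ 2).re) {A B : Op} {c : ℂ}
    (h : ∀ n : Fin m → ℤ, ∑ i, n i = N → A * screeningWord α n = c • (screeningWord α n * B)) :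
    A * multipleIntegral hN = c • (multipleIntegral hN * B) := by
  refine op_ext_coeff fun s w => ?_
  rw [Module.End.mul_apply, mul_multipleIntegral hN hρ, LinearMap.smul_apply, Module.End.mul_apply,
    Finsupp.smul_apply, multipleIntegral_apply hN hρ, integralCoeff, smul_eq_mul, mul_left_comm,
    ← tsum_mul_left (a := c)]
  congr 1
  refine tsum_congr fun n => ?_
  by_cases hn : ∑ i, n i = N
  · rw [h n hn, LinearMap.smul_apply, Finsupp.smul_apply, Module.End.mul_apply, smul_eq_mul, mul_assoc]
  · simp [contourWeight_eq_zero hN hn]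

/-! ### The multiple integral is a homomorphism -/

/-- For these currents the field under the derivative is a multiple of the bare exponential, so `p`
leaves the support and no pole involves `z_p`. For `J⁻` it is `:ψ e^{iα₋φ}:`, which can still be
contracted. -/
theorem exists_current_screeningWord (hα0 : α ≠ 0) (hα : α ^ 2 = 2 * k + 3) {a : Gen}
    (ha : a ≠ .Jminus) (l : ℤ) : ∃ c : Fin m → ℂ, ∀ n : Fin m → ℤ,
      current k α (j - m / 2) a l * screeningWord α n
        = koszul a.parity 1 ^ m • (screeningWord α n * current k α j a l)
          + ∑ p, (c p * (exponents α j m p - n p)) •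
            word α (Function.update (fun _ => Letter.V) p .E) (n + Pi.single p (l - 1)) := by
  obtain ⟨x, hx⟩ : ∃ x : ℂ, screeningU α a = x • vertexExp α := by
    cases a with
    | Jminus => exact absurd rfl ha
    | jminus => exact ⟨_, rfl⟩
    | _ => exact ⟨0, (zero_smul _ _).symm⟩
  refine ⟨fun p => (∏ i ∈ Finset.univ.filter (· < p), koszul a.parity 1) * x, fun n => ?_⟩
  -- The current in front of the factor `i` acts on the Fock space reached there, hence the
  -- dependence of the operator on the position.
  have h := mul_prod_ofFn (fun i => current k α (j - (m - i) / 2) a l) (fun i => screening α (n i))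
    (fun i => ((exponents α j m i - n i) * x) • vertexExp α (n i + (l - 1)))
    (fun _ => koszul a.parity 1) fun i => by
      have h1 := current_screening (k := k) (j - ((m : ℂ) - 1 - (i : ℕ)) / 2) hα0 hα a l (n i)
      rw [hx, Pi.smul_apply, smul_smul, show l + n i - 1 = n i + (l - 1) by ring] at h1
      rw [exponents, ← h1, show j - ((m : ℂ) - (i : ℕ)) / 2 = j - ((m : ℂ) - 1 - (i : ℕ)) / 2 - 1 / 2 by ring,
        show j - ((m : ℂ) - ((i : ℕ) + 1 : ℕ)) / 2 = j - ((m : ℂ) - 1 - (i : ℕ)) / 2 by push_cast; ring]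
      abel
  rw [Nat.cast_zero, sub_zero, sub_self, zero_div, sub_zero, Finset.prod_const, Finset.card_univ,
    Fintype.card_fin] at h
  change current k α (j - m / 2) a l * (List.ofFn fun i => screening α (n i)).prod = _
  rw [h]
  congr 1
  refine Finset.sum_congr rfl fun p _ => ?_
  rw [prod_update_smul, smul_smul]
  have h2 := word_update α (fun _ => Letter.V) n p .E (l - 1)
  rw [← h2]
  congr 1
  ring

theorem koszul_pow_mul (p m : ℕ) : koszul m p * koszul p 1 ^ m = 1 := by
  rw [koszul, koszul, mul_one, ← pow_mul, mul_comm p, ← mul_pow]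
  norm_num

/-- The boundary terms vanish. -/
theorem current_multipleIntegral (hρ : 0 < (alphaMinus α ^ 2).re) (hα0 : α ≠ 0)
    (hα : α ^ 2 = 2 * k + 3) {a : Gen} (ha : a ≠ .Jminus) (l : ℤ) :
    current k α (j - m / 2) a l * multipleIntegral hN
      = koszul a.parity 1 ^ m • (multipleIntegral hN * current k α j a l) := by
  obtain ⟨c, hc⟩ := exists_current_screeningWord (m := m) (j := j) hα0 hα ha l
  refine op_ext_coeff fun s w => ?_
  rw [Module.End.mul_apply, mul_multipleIntegral hN hρ, LinearMap.smul_apply, Module.End.mul_apply,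
    Finsupp.smul_apply, multipleIntegral_apply hN hρ, integralCoeff, smul_eq_mul, mul_left_comm]
  congr 1
  have h1 := (summable_screeningWord (j := j) (m := m) hρ (current k α j a l (Finsupp.single s 1))
    w).hasSum.mul_left (koszul a.parity 1 ^ m)
  have h2 : ∀ p : Fin m, HasSum (fun n : Fin m → ℤ =>
      c p * (word α (Function.update (fun _ => Letter.V) p .E) (n + Pi.single p (l - 1))
        (Finsupp.single s 1) w * ((exponents α j m p - n p) * contourWeight (exponents α j m) n)))
      (c p * 0) := fun p => by
    have hp : p ∉ support (Function.update (fun _ : Fin m => Letter.V) p .E) := by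
      simp [mem_support]
    have h3 := tsum_mul_contourWeight hρ hN hp (shift_mem_pairSpan (word_mem (α := α) _
      (Finsupp.single s 1) w) (Pi.single p (l - 1)))
    rw [← h3.2]
    exact h3.1.hasSum.mul_left _
  have h3 := h1.add (hasSum_sum fun p (_ : p ∈ Finset.univ) => h2 p)
  simp only [mul_zero, Finset.sum_const_zero, add_zero] at h3
  rw [← h3.tsum_eq]
  refine tsum_congr fun n => ?_
  rw [hc n, LinearMap.add_apply, Finsupp.add_apply, LinearMap.smul_apply, Finsupp.smul_apply,
    Module.End.mul_apply, LinearMap.sum_apply, Finsupp.finsetSum_apply, add_mul, Finset.sum_mul,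
    smul_eq_mul, mul_assoc]
  congr 1
  refine Finset.sum_congr rfl fun p _ => ?_
  rw [LinearMap.smul_apply, Finsupp.smul_apply, smul_eq_mul]
  ring

/-- For all currents but `J⁻` the boundary terms vanish, and two applications of the relation for
`j⁻` settle `J⁻`. -/
theorem isAffineHom_multipleIntegral (hρ : 0 < (alphaMinus α ^ 2).re) (hα0 : α ≠ 0)
    (hα : α ^ 2 = 2 * k + 3) :
    IsAffineHom m (wakimoto k α j) (wakimoto k α (j - m / 2)) (multipleIntegral hN) := by
  set Q := multipleIntegral hN with hQ
  have h0 : ∀ a l, a ≠ Gen.Jminus → current k α (j - m / 2) a l * Q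
      = koszul a.parity 1 ^ m • (Q * current k α j a l) :=
    fun a l ha => current_multipleIntegral hN hρ hα0 hα ha l
  refine ⟨?_, fun a l => ?_, ?_⟩
  · exact multipleIntegral_comm hN hρ fun n _ => parity_screening.prod_ofFn n
  · change Q * current k α j a l = koszul m a.parity • (current k α (j - m / 2) a l * Q)
    suffices h : current k α (j - m / 2) a l * Q = koszul a.parity 1 ^ m • (Q * current k α j a l) by
      rw [h, smul_smul, koszul_pow_mul, one_smul]
    by_cases ha : a = .Jminus
    · subst ha
      have MM := fun j => (isAffineModule_wakimoto k α j hα).jminus_jminus l 0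
      simp only [superBracket, koszul11, neg_smul, one_smul, sub_neg_eq_add, wakimoto, add_zero] at MM
      rw [show koszul Gen.Jminus.parity 1 = 1 from koszul01, one_pow, one_smul]
      refine two_smul_inj ?_
      have e : ∀ j, (2 : ℂ) • current k α j .Jminus l
          = -(current k α j .jminus l * current k α j .jminus 0
            + current k α j .jminus 0 * current k α j .jminus l) := fun j => by rw [MM, neg_neg]
      rw [← smul_mul_assoc, ← mul_smul_comm, e, e]
      have hε : koszul Gen.jminus.parity 1 ^ m * koszul Gen.jminus.parity 1 ^ m = 1 := by
        rw [← mul_pow, show koszul Gen.jminus.parity 1 = -1 from koszul11]; norm_num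
      have key : ∀ x y : ℤ, current k α (j - m / 2) .jminus x * (current k α (j - m / 2) .jminus y * Q)
          = Q * (current k α j .jminus x * current k α j .jminus y) := fun x y => by
        rw [h0 .jminus y (by simp), mul_smul_comm, ← mul_assoc, h0 .jminus x (by simp), smul_mul_assoc,
          smul_smul, hε, one_smul, mul_assoc]
      rw [neg_mul, mul_neg, add_mul, mul_add, mul_assoc, mul_assoc, key, key]
    · exact h0 a l ha
  · have h1 : (energyOp + (N : ℂ) • (1 : Op)) * Q = (1 : ℂ) • (Q * energyOp) := by
      refine multipleIntegral_comm hN hρ fun n hn => ?_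
      have h1 := energy_screening (α := α).prod_ofFn n
      have h5 : ∑ i, ((1 : ℂ) + -1 * (n i + 1)) = -(N : ℂ) := by
        rw [← hn, Int.cast_sum, ← Finset.sum_neg_distrib]
        exact Finset.sum_congr rfl fun i _ => by ring
      rw [h5] at h1
      change _ * (List.ofFn fun i => screening α (n i)).prod = (1 : ℂ) •
        ((List.ofFn fun i => screening α (n i)).prod * _)
      rw [add_mul, smul_mul_assoc, one_mul]
      linear_combination (norm := module) h1
    rw [add_mul, smul_mul_assoc, one_mul, one_smul] at h1
    have hk : 2 * k + 3 ≠ 0 := by rw [← hα]; exact pow_ne_zero 2 hα0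
    -- The energies of the two highest weight vectors differ by the total index `N`, and the
    -- products of modes with this total index lower the energy level by `N`.
    have e : (j - m / 2) * (2 * (j - m / 2) + 1) / (2 * k + 3) - j * (2 * j + 1) / (2 * k + 3) = N := by
      rw [← hN, sum_exponents hα0, hα]; field_simp; ring
    have e' := congrArg (fun x => x • Q) e
    simp only [sub_smul] at e'
    rw [wakimoto_d, wakimoto_d]
    simp only [mul_sub, sub_mul, neg_mul, mul_neg, mul_smul_comm, smul_mul_assoc, one_mul, mul_one]
    linear_combination (norm := module) h1 + e'

end

end Osp12

end

/-! ### The assembled result -/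

theorem proposition3 (k α : ℂ) (hk : 2 * k + 3 ≠ 0) (hα : α ^ 2 = 2 * k + 3) :
    -- the Fock spaces are modules over the affine superalgebra
    (∀ j : ℂ, Osp12.IsAffineModule k (Osp12.wakimoto k α j)) ∧
    -- the operator product expansions of the currents with `V(z)` are total derivatives
    Osp12.IsScreening k α (Osp12.screening α) ∧
    -- the zero mode of `V(z)` is an odd homomorphism from `W_j` to `W_{j-1/2}`
    (∀ (j : ℂ) (p : ℤ), Osp12.exponent α j = p →
      Osp12.IsAffineHom 1 (Osp12.wakimoto k α j) (Osp12.wakimoto k α (j - 1 / 2))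
        (Osp12.screening α p)) ∧
    -- the multiple integral `Q_m` is a homomorphism from `W_j` to `W_{j-m/2}`
    (0 < (2 * k + 3).re → ∀ (m : ℕ) [NeZero m] (j : ℂ) (N : ℤ),
      (m : ℂ) * (m - 1 - 4 * j) = 2 * N * (2 * k + 3) →
      ∃ Q : Osp12.Op, Osp12.IsMultipleIntegral α j m Q ∧
        Osp12.IsAffineHom m (Osp12.wakimoto k α j) (Osp12.wakimoto k α (j - m / 2)) Q) := by
  have hα0 : α ≠ 0 := fun h => hk (by rw [← hα, h]; norm_num)
  refine ⟨fun j => Osp12.isAffineModule_wakimoto k α j hα, Osp12.isScreening hα0 hα,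
    fun j p hp => Osp12.isAffineHom_zeroMode j hα0 hα p hp, fun hre m _ j N hN => ?_⟩
  -- The exponent of the differences is `1/(2k+3)`, whose real part has the sign of that of `2k+3`.
  -- The condition on `Re (2k+3)` enters only here.
  have hρ : 0 < (Osp12.alphaMinus α ^ 2).re := by
    rw [Osp12.alphaMinus, div_pow, hα, neg_one_sq, one_div, Complex.inv_re]
    exact div_pos hre (Complex.normSq_pos.2 hk)
  have hs : ∑ i, Osp12.exponents α j m i = N := by
    rw [Osp12.sum_exponents hα0, hN, hα]
    field_simp
  exact ⟨Osp12.multipleIntegral hs, Osp12.isMultipleIntegral hs hρ,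
    Osp12.isAffineHom_multipleIntegral hs hρ hα0 hα⟩
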